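/- **Setting.** The Fourier transform is $\hat f(\xi)=\int_{\mathbb R^n}e^{-ix\cdot\xi}f(x)\,dx$, and distributions are complex valued. Let $n\ge 1$, $\gamma>1/2$, $0\le\beta<2\gamma<\frac{n+\beta+1}{2}$, $0\le\mu<n$, $1\le p\le\infty$, $\frac{n-\mu}{n+\beta+1-4\gamma}<p$, and $s=n-\frac{n-\mu}{p}-(2\gamma-\beta)$ (with $\frac{n-\mu}{\infty}=0$). *Spaces.* For $1<p\le\infty$, $M_{p,\mu}$ is the space of $f\in L^p_{loc}(\mathbb R^n)$ with $\|f\|_{M_{p,\mu}}=\sup_{x_0\in\mathbb R^n,\,R>0}R^{-\mu/p}\|f\|_{L^p(B_R(x_0))}<\infty$; for $p=1$ it is the space of complex Radon measures, with the total variation on $B_R(x_0)$ in place of the $L^1$ norm. Fix a radial $\varphi\in\mathcal S(\mathbb R^n)$ supported in $\{\frac34\le|\xi|\le\frac83\}$ with $\sum_{k\in\mathbb Z}\varphi(2^{-k}\xi)=1$ for $\xi\ne0$, and put $\varphi_k=\varphi(2^{-k}\cdot)$. With $\mathcal P$ the space of polynomials, $\mathcal{FN}^s_{p,\mu,\infty}$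 is the space of $f\in\mathcal S'/\mathcal P$ with $\|f\|_{\mathcal{FN}^s_{p,\mu,\infty}}=\sup_{k\in\mathbb Z}2^{ks}\|\varphi_k\hat f\|_{M_{p,\mu}}<\infty$. Its elements are identified with their canonical representative in $\mathcal S'$, the one whose Fourier transform is a tempered complex Radon measure without mass at the origin. $BC((0,\infty);\mathcal{FN}^s_{p,\mu,\infty})$ is the space of bounded continuous functions, normed by $\sup_{t>0}\|\theta(t)\|_{\mathcal{FN}^s_{p,\mu,\infty}}$. *Equation.* Let $a_{jk}$ be constants and $P_1,\dots,P_n$ measurable functions with $|P_j(\xi)|\le C|\xi|^\beta$ for a.e. $\xi$; if $p=1$, let the $P_j$ be Borel and the bound hold for all $\xi\ne0$. Put $\Lambda=(-\Delta)^{1/2}$, $\mathcal R_j=-\partial_j\Lambda^{-1}$ (the Hilbert transform if $n=1$), $\widehat{P_j[\theta]}=P_j\hat\theta$, and let $P[\theta]$ be the vector with components $\sum_{j=1}^n a_{jk}\mathcal R_j\Lambda^{-1}P_j[\theta]$, $1\le k\le n$. Put $\widehat{G_\gamma(t)f}=e^{-t|\xi|^{2\gamma}}\hat f$ and $$\mathcal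 B(\theta,\phi)(t)=-\int_0^tG_\gamma(t-\tau)\,\nabla\cdot(P[\theta]\phi)(\tau)\,d\tau,$$ where a product $fg$ is given by $\widehat{fg}=(2\pi)^{-n}\hat f*\hat g$ and the integral is taken weakly in $\mathcal S'$. The mild equation with data $\theta_0$ is $$\theta(t)=G_\gamma(t)\theta_0+\mathcal B(\theta,\theta)(t),\qquad t>0.\tag{M}$$ **Theorem.** There is a constant $K>0$ such that for all $\theta,\phi\in BC((0,\infty);\mathcal{FN}^s_{p,\mu,\infty})$ the term $\mathcal B(\theta,\phi)(t)$ is defined for all $t>0$ and $$\sup_{t>0}\|\mathcal B(\theta,\phi)(t)\|_{\mathcal{FN}^s_{p,\mu,\infty}}\le K\sup_{t>0}\|\theta(t)\|_{\mathcal{FN}^s_{p,\mu,\infty}}\sup_{t>0}\|\phi(t)\|_{\mathcal{FN}^s_{p,\mu,\infty}}.\tag{B}$$ For every $K>0$ with (B) and every $0<\varepsilon<\frac1{4K}$ the following holds. (i) If $\|\theta_0\|_{\mathcal{FN}^s_{p,\mu,\infty}}\le\varepsilon$, then (M) has a unique solution $\theta\in BC((0,\infty);\mathcal{FN}^s_{p,\mu,\infty})$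 with $\sup_{t>0}\|\theta(t)\|_{\mathcal{FN}^s_{p,\mu,\infty}}\le2\varepsilon$. The map $\theta_0\mapsto\theta$ from $\{f:\|f\|_{\mathcal{FN}^s_{p,\mu,\infty}}\le\varepsilon\}$ to $BC((0,\infty);\mathcal{FN}^s_{p,\mu,\infty})$ is Lipschitz continuous, and $\theta(t)\rightharpoonup\theta_0$ in $\mathcal S'(\mathbb R^n)$ as $t\to0^+$. (ii) If moreover $P_j(\lambda\xi)=\lambda^\beta P_j(\xi)$ for all $j$, $\lambda>0$ and $\xi\ne0$, and $\theta_0$ is a homogeneous distribution of degree $-(2\gamma-\beta)$, then the solution in (i) is self-similar: $\theta(x,t)=\lambda^{2\gamma-\beta}\theta(\lambda x,\lambda^{2\gamma}t)$ for all $\lambda>0$ and $t>0$. -/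

import Mathlib

open MeasureTheory Filter Topology
open scoped ENNReal NNReal SchwartzMap FourierTransform LineDeriv

noncomputable section

namespace ActiveScalar

/-- Euclidean space `ℝⁿ`. -/
abbrev Rn (n : ℕ) := EuclideanSpace ℝ (Fin n)

/-- Complex-valued tempered distributions on `ℝⁿ`. -/
abbrev TDist (n : ℕ) := 𝓢'(Rn n, ℂ)

/-! ### Dilations and the Fourier transform -/

/-- The dilation `ψ ↦ ψ(c ·)` of Schwartz functions, `c ≠ 0`. -/
def dilateTest {n : ℕ} (c : ℝˣ) : 𝓢(Rn n, ℂ) →L[ℂ] 𝓢(Rn n, ℂ) :=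
  SchwartzMap.compCLMOfContinuousLinearEquiv ℂ (ContinuousLinearEquiv.smulLeft c)

/-- The dilation `f ↦ f(c ·)` of tempered distributions:
`⟨f(c ·), ψ⟩ = |c|⁻ⁿ ⟨f, ψ(c⁻¹ ·)⟩`. -/
def dilate {n : ℕ} (c : ℝˣ) (f : TDist n) : TDist n :=
  (((|(c : ℝ)| ^ n)⁻¹ : ℝ) : ℂ) • PointwiseConvergenceCLM.precomp ℂ (dilateTest c⁻¹) f

/-- The unit `(2π)⁻¹`. -/
def invTwoPi : ℝˣ := Units.mk0 (2 * Real.pi)⁻¹ (by positivity)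

/-- The Fourier transform of tempered distributions in the normalization
`f̂(ξ) = ∫ e^{-i x·ξ} f(x) dx` (in which `∂_j` has the symbol `i ξ_j`): `⟨f̂, ψ⟩ = ⟨f, ψ̂⟩`, where
`ψ̂(x) = (𝓕 ψ)(x / 2π)` and `𝓕` is Mathlib's transform with kernel `e^{-2πi x·ξ}`. -/
def fourierDist {n : ℕ} (f : TDist n) : TDist n :=
  𝓕 (PointwiseConvergenceCLM.precomp ℂ (dilateTest invTwoPi) f)

theorem fourierDist_apply {n : ℕ} (f : TDist n) (ψ : 𝓢(Rn n, ℂ)) :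
    fourierDist f ψ = f (dilateTest invTwoPi (𝓕 ψ)) := rfl

/-! ### Fourier–Besov–Morrey spaces -/

/-- A radial Schwartz function supported in `{3/4 ≤ |ξ| ≤ 8/3}` whose dyadic dilates form a
partition of unity on `ℝⁿ \ {0}`. -/
structure IsLittlewoodPaley {n : ℕ} (φ : 𝓢(Rn n, ℂ)) : Prop where
  radial : ∀ ξ η : Rn n, ‖ξ‖ = ‖η‖ → φ ξ = φ η
  supp : ∀ ξ : Rn n, φ ξ ≠ 0 → 3 / 4 ≤ ‖ξ‖ ∧ ‖ξ‖ ≤ 8 / 3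
  sum_eq_one : ∀ ξ : Rn n, ξ ≠ 0 → HasSum (fun k : ℤ => φ ((2 : ℝ) ^ (-k) • ξ)) 1

/-- `φ_k(ξ) = φ(2^{-k} ξ)`. -/
def dyadic {n : ℕ} (φ : 𝓢(Rn n, ℂ)) (k : ℤ) (ξ : Rn n) : ℂ := φ ((2 : ℝ) ^ (-k) • ξ)

/-- `sup_{x₀, R > 0} R^{-μ/p} ‖h‖_{L^p(B_R(x₀), ν)}`. -/
def morreySup {n : ℕ} (p : ℝ≥0∞) (μ : ℝ) (ν : Measure (Rn n)) (h : Rn n → ℂ) : ℝ≥0∞ :=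
  ⨆ (x₀ : Rn n) (R : ℝ) (_ : 0 < R),
    ENNReal.ofReal (R ^ (-(μ * p⁻¹.toReal))) * eLpNorm h p (ν.restrict (Metric.ball x₀ R))

/-- `T` is the complex Radon measure `h dν`, where for `p ≠ 1` the base measure `ν` is Lebesgue
measure, so that `T` is then the locally integrable function `h`. For `p = 1` every complex Radon
measure occurs (take for `ν` its total variation), and its total variation is `|h| dν`. -/
structure IsMorreyDensity {n : ℕ} (p : ℝ≥0∞) (T : TDist n) (ν : Measure (Rn n))
    (h : Rn n → ℂ) : Prop where
  volume_of_ne_one : p ≠ 1 → ν = volume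
  locallyFinite : IsLocallyFiniteMeasure ν
  locallyIntegrable : LocallyIntegrable h ν
  eq_integral : ∀ ψ : 𝓢(Rn n, ℂ), HasCompactSupport ψ → T ψ = ∫ ξ, ψ ξ * h ξ ∂ν

/-- The norm of the Morrey space `M_{p,μ}` (a space of functions for `1 < p ≤ ∞`, a space of Radon
measures, normed through the total variation, for `p = 1`), with the value `∞` on the tempered
distributions outside the space. The density is unique up to null sets, so that for `T` in the space
the infimum is over equal numbers. -/
def morreyNorm {n : ℕ} (p : ℝ≥0∞) (μ : ℝ) (T : TDist n) : ℝ≥0∞ :=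
  ⨅ (ν : Measure (Rn n)) (h : Rn n → ℂ) (_ : IsMorreyDensity p T ν h), morreySup p μ ν h

/-- The space `𝒫` of polynomials, as tempered distributions. (The polynomials form a linear
subspace, so that the span adds nothing.) -/
def polynomials (n : ℕ) : Submodule ℂ (TDist n) :=
  Submodule.span ℂ {f | ∃ q : MvPolynomial (Fin n) ℂ, ∀ ψ : 𝓢(Rn n, ℂ),
    f ψ = ∫ x, MvPolynomial.eval (fun i => (x i : ℂ)) q * ψ x}

/-- `𝓢' / 𝒫`. -/
abbrev DistMod (n : ℕ) := TDist n ⧸ polynomials n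

/-- The class modulo polynomials. -/
abbrev toMod {n : ℕ} (f : TDist n) : DistMod n := Submodule.Quotient.mk f

/-- `sup_{k ∈ ℤ} 2^{ks} ‖φ_k f̂‖_{M_{p,μ}}` for a tempered distribution `f`. -/
def fnNormDist {n : ℕ} (φ : 𝓢(Rn n, ℂ)) (s : ℝ) (p : ℝ≥0∞) (μ : ℝ) (f : TDist n) : ℝ≥0∞ :=
  ⨆ k : ℤ, ENNReal.ofReal ((2 : ℝ) ^ ((k : ℝ) * s)) *
    morreyNorm p μ (TemperedDistribution.smulLeftCLM ℂ (dyadic φ k) (fourierDist f))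

/-- The norm of the Fourier–Besov–Morrey space `FN^s_{p,μ,∞}`, as a function on `𝓢' / 𝒫` with
values in `[0, ∞]`; the space consists of the classes of finite norm. The infimum is over the
representatives of the class, which all give the same value: the Fourier transform of a polynomial
is supported at the origin and is annihilated by every `φ_k`. -/
def fnNorm {n : ℕ} (φ : 𝓢(Rn n, ℂ)) (s : ℝ) (p : ℝ≥0∞) (μ : ℝ) (F : DistMod n) : ℝ≥0∞ :=
  ⨅ (f : TDist n) (_ : toMod f = F), fnNormDist φ s p μ f

/-- `sup_{t > 0} ‖θ(t)‖`. -/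
def supNorm {n : ℕ} (φ : 𝓢(Rn n, ℂ)) (s : ℝ) (p : ℝ≥0∞) (μ : ℝ) (θ : ℝ → DistMod n) : ℝ≥0∞ :=
  ⨆ (t : ℝ) (_ : 0 < t), fnNorm φ s p μ (θ t)

/-- `θ ∈ BC((0,∞); FN^s_{p,μ,∞})`; only the values `θ t` with `t > 0` matter. -/
structure IsBC {n : ℕ} (φ : 𝓢(Rn n, ℂ)) (s : ℝ) (p : ℝ≥0∞) (μ : ℝ) (θ : ℝ → DistMod n) :
    Prop where
  bounded : supNorm φ s p μ θ < ∞
  continuous : ∀ t : ℝ, 0 < t → Tendsto (fun τ => fnNorm φ s p μ (θ τ - θ t)) (𝓝 t) (𝓝 0)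

/-! ### Distributions whose Fourier transform is a measure; multipliers and products -/

/-- `f̂` is the tempered complex Radon measure `h dν`, and it does not charge the origin. -/
structure IsFourierDensity {n : ℕ} (f : TDist n) (ν : Measure (Rn n)) (h : Rn n → ℂ) : Prop where
  locallyFinite : IsLocallyFiniteMeasure ν
  zero : ν {0} = 0
  tempered : ∃ N : ℕ, Integrable (fun ξ => ((1 + ‖ξ‖) ^ N)⁻¹ • h ξ) ν
  eq_integral : ∀ ψ : 𝓢(Rn n, ℂ), fourierDist f ψ = ∫ ξ, ψ ξ * h ξ ∂ν

/-- `f` is the canonical representative of the class `F`, on which the nonlinear operations act: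
the one whose Fourier transform is a tempered complex Radon measure without mass at the origin.
There is at most one, since no nonzero polynomial has such a Fourier transform. -/
def IsRealization {n : ℕ} (F : DistMod n) (f : TDist n) : Prop :=
  toMod f = F ∧ ∃ ν h, IsFourierDensity f ν h

/-- `ĝ = m f̂`, where `f̂` and `ĝ` are measures. -/
def IsMultiplier {n : ℕ} (m : Rn n → ℂ) (f g : TDist n) : Prop :=
  ∃ ν h, IsFourierDensity f ν h ∧ IsFourierDensity g ν (fun ξ => m ξ * h ξ)

/-- `w = f g`, where `f̂` and `ĝ` are measures whose convolution converges absolutely: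
`ŵ = (2π)⁻ⁿ f̂ ∗ ĝ`. -/
def IsProduct {n : ℕ} (f g w : TDist n) : Prop :=
  ∃ ν h ν' h', IsFourierDensity f ν h ∧ IsFourierDensity g ν' h' ∧
    ∀ ψ : 𝓢(Rn n, ℂ),
      Integrable (fun z : Rn n × Rn n => ψ (z.1 + z.2) * (h z.1 * h' z.2)) (ν.prod ν') ∧
      fourierDist w ψ = (((2 * Real.pi) ^ n)⁻¹ : ℝ) *
        ∫ z : Rn n × Rn n, ψ (z.1 + z.2) * (h z.1 * h' z.2) ∂(ν.prod ν')

/-! ### The equation -/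

/-- The symbols `P_j` are measurable with `|P_j(ξ)| ≤ C |ξ|^β` almost everywhere. For `p = 1` they
act on measures that may be singular; there they are Borel and the bound holds for all `ξ ≠ 0`. -/
structure IsAdmissibleSymbol {n : ℕ} (p : ℝ≥0∞) (β : ℝ) (P : Rn n → ℂ) : Prop where
  measurable : AEMeasurable P volume
  bound : ∃ C : ℝ, ∀ᵐ ξ : Rn n, ‖P ξ‖ ≤ C * ‖ξ‖ ^ β
  borel_of_eq_one : p = 1 → Measurable P
  bound_of_eq_one : p = 1 → ∃ C : ℝ, ∀ ξ : Rn n, ξ ≠ 0 → ‖P ξ‖ ≤ C * ‖ξ‖ ^ β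

/-- `P` is homogeneous of degree `β`. -/
def IsHomogeneousSymbol {n : ℕ} (β : ℝ) (P : Rn n → ℂ) : Prop :=
  ∀ l : ℝ, 0 < l → ∀ ξ : Rn n, ξ ≠ 0 → P (l • ξ) = ((l ^ β : ℝ) : ℂ) * P ξ

/-- The symbol `-i ξ_j / |ξ|` of the Riesz transform `R_j = -∂_j (-Δ)^{-1/2}` (for `n = 1` the
symbol `-i sgn ξ` of the Hilbert transform). -/
def rieszSymbol {n : ℕ} (j : Fin n) (ξ : Rn n) : ℂ := -(Complex.I * (ξ j : ℂ)) / (‖ξ‖ : ℂ)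

/-- The symbol of `θ ↦ u_k = ∑_j a_{jk} R_j Λ⁻¹ P_j[θ]`, with `Λ = (-Δ)^{1/2}`. -/
def velocitySymbol {n : ℕ} (a : Fin n → Fin n → ℂ) (P : Fin n → Rn n → ℂ) (k : Fin n)
    (ξ : Rn n) : ℂ :=
  ∑ j, a j k * rieszSymbol j ξ * (‖ξ‖ : ℂ)⁻¹ * P j ξ

/-- The symbol `e^{-t |ξ|^{2γ}}` of `G_γ(t)`. -/
def heatSymbol {n : ℕ} (γ t : ℝ) (ξ : Rn n) : ℂ := ((Real.exp (-t * ‖ξ‖ ^ (2 * γ)) : ℝ) : ℂ)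

/-- `b = 𝓑(f, g)(t) = -∫₀ᵗ G_γ(t - τ) (∇ · (P[f] g))(τ) dτ`, where `u τ = P[f τ]`, `w τ = u τ g τ`,
`v τ = G_γ(t - τ) ∇ · w τ`, and the integral in `τ` is an absolutely convergent weak integral in
`𝓢'`. -/
def IsDuhamel {n : ℕ} (γ : ℝ) (a : Fin n → Fin n → ℂ) (P : Fin n → Rn n → ℂ) (f g : ℝ → TDist n)
    (t : ℝ) (b : TDist n) : Prop :=
  ∃ (u w : Fin n → ℝ → TDist n) (v : ℝ → TDist n),
    (∀ τ : ℝ, 0 < τ → τ < t →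
      (∀ k, IsMultiplier (velocitySymbol a P k) (f τ) (u k τ) ∧ IsProduct (u k τ) (g τ) (w k τ)) ∧
      IsMultiplier (heatSymbol γ (t - τ))
        (∑ k, ∂_{(EuclideanSpace.single k 1 : Rn n)} (w k τ)) (v τ)) ∧
    ∀ ψ : 𝓢(Rn n, ℂ),
      IntervalIntegrable (fun τ => v τ ψ) volume 0 t ∧ b ψ = -∫ τ in (0 : ℝ)..t, v τ ψ

/-- `θ(t) = G_γ(t) θ₀ + 𝓑(θ, θ)(t)` for all `t > 0`: the identity holds in `𝓢'` for the canonical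
representatives `f₀` of `θ₀` and `f t` of `θ t`. -/
def IsMildSolution {n : ℕ} (γ : ℝ) (a : Fin n → Fin n → ℂ) (P : Fin n → Rn n → ℂ)
    (θ₀ : DistMod n) (θ : ℝ → DistMod n) : Prop :=
  ∃ (f₀ : TDist n) (f : ℝ → TDist n), IsRealization θ₀ f₀ ∧
    (∀ t : ℝ, 0 < t → IsRealization (θ t) (f t)) ∧
    ∀ t : ℝ, 0 < t → ∃ e b : TDist n,
      IsMultiplier (heatSymbol γ t) f₀ e ∧ IsDuhamel γ a P f f t b ∧ f t = e + b

/-- `θ` is a mild solution in `BC((0,∞); FN^s_{p,μ,∞})` with `sup_{t > 0} ‖θ(t)‖ ≤ r`. -/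
structure IsSolutionInBall {n : ℕ} (φ : 𝓢(Rn n, ℂ)) (s : ℝ) (p : ℝ≥0∞) (μ γ : ℝ)
    (a : Fin n → Fin n → ℂ) (P : Fin n → Rn n → ℂ) (r : ℝ) (θ₀ : DistMod n)
    (θ : ℝ → DistMod n) : Prop where
  bc : IsBC φ s p μ θ
  norm_le : supNorm φ s p μ θ ≤ ENNReal.ofReal r
  mild : IsMildSolution γ a P θ₀ θ

/-- `K` is a constant in the bilinear estimate: for all `θ, ϑ ∈ BC((0,∞); FN^s_{p,μ,∞})` the term
`𝓑(θ, ϑ)(t)` exists for all `t > 0` and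
`sup_{t > 0} ‖𝓑(θ, ϑ)(t)‖ ≤ K sup_{t > 0} ‖θ(t)‖ sup_{t > 0} ‖ϑ(t)‖`. -/
def IsBilinearConst {n : ℕ} (φ : 𝓢(Rn n, ℂ)) (s : ℝ) (p : ℝ≥0∞) (μ γ : ℝ)
    (a : Fin n → Fin n → ℂ) (P : Fin n → Rn n → ℂ) (K : ℝ) : Prop :=
  ∀ θ ϑ : ℝ → DistMod n, IsBC φ s p μ θ → IsBC φ s p μ ϑ →
    ∃ f g b : ℝ → TDist n, (∀ t : ℝ, 0 < t → IsRealization (θ t) (f t)) ∧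
      (∀ t : ℝ, 0 < t → IsRealization (ϑ t) (g t)) ∧
      (∀ t : ℝ, 0 < t → IsDuhamel γ a P f g t (b t)) ∧
      supNorm φ s p μ (fun t => toMod (b t)) ≤
        ENNReal.ofReal K * supNorm φ s p μ θ * supNorm φ s p μ ϑ

/-- The tempered distribution `f` is homogeneous of degree `d`: `f(l ·) = l^d f` for all
`l > 0`. -/
def IsHomogeneousDist {n : ℕ} (d : ℝ) (f : TDist n) : Prop :=
  ∀ (l : ℝ) (hl : 0 < l), dilate (Units.mk0 l hl.ne') f = ((l ^ d : ℝ) : ℂ) • f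

end ActiveScalar

end

noncomputable section

namespace ActiveScalar

/-! ### Dilations, the Fourier transform and derivatives -/

section

variable {n : ℕ}

/-! The whole argument takes place on the Fourier side, with positive measures. When `s < massExp n
p μ`, a class of finite norm has exactly one representative whose Fourier transform is a tempered
measure without an atom at the origin, and its norm equals the dyadic norm `fnMeas` of the total
variation `tv` (`exists_isRealization`, `IsRealization.unique`, `fnNormDist_eq_fnN`). Existence
comes from summing the pieces `φ_k f̂` under one dominating measure; what remains is carried by the
origin and is the transform of a polynomial. By duality the Morrey norm of a positive measure is a
supremum of integrals against a translation-invariant family of test functions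
(`morrey_withDensity`), so that convolutions and time integrals reduce to Tonelli's theorem and
geometric series.

For the bilinear estimate put `d = massExp n p μ - s = 2γ - β`. Up to constants, a measure of norm
one gives mass `2^{jd}` to the annulus of radius `2^j`, and a translated test function has integral
at most `2^{-js}` over it. In the convolution of `|ξ|^{β-1} |f̂|` with `|ĝ|` near the frequency
`2^k`, the larger variable has size about `2^j` with `j ≥ k - 2`; it contributes `2^{-js}`, while
the weight and the mass of the smaller variable contribute `2^{j(d+β-1)} = 2^{j(2γ-1)}`. The sums
over small frequencies converge because `β < 2γ` and `1 < 2γ`, the sum over `j` because `2γ - 1 <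
s`, which is the meaning of the lower bound on `p`. The product has order `s - (2γ - 1)`, the
divergence lowers it to `s - 2γ` (`exists_fnN_flux_le`), and the time integral of `e^{-τ|ξ|^{2γ}}`
restores the `2γ`, uniformly in `t` (`IsCurve.exists_heat_integral`). Continuity in `t` is
`IsHeatIntegral.tendsto`.

With the bilinear bound, `4Kε < 1` makes the mild equation a contraction of ratio `4Kε` on the ball
of radius `2ε`, and absolutely convergent series converge in the space (`exists_fnN_sum_sub_le`), so
the Picard iterates converge. The same contraction gives uniqueness and the Lipschitz bound. The
data are attained weakly since the heat flow is weakly continuous at `0` and the Duhamel term tested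
against a fixed function is `O(t)`. Self-similarity holds for every Picard iterate started from zero
(`IsStep.dilate`) and passes to the limit. -/

theorem dilateTest_apply (c : ℝˣ) (ψ : 𝓢(Rn n, ℂ)) (x : Rn n) :
    dilateTest c ψ x = ψ ((c : ℝ) • x) := rfl

theorem dilateTest_inv_dilateTest (c : ℝˣ) (ψ : 𝓢(Rn n, ℂ)) :
    dilateTest c⁻¹ (dilateTest c ψ) = ψ := by
  ext x
  simp [dilateTest_apply, smul_smul]

theorem dilateTest_dilateTest_inv (c : ℝˣ) (ψ : 𝓢(Rn n, ℂ)) :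
    dilateTest c (dilateTest c⁻¹ ψ) = ψ := by
  ext x
  simp [dilateTest_apply, smul_smul]

/-- The inverse of the Fourier transform on test functions. -/
def invTestFourier (ψ : 𝓢(Rn n, ℂ)) : 𝓢(Rn n, ℂ) := 𝓕⁻ (dilateTest invTwoPi⁻¹ ψ)

theorem dilateTest_fourier_invTestFourier (ψ : 𝓢(Rn n, ℂ)) :
    dilateTest invTwoPi (𝓕 (invTestFourier ψ)) = ψ := by
  rw [invTestFourier, FourierTransform.fourier_fourierInv_eq, dilateTest_dilateTest_inv]

theorem invTestFourier_dilateTest_fourier (ψ : 𝓢(Rn n, ℂ)) :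
    invTestFourier (dilateTest invTwoPi (𝓕 ψ)) = ψ := by
  rw [invTestFourier, dilateTest_inv_dilateTest, FourierTransform.fourierInv_fourier_eq]

theorem apply_eq_fourierDist (f : TDist n) (ψ : 𝓢(Rn n, ℂ)) :
    f ψ = fourierDist f (invTestFourier ψ) := by
  rw [fourierDist_apply, dilateTest_fourier_invTestFourier]

/-- The inverse Fourier transform of tempered distributions. -/
def invFourierDist (T : TDist n) : TDist n :=
  PointwiseConvergenceCLM.precomp ℂ (dilateTest invTwoPi⁻¹) (𝓕⁻ T)

theorem invFourierDist_apply (T : TDist n) (ψ : 𝓢(Rn n, ℂ)) :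
    invFourierDist T ψ = T (invTestFourier ψ) := rfl

theorem fourierDist_invFourierDist (T : TDist n) : fourierDist (invFourierDist T) = T := by
  ext ψ
  rw [fourierDist_apply, invFourierDist_apply, invTestFourier_dilateTest_fourier]

theorem invFourierDist_fourierDist (f : TDist n) : invFourierDist (fourierDist f) = f := by
  ext ψ
  rw [invFourierDist_apply, ← apply_eq_fourierDist]

theorem fourierDist_injective : Function.Injective (fourierDist (n := n)) :=
  Function.LeftInverse.injective invFourierDist_fourierDist

theorem fourierDist_add (f g : TDist n) : fourierDist (f + g) = fourierDist f + fourierDist g := by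
  ext ψ; rfl

theorem fourierDist_smul (c : ℂ) (f : TDist n) : fourierDist (c • f) = c • fourierDist f := by
  ext ψ; rfl

theorem fourierDist_neg (f : TDist n) : fourierDist (-f) = -fourierDist f := by
  ext ψ; rfl

theorem fourierDist_sub (f g : TDist n) : fourierDist (f - g) = fourierDist f - fourierDist g := by
  ext ψ; rfl

theorem fourierDist_zero : fourierDist (0 : TDist n) = 0 := by
  ext ψ; rfl

theorem fourierDist_sum {ι : Type*} (s : Finset ι) (f : ι → TDist n) :
    fourierDist (∑ i ∈ s, f i) = ∑ i ∈ s, fourierDist (f i) := by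
  classical
  induction s using Finset.induction_on with
  | empty => simp [fourierDist_zero]
  | insert a s ha ih => rw [Finset.sum_insert ha, Finset.sum_insert ha, fourierDist_add, ih]

theorem tdist_add_apply (f g : TDist n) (ψ : 𝓢(Rn n, ℂ)) : (f + g) ψ = f ψ + g ψ := rfl

theorem tdist_sub_apply (f g : TDist n) (ψ : 𝓢(Rn n, ℂ)) : (f - g) ψ = f ψ - g ψ := rfl

theorem tdist_neg_apply (f : TDist n) (ψ : 𝓢(Rn n, ℂ)) : (-f) ψ = -f ψ := rfl

theorem tdist_smul_apply (c : ℂ) (f : TDist n) (ψ : 𝓢(Rn n, ℂ)) : (c • f) ψ = c * f ψ := rfl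

theorem tdist_sum_apply {ι : Type*} (s : Finset ι) (f : ι → TDist n) (ψ : 𝓢(Rn n, ℂ)) :
    (∑ i ∈ s, f i) ψ = ∑ i ∈ s, f i ψ := by
  classical
  induction s using Finset.induction_on with
  | empty => simp
  | insert a s ha ih => rw [Finset.sum_insert ha, Finset.sum_insert ha, tdist_add_apply, ih]

/-- The function `ξ ↦ i ⟪ξ, m⟫`. -/
def derivSymbol (m ξ : Rn n) : ℂ := Complex.I * (inner ℝ ξ m : ℝ)

theorem hasTemperateGrowth_derivSymbol (m : Rn n) :
    (derivSymbol m).HasTemperateGrowth := by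
  unfold derivSymbol
  fun_prop

theorem fourierDist_lineDeriv (f : TDist n) (m : Rn n) (ψ : 𝓢(Rn n, ℂ)) :
    fourierDist (∂_{m} f) ψ = fourierDist f (SchwartzMap.smulLeftCLM ℂ (derivSymbol m) ψ) := by
  rw [fourierDist_apply, fourierDist_apply, TemperedDistribution.lineDerivOp_apply_apply]
  congr 1
  ext x
  have hm : (fun ξ : Rn n => inner ℝ ξ m).HasTemperateGrowth :=
    ((innerSL ℝ).flip m).hasTemperateGrowth
  -- The chain-rule factor `(2π)⁻¹` of the dilation cancels the `2π` of the kernel `e^{-2πi x·ξ}`;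
  -- the remaining minus sign cancels the one from transposing the derivative.
  have h : ∂_{m} (dilateTest invTwoPi (𝓕 ψ)) =
      dilateTest invTwoPi (𝓕 (-SchwartzMap.smulLeftCLM ℂ (derivSymbol m) ψ)) := by
    rw [dilateTest, SchwartzMap.lineDerivOp_compCLMOfContinuousLinearEquiv]
    congr 1
    have hc : (ContinuousLinearEquiv.smulLeft invTwoPi : Rn n ≃L[ℝ] Rn n) m =
      (2 * Real.pi)⁻¹ • m := rfl
    rw [hc, SchwartzMap.lineDerivOp_fourier_eq]
    congr 1
    ext ξ
    have h2 : (fun ξ : Rn n => inner ℝ ξ ((2 * Real.pi)⁻¹ • m)).HasTemperateGrowth :=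
      ((innerSL ℝ).flip ((2 * Real.pi)⁻¹ • m)).hasTemperateGrowth
    simp only [neg_smul, neg_apply, smul_apply,
      SchwartzMap.smulLeftCLM_apply_apply h2]
    simp only [inner_smul_right, SchwartzMap.smulLeftCLM_apply_apply (hasTemperateGrowth_derivSymbol m), derivSymbol,
      smul_eq_mul, Complex.real_smul]
    push_cast
    have : (Real.pi : ℂ) ≠ 0 := by exact_mod_cast Real.pi_ne_zero
    field_simp
  rw [h, ← map_neg, ← FourierTransform.fourier_neg, neg_neg]

theorem dilate_apply (c : ℝˣ) (f : TDist n) (ψ : 𝓢(Rn n, ℂ)) :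
    dilate c f ψ = (((|(c : ℝ)| ^ n)⁻¹ : ℝ) : ℂ) * f (dilateTest c⁻¹ ψ) := rfl

/-- The factor `|c|⁻ⁿ` is the Jacobian of `v ↦ c v` in the Fourier integral, so on the Fourier side
dilation is a substitution in the test function without any factor. -/
theorem fourierDist_dilate (c : ℝˣ) (f : TDist n) (ψ : 𝓢(Rn n, ℂ)) :
    fourierDist (dilate c f) ψ = fourierDist f (dilateTest c ψ) := by
  rw [fourierDist_apply, fourierDist_apply, dilate_apply, ← smul_eq_mul, ← map_smul]
  congr 1
  ext x
  have h := Measure.integral_comp_smul (volume : Measure (Rn n)) (fun v => Real.fourierChar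
    (-inner ℝ v (((c⁻¹ : ℝˣ) : ℝ) • ((invTwoPi : ℝˣ) : ℝ) • x)) • ψ v) (c : ℝ)
  simp only [smul_apply, dilateTest_apply, SchwartzMap.fourier_coe, Real.fourier_eq, smul_eq_mul]
  rw [smul_comm ((invTwoPi : ℝˣ) : ℝ)]
  rw [finrank_euclideanSpace_fin, abs_inv, abs_pow, Complex.real_smul] at h
  rw [← h]
  congr 1
  ext v
  rw [inner_smul_left, inner_smul_right]
  congr 3
  simp

end

/-! ### Distributions dominated by a measure -/

section

variable {n : ℕ}

/-- The tempered distribution `T` is dominated by the positive measure `ν`. -/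
def Dominated (T : TDist n) (ν : Measure (Rn n)) : Prop :=
  ∀ ψ : 𝓢(Rn n, ℂ), ‖T ψ‖ₑ ≤ ∫⁻ ξ, ‖ψ ξ‖ₑ ∂ν

/-- For `ν` of temperate growth, `𝓢` embeds continuously into `L¹(ν)`, so a functional bounded by
the `L¹(ν)` norm is tempered. Series, multiplier images, products and time integrals are all
constructed through this. -/
theorem exists_tdist_of_dominated (ν : Measure (Rn n)) [ν.HasTemperateGrowth]
    (S : 𝓢(Rn n, ℂ) →ₗ[ℂ] ℂ) (hS : ∀ ψ, ‖S ψ‖ₑ ≤ ∫⁻ ξ, ‖ψ ξ‖ₑ ∂ν) :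
    ∃ T : TDist n, ∀ ψ, T ψ = S ψ := by
  have hb : ∀ ψ, ‖S ψ‖ ≤ ‖SchwartzMap.toLpCLM ℂ ℂ 1 ν ψ‖ := by
    intro ψ
    have h := hS ψ
    rw [← ofReal_integral_norm_eq_lintegral_enorm (ψ.integrable (μ := ν)),
      ← ofReal_norm, ENNReal.ofReal_le_ofReal_iff (by positivity)] at h
    simpa [SchwartzMap.norm_toLp_one] using h
  have hc : Continuous S := by
    apply continuous_of_continuousAt_zero S
    rw [ContinuousAt, map_zero]
    apply squeeze_zero_norm hb
    have : Continuous fun ψ => ‖SchwartzMap.toLpCLM ℂ ℂ 1 ν ψ‖ := by fun_prop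
    have h0 := this.tendsto 0
    rwa [map_zero, norm_zero] at h0
  exact ⟨ContinuousLinearMap.toPointwiseConvergenceCLM _ _ _ _ ⟨S, hc⟩, fun ψ => rfl⟩

theorem isLocallyFiniteMeasure_of_hasTemperateGrowth (ν : Measure (Rn n))
    [hν : ν.HasTemperateGrowth] : IsLocallyFiniteMeasure ν := by
  obtain ⟨N, hN⟩ := hν
  have h1 := hN.locallyIntegrable
  have h2 : Continuous fun x : Rn n => (1 + ‖x‖) ^ (N : ℝ) := by
    apply Continuous.rpow_const (by fun_prop)
    intro x; left; positivity
  have h3 := (locallyIntegrableOn_univ.2 h1).continuousOn_mul h2.continuousOn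
    isOpen_univ.isLocallyClosed
  rw [locallyIntegrableOn_univ] at h3
  have h4 : (fun x : Rn n => (1 + ‖x‖) ^ (N : ℝ) * (1 + ‖x‖) ^ (-(N : ℝ))) = fun _ => 1 := by
    ext x
    rw [← Real.rpow_add (by positivity)]
    simp
  rw [h4] at h3
  refine ⟨fun x => ?_⟩
  obtain ⟨U, hU, hi⟩ := h3 x
  refine ⟨U, hU, ?_⟩
  rw [integrableOn_const_iff] at hi
  simpa using hi

/-- A tempered distribution dominated by a positive measure `ν` of temperate growth has a density
with respect to `ν`. -/
theorem Dominated.exists_density {T : TDist n} {ν : Measure (Rn n)} [ν.HasTemperateGrowth]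
    (hT : Dominated T ν) :
    ∃ h : Rn n → ℂ, Measurable h ∧ (∀ ξ, ‖h ξ‖ ≤ 1) ∧ ∀ ψ, T ψ = ∫ ξ, ψ ξ * h ξ ∂ν := by
  set N := ν.integrablePower
  set w : Rn n → ℝ := fun ξ => (1 + ‖ξ‖ ^ 2) ^ (-(N : ℝ)) with hw
  have hwpos : ∀ ξ, 0 < w ξ := fun ξ => by positivity
  have hwc : Continuous w := by
    apply Continuous.rpow_const (by fun_prop)
    intro x; left; positivity
  have hwm : Measurable fun ξ => ENNReal.ofReal (w ξ) := hwc.measurable.ennreal_ofReal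
  have hwt : (fun ξ => ((w ξ : ℝ) : ℂ)).HasTemperateGrowth :=
    Function.Complex.hasTemperateGrowth_ofReal.comp (Function.hasTemperateGrowth_one_add_norm_sq_rpow _ _)
  have hwit : (fun ξ : Rn n => (((1 + ‖ξ‖ ^ 2) ^ (N : ℝ) : ℝ) : ℂ)).HasTemperateGrowth :=
    Function.Complex.hasTemperateGrowth_ofReal.comp (Function.hasTemperateGrowth_one_add_norm_sq_rpow _ _)
  set ν' := ν.withDensity fun ξ => ENNReal.ofReal (w ξ) with hν'
  have hfin : IsFiniteMeasure ν' := by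
    apply isFiniteMeasure_withDensity_ofReal
    -- The constant `2 ^ N` comes from `1 + ‖ξ‖ ≤ 2 (1 + ‖ξ‖²)`.
    have h1 := (ν.integrable_pow_neg_integrablePower).const_mul (2 ^ (N : ℝ))
    refine (h1.mono' hwc.aestronglyMeasurable (.of_forall fun ξ => ?_)).2
    rw [Real.norm_of_nonneg (hwpos ξ).le, hw]
    simp only
    rw [Real.rpow_neg (by positivity), Real.rpow_neg (by positivity),
      ← div_eq_mul_inv, ← Real.div_rpow (by positivity) (by positivity),
      ← Real.inv_rpow (by positivity)]
    apply Real.rpow_le_rpow (by positivity) _ (by positivity)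
    rw [inv_eq_one_div, div_le_div_iff₀ (by positivity) (by positivity)]
    nlinarith [sq_nonneg (‖ξ‖ - 1)]
  set S : 𝓢(Rn n, ℂ) →ₗ[ℂ] ℂ :=
    (TemperedDistribution.smulLeftCLM ℂ (fun ξ => ((w ξ : ℝ) : ℂ)) T).toLinearMap with hSdef
  have hSapp : ∀ ψ, S ψ = T (SchwartzMap.smulLeftCLM ℂ (fun ξ => ((w ξ : ℝ) : ℂ)) ψ) :=
    fun ψ => rfl
  have hS1 : ∀ ψ, ‖S ψ‖ₑ ≤ eLpNorm ψ 1 ν' := by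
    intro ψ
    rw [hSapp]
    refine (hT _).trans (le_of_eq ?_)
    rw [eLpNorm_one_eq_lintegral_enorm, hν',
      lintegral_withDensity_eq_lintegral_mul _ hwm ψ.continuous.measurable.enorm]
    refine lintegral_congr fun ξ => ?_
    rw [SchwartzMap.smulLeftCLM_apply_apply hwt]
    rw [smul_eq_mul, enorm_mul, ← ofReal_norm ((w ξ : ℝ) : ℂ), Complex.norm_real,
      Real.norm_of_nonneg (hwpos ξ).le]
    rfl
  -- Since `ν'` is finite, the `L¹(ν')` bound implies an `L²(ν')` bound, and the density comes from
  -- the Riesz representation in a Hilbert space.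
  set c : ℝ≥0∞ := ν' Set.univ ^ ((1 : ℝ≥0∞).toReal⁻¹ - (2 : ℝ≥0∞).toReal⁻¹) with hc
  have hcfin : c ≠ ∞ := by
    apply ENNReal.rpow_ne_top_of_nonneg _ (measure_ne_top _ _)
    norm_num
  have h12 : ∀ f : Rn n → ℂ, AEStronglyMeasurable f ν' → eLpNorm f 1 ν' ≤ eLpNorm f 2 ν' * c := by
    intro f hf
    simpa only [one_div] using eLpNorm_le_eLpNorm_mul_rpow_measure_univ (p := 1) (q := 2) one_le_two hf
  set e : 𝓢(Rn n, ℂ) →ₗ[ℂ] Lp ℂ 2 ν' := (SchwartzMap.toLpCLM ℂ ℂ 2 ν').toLinearMap with he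
  have hdense : DenseRange e :=
    SchwartzMap.denseRange_toLpCLM (F := ℂ) (μ := ν') ENNReal.ofNat_ne_top
  have hbound : ∀ ψ, ‖S ψ‖ ≤ c.toReal * ‖e ψ‖ := by
    intro ψ
    have h1 := (hS1 ψ).trans (h12 ψ ψ.continuous.aestronglyMeasurable)
    have h2 := ENNReal.toReal_mono
      (ENNReal.mul_ne_top (ψ.eLpNorm_lt_top 2 ν').ne hcfin) h1
    rw [ENNReal.toReal_mul, toReal_enorm, mul_comm] at h2
    simpa [he, SchwartzMap.norm_toLp] using h2
  set ext := S.extendOfNorm e with hext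
  have hexte : ∀ ψ, ext (e ψ) = S ψ := LinearMap.extendOfNorm_eq hdense ⟨_, hbound⟩
  have hextn : ∀ F, ‖ext F‖ ≤ c.toReal * ‖F‖ :=
    LinearMap.norm_extendOfNorm_apply_le hdense _ hbound
  -- The `L¹` bound survives the extension by density; it is what forces the density to have modulus
  -- at most one.
  have hext1 : ∀ F : Lp ℂ 2 ν', ‖ext F‖ₑ ≤ eLpNorm F 1 ν' := by
    intro F
    apply ENNReal.le_of_forall_pos_le_add
    intro ε hε _
    set ε' : ℝ := ε / (2 * (c.toReal + 1)) with hε'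
    have hε'pos : 0 < ε' := by positivity
    obtain ⟨ψ, hψ⟩ := hdense.exists_dist_lt F hε'pos
    rw [dist_eq_norm] at hψ
    have e1 : ‖ext F‖ₑ ≤ ‖ext (F - e ψ)‖ₑ + ‖S ψ‖ₑ := by
      rw [← hexte]
      conv_lhs => rw [← sub_add_cancel F (e ψ), map_add]
      exact enorm_add_le _ _
    have e2 : eLpNorm ψ 1 ν' ≤ eLpNorm F 1 ν' + eLpNorm (F - e ψ : Lp ℂ 2 ν') 1 ν' := by
      have : (ψ : Rn n → ℂ) =ᵐ[ν'] (F : Rn n → ℂ) - ((F - e ψ : Lp ℂ 2 ν') : Rn n → ℂ) := by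
        filter_upwards [Lp.coeFn_sub F (e ψ), ψ.coeFn_toLp 2 ν'] with x hx hx'
        simp only [Pi.sub_apply, hx]
        rw [← hx', he]
        simp
      rw [eLpNorm_congr_ae this]
      exact eLpNorm_sub_le (Lp.aestronglyMeasurable _) (Lp.aestronglyMeasurable _) le_rfl
    have e3 : eLpNorm (F - e ψ : Lp ℂ 2 ν') 1 ν' ≤ ENNReal.ofReal (ε' * c.toReal) := by
      refine (h12 _ (Lp.aestronglyMeasurable _)).trans ?_
      rw [ENNReal.ofReal_mul hε'pos.le, ENNReal.ofReal_toReal hcfin]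
      gcongr
      rw [← Lp.enorm_def, ← ofReal_norm]
      exact ENNReal.ofReal_le_ofReal hψ.le
    have e4 : ‖ext (F - e ψ)‖ₑ ≤ ENNReal.ofReal (c.toReal * ε') := by
      rw [← ofReal_norm]
      apply ENNReal.ofReal_le_ofReal
      exact (hextn _).trans (by gcongr)
    have e5 : ENNReal.ofReal (c.toReal * ε') + ENNReal.ofReal (ε' * c.toReal) ≤ ε := by
      rw [← ENNReal.ofReal_add (by positivity) (by positivity)]
      apply ENNReal.ofReal_le_of_le_toReal
      simp only [ENNReal.coe_toReal, hε']
      have : 0 ≤ c.toReal := by positivity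
      rw [show c.toReal * (ε / (2 * (c.toReal + 1))) + ε / (2 * (c.toReal + 1)) * c.toReal =
        ε * (c.toReal / (c.toReal + 1)) by field_simp; ring]
      have h3 : c.toReal / (c.toReal + 1) ≤ 1 := by
        rw [div_le_one (by positivity)]; linarith
      exact mul_le_of_le_one_right ε.2 h3
    calc ‖ext F‖ₑ ≤ _ := e1
      _ ≤ ENNReal.ofReal (c.toReal * ε') +
          (eLpNorm F 1 ν' + ENNReal.ofReal (ε' * c.toReal)) := by
        gcongr
        exact (hS1 ψ).trans (e2.trans (by gcongr))
      _ = eLpNorm F 1 ν' + (ENNReal.ofReal (c.toReal * ε') + ENNReal.ofReal (ε' * c.toReal)) := by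
        ring
      _ ≤ _ := by gcongr
  set h0 := (InnerProductSpace.toDual ℂ (Lp ℂ 2 ν')).symm ext with hh0
  have hrep : ∀ F : Lp ℂ 2 ν', ext F = ∫ x, F x * (starRingEnd ℂ) (h0 x) ∂ν' := by
    intro F
    have : ext F = inner ℂ h0 F := (InnerProductSpace.toDual_symm_apply).symm
    rw [this, L2.inner_def]
    rfl
  set g : Rn n → ℂ := fun x => (starRingEnd ℂ) (h0 x) with hg
  have hgm : StronglyMeasurable g :=
    Complex.continuous_conj.comp_stronglyMeasurable (Lp.stronglyMeasurable h0)
  have hg2 : MemLp g 2 ν' := by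
    refine (Lp.memLp h0).congr_norm hgm.aestronglyMeasurable (.of_forall fun x => ?_)
    simp [hg]
  have hg1 : ∀ᵐ x ∂ν', ‖g x‖ ≤ 1 := by
    refine ae_le_of_forall_setIntegral_le (f := fun x => ‖g x‖) (g := fun _ => (1 : ℝ))
      (hg2.integrable one_le_two).norm (integrable_const _) fun s hs _ => ?_
    -- The phase of `h0`, cut off to `s`, turns the `L¹` bound into `∫_s ‖g‖ ≤ ν'(s)` for arbitrary
    -- `s`.
    set F0 : Rn n → ℂ := s.indicator fun x => h0 x / (‖h0 x‖ : ℂ) with hF0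
    have hF0m : AEStronglyMeasurable F0 ν' := by
      have hm := (Lp.stronglyMeasurable h0).measurable
      exact ((hm.div (Complex.measurable_ofReal.comp hm.norm)).indicator hs).aestronglyMeasurable
    have hF0b : ∀ x, ‖F0 x‖ ≤ s.indicator (fun _ => (1 : ℝ)) x := by
      intro x
      rw [hF0, norm_indicator_eq_indicator_norm]
      apply Set.indicator_le_indicator
      simp only [norm_div, Complex.norm_real, norm_norm]
      exact div_self_le_one _
    have hF0L : MemLp F0 2 ν' := by
      refine MemLp.of_bound hF0m 1 (.of_forall fun x => (hF0b x).trans ?_)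
      exact Set.indicator_le_self' (fun _ _ => zero_le_one) x
    have i1 := hext1 (hF0L.toLp F0)
    rw [hrep, eLpNorm_congr_ae hF0L.coeFn_toLp, eLpNorm_one_eq_lintegral_enorm] at i1
    have i2 : ∫ x, (hF0L.toLp F0) x * (starRingEnd ℂ) (h0 x) ∂ν' =
        ((∫ x in s, ‖g x‖ ∂ν' : ℝ) : ℂ) := by
      rw [← integral_indicator hs, ← integral_complex_ofReal]
      apply integral_congr_ae
      filter_upwards [hF0L.coeFn_toLp] with x hx
      rw [hx, hF0]
      by_cases hxs : x ∈ s
      · simp only [Set.indicator_of_mem hxs, hg]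
        by_cases h00 : h0 x = 0
        · simp [h00]
        · have : (‖h0 x‖ : ℂ) ≠ 0 := by simpa using h00
          rw [div_mul_eq_mul_div, Complex.mul_conj, Complex.normSq_eq_norm_sq]
          simp only [RCLike.norm_conj]
          push_cast
          field_simp
      · simp [Set.indicator_of_notMem hxs]
    rw [i2, ← ofReal_norm, Complex.norm_real, Real.norm_of_nonneg
      (integral_nonneg fun x => norm_nonneg _)] at i1
    have i3 : ∫⁻ x, ‖F0 x‖ₑ ∂ν' ≤ ν' s := by
      rw [← lintegral_indicator_one hs]
      refine lintegral_mono fun x => ?_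
      have := hF0b x
      rw [← ofReal_norm]
      refine (ENNReal.ofReal_le_ofReal this).trans ?_
      by_cases hxs : x ∈ s <;> simp [hxs]
    have i4 := i1.trans i3
    simp only [integral_const, MeasurableSet.univ, measureReal_restrict_apply, Set.univ_inter,
      smul_eq_mul, mul_one]
    exact (ENNReal.ofReal_le_iff_le_toReal (measure_ne_top _ _)).1 i4
  refine ⟨fun x => if ‖g x‖ ≤ 1 then g x else 0, ?_, ?_, ?_⟩
  · exact Measurable.ite (measurableSet_le hgm.measurable.norm measurable_const)
      hgm.measurable measurable_const
  · intro ξ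
    dsimp only
    split_ifs with h
    · exact h
    · simp
  · intro ψ
    -- The reciprocal of `w` has temperate growth, so every test function is `w` times a test
    -- function and the representation of `S` yields one of `T`.
    have hψ : ψ = SchwartzMap.smulLeftCLM ℂ (fun ξ => ((w ξ : ℝ) : ℂ))
        (SchwartzMap.smulLeftCLM ℂ (fun ξ : Rn n => (((1 + ‖ξ‖ ^ 2) ^ (N : ℝ) : ℝ) : ℂ)) ψ) := by
      ext ξ
      rw [SchwartzMap.smulLeftCLM_apply_apply hwt, SchwartzMap.smulLeftCLM_apply_apply hwit, hw]
      simp only [smul_eq_mul]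
      rw [← mul_assoc, ← Complex.ofReal_mul, ← Real.rpow_add (by positivity)]
      simp
    conv_lhs => rw [hψ, ← hSapp, ← hexte, hrep]
    have : ∫ x, (e (SchwartzMap.smulLeftCLM ℂ
        (fun ξ : Rn n => (((1 + ‖ξ‖ ^ 2) ^ (N : ℝ) : ℝ) : ℂ)) ψ)) x * (starRingEnd ℂ) (h0 x) ∂ν' =
        ∫ x, (((1 + ‖x‖ ^ 2) ^ (N : ℝ) : ℝ) : ℂ) * ψ x * (if ‖g x‖ ≤ 1 then g x else 0) ∂ν' := by
      apply integral_congr_ae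
      filter_upwards [SchwartzMap.coeFn_toLp (SchwartzMap.smulLeftCLM ℂ
        (fun ξ : Rn n => (((1 + ‖ξ‖ ^ 2) ^ (N : ℝ) : ℝ) : ℂ)) ψ) 2 ν', hg1] with x hx hx'
      rw [if_pos hx']
      congr 1
      refine hx.trans ?_
      rw [SchwartzMap.smulLeftCLM_apply_apply hwit]
      rfl
    rw [this, hν', integral_withDensity_eq_integral_toReal_smul hwm (by simp)]
    apply integral_congr_ae
    refine .of_forall fun x => ?_
    simp only [ENNReal.toReal_ofReal (hwpos x).le, Complex.real_smul]
    rw [← mul_assoc, ← mul_assoc, ← Complex.ofReal_mul, hw]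
    simp only
    rw [← Real.rpow_add (by positivity)]
    simp

end

/-! ### Densities and total variations -/

section

variable {n : ℕ}

/-- The complex measures `h dν` and `h' dν'` coincide: they have the same density with respect to a
common base measure. -/
def SameDensity (ν : Measure (Rn n)) (h : Rn n → ℂ) (ν' : Measure (Rn n)) (h' : Rn n → ℂ) : Prop :=
  ∃ (σ : Measure (Rn n)) (r r' : Rn n → ℝ≥0∞), Measurable r ∧ Measurable r' ∧
    (∀ᵐ x ∂σ, r x < ∞) ∧ (∀ᵐ x ∂σ, r' x < ∞) ∧ ν = σ.withDensity r ∧ ν' = σ.withDensity r' ∧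
    ∀ᵐ x ∂σ, (r x).toReal • h x = (r' x).toReal • h' x

section SameDensity

variable {ν ν' : Measure (Rn n)} {h h' : Rn n → ℂ}

/-- Both base measures are absolutely continuous with respect to `ν + ν'`. The two resulting
densities are locally integrable and agree against smooth compactly supported functions, hence
almost everywhere. -/
theorem sameDensity_of_integral_eq [IsLocallyFiniteMeasure ν] [IsLocallyFiniteMeasure ν']
    (hh : LocallyIntegrable h ν) (hh' : LocallyIntegrable h' ν')
    (H : ∀ ψ : 𝓢(Rn n, ℂ), HasCompactSupport ψ → ∫ ξ, ψ ξ * h ξ ∂ν = ∫ ξ, ψ ξ * h' ξ ∂ν') :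
    SameDensity ν h ν' h' := by
  have key : ∀ {ρ σ : Measure (Rn n)} {g : Rn n → ℂ} {r : Rn n → ℝ≥0∞}, Measurable r →
      (∀ᵐ x ∂σ, r x < ∞) → ρ = σ.withDensity r → LocallyIntegrable g ρ →
      LocallyIntegrable (fun x => (r x).toReal • g x) σ := by
    intro ρ σ g r hr hr' hρ hg x
    obtain ⟨U, hU, hi⟩ := hg x
    obtain ⟨V, hVU, hVo, hxV⟩ := mem_nhds_iff.1 hU
    refine ⟨V, hVo.mem_nhds hxV, ?_⟩
    have h1 := hi.mono_set hVU
    rw [IntegrableOn, hρ, restrict_withDensity hVo.measurableSet,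
      integrable_withDensity_iff_integrable_smul' hr (ae_restrict_of_ae hr')] at h1
    exact h1
  have m1 := Measure.measurable_rnDeriv ν (ν + ν')
  have m2 := Measure.measurable_rnDeriv ν' (ν + ν')
  have a1 : ∀ᵐ x ∂(ν + ν'), ν.rnDeriv (ν + ν') x < ∞ := Measure.rnDeriv_lt_top _ _
  have a2 : ∀ᵐ x ∂(ν + ν'), ν'.rnDeriv (ν + ν') x < ∞ := Measure.rnDeriv_lt_top _ _
  have e1 : ν = (ν + ν').withDensity (ν.rnDeriv (ν + ν')) :=
    (Measure.withDensity_rnDeriv_eq _ _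
      (Measure.le_add_right le_rfl).absolutelyContinuous).symm
  have e2 : ν' = (ν + ν').withDensity (ν'.rnDeriv (ν + ν')) :=
    (Measure.withDensity_rnDeriv_eq _ _
      (Measure.le_add_left le_rfl).absolutelyContinuous).symm
  refine ⟨ν + ν', _, _, m1, m2, a1, a2, e1, e2, ?_⟩
  refine ae_eq_of_integral_contDiff_smul_eq (key m1 a1 e1 hh) (key m2 a2 e2 hh') ?_
  intro g hg hgs
  have hgs' : HasCompactSupport fun x => (g x : ℂ) :=
    hgs.comp_left (g := fun t : ℝ => (t : ℂ)) Complex.ofReal_zero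
  have hg' : ContDiff ℝ (⊤ : ℕ∞) fun x => (g x : ℂ) := Complex.ofRealCLM.contDiff.comp hg
  have hH := H (hgs'.toSchwartzMap hg') hgs'
  have t1 : ∀ {ρ : Measure (Rn n)} {g' : Rn n → ℂ} {r : Rn n → ℝ≥0∞}, Measurable r →
      (∀ᵐ x ∂(ν + ν'), r x < ∞) → ρ = (ν + ν').withDensity r →
      ∫ x, g x • (r x).toReal • g' x ∂(ν + ν') = ∫ x, (g x : ℂ) * g' x ∂ρ := by
    intro ρ g' r hr hr' hρ
    rw [hρ, integral_withDensity_eq_integral_toReal_smul hr hr']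
    refine integral_congr_ae (.of_forall fun x => ?_)
    simp only [Complex.real_smul]
    ring
  rw [t1 m1 a1 e1, t1 m2 a2 e2]
  exact hH

/-- `G` may be an arbitrary function: passing to the base measure `σ` only requires `r` and `r'` to
be measurable and finite almost everywhere. Symbols can therefore be moved between densities before
their measurability is known. -/
theorem SameDensity.integrable_iff (H : SameDensity ν h ν' h') (G : Rn n → ℂ) :
    Integrable (fun x => G x * h x) ν ↔ Integrable (fun x => G x * h' x) ν' := by
  obtain ⟨σ, r, r', hr, hr', hf, hf', rfl, rfl, hE⟩ := H
  rw [integrable_withDensity_iff_integrable_smul' hr hf,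
    integrable_withDensity_iff_integrable_smul' hr' hf']
  apply integrable_congr
  filter_upwards [hE] with x hx
  rw [← smul_eq_mul, ← smul_eq_mul, smul_comm, hx, smul_comm]

theorem SameDensity.integral_eq (H : SameDensity ν h ν' h') (G : Rn n → ℂ) :
    ∫ x, G x * h x ∂ν = ∫ x, G x * h' x ∂ν' := by
  obtain ⟨σ, r, r', hr, hr', hf, hf', rfl, rfl, hE⟩ := H
  rw [integral_withDensity_eq_integral_toReal_smul hr hf,
    integral_withDensity_eq_integral_toReal_smul hr' hf']
  apply integral_congr_ae
  filter_upwards [hE] with x hx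
  rw [← smul_eq_mul, ← smul_eq_mul, smul_comm, hx, smul_comm]

theorem SameDensity.lintegral_eq (H : SameDensity ν h ν' h') (g : Rn n → ℝ≥0∞) :
    ∫⁻ x, g x * ‖h x‖ₑ ∂ν = ∫⁻ x, g x * ‖h' x‖ₑ ∂ν' := by
  obtain ⟨σ, r, r', hr, hr', hf, hf', rfl, rfl, hE⟩ := H
  rw [lintegral_withDensity_eq_lintegral_mul_non_measurable _ hr hf,
    lintegral_withDensity_eq_lintegral_mul_non_measurable _ hr' hf']
  apply lintegral_congr_ae
  filter_upwards [hE, hf, hf'] with x hx h1 h2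
  have e : ∀ (a : ℝ≥0∞) (z : ℂ), a < ∞ → ‖a.toReal • z‖ₑ = a * ‖z‖ₑ := by
    intro a z ha
    rw [enorm_smul, Real.enorm_eq_ofReal ENNReal.toReal_nonneg, ENNReal.ofReal_toReal ha.ne]
  simp only [Pi.mul_apply]
  rw [mul_left_comm, mul_left_comm (r' x), ← e _ _ h1, ← e _ _ h2, hx]

theorem SameDensity.withDensity_eq (H : SameDensity ν h ν' h') :
    ν.withDensity (fun x => ‖h x‖ₑ) = ν'.withDensity (fun x => ‖h' x‖ₑ) := by
  ext s hs
  rw [withDensity_apply _ hs, withDensity_apply _ hs, ← lintegral_indicator hs,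
    ← lintegral_indicator hs]
  convert H.lintegral_eq (s.indicator 1) using 3 with x x
  all_goals by_cases hx : x ∈ s <;> simp [hx]

end SameDensity

theorem IsFourierDensity.locallyIntegrable {f : TDist n} {ν : Measure (Rn n)} {h : Rn n → ℂ}
    (H : IsFourierDensity f ν h) : LocallyIntegrable h ν := by
  obtain ⟨N, hN⟩ := H.tempered
  have h1 := hN.locallyIntegrable
  have h2 : Continuous fun x : Rn n => (((1 + ‖x‖) ^ N : ℝ) : ℂ) := by fun_prop
  have h3 := (locallyIntegrableOn_univ.2 h1).continuousOn_mul h2.continuousOn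
    isOpen_univ.isLocallyClosed
  rw [locallyIntegrableOn_univ] at h3
  convert h3 using 2 with x
  rw [← Complex.real_smul, smul_smul, mul_inv_cancel₀ (by positivity), one_smul]

theorem IsFourierDensity.sameDensity {f : TDist n} {ν ν' : Measure (Rn n)} {h h' : Rn n → ℂ}
    (H : IsFourierDensity f ν h) (H' : IsFourierDensity f ν' h') : SameDensity ν h ν' h' := by
  have := H.locallyFinite
  have := H'.locallyFinite
  refine sameDensity_of_integral_eq H.locallyIntegrable H'.locallyIntegrable fun ψ _ => ?_
  rw [← H.eq_integral, ← H'.eq_integral]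

/-- The Fourier transform of `f` is a tempered measure without mass at the origin. -/
def IsMeas (f : TDist n) : Prop := ∃ ν h, IsFourierDensity f ν h

open scoped Classical in
/-- The total variation of the Fourier transform of `f`. -/
def tv (f : TDist n) : Measure (Rn n) :=
  if H : IsMeas f then H.choose.withDensity fun x => ‖H.choose_spec.choose x‖ₑ else 0

/-- The choice made in `tv` is immaterial, because all densities of one Fourier transform define the
same variation. -/
theorem IsFourierDensity.tv_eq {f : TDist n} {ν : Measure (Rn n)} {h : Rn n → ℂ}
    (H : IsFourierDensity f ν h) : tv f = ν.withDensity fun x => ‖h x‖ₑ := by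
  have hM : IsMeas f := ⟨ν, h, H⟩
  rw [tv, dif_pos hM]
  exact (hM.choose_spec.choose_spec.sameDensity H).withDensity_eq

theorem IsFourierDensity.lintegral_tv {f : TDist n} {ν : Measure (Rn n)} {h : Rn n → ℂ}
    (H : IsFourierDensity f ν h) (g : Rn n → ℝ≥0∞) (hg : Measurable g) :
    ∫⁻ x, g x ∂(tv f) = ∫⁻ x, g x * ‖h x‖ₑ ∂ν := by
  rw [H.tv_eq, lintegral_withDensity_eq_lintegral_mul₀' H.locallyIntegrable.aestronglyMeasurable.enorm
    hg.aemeasurable]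
  simp only [Pi.mul_apply, mul_comm]

theorem hasTemperateGrowth_of_lintegral {ν : Measure (Rn n)} {N : ℕ}
    (h : ∫⁻ x, ENNReal.ofReal ((1 + ‖x‖) ^ (-(N : ℝ))) ∂ν < ∞) : ν.HasTemperateGrowth := by
  refine ⟨N, ?_, ?_⟩
  · apply Continuous.aestronglyMeasurable
    apply Continuous.rpow_const (by fun_prop)
    intro x; left; positivity
  · rw [hasFiniteIntegral_iff_ofReal (.of_forall fun x => by positivity)]
    exact h

theorem IsMeas.hasTemperateGrowth_tv {f : TDist n} (hf : IsMeas f) : (tv f).HasTemperateGrowth := by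
  obtain ⟨ν, h, H⟩ := hf
  obtain ⟨N, hN⟩ := H.tempered
  apply hasTemperateGrowth_of_lintegral (N := N)
  have hm : Measurable fun x : Rn n => ENNReal.ofReal ((1 + ‖x‖) ^ (-(N : ℝ))) := by
    apply Measurable.ennreal_ofReal
    apply Continuous.measurable
    apply Continuous.rpow_const (by fun_prop)
    intro x; left; positivity
  rw [H.lintegral_tv _ hm]
  refine lt_of_eq_of_lt (lintegral_congr fun x => ?_) hN.2
  rw [enorm_smul, Real.rpow_neg (by positivity), Real.rpow_natCast,
    Real.enorm_eq_ofReal (by positivity)]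

theorem tv_zero_singleton (f : TDist n) : tv f {0} = 0 := by
  by_cases hf : IsMeas f
  · obtain ⟨ν, h, H⟩ := hf
    rw [H.tv_eq]
    exact withDensity_absolutelyContinuous _ _ H.zero
  · rw [tv, dif_neg hf]; simp

theorem IsMeas.dominated_tv {f : TDist n} (hf : IsMeas f) : Dominated (fourierDist f) (tv f) := by
  obtain ⟨ν, h, H⟩ := hf
  intro ψ
  rw [H.lintegral_tv _ ψ.continuous.measurable.enorm, H.eq_integral]
  refine (enorm_integral_le_lintegral_enorm _).trans (le_of_eq ?_)
  simp only [enorm_mul]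

theorem isFourierDensity_of_bounded {f : TDist n} {ν : Measure (Rn n)} {h : Rn n → ℂ}
    (hν : ν.HasTemperateGrowth) (h0 : ν {0} = 0) (hm : AEStronglyMeasurable h ν)
    (hb : ∀ᵐ ξ ∂ν, ‖h ξ‖ ≤ 1) (he : ∀ ψ, fourierDist f ψ = ∫ ξ, ψ ξ * h ξ ∂ν) :
    IsFourierDensity f ν h where
  locallyFinite := isLocallyFiniteMeasure_of_hasTemperateGrowth ν
  zero := h0
  tempered := by
    obtain ⟨N, hN⟩ := hν
    refine ⟨N, hN.mono' ?_ ?_⟩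
    · refine AEStronglyMeasurable.fun_smul ?_ hm
      apply Continuous.aestronglyMeasurable
      apply Continuous.inv₀ (by fun_prop)
      intro x; positivity
    · filter_upwards [hb] with x hx
      rw [norm_smul, Real.rpow_neg (by positivity), Real.rpow_natCast,
        Real.norm_of_nonneg (by positivity)]
      exact mul_le_of_le_one_right (by positivity) hx
  eq_integral := he

theorem Dominated.exists_isFourierDensity {f : TDist n} {ν : Measure (Rn n)}
    (hν : ν.HasTemperateGrowth) (h0 : ν {0} = 0) (hf : Dominated (fourierDist f) ν) :
    ∃ h, Measurable h ∧ (∀ ξ, ‖h ξ‖ ≤ 1) ∧ IsFourierDensity f ν h := by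
  obtain ⟨h, hm, hb, he⟩ := hf.exists_density
  exact ⟨h, hm, hb, isFourierDensity_of_bounded hν h0 hm.aestronglyMeasurable
    (.of_forall hb) he⟩

theorem Dominated.isMeas {f : TDist n} {ν : Measure (Rn n)} (hf : Dominated (fourierDist f) ν)
    (hν : ν.HasTemperateGrowth) (h0 : ν {0} = 0) : IsMeas f := by
  obtain ⟨h, -, -, H⟩ := hf.exists_isFourierDensity hν h0
  exact ⟨ν, h, H⟩

/-- The density with respect to `ν` has modulus at most one. Thus `tv f` is the least dominating
measure of temperate growth without an atom at the origin, and bounds on dominating measures pass to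
it. -/
theorem Dominated.tv_le {f : TDist n} {ν : Measure (Rn n)} (hf : Dominated (fourierDist f) ν)
    (hν : ν.HasTemperateGrowth) (h0 : ν {0} = 0) : tv f ≤ ν := by
  obtain ⟨h, hm, hb, H⟩ := hf.exists_isFourierDensity hν h0
  rw [H.tv_eq]
  refine (withDensity_mono (.of_forall fun x => ?_)).trans_eq withDensity_one
  rw [Pi.one_apply, ← ofReal_norm]
  exact ENNReal.ofReal_le_one.2 (hb x)

/-- The Fourier transform of `f` has a density of modulus at most one with respect to its total
variation. -/
theorem IsMeas.exists_density {f : TDist n} (hf : IsMeas f) :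
    ∃ h, Measurable h ∧ (∀ ξ, ‖h ξ‖ ≤ 1) ∧ IsFourierDensity f (tv f) h :=
  hf.dominated_tv.exists_isFourierDensity hf.hasTemperateGrowth_tv (tv_zero_singleton f)

theorem Dominated.add {S T : TDist n} {ν ν' : Measure (Rn n)} (hS : Dominated S ν)
    (hT : Dominated T ν') : Dominated (S + T) (ν + ν') := by
  intro ψ
  rw [tdist_add_apply, lintegral_add_measure]
  exact (enorm_add_le _ _).trans (add_le_add (hS ψ) (hT ψ))

theorem Dominated.neg {T : TDist n} {ν : Measure (Rn n)} (hT : Dominated T ν) :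
    Dominated (-T) ν := by
  intro ψ
  rw [tdist_neg_apply, enorm_neg]
  exact hT ψ

theorem Dominated.mono {T : TDist n} {ν ν' : Measure (Rn n)} (hT : Dominated T ν) (h : ν ≤ ν') :
    Dominated T ν' := fun ψ => (hT ψ).trans (lintegral_mono' h le_rfl)

theorem hasTemperateGrowth_add {ν ν' : Measure (Rn n)} (hν : ν.HasTemperateGrowth)
    (hν' : ν'.HasTemperateGrowth) : (ν + ν').HasTemperateGrowth := by
  obtain ⟨N, hN⟩ := hν
  obtain ⟨N', hN'⟩ := hν'
  have key : ∀ {ρ : Measure (Rn n)} {a b : ℕ}, a ≤ b →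
      Integrable (fun x : Rn n => (1 + ‖x‖) ^ (-(a : ℝ))) ρ →
      Integrable (fun x : Rn n => (1 + ‖x‖) ^ (-(b : ℝ))) ρ := by
    intro ρ a b hab h
    refine h.mono' ?_ (.of_forall fun x => ?_)
    · apply Continuous.aestronglyMeasurable
      apply Continuous.rpow_const (by fun_prop)
      intro x; left; positivity
    · rw [Real.norm_of_nonneg (by positivity)]
      apply Real.rpow_le_rpow_of_exponent_le
      · linarith [norm_nonneg x]
      · simpa using hab
  exact ⟨N + N', (key (by omega) hN).add_measure (key (by omega) hN')⟩

theorem IsMeas.add {f g : TDist n} (hf : IsMeas f) (hg : IsMeas g) : IsMeas (f + g) := by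
  refine Dominated.isMeas (ν := tv f + tv g) ?_
    (hasTemperateGrowth_add hf.hasTemperateGrowth_tv hg.hasTemperateGrowth_tv) ?_
  · rw [fourierDist_add]
    exact hf.dominated_tv.add hg.dominated_tv
  · simp [tv_zero_singleton]

theorem tv_add_le {f g : TDist n} (hf : IsMeas f) (hg : IsMeas g) :
    tv (f + g) ≤ tv f + tv g := by
  refine Dominated.tv_le ?_
    (hasTemperateGrowth_add hf.hasTemperateGrowth_tv hg.hasTemperateGrowth_tv) ?_
  · rw [fourierDist_add]
    exact hf.dominated_tv.add hg.dominated_tv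
  · simp [tv_zero_singleton]

theorem IsMeas.neg {f : TDist n} (hf : IsMeas f) : IsMeas (-f) := by
  refine Dominated.isMeas (ν := tv f) ?_ hf.hasTemperateGrowth_tv (tv_zero_singleton f)
  rw [fourierDist_neg]
  exact hf.dominated_tv.neg

theorem IsMeas.sub {f g : TDist n} (hf : IsMeas f) (hg : IsMeas g) : IsMeas (f - g) := by
  rw [sub_eq_add_neg]
  exact hf.add hg.neg

theorem isMeas_zero : IsMeas (0 : TDist n) := by
  refine Dominated.isMeas (ν := 0) ?_ ⟨0, by simp⟩ (by simp)
  intro ψ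
  rw [fourierDist_zero]
  simp

end

/-! ### Morrey norms through duality -/

section

variable {n : ℕ}

/-- The exponent conjugate to `p`, as a real number. -/
def conjExp (p : ℝ≥0∞) : ℝ := (1 - p⁻¹.toReal)⁻¹

/-- The norm dual to `L^p`; for `p = 1` the supremum, since the measures may be singular. -/
def dualNorm (p : ℝ≥0∞) (g : Rn n → ℝ≥0∞) : ℝ≥0∞ :=
  if p = 1 then ⨆ x, g x else (∫⁻ x, g x ^ conjExp p) ^ (1 - p⁻¹.toReal)

theorem inv_toReal_le_one {p : ℝ≥0∞} (hp : 1 ≤ p) : p⁻¹.toReal ≤ 1 := by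
  have : p⁻¹ ≤ 1 := ENNReal.inv_le_one.2 hp
  simpa using ENNReal.toReal_mono ENNReal.one_ne_top this

theorem inv_toReal_lt_one {p : ℝ≥0∞} (hp : 1 ≤ p) (h1 : p ≠ 1) : p⁻¹.toReal < 1 := by
  have : p⁻¹ < 1 := ENNReal.inv_lt_one.2 (lt_of_le_of_ne hp h1.symm)
  simpa using (ENNReal.toReal_lt_toReal this.ne_top ENNReal.one_ne_top).2 this

theorem conjExp_pos {p : ℝ≥0∞} (hp : 1 ≤ p) (h1 : p ≠ 1) : 0 < conjExp p :=
  inv_pos.2 (by linarith [inv_toReal_lt_one hp h1])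

theorem holderConjugate_conjExp {p : ℝ≥0∞} (hp : 1 ≤ p) (h1 : p ≠ 1) (ht : p ≠ ∞) :
    p.toReal.HolderConjugate (conjExp p) := by
  rw [Real.holderConjugate_iff]
  constructor
  · have : 1 < p := lt_of_le_of_ne hp h1.symm
    simpa using (ENNReal.toReal_lt_toReal ENNReal.one_ne_top ht).2 this
  · rw [conjExp, inv_inv, ENNReal.toReal_inv]; ring

theorem dualNorm_comp_add {p : ℝ≥0∞} (g : Rn n → ℝ≥0∞) (a : Rn n) :
    dualNorm p (fun x => g (x + a)) = dualNorm p g := by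
  unfold dualNorm
  split_ifs with h1
  · exact (Equiv.addRight a).iSup_comp (g := g)
  · rw [lintegral_add_right_eq_self (fun x => g x ^ conjExp p) a]

/-- Hölder's inequality. For `p = 1` the dual norm is a true supremum, so that `ν` may be singular.
-/
theorem lintegral_mul_le_dualNorm {p : ℝ≥0∞} (hp : 1 ≤ p) {ν : Measure (Rn n)}
    (hν : p ≠ 1 → ν = volume) {g H : Rn n → ℝ≥0∞} (hg : Measurable g) (hH : Measurable H)
    {B : Set (Rn n)} (hB : MeasurableSet B) (hgB : ∀ x ∉ B, g x = 0) :
    ∫⁻ x, g x * H x ∂ν ≤ dualNorm p g * eLpNorm H p (ν.restrict B) := by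
  have h0 : ∫⁻ x, g x * H x ∂ν = ∫⁻ x in B, g x * H x ∂ν := by
    rw [← lintegral_indicator hB]
    refine lintegral_congr fun x => ?_
    by_cases hx : x ∈ B <;> simp [hx, hgB]
  rw [h0]
  unfold dualNorm
  split_ifs with h1
  · rw [h1, eLpNorm_one_eq_lintegral_enorm, ← lintegral_const_mul _ hH.enorm]
    exact lintegral_mono fun x => mul_le_mul' (le_iSup g x) le_rfl
  · rw [hν h1]
    by_cases ht : p = ∞
    · subst ht
      have hq : conjExp ∞ = 1 := by simp [conjExp]
      rw [eLpNorm_exponent_top, hq]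
      simp only [ENNReal.rpow_one, ENNReal.inv_top, ENNReal.toReal_zero, sub_zero]
      calc ∫⁻ x in B, g x * H x ≤ ∫⁻ x in B, g x * eLpNormEssSup H (volume.restrict B) := by
            apply lintegral_mono_ae
            filter_upwards [enorm_ae_le_eLpNormEssSup H (volume.restrict B)] with x hx
            gcongr
            exact hx
        _ = (∫⁻ x in B, g x) * eLpNormEssSup H (volume.restrict B) := lintegral_mul_const _ hg
        _ ≤ _ := by gcongr; exact Measure.restrict_le_self
    · have hpq := holderConjugate_conjExp hp h1 ht
      have := ENNReal.lintegral_mul_le_Lp_mul_Lq (volume.restrict B) hpq.symm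
        hg.aemeasurable hH.aemeasurable
      refine this.trans ?_
      rw [eLpNorm_eq_lintegral_rpow_enorm_toReal (by positivity) ht]
      have e : 1 / conjExp p = 1 - p⁻¹.toReal := by rw [conjExp, one_div, inv_inv]
      rw [e]
      gcongr
      · linarith [inv_toReal_le_one hp]
      · exact Measure.restrict_le_self
      · rfl

/-- The converse of Hölder's inequality on a set of finite volume. The test functions are multiples
of indicators for `p = 1` and `p = ∞`, and of truncations of `H ^ (p - 1)` otherwise. The constant
`c` is later the factor `R^{-μ/p}` of the Morrey norm. -/
theorem le_iSup_lintegral_mul {p : ℝ≥0∞} (hp : 1 ≤ p) {ν : Measure (Rn n)}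
    (hν : p ≠ 1 → ν = volume) {H : Rn n → ℝ≥0∞} (hH : Measurable H)
    {B : Set (Rn n)} (hB : MeasurableSet B) (hBv : volume B ≠ ∞) {c : ℝ≥0∞} (hc : c ≠ ∞)
    {S : ℝ≥0∞} (hS : ∀ g : Rn n → ℝ≥0∞, Measurable g → (∀ x ∉ B, g x = 0) → dualNorm p g ≤ c →
      ∫⁻ x, g x * H x ∂ν ≤ S) :
    c * eLpNorm H p (ν.restrict B) ≤ S := by
  by_cases h1 : p = 1
  · subst h1
    rw [eLpNorm_one_eq_lintegral_enorm, ← lintegral_const_mul _ hH.enorm]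
    refine le_trans (le_of_eq ?_) (hS (B.indicator fun _ => c) (measurable_const.indicator hB)
      (fun x hx => by simp [hx]) ?_)
    · rw [← lintegral_indicator hB]
      refine lintegral_congr fun x => ?_
      by_cases hx : x ∈ B <;> simp [hx]
    · rw [dualNorm, if_pos rfl]
      exact iSup_le fun x => Set.indicator_le_self' (fun _ _ => zero_le) x
  rw [hν h1] at *
  have hind : ∀ (k : Rn n → ℝ≥0∞), ∫⁻ x, (B.indicator k) x * H x = ∫⁻ x in B, k x * H x := by
    intro k
    rw [← lintegral_indicator hB]
    refine lintegral_congr fun x => ?_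
    by_cases hx : x ∈ B <;> simp [hx]
  by_cases ht : p = ∞
  · subst ht
    have hq : conjExp ∞ = 1 := by simp [conjExp]
    rw [eLpNorm_exponent_top]
    by_cases hc0 : c = 0
    · simp [hc0]
    rw [mul_comm, ← ENNReal.le_div_iff_mul_le (.inl hc0) (.inl hc)]
    refine essSup_le_of_ae_le _ ?_
    change (fun x => ‖H x‖ₑ) ≤ᵐ[volume.restrict B] fun _ => S / c
    have : IsFiniteMeasure ((volume : Measure (Rn n)).restrict B) :=
      ⟨by simpa using hBv.lt_top⟩
    refine ae_le_of_forall_setLIntegral_le_of_sigmaFinite hH.enorm fun E hE _ => ?_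
    rw [Measure.restrict_restrict hE, setLIntegral_const]
    set V := volume (E ∩ B) with hV
    have hVt : V ≠ ∞ := ((measure_mono Set.inter_subset_right).trans_lt hBv.lt_top).ne
    by_cases hV0 : V = 0
    · rw [Measure.restrict_eq_zero.2 hV0]; simp
    -- The value `c / V` on `E ∩ B` has integral `c`, so testing with it bounds the mean of `H` over
    -- `E ∩ B` by `S / c`.
    have h2 := hS (B.indicator (E.indicator fun _ => c / V))
      ((measurable_const.indicator hE).indicator hB) (fun x hx => by simp [hx]) ?_
    · rw [hind] at h2
      have h3 : ∫⁻ x in B, E.indicator (fun _ => c / V) x * H x =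
          c / V * ∫⁻ x in E ∩ B, H x := by
        rw [← lintegral_const_mul _ hH, ← Measure.restrict_restrict hE, ← lintegral_indicator hE]
        refine lintegral_congr fun x => ?_
        by_cases hx : x ∈ E <;> simp [hx]
      rw [h3] at h2
      change ∫⁻ x in E ∩ B, H x ≤ _
      rw [mul_comm, ← ENNReal.le_div_iff_mul_le
        (.inl (ENNReal.div_pos hc0 hVt).ne') (.inl (ENNReal.div_ne_top hc hV0))] at h2
      refine h2.trans (le_of_eq ?_)
      rw [div_eq_mul_inv, ENNReal.inv_div (.inl hVt) (.inl hV0), div_eq_mul_inv,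
        div_eq_mul_inv]
      ring
    · rw [dualNorm, if_neg h1, hq]
      simp only [ENNReal.rpow_one, ENNReal.inv_top, ENNReal.toReal_zero, sub_zero]
      rw [lintegral_indicator hB, lintegral_indicator hE, Measure.restrict_restrict hE,
        setLIntegral_const, ENNReal.div_mul_cancel hV0 hVt]
  · have hpq := holderConjugate_conjExp hp h1 ht
    set P := p.toReal with hP
    set q := conjExp p with hq
    have hP0 : 0 < P := hpq.pos
    have hq0 : 0 < q := hpq.symm.pos
    have e : 1 - p⁻¹.toReal = 1 / q := by rw [hq, conjExp, one_div, inv_inv]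
    rw [eLpNorm_eq_lintegral_rpow_enorm_toReal (by positivity) ht, ← hP]
    by_cases hc0 : c = 0
    · simp [hc0]
    rw [mul_comm, ← ENNReal.le_div_iff_mul_le (.inl hc0) (.inl hc),
      one_div, ENNReal.rpow_inv_le_iff hP0]
    -- Truncation at height `m` makes the normalising integral `I` finite; monotone convergence
    -- removes it.
    set k : ℕ → Rn n → ℝ≥0∞ := fun m x => min (H x) m with hk
    have hkm : ∀ m, Measurable (k m) := fun m => hH.min measurable_const
    have hsup : ∀ x, ⨆ m, k m x ^ P = H x ^ P := by
      intro x
      apply le_antisymm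
      · exact iSup_le fun m => ENNReal.rpow_le_rpow (min_le_left _ _) hP0.le
      · have : Tendsto (fun m : ℕ => k m x ^ P) atTop (𝓝 (min (H x) ∞ ^ P)) :=
          (ENNReal.continuous_rpow_const.tendsto _).comp
            (tendsto_const_nhds.min ENNReal.tendsto_nat_nhds_top)
        rw [min_eq_left le_top] at this
        exact le_of_tendsto' this fun m => le_iSup (fun m => k m x ^ P) m
    have hlim : ∫⁻ x in B, ‖H x‖ₑ ^ P = ⨆ m, ∫⁻ x in B, k m x ^ P := by
      rw [← lintegral_iSup (fun m => (hkm m).pow_const _)]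
      · exact lintegral_congr fun x => (hsup x).symm
      · intro a b hab x
        apply ENNReal.rpow_le_rpow _ hP0.le
        exact min_le_min le_rfl (by exact_mod_cast hab)
    rw [hlim]
    refine iSup_le fun m => ?_
    set I := ∫⁻ x in B, k m x ^ P with hI
    have hIt : I ≠ ∞ := by
      have h2 : I ≤ (m : ℝ≥0∞) ^ P * volume B := by
        rw [← setLIntegral_const]
        exact lintegral_mono fun x => ENNReal.rpow_le_rpow (min_le_right _ _) hP0.le
      exact (h2.trans_lt (ENNReal.mul_lt_top
        (ENNReal.rpow_lt_top_of_nonneg hP0.le (by simp)) hBv.lt_top)).ne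
    by_cases hI0 : I = 0
    · rw [hI0]; exact zero_le
    -- The extremal function of Hölder's inequality for `k m`, normalised to have dual norm `c`.
    have hb := hS (B.indicator fun x => c * I ^ (-(1 / q)) * k m x ^ (P - 1))
      (((hkm m).pow_const _).const_mul _ |>.indicator hB) (fun x hx => by simp [hx]) ?_
    · rw [hind] at hb
      have h3 : c * I ^ (1 / P) ≤ S := by
        refine le_trans (le_of_eq ?_) (le_trans
          (lintegral_mono (f := fun x => c * I ^ (-(1 / q)) * k m x ^ P) fun x => ?_) hb)
        · rw [lintegral_const_mul _ ((hkm m).pow_const _), ← hI, mul_assoc]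
          conv_rhs => rw [← ENNReal.rpow_one I, ← ENNReal.rpow_mul,
            ← ENNReal.rpow_add _ _ hI0 hIt]
          congr 2
          have := hpq.inv_add_inv_eq_one
          rw [one_div, one_div]
          linarith
        · rw [mul_assoc (c * _)]
          refine mul_le_mul' le_rfl ?_
          have h4 : k m x ^ P = k m x ^ (P - 1) * k m x ^ (1 : ℝ) := by
            rw [← ENNReal.rpow_add_of_nonneg _ _ (by linarith [hpq.lt]) zero_le_one]
            ring_nf
          rw [h4, ENNReal.rpow_one]
          exact mul_le_mul' le_rfl (min_le_left _ _)
      have h5 : I ^ (1 / P) ≤ S / c := by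
        rw [ENNReal.le_div_iff_mul_le (.inl hc0) (.inl hc), mul_comm]; exact h3
      rw [one_div, ENNReal.rpow_inv_le_iff hP0] at h5
      exact h5
    · rw [dualNorm, if_neg h1, ← hq, e]
      have h6 : ∫⁻ x, (B.indicator fun x => c * I ^ (-(1 / q)) * k m x ^ (P - 1)) x ^ q =
          c ^ q * I⁻¹ * I := by
        have : ∀ x, (B.indicator fun x => c * I ^ (-(1 / q)) * k m x ^ (P - 1)) x ^ q =
            B.indicator (fun x => c ^ q * I⁻¹ * k m x ^ P) x := by
          intro x
          by_cases hx : x ∈ B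
          · simp only [Set.indicator_of_mem hx]
            rw [ENNReal.mul_rpow_of_nonneg _ _ hq0.le, ENNReal.mul_rpow_of_nonneg _ _ hq0.le,
              ← ENNReal.rpow_mul, ← ENNReal.rpow_mul, hpq.sub_one_mul_conj]
            congr 2
            rw [← ENNReal.rpow_neg_one]
            congr 1
            field_simp
          · simp [hx, hq0]
        simp_rw [this]
        rw [lintegral_indicator hB, lintegral_const_mul _ ((hkm m).pow_const _)]
      rw [h6, mul_assoc, ENNReal.inv_mul_cancel hI0 hIt, mul_one, ← ENNReal.rpow_mul,
        mul_one_div_cancel hq0.ne', ENNReal.rpow_one]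

/-- The test functions by which the norm of `M_{p,μ}` is computed. -/
structure IsMorreyTest (p : ℝ≥0∞) (μ : ℝ) (g : Rn n → ℝ≥0∞) : Prop where
  measurable : Measurable g
  bound : ∃ (x₀ : Rn n) (R : ℝ), 0 < R ∧ (∀ x ∉ Metric.ball x₀ R, g x = 0) ∧
    dualNorm p g ≤ ENNReal.ofReal (R ^ (-(μ * p⁻¹.toReal)))

/-- The norm of `M_{p,μ}` of a positive measure. -/
def morrey (p : ℝ≥0∞) (μ : ℝ) (ν : Measure (Rn n)) : ℝ≥0∞ :=
  ⨆ (g : Rn n → ℝ≥0∞) (_ : IsMorreyTest p μ g), ∫⁻ x, g x ∂ν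

variable {p : ℝ≥0∞} {μ : ℝ}

theorem IsMorreyTest.lintegral_le {g : Rn n → ℝ≥0∞} (hg : IsMorreyTest p μ g)
    (ν : Measure (Rn n)) : ∫⁻ x, g x ∂ν ≤ morrey p μ ν :=
  le_iSup₂ (f := fun (g : Rn n → ℝ≥0∞) (_ : IsMorreyTest p μ g) => ∫⁻ x, g x ∂ν) g hg

/-- The supremum over all centres absorbs the shift. This invariance is what makes convolutions
tractable: one factor can be tested with the other variable frozen. -/
theorem IsMorreyTest.comp_add {g : Rn n → ℝ≥0∞} (hg : IsMorreyTest p μ g) (a : Rn n) :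
    IsMorreyTest p μ fun x => g (x + a) := by
  obtain ⟨hgm, x₀, R, hR, h0, hb⟩ := hg
  refine ⟨hgm.comp (measurable_add_const a), x₀ - a, R, hR, fun x hx => h0 _ ?_, ?_⟩
  · intro h
    apply hx
    rw [Metric.mem_ball, dist_eq_norm] at h ⊢
    rwa [show x - (x₀ - a) = x + a - x₀ by abel]
  · rwa [dualNorm_comp_add]

theorem morrey_mono {ν ν' : Measure (Rn n)} (h : ν ≤ ν') : morrey p μ ν ≤ morrey p μ ν' :=
  iSup₂_mono fun _ _ => lintegral_mono' h le_rfl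

theorem morrey_le {ν : Measure (Rn n)} {A : ℝ≥0∞}
    (h : ∀ g : Rn n → ℝ≥0∞, IsMorreyTest p μ g → ∫⁻ x, g x ∂ν ≤ A) : morrey p μ ν ≤ A :=
  iSup₂_le h

/-- Hölder's inequality and its converse on each ball. In the dual form every norm estimate becomes
an estimate of integrals of positive functions. -/
theorem morrey_withDensity (hp : 1 ≤ p) {ν : Measure (Rn n)} (hν : p ≠ 1 → ν = volume)
    {h : Rn n → ℂ} (hh : AEStronglyMeasurable h ν) :
    morrey p μ (ν.withDensity fun x => ‖h x‖ₑ) = morreySup p μ ν h := by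
  set H : Rn n → ℝ≥0∞ := hh.enorm.mk with hH
  have hHm : Measurable H := hh.enorm.measurable_mk
  have hHe : (fun x => ‖h x‖ₑ) =ᵐ[ν] H := hh.enorm.ae_eq_mk
  have hI : ∀ g : Rn n → ℝ≥0∞, Measurable g →
      ∫⁻ x, g x ∂(ν.withDensity fun x => ‖h x‖ₑ) = ∫⁻ x, g x * H x ∂ν := by
    intro g hg
    rw [withDensity_congr_ae hHe, lintegral_withDensity_eq_lintegral_mul _ hHm hg]
    simp only [Pi.mul_apply, mul_comm]
  have hN : ∀ (x₀ : Rn n) (R : ℝ), eLpNorm h p (ν.restrict (Metric.ball x₀ R)) =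
      eLpNorm H p (ν.restrict (Metric.ball x₀ R)) := by
    intro x₀ R
    apply eLpNorm_congr_enorm_ae
    filter_upwards [ae_restrict_of_ae hHe] with x hx
    exact hx
  apply le_antisymm
  · refine morrey_le fun g ⟨hg, x₀, R, hR, h0, hb⟩ => ?_
    rw [hI g hg]
    refine (lintegral_mul_le_dualNorm hp hν hg hHm measurableSet_ball h0).trans ?_
    rw [morreySup]
    refine le_trans ?_ (le_iSup₂_of_le x₀ R (le_iSup_of_le hR le_rfl))
    rw [hN]
    gcongr
  · refine iSup₂_le fun x₀ R => iSup_le fun hR => ?_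
    rw [hN]
    refine le_iSup_lintegral_mul hp hν hHm measurableSet_ball measure_ball_lt_top.ne
      ENNReal.ofReal_ne_top fun g hg h0 hb => ?_
    rw [← hI g hg]
    exact IsMorreyTest.lintegral_le ⟨hg, x₀, R, hR, h0, hb⟩ _

/-- If `E` is Lebesgue null and `p ≠ 1`, the function equal to `∞` on a bounded part of `E` has dual
norm zero. It is therefore an admissible test function and detects any mass on `E`. -/
theorem absolutelyContinuous_of_morrey_lt_top (hp : 1 ≤ p) (h1 : p ≠ 1) {ν : Measure (Rn n)}
    (hν : morrey p μ ν < ∞) : ν ≪ volume := by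
  refine Measure.AbsolutelyContinuous.mk fun E hE h0 => ?_
  have key : ∀ m : ℕ, ν (E ∩ Metric.ball 0 ((m : ℝ) + 1)) = 0 := by
    intro m
    by_contra hne
    have hmeas : MeasurableSet (E ∩ Metric.ball (0 : Rn n) ((m : ℝ) + 1)) :=
      hE.inter measurableSet_ball
    have ht : IsMorreyTest p μ
        ((E ∩ Metric.ball (0 : Rn n) ((m : ℝ) + 1)).indicator fun _ => ∞) := by
      refine ⟨measurable_const.indicator hmeas, 0, (m : ℝ) + 1, by positivity,
        fun x hx => ?_, ?_⟩
      · exact Set.indicator_of_notMem (fun h => hx h.2) _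
      · rw [dualNorm, if_neg h1]
        have : ∫⁻ x, ((E ∩ Metric.ball (0 : Rn n) ((m : ℝ) + 1)).indicator
            (fun _ => (∞ : ℝ≥0∞)) x) ^ conjExp p = 0 := by
          have hz : volume (E ∩ Metric.ball (0 : Rn n) ((m : ℝ) + 1)) = 0 :=
            measure_mono_null Set.inter_subset_left h0
          rw [lintegral_eq_zero_iff ((measurable_const.indicator hmeas).pow_const _)]
          filter_upwards [measure_eq_zero_iff_ae_notMem.1 hz] with x hx
          simp [Set.indicator_of_notMem hx, conjExp_pos hp h1]
        rw [this, ENNReal.zero_rpow_of_pos (by linarith [inv_toReal_lt_one hp h1])]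
        exact zero_le
    have := ht.lintegral_le ν
    rw [lintegral_indicator hmeas, setLIntegral_const, ENNReal.top_mul hne] at this
    exact (this.trans_lt hν).ne rfl
  have hU : E ⊆ ⋃ m : ℕ, E ∩ Metric.ball 0 ((m : ℝ) + 1) := by
    intro x hx
    obtain ⟨m, hm⟩ := exists_nat_ge ‖x‖
    exact Set.mem_iUnion.2 ⟨m, hx, by rw [mem_ball_zero_iff]; linarith⟩
  exact measure_mono_null hU (measure_iUnion_null key)

/-- The exponent `n - (n - μ) / p`, by which the mass of a ball grows. -/
def massExp (n : ℕ) (p : ℝ≥0∞) (μ : ℝ) : ℝ := n - (n - μ) * p⁻¹.toReal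

/-- The test function is the indicator of the ball, scaled to dual norm at most `R^{-μ/p}`; the
volume factor `(R^n v)^{1-1/p}` turns the exponent `μ/p` into `massExp n p μ`. -/
theorem exists_measure_ball_le_morrey (n : ℕ) (hp : 1 ≤ p) (μ : ℝ) :
    ∃ C : ℝ, 0 < C ∧ ∀ (ν : Measure (Rn n)) (x₀ : Rn n) (R : ℝ), 0 < R →
      ν (Metric.ball x₀ R) ≤ ENNReal.ofReal (C * R ^ massExp n p μ) * morrey p μ ν := by
  set v : ℝ := (volume (Metric.ball (0 : Rn n) 1)).toReal with hv
  have hv0 : 0 < v := ENNReal.toReal_pos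
    (Metric.measure_ball_pos volume _ one_pos).ne' measure_ball_lt_top.ne
  refine ⟨v ^ (1 - p⁻¹.toReal), by positivity, fun ν x₀ R hR => ?_⟩
  have hvol : volume (Metric.ball x₀ R) = ENNReal.ofReal (R ^ n * v) := by
    rw [Measure.addHaar_ball_of_pos volume x₀ hR, ENNReal.ofReal_mul (by positivity), hv,
      ENNReal.ofReal_toReal measure_ball_lt_top.ne, finrank_euclideanSpace_fin]
  set c : ℝ := R ^ (-(μ * p⁻¹.toReal)) * (R ^ n * v) ^ (-(1 - p⁻¹.toReal)) with hc
  have hc0 : 0 < c := by positivity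
  have ht : IsMorreyTest p μ ((Metric.ball x₀ R).indicator fun _ => ENNReal.ofReal c) := by
    refine ⟨measurable_const.indicator measurableSet_ball, x₀, R, hR,
      fun x hx => Set.indicator_of_notMem hx _, ?_⟩
    rw [dualNorm]
    split_ifs with h1
    · refine iSup_le fun x => (Set.indicator_le_self' (fun _ _ => zero_le) x).trans ?_
      rw [hc, h1]
      simp
    · have hq := conjExp_pos hp h1
      have h2 : ∀ x, ((Metric.ball x₀ R).indicator (fun _ => ENNReal.ofReal c) x) ^ conjExp p =
          (Metric.ball x₀ R).indicator (fun _ => ENNReal.ofReal c ^ conjExp p) x := by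
        intro x
        by_cases hx : x ∈ Metric.ball x₀ R
        · simp only [Set.indicator_of_mem hx]
        · simp only [Set.indicator_of_notMem hx, ENNReal.zero_rpow_of_pos hq]
      simp_rw [h2]
      rw [lintegral_indicator measurableSet_ball, setLIntegral_const, hvol,
        ENNReal.ofReal_rpow_of_pos hc0, ← ENNReal.ofReal_mul (by positivity),
        ENNReal.ofReal_rpow_of_pos (by positivity)]
      apply ENNReal.ofReal_le_ofReal
      rw [Real.mul_rpow (by positivity) (by positivity), ← Real.rpow_mul hc0.le, conjExp,
        inv_mul_cancel₀ (by linarith [inv_toReal_lt_one hp h1]), Real.rpow_one, hc, mul_assoc,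
        ← Real.rpow_add (by positivity)]
      simp
  have h3 := ht.lintegral_le ν
  rw [lintegral_indicator measurableSet_ball, setLIntegral_const] at h3
  calc ν (Metric.ball x₀ R) = ENNReal.ofReal c⁻¹ * (ENNReal.ofReal c * ν (Metric.ball x₀ R)) := by
        rw [← mul_assoc, ← ENNReal.ofReal_mul (by positivity), inv_mul_cancel₀ hc0.ne']
        simp
    _ ≤ ENNReal.ofReal c⁻¹ * morrey p μ ν := by gcongr
    _ = _ := by
        congr 2
        rw [hc, mul_inv, ← Real.rpow_neg (by positivity), ← Real.rpow_neg (by positivity), neg_neg,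
          neg_neg, Real.mul_rpow (by positivity) hv0.le, ← Real.rpow_natCast_mul hR.le,
          ← mul_assoc, ← Real.rpow_add hR, mul_comm, massExp]
        congr 2
        ring

end

/-! ### Fourier–Besov–Morrey norms of positive measures -/

section

variable {n : ℕ}

/-- The power `2^x` in `[0, ∞]`. -/
def pw (x : ℝ) : ℝ≥0∞ := ENNReal.ofReal ((2 : ℝ) ^ x)

theorem pw_add (x y : ℝ) : pw (x + y) = pw x * pw y := by
  rw [pw, pw, pw, Real.rpow_add two_pos, ENNReal.ofReal_mul (by positivity)]

theorem pw_zero : pw 0 = 1 := by simp [pw]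

theorem pw_ne_zero (x : ℝ) : pw x ≠ 0 := by
  rw [pw, Ne, ENNReal.ofReal_eq_zero, not_le]; positivity

theorem pw_ne_top (x : ℝ) : pw x ≠ ∞ := ENNReal.ofReal_ne_top

theorem pw_mul_pw_neg (x : ℝ) : pw x * pw (-x) = 1 := by
  rw [← pw_add, add_neg_cancel, pw_zero]

theorem pw_mono {x y : ℝ} (h : x ≤ y) : pw x ≤ pw y :=
  ENNReal.ofReal_le_ofReal (Real.rpow_le_rpow_of_exponent_le one_le_two h)

theorem le_pw_neg_mul {x : ℝ} {a b : ℝ≥0∞} (h : pw x * a ≤ b) : a ≤ pw (-x) * b := by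
  calc a = pw (-x) * (pw x * a) := by
        rw [← mul_assoc, mul_comm (pw (-x)), pw_mul_pw_neg, one_mul]
    _ ≤ _ := by gcongr

theorem pw_mul_le {x : ℝ} {a b : ℝ≥0∞} (h : a ≤ pw (-x) * b) : pw x * a ≤ b := by
  calc pw x * a ≤ pw x * (pw (-x) * b) := by gcongr
    _ = b := by rw [← mul_assoc, pw_mul_pw_neg, one_mul]

theorem exists_tsum_pw_le_of_le {a : ℝ} (ha : 0 < a) : ∃ C : ℝ≥0∞, C ≠ ∞ ∧ ∀ k : ℤ,
    ∑' j : ℤ, (if k ≤ j then pw (-(j * a)) else 0) ≤ C * pw (-(k * a)) := by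
  refine ⟨∑' m : ℕ, pw (-a) ^ m, ?_, fun k => ?_⟩
  · rw [ENNReal.tsum_geometric]
    apply ENNReal.inv_ne_top.2
    rw [Ne, tsub_eq_zero_iff_le, not_le]
    exact ENNReal.ofReal_lt_one.2 (Real.rpow_lt_one_of_one_lt_of_neg one_lt_two (by linarith))
  · have hinj : Function.Injective fun m : ℕ => k + (m : ℤ) := fun a b h => by simpa using h
    rw [← hinj.tsum_eq]
    · rw [← ENNReal.tsum_mul_right]
      refine ENNReal.tsum_le_tsum fun m => ?_
      rw [if_pos (by omega)]
      have : pw (-a) ^ m = pw (-(m * a)) := by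
        rw [pw, pw, ← ENNReal.ofReal_pow (by positivity), ← Real.rpow_mul_natCast (by positivity)]
        congr 2; ring
      rw [this, ← pw_add]
      apply le_of_eq
      congr 1
      push_cast; ring
    · intro j hj
      have hkj : k ≤ j := by
        by_contra h
        simp [h] at hj
      exact ⟨(j - k).toNat, by simp; omega⟩

theorem exists_tsum_pw_le_of_ge {a : ℝ} (ha : 0 < a) : ∃ C : ℝ≥0∞, C ≠ ∞ ∧ ∀ k : ℤ,
    ∑' j : ℤ, (if j ≤ k then pw (j * a) else 0) ≤ C * pw (k * a) := by
  obtain ⟨C, hC, h⟩ := exists_tsum_pw_le_of_le ha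
  refine ⟨C, hC, fun k => ?_⟩
  have := h (-k)
  rw [← (Equiv.neg ℤ).tsum_eq] at this
  simpa using this

/-- The annulus `2^i ≤ |ξ| < 2^{i+1}`. -/
def annulus (n : ℕ) (i : ℤ) : Set (Rn n) :=
  {ξ | (2 : ℝ) ^ (i : ℝ) ≤ ‖ξ‖ ∧ ‖ξ‖ < (2 : ℝ) ^ ((i : ℝ) + 1)}

theorem measurableSet_annulus (i : ℤ) : MeasurableSet (annulus n i) :=
  (measurableSet_le measurable_const measurable_norm).inter
    (measurableSet_lt measurable_norm measurable_const)

theorem exists_mem_annulus {ξ : Rn n} (h : ξ ≠ 0) : ∃ i, ξ ∈ annulus n i := by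
  obtain ⟨i, hi⟩ := exists_mem_Ico_zpow (norm_pos_iff.2 h) one_lt_two
  refine ⟨i, ?_, ?_⟩
  · rw [Real.rpow_intCast]; exact hi.1
  · have := hi.2
    rwa [← Real.rpow_intCast, Int.cast_add, Int.cast_one] at this

theorem ne_zero_of_mem_annulus {ξ : Rn n} {i : ℤ} (h : ξ ∈ annulus n i) : ξ ≠ 0 := by
  rintro rfl
  have := h.1
  rw [norm_zero] at this
  exact (Real.rpow_pos_of_pos two_pos _).not_ge this

theorem rpow_two_lt_iff {x y : ℝ} : (2 : ℝ) ^ x < (2 : ℝ) ^ y ↔ x < y :=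
  Real.rpow_lt_rpow_left_iff one_lt_two

theorem disjoint_annulus : Pairwise (Function.onFun Disjoint (annulus n)) := by
  intro i j hij
  rw [Function.onFun, Set.disjoint_left]
  rintro ξ ⟨h1, h2⟩ ⟨h3, h4⟩
  have a := rpow_two_lt_iff.1 (h1.trans_lt h4)
  have b := rpow_two_lt_iff.1 (h3.trans_lt h2)
  apply hij
  have a' : i < j + 1 := by exact_mod_cast a
  have b' : j < i + 1 := by exact_mod_cast b
  omega

theorem iUnion_annulus : ⋃ i, annulus n i = {0}ᶜ := by
  ext ξ
  simp only [Set.mem_iUnion, Set.mem_compl_iff, Set.mem_singleton_iff]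
  exact ⟨fun ⟨i, hi⟩ => ne_zero_of_mem_annulus hi, exists_mem_annulus⟩

theorem sum_restrict_annulus {ν : Measure (Rn n)} (h0 : ν {0} = 0) :
    Measure.sum (fun i => ν.restrict (annulus n i)) = ν := by
  rw [← Measure.restrict_iUnion disjoint_annulus measurableSet_annulus, iUnion_annulus]
  exact Measure.restrict_eq_self_of_ae_mem (measure_eq_zero_iff_ae_notMem.1 h0)

theorem lintegral_eq_tsum_annulus {ν : Measure (Rn n)} (h0 : ν {0} = 0) (g : Rn n → ℝ≥0∞) :
    ∫⁻ ξ, g ξ ∂ν = ∑' i : ℤ, ∫⁻ ξ in annulus n i, g ξ ∂ν := by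
  conv_lhs => rw [← sum_restrict_annulus h0]
  rw [lintegral_sum_measure]

theorem rpow_norm_le_of_mem_annulus {ξ : Rn n} {i : ℤ} (h : ξ ∈ annulus n i) (r : ℝ) :
    ENNReal.ofReal (‖ξ‖ ^ r) ≤ pw |r| * pw (i * r) := by
  rw [← pw_add]
  apply ENNReal.ofReal_le_ofReal
  have h2 : (0 : ℝ) < 2 ^ (i : ℝ) := by positivity
  rcases le_or_gt 0 r with hr | hr
  · calc ‖ξ‖ ^ r ≤ ((2 : ℝ) ^ ((i : ℝ) + 1)) ^ r :=
          Real.rpow_le_rpow (norm_nonneg _) h.2.le hr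
      _ = _ := by rw [← Real.rpow_mul two_pos.le, abs_of_nonneg hr]; ring_nf
  · calc ‖ξ‖ ^ r ≤ ((2 : ℝ) ^ (i : ℝ)) ^ r := Real.rpow_le_rpow_of_nonpos h2 h.1 hr.le
      _ = 2 ^ (i * r) := by rw [← Real.rpow_mul two_pos.le]
      _ ≤ _ := Real.rpow_le_rpow_of_exponent_le one_le_two (by linarith [abs_nonneg r])

/-! ### Dyadic pieces and the dyadic norm of positive measures. -/

section LittlewoodPaley

variable {φ : 𝓢(Rn n, ℂ)}

theorem dyadic_eq_dilateTest (φ : 𝓢(Rn n, ℂ)) (k : ℤ) : dyadic φ k =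
    dilateTest (Units.mk0 ((2 : ℝ) ^ (-k)) (by positivity)) φ := rfl

theorem hasTemperateGrowth_dyadic (φ : 𝓢(Rn n, ℂ)) (k : ℤ) : (dyadic φ k).HasTemperateGrowth := by
  rw [dyadic_eq_dilateTest]
  exact SchwartzMap.hasTemperateGrowth _

theorem continuous_dyadic (φ : 𝓢(Rn n, ℂ)) (k : ℤ) : Continuous (dyadic φ k) := by
  rw [dyadic_eq_dilateTest]
  exact SchwartzMap.continuous _

theorem measurable_enorm_dyadic (φ : 𝓢(Rn n, ℂ)) (k : ℤ) :
    Measurable fun ξ => ‖dyadic φ k ξ‖ₑ := (continuous_dyadic φ k).measurable.enorm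

theorem exists_enorm_dyadic_le (φ : 𝓢(Rn n, ℂ)) :
    ∃ C : ℝ≥0∞, C ≠ ∞ ∧ ∀ k ξ, ‖dyadic φ k ξ‖ₑ ≤ C := by
  refine ⟨ENNReal.ofReal (SchwartzMap.seminorm ℝ 0 0 φ), ENNReal.ofReal_ne_top, fun k ξ => ?_⟩
  rw [← ofReal_norm]
  exact ENNReal.ofReal_le_ofReal (SchwartzMap.norm_le_seminorm ℝ φ _)

theorem IsLittlewoodPaley.dyadic_support (hφ : IsLittlewoodPaley φ) {k : ℤ} {ξ : Rn n}
    (h : dyadic φ k ξ ≠ 0) :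
    3 / 4 * (2 : ℝ) ^ (k : ℝ) ≤ ‖ξ‖ ∧ ‖ξ‖ ≤ 8 / 3 * (2 : ℝ) ^ (k : ℝ) := by
  obtain ⟨h1, h2⟩ := hφ.supp _ h
  rw [norm_smul, Real.norm_of_nonneg (by positivity), zpow_neg, Real.rpow_intCast] at *
  have : (0 : ℝ) < 2 ^ k := by positivity
  rw [inv_mul_eq_div, le_div_iff₀ this] at h1
  rw [inv_mul_eq_div, div_le_iff₀ this] at h2
  exact ⟨h1, h2⟩

/-- The ratios `8/3` and `2 · 4/3` between the bounds for the two shells are both below `4`, so the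
indices differ by less than `2`. -/
theorem IsLittlewoodPaley.near_of_mem_annulus (hφ : IsLittlewoodPaley φ) {k i : ℤ} {ξ : Rn n}
    (hξ : ξ ∈ annulus n i) (h : dyadic φ k ξ ≠ 0) : i - 1 ≤ k ∧ k ≤ i + 1 := by
  obtain ⟨h1, h2⟩ := hφ.dyadic_support h
  obtain ⟨h3, h4⟩ := hξ
  have hk : (0 : ℝ) < 2 ^ (k : ℝ) := by positivity
  constructor
  · have : (2 : ℝ) ^ (i : ℝ) < 2 ^ ((k : ℝ) + 2) := by
      rw [Real.rpow_add two_pos, show (2 : ℝ) ^ (2 : ℝ) = 4 by norm_num]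
      linarith
    have := rpow_two_lt_iff.1 this
    have : i < k + 2 := by exact_mod_cast this
    omega
  · have : (2 : ℝ) ^ (k : ℝ) < 2 ^ ((i : ℝ) + 2) := by
      rw [Real.rpow_add two_pos, Real.rpow_one] at h4
      rw [Real.rpow_add two_pos, show (2 : ℝ) ^ (2 : ℝ) = 4 by norm_num]
      linarith
    have := rpow_two_lt_iff.1 this
    have : k < i + 2 := by exact_mod_cast this
    omega

theorem IsLittlewoodPaley.sum_near_eq_one (hφ : IsLittlewoodPaley φ) {i : ℤ} {ξ : Rn n}
    (hξ : ξ ∈ annulus n i) : ∑ k ∈ Finset.Icc (i - 1) (i + 1), dyadic φ k ξ = 1 := by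
  have h := hφ.sum_eq_one ξ (ne_zero_of_mem_annulus hξ)
  refine HasSum.unique (hasSum_sum_of_ne_finset_zero fun k hk => ?_) h
  by_contra hne
  exact hk (Finset.mem_Icc.2 (hφ.near_of_mem_annulus hξ hne))

theorem IsLittlewoodPaley.one_le_sum_near (hφ : IsLittlewoodPaley φ) {i : ℤ} {ξ : Rn n}
    (hξ : ξ ∈ annulus n i) : 1 ≤ ∑ k ∈ Finset.Icc (i - 1) (i + 1), ‖dyadic φ k ξ‖ₑ := by
  have h := hφ.sum_near_eq_one hξ
  calc (1 : ℝ≥0∞) = ‖∑ k ∈ Finset.Icc (i - 1) (i + 1), dyadic φ k ξ‖ₑ := by rw [h]; simp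
    _ ≤ _ := enorm_sum_le _ _

/-- `sup_k 2^{ks} ‖φ_k ν‖_{M_{p,μ}}` for a positive measure `ν`. -/
def fnMeas (φ : 𝓢(Rn n, ℂ)) (s : ℝ) (p : ℝ≥0∞) (μ : ℝ) (ν : Measure (Rn n)) : ℝ≥0∞ :=
  ⨆ k : ℤ, pw (k * s) * morrey p μ (ν.withDensity fun ξ => ‖dyadic φ k ξ‖ₑ)

variable {s : ℝ} {p : ℝ≥0∞} {μ : ℝ}

theorem morrey_dyadic_le_fnMeas (ν : Measure (Rn n)) (k : ℤ) :
    morrey p μ (ν.withDensity fun ξ => ‖dyadic φ k ξ‖ₑ) ≤ pw (-(k * s)) * fnMeas φ s p μ ν :=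
  le_pw_neg_mul (le_iSup (fun k : ℤ => pw (k * s) *
    morrey p μ (ν.withDensity fun ξ => ‖dyadic φ k ξ‖ₑ)) k)

theorem fnMeas_le {ν : Measure (Rn n)} {A : ℝ≥0∞}
    (h : ∀ k : ℤ, ∀ g, IsMorreyTest p μ g →
      ∫⁻ ξ, ‖dyadic φ k ξ‖ₑ * g ξ ∂ν ≤ pw (-(k * s)) * A) : fnMeas φ s p μ ν ≤ A := by
  refine iSup_le fun k => pw_mul_le (morrey_le fun g hg => ?_)
  rw [lintegral_withDensity_eq_lintegral_mul _ (measurable_enorm_dyadic φ k) hg.measurable]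
  exact h k g hg

theorem IsMorreyTest.lintegral_dyadic_le {g : Rn n → ℝ≥0∞} (hg : IsMorreyTest p μ g)
    (ν : Measure (Rn n)) (k : ℤ) :
    ∫⁻ ξ, ‖dyadic φ k ξ‖ₑ * g ξ ∂ν ≤ pw (-(k * s)) * fnMeas φ s p μ ν := by
  refine le_trans ?_ (morrey_dyadic_le_fnMeas ν k)
  refine le_trans (le_of_eq ?_) (hg.lintegral_le _)
  rw [lintegral_withDensity_eq_lintegral_mul _ (measurable_enorm_dyadic φ k) hg.measurable]
  rfl

theorem fnMeas_mono {ν ν' : Measure (Rn n)} (h : ν ≤ ν') :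
    fnMeas φ s p μ ν ≤ fnMeas φ s p μ ν' := by
  refine fnMeas_le fun k g hg => ?_
  exact (lintegral_mono' h le_rfl).trans (hg.lintegral_dyadic_le ν' k)

theorem fnMeas_sum_le {ι : Type*} (ν : ι → Measure (Rn n)) :
    fnMeas φ s p μ (Measure.sum ν) ≤ ∑' i, fnMeas φ s p μ (ν i) := by
  refine fnMeas_le fun k g hg => ?_
  rw [lintegral_sum_measure, ← ENNReal.tsum_mul_left]
  exact ENNReal.tsum_le_tsum fun i => hg.lintegral_dyadic_le _ k

theorem fnMeas_add_le (ν ν' : Measure (Rn n)) :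
    fnMeas φ s p μ (ν + ν') ≤ fnMeas φ s p μ ν + fnMeas φ s p μ ν' := by
  refine fnMeas_le fun k g hg => ?_
  rw [lintegral_add_measure, mul_add]
  exact add_le_add (hg.lintegral_dyadic_le _ k) (hg.lintegral_dyadic_le _ k)

/-- A test function integrated over an annulus. -/
theorem exists_setLIntegral_annulus_le (hφ : IsLittlewoodPaley φ) (s : ℝ) :
    ∃ C : ℝ≥0∞, C ≠ ∞ ∧ ∀ (ν : Measure (Rn n)) (i : ℤ) (g : Rn n → ℝ≥0∞), IsMorreyTest p μ g →
      ∫⁻ ξ in annulus n i, g ξ ∂ν ≤ C * pw (-(i * s)) * fnMeas φ s p μ ν := by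
  -- Three pieces meet the annulus, and replacing `2^{-ks}` by `2^{-is}` for `|k - i| ≤ 1` costs at
  -- most `2^{|s|}`.
  refine ⟨3 * pw |s|, ENNReal.mul_ne_top (by simp) (pw_ne_top _), fun ν i g hg => ?_⟩
  calc ∫⁻ ξ in annulus n i, g ξ ∂ν
      ≤ ∫⁻ ξ in annulus n i, ∑ k ∈ Finset.Icc (i - 1) (i + 1), ‖dyadic φ k ξ‖ₑ * g ξ ∂ν := by
        refine setLIntegral_mono' (measurableSet_annulus i) fun ξ hξ => ?_
        rw [← Finset.sum_mul]
        exact le_mul_of_one_le_left' (hφ.one_le_sum_near hξ)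
    _ ≤ ∫⁻ ξ, ∑ k ∈ Finset.Icc (i - 1) (i + 1), ‖dyadic φ k ξ‖ₑ * g ξ ∂ν :=
        setLIntegral_le_lintegral _ _
    _ = ∑ k ∈ Finset.Icc (i - 1) (i + 1), ∫⁻ ξ, ‖dyadic φ k ξ‖ₑ * g ξ ∂ν :=
        lintegral_finsetSum _ fun k _ => (measurable_enorm_dyadic φ k).mul hg.measurable
    _ ≤ ∑ k ∈ Finset.Icc (i - 1) (i + 1), pw |s| * pw (-(i * s)) * fnMeas φ s p μ ν := by
        refine Finset.sum_le_sum fun k hk => ?_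
        refine (hg.lintegral_dyadic_le (φ := φ) (s := s) ν k).trans ?_
        gcongr
        rw [← pw_add]
        apply pw_mono
        rw [Finset.mem_Icc] at hk
        have h1 : ((i : ℝ) - 1) ≤ k := by exact_mod_cast hk.1
        have h2 : (k : ℝ) ≤ i + 1 := by exact_mod_cast hk.2
        rcases abs_cases s with ⟨h, h'⟩ | ⟨h, h'⟩ <;> rw [h] <;> nlinarith
    _ = _ := by
        rw [Finset.sum_const, Int.card_Icc]
        simp only [show (i + 1 + 1 - (i - 1)).toNat = 3 by omega, nsmul_eq_mul]
        push_cast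
        ring

theorem morrey_restrict_le {ν : Measure (Rn n)} {A : Set (Rn n)} {B : ℝ≥0∞}
    (h : ∀ g, IsMorreyTest p μ g → ∫⁻ ξ in A, g ξ ∂ν ≤ B) : morrey p μ (ν.restrict A) ≤ B :=
  morrey_le h

/-- The mass of an annulus. -/
theorem exists_measure_annulus_le (hφ : IsLittlewoodPaley φ) (hp : 1 ≤ p) (s μ : ℝ) :
    ∃ C : ℝ≥0∞, C ≠ ∞ ∧ ∀ (ν : Measure (Rn n)) (i : ℤ),
      ν (annulus n i) ≤ C * pw (i * (massExp n p μ - s)) * fnMeas φ s p μ ν := by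
  obtain ⟨C, hC, h⟩ := exists_setLIntegral_annulus_le (p := p) (μ := μ) hφ s
  obtain ⟨C', hC', h'⟩ := exists_measure_ball_le_morrey n hp μ
  refine ⟨ENNReal.ofReal C' * pw (massExp n p μ) * C, ENNReal.mul_ne_top
    (ENNReal.mul_ne_top ENNReal.ofReal_ne_top (pw_ne_top _)) hC, fun ν i => ?_⟩
  have h1 : ν (annulus n i) = (ν.restrict (annulus n i))
      (Metric.ball 0 ((2 : ℝ) ^ ((i : ℝ) + 1))) := by
    rw [Measure.restrict_apply measurableSet_ball, Set.inter_eq_self_of_subset_right]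
    intro ξ hξ
    rw [mem_ball_zero_iff]
    exact hξ.2
  rw [h1]
  refine (h' _ 0 _ (by positivity)).trans ?_
  have h2 := morrey_restrict_le (h ν i)
  calc _ ≤ ENNReal.ofReal (C' * ((2 : ℝ) ^ ((i : ℝ) + 1)) ^ massExp n p μ) *
        (C * pw (-(i * s)) * fnMeas φ s p μ ν) := by gcongr
    _ = _ := by
        rw [ENNReal.ofReal_mul hC'.le, ← Real.rpow_mul two_pos.le]
        change ENNReal.ofReal C' * pw _ * _ = _
        rw [show ((i : ℝ) + 1) * massExp n p μ = massExp n p μ + i * massExp n p μ by ring,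
          pw_add, show (i : ℝ) * (massExp n p μ - s) = i * massExp n p μ + -(i * s) by ring, pw_add]
        ring

/-- The weighted mass of a ball about the origin. -/
theorem exists_lintegral_rpow_ball_le (hφ : IsLittlewoodPaley φ) (hp : 1 ≤ p) {s μ r : ℝ}
    (hr : 0 < massExp n p μ - s + r) :
    ∃ C : ℝ≥0∞, C ≠ ∞ ∧ ∀ (ν : Measure (Rn n)), ν {0} = 0 → ∀ i : ℤ,
      ∫⁻ ξ in {ξ | ‖ξ‖ < (2 : ℝ) ^ (i : ℝ)}, ENNReal.ofReal (‖ξ‖ ^ r) ∂ν ≤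
        C * pw (i * (massExp n p μ - s + r)) * fnMeas φ s p μ ν := by
  obtain ⟨C, hC, h⟩ := exists_measure_annulus_le hφ hp s μ
  obtain ⟨C', hC', h'⟩ := exists_tsum_pw_le_of_ge hr
  refine ⟨pw |r| * C * C', ENNReal.mul_ne_top (ENNReal.mul_ne_top (pw_ne_top _) hC) hC',
    fun ν h0 i => ?_⟩
  have hm : MeasurableSet {ξ : Rn n | ‖ξ‖ < (2 : ℝ) ^ (i : ℝ)} :=
    measurableSet_lt measurable_norm measurable_const
  rw [← lintegral_indicator hm, lintegral_eq_tsum_annulus h0]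
  calc _ ≤ ∑' j : ℤ, pw |r| * C * fnMeas φ s p μ ν *
        (if j ≤ i then pw (j * (massExp n p μ - s + r)) else 0) := by
        refine ENNReal.tsum_le_tsum fun j => ?_
        split_ifs with hj
        · calc _ ≤ ∫⁻ ξ in annulus n j, pw |r| * pw (j * r) ∂ν := by
                refine setLIntegral_mono' (measurableSet_annulus j) fun ξ hξ => ?_
                exact (Set.indicator_le_self' (fun _ _ => zero_le) ξ).trans
                  (rpow_norm_le_of_mem_annulus hξ r)
            _ ≤ pw |r| * pw (j * r) * (C * pw (j * (massExp n p μ - s)) * fnMeas φ s p μ ν) := by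
                rw [setLIntegral_const]
                gcongr
                exact h ν j
            _ = _ := by rw [mul_add, pw_add]; ring
        · rw [mul_zero, nonpos_iff_eq_zero, setLIntegral_eq_zero_iff (measurableSet_annulus j)]
          · refine .of_forall fun ξ hξ => Set.indicator_of_notMem (fun hlt => hj ?_) _
            have := rpow_two_lt_iff.1 (hξ.1.trans_lt hlt)
            exact_mod_cast this.le
          · exact ((measurable_norm.pow_const r).ennreal_ofReal).indicator hm
    _ ≤ pw |r| * C * fnMeas φ s p μ ν * (C' * pw (i * (massExp n p μ - s + r))) := by
        rw [ENNReal.tsum_mul_left]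
        gcongr
        exact h' i
    _ = _ := by ring

/-- The sum over small annuli converges because the exponent in `hr` is positive, the sum over large
ones once `N` exceeds it. With `r = 0` measures of finite norm are seen to be tempered; `r = β - 1`
serves for the velocity. -/
theorem exists_lintegral_rpow_weight_le (hφ : IsLittlewoodPaley φ) (hp : 1 ≤ p) {s μ r : ℝ}
    (hr : 0 < massExp n p μ - s + r) :
    ∃ (N : ℕ) (C : ℝ≥0∞), C ≠ ∞ ∧ ∀ (ν : Measure (Rn n)), ν {0} = 0 →
      ∫⁻ ξ, ENNReal.ofReal (‖ξ‖ ^ r) * ENNReal.ofReal ((1 + ‖ξ‖) ^ (-(N : ℝ))) ∂ν ≤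
        C * fnMeas φ s p μ ν := by
  obtain ⟨C, hC, h⟩ := exists_measure_annulus_le hφ hp s μ
  obtain ⟨N, hN⟩ := exists_nat_gt (massExp n p μ - s + r)
  obtain ⟨C1, hC1, h1⟩ := exists_tsum_pw_le_of_ge hr
  obtain ⟨C2, hC2, h2⟩ := exists_tsum_pw_le_of_le (sub_pos.2 hN)
  refine ⟨N, pw |r| * C * (C1 + C2), ENNReal.mul_ne_top (ENNReal.mul_ne_top (pw_ne_top _) hC)
    (ENNReal.add_ne_top.2 ⟨hC1, hC2⟩), fun ν h0 => ?_⟩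
  rw [lintegral_eq_tsum_annulus h0]
  calc _ ≤ ∑' j : ℤ, pw |r| * C * fnMeas φ s p μ ν *
        ((if j ≤ 0 then pw (j * (massExp n p μ - s + r)) else 0) +
          if 0 ≤ j then pw (-(j * (N - (massExp n p μ - s + r)))) else 0) := by
        refine ENNReal.tsum_le_tsum fun j => ?_
        calc _ ≤ ∫⁻ ξ in annulus n j, pw |r| * pw (j * r) *
              (if j ≤ 0 then 1 else pw (-(j * N))) ∂ν := by
              refine setLIntegral_mono' (measurableSet_annulus j) fun ξ hξ => ?_
              refine mul_le_mul' (rpow_norm_le_of_mem_annulus hξ r) ?_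
              split_ifs with hj
              · apply ENNReal.ofReal_le_one.2
                apply Real.rpow_le_one_of_one_le_of_nonpos
                · linarith [norm_nonneg ξ]
                · simp
              · rw [pw]
                apply ENNReal.ofReal_le_ofReal
                rw [show -((j : ℝ) * N) = j * (-(N : ℝ)) by ring, Real.rpow_mul two_pos.le]
                apply Real.rpow_le_rpow_of_nonpos (by positivity) _ (by simp)
                linarith [hξ.1]
          _ ≤ pw |r| * pw (j * r) * (if j ≤ 0 then 1 else pw (-(j * N))) *
              (C * pw (j * (massExp n p μ - s)) * fnMeas φ s p μ ν) := by
              rw [setLIntegral_const]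
              gcongr
              exact h ν j
          _ ≤ _ := by
              split_ifs with ha hb hb
              · refine le_trans (le_of_eq ?_) (mul_le_mul' le_rfl le_self_add)
                rw [mul_add, pw_add]; ring
              · rw [add_zero, mul_add, pw_add]
                exact le_of_eq (by ring)
              · rw [zero_add, show -((j : ℝ) * (N - (massExp n p μ - s + r))) =
                  j * (massExp n p μ - s) + (j * r + -(j * N)) by ring, pw_add, pw_add]
                exact le_of_eq (by ring)
              · omega
    _ ≤ pw |r| * C * fnMeas φ s p μ ν * (C1 + C2) := by
        rw [ENNReal.tsum_mul_left, ENNReal.tsum_add]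
        gcongr
        · simpa [pw_zero] using h1 0
        · simpa [pw_zero] using h2 0
    _ = _ := by ring

theorem exists_schwartz_le (ψ : 𝓢(Rn n, ℂ)) (N : ℕ) : ∃ C : ℝ≥0∞, C ≠ ∞ ∧ ∀ ξ,
    ‖ψ ξ‖ₑ ≤ C * ENNReal.ofReal ((1 + ‖ξ‖) ^ (-(N : ℝ))) := by
  refine ⟨ENNReal.ofReal (2 ^ N * (Finset.Iic (N, 0)).sup
    (fun m => SchwartzMap.seminorm ℝ m.1 m.2) ψ), ENNReal.ofReal_ne_top, fun ξ => ?_⟩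
  have h := SchwartzMap.one_add_le_sup_seminorm_apply (𝕜 := ℝ) (m := (N, 0)) (le_refl N)
    (le_refl 0) ψ ξ
  rw [← ofReal_norm, ← ENNReal.ofReal_mul (by positivity)]
  apply ENNReal.ofReal_le_ofReal
  rw [Real.rpow_neg (by positivity), Real.rpow_natCast, ← div_eq_mul_inv, le_div_iff₀ (by positivity),
    mul_comm]
  simpa using h

theorem exists_lintegral_schwartz_rpow_le (hφ : IsLittlewoodPaley φ) (hp : 1 ≤ p) {s μ r : ℝ}
    (hr : 0 < massExp n p μ - s + r) (ψ : 𝓢(Rn n, ℂ)) :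
    ∃ C : ℝ≥0∞, C ≠ ∞ ∧ ∀ (ν : Measure (Rn n)), ν {0} = 0 →
      ∫⁻ ξ, ENNReal.ofReal (‖ξ‖ ^ r) * ‖ψ ξ‖ₑ ∂ν ≤ C * fnMeas φ s p μ ν := by
  obtain ⟨N, C, hC, h⟩ := exists_lintegral_rpow_weight_le hφ hp hr
  obtain ⟨C', hC', h'⟩ := exists_schwartz_le ψ N
  refine ⟨C' * C, ENNReal.mul_ne_top hC' hC, fun ν h0 => ?_⟩
  calc _ ≤ ∫⁻ ξ, C' * (ENNReal.ofReal (‖ξ‖ ^ r) * ENNReal.ofReal ((1 + ‖ξ‖) ^ (-(N : ℝ)))) ∂ν := by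
        refine lintegral_mono fun ξ => ?_
        calc _ ≤ ENNReal.ofReal (‖ξ‖ ^ r) * (C' * ENNReal.ofReal ((1 + ‖ξ‖) ^ (-(N : ℝ)))) := by
              gcongr
              exact h' ξ
          _ = _ := by ring
    _ = C' * ∫⁻ ξ, ENNReal.ofReal (‖ξ‖ ^ r) * ENNReal.ofReal ((1 + ‖ξ‖) ^ (-(N : ℝ))) ∂ν :=
        lintegral_const_mul' _ _ hC'
    _ ≤ C' * (C * fnMeas φ s p μ ν) := by gcongr; exact h ν h0
    _ = _ := by ring

theorem exists_lintegral_schwartz_le (hφ : IsLittlewoodPaley φ) (hp : 1 ≤ p) {s μ : ℝ}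
    (hs : s < massExp n p μ) (ψ : 𝓢(Rn n, ℂ)) :
    ∃ C : ℝ≥0∞, C ≠ ∞ ∧ ∀ (ν : Measure (Rn n)), ν {0} = 0 →
      ∫⁻ ξ, ‖ψ ξ‖ₑ ∂ν ≤ C * fnMeas φ s p μ ν := by
  obtain ⟨C, hC, h⟩ := exists_lintegral_schwartz_rpow_le (r := 0) hφ hp (s := s) (μ := μ)
    (by linarith) ψ
  exact ⟨C, hC, fun ν h0 => by simpa using h ν h0⟩

theorem hasTemperateGrowth_of_fnMeas (hφ : IsLittlewoodPaley φ) (hp : 1 ≤ p) {s μ : ℝ}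
    (hs : s < massExp n p μ) {ν : Measure (Rn n)} (h0 : ν {0} = 0)
    (h : fnMeas φ s p μ ν < ∞) : ν.HasTemperateGrowth := by
  obtain ⟨N, C, hC, hN⟩ := exists_lintegral_rpow_weight_le (r := 0) hφ hp (s := s) (μ := μ)
    (by linarith)
  apply hasTemperateGrowth_of_lintegral (N := N)
  have := hN ν h0
  simp only [Real.rpow_zero, ENNReal.ofReal_one, one_mul] at this
  exact this.trans_lt (ENNReal.mul_lt_top hC.lt_top h)

end LittlewoodPaley

end

/-! ### The norm through dominating measures; completeness -/

section

variable {n : ℕ}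

/-- The norm of `FN^s_{p,μ,∞}` on the distributions whose Fourier transform is a measure, computed
through the positive measures that dominate the Fourier transform. -/
def fnN (φ : 𝓢(Rn n, ℂ)) (s : ℝ) (p : ℝ≥0∞) (μ : ℝ) (f : TDist n) : ℝ≥0∞ :=
  ⨅ (ν : Measure (Rn n)) (_ : ν {0} = 0 ∧ Dominated (fourierDist f) ν), fnMeas φ s p μ ν

variable {φ : 𝓢(Rn n, ℂ)} {s : ℝ} {p : ℝ≥0∞} {μ : ℝ}

theorem fnN_le {f : TDist n} {ν : Measure (Rn n)} (h0 : ν {0} = 0)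
    (h : Dominated (fourierDist f) ν) : fnN φ s p μ f ≤ fnMeas φ s p μ ν :=
  iInf₂_le ν ⟨h0, h⟩

theorem exists_of_fnN_lt {f : TDist n} {A : ℝ≥0∞} (h : fnN φ s p μ f < A) :
    ∃ ν : Measure (Rn n), ν {0} = 0 ∧ Dominated (fourierDist f) ν ∧ fnMeas φ s p μ ν < A := by
  simp only [fnN, iInf_lt_iff] at h
  obtain ⟨ν, ⟨h0, hd⟩, h⟩ := h
  exact ⟨ν, h0, hd, h⟩

theorem isMeas_of_fnN_lt_top (hφ : IsLittlewoodPaley φ) (hp : 1 ≤ p) (hs : s < massExp n p μ)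
    {f : TDist n} (h : fnN φ s p μ f < ∞) : IsMeas f := by
  obtain ⟨ν, h0, hd, h⟩ := exists_of_fnN_lt h
  exact hd.isMeas (hasTemperateGrowth_of_fnMeas hφ hp hs h0 h) h0

theorem fnN_eq_fnMeas_tv (hφ : IsLittlewoodPaley φ) (hp : 1 ≤ p) (hs : s < massExp n p μ)
    {f : TDist n} (hf : IsMeas f) : fnN φ s p μ f = fnMeas φ s p μ (tv f) := by
  apply le_antisymm (fnN_le (tv_zero_singleton f) hf.dominated_tv)
  refine le_iInf₂ fun ν ⟨h0, hd⟩ => ?_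
  by_cases h : fnMeas φ s p μ ν = ∞
  · rw [h]; exact le_top
  · exact fnMeas_mono (hd.tv_le (hasTemperateGrowth_of_fnMeas hφ hp hs h0 (lt_top_iff_ne_top.2 h)) h0)

theorem fnN_add_le (f g : TDist n) :
    fnN φ s p μ (f + g) ≤ fnN φ s p μ f + fnN φ s p μ g := by
  refine ENNReal.le_of_forall_pos_le_add fun ε hε htop => ?_
  have hε2 : (0 : ℝ≥0∞) < ε / 2 := ENNReal.half_pos (by exact_mod_cast hε.ne')
  have hf : fnN φ s p μ f < fnN φ s p μ f + ε / 2 :=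
    ENNReal.lt_add_right (ENNReal.add_lt_top.1 htop).1.ne hε2.ne'
  have hg : fnN φ s p μ g < fnN φ s p μ g + ε / 2 :=
    ENNReal.lt_add_right (ENNReal.add_lt_top.1 htop).2.ne hε2.ne'
  obtain ⟨ν, h0, hd, h⟩ := exists_of_fnN_lt hf
  obtain ⟨ν', h0', hd', h'⟩ := exists_of_fnN_lt hg
  calc fnN φ s p μ (f + g) ≤ fnMeas φ s p μ (ν + ν') := by
        refine fnN_le (by simp [h0, h0']) ?_
        rw [fourierDist_add]
        exact hd.add hd'
    _ ≤ fnMeas φ s p μ ν + fnMeas φ s p μ ν' := fnMeas_add_le _ _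
    _ ≤ (fnN φ s p μ f + ε / 2) + (fnN φ s p μ g + ε / 2) := add_le_add h.le h'.le
    _ = fnN φ s p μ f + fnN φ s p μ g + (ε / 2 + ε / 2) := by ring
    _ = _ := by rw [ENNReal.add_halves]

theorem fnN_neg_le (f : TDist n) : fnN φ s p μ (-f) ≤ fnN φ s p μ f := by
  refine le_iInf₂ fun ν ⟨h0, hd⟩ => fnN_le h0 ?_
  rw [fourierDist_neg]
  exact hd.neg

theorem fnN_neg (f : TDist n) : fnN φ s p μ (-f) = fnN φ s p μ f :=
  le_antisymm (fnN_neg_le f) (by simpa using fnN_neg_le (φ := φ) (s := s) (p := p) (μ := μ) (-f))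

theorem fnN_sub_le (f g : TDist n) :
    fnN φ s p μ (f - g) ≤ fnN φ s p μ f + fnN φ s p μ g := by
  rw [sub_eq_add_neg, ← fnN_neg g]
  exact fnN_add_le _ _

theorem fnMeas_zero : fnMeas φ s p μ 0 = 0 := by
  refine le_antisymm (fnMeas_le fun k g _ => ?_) zero_le
  simp

theorem fnN_zero : fnN φ s p μ 0 = 0 := by
  refine le_antisymm ((fnN_le (ν := 0) (by simp) fun ψ => ?_).trans fnMeas_zero.le) zero_le
  rw [fourierDist_zero]
  simp

theorem exists_enorm_fourierDist_le (hφ : IsLittlewoodPaley φ) (hp : 1 ≤ p)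
    (hs : s < massExp n p μ) (ψ : 𝓢(Rn n, ℂ)) :
    ∃ C : ℝ≥0∞, C ≠ ∞ ∧ ∀ f : TDist n, ‖fourierDist f ψ‖ₑ ≤ C * fnN φ s p μ f := by
  obtain ⟨C, hC, h⟩ := exists_lintegral_schwartz_le hφ hp hs ψ
  -- A nonzero finite constant may be moved inside the infimum that defines `fnN`; `C` itself might
  -- vanish.
  refine ⟨C + 1, by simp [hC], fun f => ?_⟩
  rw [fnN, ENNReal.mul_iInf_of_ne (by simp) (by simp [hC])]
  refine le_iInf fun ν => ?_
  rw [ENNReal.mul_iInf_of_ne (by simp) (by simp [hC])]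
  refine le_iInf fun ⟨h0, hd⟩ => (hd ψ).trans ((h ν h0).trans ?_)
  gcongr
  exact le_self_add

theorem exists_enorm_apply_le (hφ : IsLittlewoodPaley φ) (hp : 1 ≤ p)
    (hs : s < massExp n p μ) (ψ : 𝓢(Rn n, ℂ)) :
    ∃ C : ℝ≥0∞, C ≠ ∞ ∧ ∀ f : TDist n, ‖f ψ‖ₑ ≤ C * fnN φ s p μ f := by
  obtain ⟨C, hC, h⟩ := exists_enorm_fourierDist_le hφ hp hs (invTestFourier ψ)
  exact ⟨C, hC, fun f => by rw [apply_eq_fourierDist]; exact h f⟩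

theorem eq_zero_of_fnN_eq_zero (hφ : IsLittlewoodPaley φ) (hp : 1 ≤ p)
    (hs : s < massExp n p μ) {f : TDist n} (h : fnN φ s p μ f = 0) : f = 0 := by
  ext ψ
  obtain ⟨C, hC, hb⟩ := exists_enorm_apply_le hφ hp hs ψ
  have := hb f
  rw [h, mul_zero, nonpos_iff_eq_zero, enorm_eq_zero] at this
  exact this

/-- Completeness in the form in which it is used. The sum of the total variations dominates the
series, and the sum over the indices from `m` on dominates the remainder. -/
theorem exists_fnN_sum_sub_le (hφ : IsLittlewoodPaley φ) (hp : 1 ≤ p)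
    (hs : s < massExp n p μ) (d : ℕ → TDist n) (hd : ∑' i, fnN φ s p μ (d i) ≠ ∞) :
    ∃ f : TDist n, ∀ m, fnN φ s p μ (f - ∑ i ∈ Finset.range m, d i) ≤
      ∑' i, fnN φ s p μ (d (i + m)) := by
  have hM : ∀ i, IsMeas (d i) := fun i =>
    isMeas_of_fnN_lt_top hφ hp hs (lt_top_iff_ne_top.2 (ENNReal.ne_top_of_tsum_ne_top hd i))
  have hN : ∀ i, fnN φ s p μ (d i) = fnMeas φ s p μ (tv (d i)) := fun i =>
    fnN_eq_fnMeas_tv hφ hp hs (hM i)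
  set ν := Measure.sum fun i => tv (d i) with hν
  have h0 : ν {0} = 0 := by
    rw [hν, Measure.sum_apply _ (measurableSet_singleton _)]
    simp [tv_zero_singleton]
  have hfin : fnMeas φ s p μ ν < ∞ := by
    refine (fnMeas_sum_le _).trans_lt ?_
    simp_rw [← hN]
    exact lt_top_iff_ne_top.2 hd
  have hT : ν.HasTemperateGrowth := hasTemperateGrowth_of_fnMeas hφ hp hs h0 hfin
  have hb : ∀ ψ : 𝓢(Rn n, ℂ), ∑' i, ‖fourierDist (d i) ψ‖ₑ ≤ ∫⁻ ξ, ‖ψ ξ‖ₑ ∂ν := by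
    intro ψ
    rw [hν, lintegral_sum_measure]
    exact ENNReal.tsum_le_tsum fun i => (hM i).dominated_tv ψ
  have hsum : ∀ ψ : 𝓢(Rn n, ℂ), Summable fun i => fourierDist (d i) ψ := by
    intro ψ
    obtain ⟨C, hC, hC'⟩ := exists_lintegral_schwartz_le hφ hp hs ψ
    have hlt : ∑' i, ‖fourierDist (d i) ψ‖ₑ < ∞ :=
      (hb ψ).trans_lt ((hC' ν h0).trans_lt (ENNReal.mul_lt_top hC.lt_top hfin))
    apply Summable.of_norm
    have := ENNReal.summable_toReal hlt.ne
    simpa using this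
  have htsum : ∀ g : ℕ → ℂ, ‖∑' i, g i‖ₑ ≤ ∑' i, ‖g i‖ₑ := fun g => enorm_tsum_le_tsum_enorm
  obtain ⟨T, hTS⟩ := exists_tdist_of_dominated ν
    { toFun := fun ψ => ∑' i, fourierDist (d i) ψ
      map_add' := fun ψ ψ' => by
        simp only [map_add]
        exact (hsum ψ).tsum_add (hsum ψ')
      map_smul' := fun c ψ => by
        simp only [map_smul, RingHom.id_apply]
        exact (hsum ψ).tsum_const_smul c } (fun ψ => (htsum _).trans (hb ψ))
  refine ⟨invFourierDist T, fun m => ?_⟩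
  simp_rw [hN]
  refine le_trans (fnN_le (ν := Measure.sum fun i => tv (d (i + m))) ?_ ?_) (fnMeas_sum_le _)
  · rw [Measure.sum_apply _ (measurableSet_singleton _)]
    simp [tv_zero_singleton]
  · intro ψ
    rw [lintegral_sum_measure, fourierDist_sub, fourierDist_invFourierDist, fourierDist_sum,
      tdist_sub_apply, tdist_sum_apply, hTS]
    have e : (∑' i, fourierDist (d i) ψ) - ∑ i ∈ Finset.range m, fourierDist (d i) ψ =
        ∑' i, fourierDist (d (i + m)) ψ := by
      rw [← (hsum ψ).sum_add_tsum_nat_add m]; ring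
    change ‖(∑' i, fourierDist (d i) ψ) - _‖ₑ ≤ _
    rw [e]
    exact (htsum _).trans (ENNReal.tsum_le_tsum fun i => (hM (i + m)).dominated_tv ψ)

/-- For `p ≠ 1` a competitor in `morreyNorm` must be a density with respect to Lebesgue measure. If
the right-hand side is finite, the variation is absolutely continuous, and its Radon–Nikodym
derivative times the phase of `h` is such a density. -/
theorem morreyNorm_le_of_density (hp : 1 ≤ p) {T : TDist n} {ν : Measure (Rn n)} {h : Rn n → ℂ}
    [IsLocallyFiniteMeasure ν] (hm : Measurable h) (hh : LocallyIntegrable h ν)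
    (hT : ∀ ψ : 𝓢(Rn n, ℂ), HasCompactSupport ψ → T ψ = ∫ ξ, ψ ξ * h ξ ∂ν) :
    morreyNorm p μ T ≤ morrey p μ (ν.withDensity fun ξ => ‖h ξ‖ₑ) := by
  by_cases h1 : p = 1
  · refine (iInf_le_of_le ν (iInf₂_le h ⟨fun h => absurd h1 h, inferInstance, hh, hT⟩)).trans ?_
    rw [morrey_withDensity hp (fun h => absurd h1 h) hm.aestronglyMeasurable]
  by_cases ht : morrey p μ (ν.withDensity fun ξ => ‖h ξ‖ₑ) = ∞
  · rw [ht]; exact le_top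
  set ρ := ν.withDensity fun ξ => ‖h ξ‖ₑ with hρ
  have hac : ρ ≪ volume := absolutelyContinuous_of_morrey_lt_top hp h1 (lt_top_iff_ne_top.2 ht)
  have hρf : IsLocallyFiniteMeasure ρ := by
    refine ⟨fun x => ?_⟩
    obtain ⟨U, hU, hi⟩ := hh x
    refine ⟨interior U, interior_mem_nhds.2 hU, ?_⟩
    rw [hρ, withDensity_apply _ isOpen_interior.measurableSet]
    exact (hi.mono_set interior_subset).2
  set r := ρ.rnDeriv volume with hr
  have hrm : Measurable r := Measure.measurable_rnDeriv _ _
  have hrf : ∀ᵐ x, r x < ∞ := Measure.rnDeriv_lt_top _ _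
  have hρr : volume.withDensity r = ρ := Measure.withDensity_rnDeriv_eq _ _ hac
  set sg : Rn n → ℂ := fun ξ => h ξ / (‖h ξ‖ : ℂ) with hsg
  have hsgm : Measurable sg := hm.div (Complex.measurable_ofReal.comp hm.norm)
  have hsg1 : ∀ ξ, ‖sg ξ‖ ≤ 1 := fun ξ => by
    simp only [hsg, norm_div, Complex.norm_real, norm_norm]
    exact div_self_le_one _
  set H : Rn n → ℂ := fun ξ => (r ξ).toReal • sg ξ with hH
  have hHm : Measurable H := hrm.ennreal_toReal.smul hsgm
  have hHr : ∀ᵐ x, ‖H x‖ₑ ≤ r x := by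
    filter_upwards [hrf] with x hx
    rw [hH, enorm_smul, Real.enorm_eq_ofReal ENNReal.toReal_nonneg, ENNReal.ofReal_toReal hx.ne]
    refine mul_le_of_le_one_right' ?_
    rw [← ofReal_norm]
    exact ENNReal.ofReal_le_one.2 (hsg1 x)
  have hHl : volume.withDensity (fun ξ => ‖H ξ‖ₑ) ≤ ρ := by
    rw [← hρr]
    exact withDensity_mono hHr
  have hHint : LocallyIntegrable H volume := by
    intro x
    obtain ⟨U, hU, hi⟩ := hρf.finiteAtNhds x
    refine ⟨interior U, interior_mem_nhds.2 hU, hHm.aestronglyMeasurable, ?_⟩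
    rw [hasFiniteIntegral_def, ← withDensity_apply _ isOpen_interior.measurableSet]
    exact (hHl _).trans_lt ((measure_mono interior_subset).trans_lt hi)
  refine (iInf_le_of_le volume (iInf₂_le H ⟨fun _ => rfl, inferInstance, hHint, ?_⟩)).trans ?_
  swap
  · intro ψ hψ
    rw [hT ψ hψ]
    have e1 : ∫ ξ, ψ ξ * sg ξ ∂ρ = ∫ ξ, ψ ξ * H ξ := by
      rw [← hρr, integral_withDensity_eq_integral_toReal_smul hrm hrf]
      refine integral_congr_ae (.of_forall fun ξ => ?_)
      simp only [hH, Complex.real_smul]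
      ring
    rw [← e1, hρ, integral_withDensity_eq_integral_toReal_smul hm.enorm (by simp)]
    refine integral_congr_ae (.of_forall fun ξ => ?_)
    simp only [hsg, toReal_enorm, Complex.real_smul]
    by_cases h0 : h ξ = 0
    · simp [h0]
    · have : (‖h ξ‖ : ℂ) ≠ 0 := by simpa using h0
      field_simp
  · rw [← morrey_withDensity hp (fun _ => rfl) hHm.aestronglyMeasurable]
    exact morrey_mono hHl

theorem smulLeftCLM_dyadic_apply {f : TDist n} {ν : Measure (Rn n)} {h : Rn n → ℂ}
    (H : IsFourierDensity f ν h) (k : ℤ) (ψ : 𝓢(Rn n, ℂ)) :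
    TemperedDistribution.smulLeftCLM ℂ (dyadic φ k) (fourierDist f) ψ =
      ∫ ξ, ψ ξ * (dyadic φ k ξ * h ξ) ∂ν := by
  rw [TemperedDistribution.smulLeftCLM_apply_apply, H.eq_integral]
  refine integral_congr_ae (.of_forall fun ξ => ?_)
  simp only [SchwartzMap.smulLeftCLM_apply_apply (hasTemperateGrowth_dyadic φ k), smul_eq_mul]
  ring

theorem IsFourierDensity.locallyIntegrable_dyadic {f : TDist n} {ν : Measure (Rn n)} {h : Rn n → ℂ}
    (H : IsFourierDensity f ν h) (k : ℤ) : LocallyIntegrable (fun ξ => dyadic φ k ξ * h ξ) ν := by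
  have h3 := (locallyIntegrableOn_univ.2 H.locallyIntegrable).continuousOn_mul
    (continuous_dyadic φ k).continuousOn isOpen_univ.isLocallyClosed
  rwa [locallyIntegrableOn_univ] at h3

/-- Every Morrey density of `φ_k f̂` has the variation `|φ_k| tv f`, because it defines the same
complex measure. This passes from the norm of the theorem to `fnN`, in which the estimates are
carried out. -/
theorem fnNormDist_eq_fnN (hφ : IsLittlewoodPaley φ) (hp : 1 ≤ p) (hs : s < massExp n p μ)
    {f : TDist n} (hf : IsMeas f) : fnNormDist φ s p μ f = fnN φ s p μ f := by
  rw [fnN_eq_fnMeas_tv hφ hp hs hf]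
  obtain ⟨h, hm, hb, H⟩ := hf.exists_density
  have hlf := H.locallyFinite
  apply le_antisymm
  · refine iSup_mono fun k => mul_le_mul' le_rfl ?_
    refine (morreyNorm_le_of_density hp (ν := tv f) (h := fun ξ => dyadic φ k ξ * h ξ)
      ((continuous_dyadic φ k).measurable.mul hm) (H.locallyIntegrable_dyadic k)
      fun ψ _ => smulLeftCLM_dyadic_apply H k ψ).trans ?_
    refine morrey_mono (withDensity_mono (.of_forall fun ξ => ?_))
    simp only [enorm_mul]
    refine mul_le_of_le_one_right' ?_
    rw [← ofReal_norm]
    exact ENNReal.ofReal_le_one.2 (hb ξ)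
  · refine iSup_mono fun k => mul_le_mul' le_rfl ?_
    refine le_iInf fun ν' => le_iInf₂ fun h' D => ?_
    have := D.locallyFinite
    have hS : SameDensity (tv f) (fun ξ => dyadic φ k ξ * h ξ) ν' h' := by
      refine sameDensity_of_integral_eq (H.locallyIntegrable_dyadic k) D.locallyIntegrable
        fun ψ hψ => ?_
      rw [← D.eq_integral ψ hψ, smulLeftCLM_dyadic_apply H]
    rw [← morrey_withDensity hp D.volume_of_ne_one D.locallyIntegrable.aestronglyMeasurable,
      ← hS.withDensity_eq]
    apply le_of_eq
    congr 1
    conv_lhs => rw [H.tv_eq]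
    rw [← withDensity_mul _ hm.enorm (measurable_enorm_dyadic φ k)]
    congr 1
    ext ξ
    simp only [Pi.mul_apply, enorm_mul, mul_comm]

end

/-! ### Distributions of finite order at the origin -/

section

variable {n : ℕ} {φ : 𝓢(Rn n, ℂ)}

theorem IsLittlewoodPaley.sum_eq_one_of_subset (hφ : IsLittlewoodPaley φ) {i : ℤ} {ξ : Rn n}
    (hξ : ξ ∈ annulus n i) {S : Finset ℤ} (hS : Finset.Icc (i - 1) (i + 1) ⊆ S) :
    ∑ k ∈ S, dyadic φ k ξ = 1 := by
  rw [← hφ.sum_near_eq_one hξ]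
  refine (Finset.sum_subset hS fun k _ hk => ?_).symm
  by_contra hne
  exact hk (Finset.mem_Icc.2 (hφ.near_of_mem_annulus hξ hne))

/-- Near a point of an annulus finitely many dyadic pieces add up to one. -/
theorem IsLittlewoodPaley.eventually_sum_eq_one (hφ : IsLittlewoodPaley φ) {i : ℤ} {ξ : Rn n}
    (hξ : ξ ∈ annulus n i) {S : Finset ℤ} (hS : Finset.Icc (i - 2) (i + 2) ⊆ S) :
    ∀ᶠ η in 𝓝 ξ, ∑ k ∈ S, dyadic φ k η = 1 := by
  have h1 : (2 : ℝ) ^ (((i - 1 : ℤ)) : ℝ) < ‖ξ‖ :=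
    lt_of_lt_of_le (rpow_two_lt_iff.2 (by push_cast; linarith)) hξ.1
  have h2 : ‖ξ‖ < (2 : ℝ) ^ (((i + 1 : ℤ)) : ℝ) := by
    have := hξ.2; push_cast; exact this
  filter_upwards [continuous_norm.continuousAt.eventually (Ioo_mem_nhds h1 h2)] with η hη
  have h0 : η ≠ 0 := by
    rintro rfl
    have : (0 : ℝ) < 2 ^ (((i - 1 : ℤ)) : ℝ) := by positivity
    simp only [norm_zero] at hη
    linarith [hη.1]
  obtain ⟨j, hj⟩ := exists_mem_annulus h0
  have h3 : (i - 1 : ℤ) < j + 1 := by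
    have := rpow_two_lt_iff.1 (hη.1.trans hj.2); exact_mod_cast this
  have h4 : j < i + 1 := by
    have := rpow_two_lt_iff.1 (hj.1.trans_lt hη.2); exact_mod_cast this
  apply hφ.sum_eq_one_of_subset hj
  refine subset_trans (fun k hk => ?_) hS
  simp only [Finset.mem_Icc] at hk ⊢
  omega

theorem IsLittlewoodPaley.tsupport_dyadic (hφ : IsLittlewoodPaley φ) (k : ℤ) :
    tsupport (dyadic φ k) ⊆
      {ξ | 3 / 4 * (2 : ℝ) ^ (k : ℝ) ≤ ‖ξ‖ ∧ ‖ξ‖ ≤ 8 / 3 * (2 : ℝ) ^ (k : ℝ)} :=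
  closure_minimal (fun _ hξ => hφ.dyadic_support hξ)
    ((isClosed_le continuous_const continuous_norm).inter
      (isClosed_le continuous_norm continuous_const))

theorem contDiff_dyadic (φ : 𝓢(Rn n, ℂ)) (k : ℤ) : ContDiff ℝ (⊤ : ℕ∞) (dyadic φ k) :=
  (φ.smooth ⊤).comp (contDiff_const_smul _)

/-- Each derivative of `φ(2^{-k} ·)` costs `2^{-k}`, and on the support `‖ξ‖ ≤ 8/3 · 2^k`. The
product is scale invariant, hence bounded uniformly in `k`. -/
theorem IsLittlewoodPaley.exists_iteratedFDeriv_dyadic_le (hφ : IsLittlewoodPaley φ) (i : ℕ) :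
    ∃ C : ℝ, 0 ≤ C ∧ ∀ (k : ℤ) (ξ : Rn n), ‖ξ‖ ^ i * ‖iteratedFDeriv ℝ i (dyadic φ k) ξ‖ ≤ C := by
  refine ⟨(8 / 3) ^ i * SchwartzMap.seminorm ℝ 0 i φ, by positivity, fun k ξ => ?_⟩
  by_cases hξ : ξ ∈ tsupport (dyadic φ k)
  · have h1 := (hφ.tsupport_dyadic k hξ).2
    have h2 : iteratedFDeriv ℝ i (dyadic φ k) ξ =
        ((2 : ℝ) ^ (-k)) ^ i • iteratedFDeriv ℝ i φ ((2 : ℝ) ^ (-k) • ξ) :=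
      congrFun (iteratedFDeriv_comp_const_smul ((2 : ℝ) ^ (-k)) (φ.smooth i)) ξ
    rw [h2, norm_smul, norm_pow, Real.norm_of_nonneg (by positivity), ← mul_assoc, ← mul_pow]
    have h3 := SchwartzMap.le_seminorm ℝ 0 i φ ((2 : ℝ) ^ (-k) • ξ)
    rw [pow_zero, one_mul] at h3
    gcongr
    rw [zpow_neg, ← Real.rpow_intCast, ← div_eq_mul_inv, div_le_iff₀ (by positivity)]
    exact h1
  · rw [image_eq_zero_of_notMem_tsupport (fun h => hξ (tsupport_iteratedFDeriv_subset i h)),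
      norm_zero, mul_zero]
    positivity

/-- Taylor's estimate for a Schwartz function whose derivatives up to the order `N` vanish at the
origin. -/
theorem exists_iteratedFDeriv_le_of_flat (ψ : 𝓢(Rn n, ℂ)) (N : ℕ)
    (h0 : ∀ j ≤ N, iteratedFDeriv ℝ j ψ 0 = 0) (j : ℕ) (hj : j ≤ N + 1) :
    ∃ C : ℝ, 0 ≤ C ∧ ∀ ξ : Rn n, ‖iteratedFDeriv ℝ j ψ ξ‖ ≤ C * ‖ξ‖ ^ (N + 1 - j) := by
  -- Descending induction: the derivative of order `N + 1` is bounded, and each mean value estimate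
  -- from the origin gains one power of `‖ξ‖`.
  induction hj using Nat.decreasingInduction with
  | self =>
    refine ⟨SchwartzMap.seminorm ℝ 0 (N + 1) ψ, by positivity, fun ξ => ?_⟩
    simpa using SchwartzMap.le_seminorm ℝ 0 (N + 1) ψ ξ
  | of_succ j hj ih =>
    obtain ⟨C, hC, h⟩ := ih
    refine ⟨C, hC, fun ξ => ?_⟩
    have hd : Differentiable ℝ (iteratedFDeriv ℝ j ψ) :=
      (ψ.smooth ⊤).differentiable_iteratedFDeriv (mod_cast ENat.natCast_lt_top j)
    have := (convex_closedBall (0 : Rn n) ‖ξ‖).norm_image_sub_le_of_norm_fderiv_le (𝕜 := ℝ)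
      (f := iteratedFDeriv ℝ j ψ) (C := C * ‖ξ‖ ^ (N + 1 - (j + 1))) (x := 0) (y := ξ)
      (fun x _ => hd x) (fun x hx => ?_) (by simp) (by simp)
    · rw [h0 j (by omega), sub_zero, sub_zero, mul_assoc, ← pow_succ] at this
      rwa [show N + 1 - (j + 1) + 1 = N + 1 - j by omega] at this
    · rw [norm_fderiv_iteratedFDeriv]
      refine (h x).trans ?_
      gcongr
      simpa using hx

/-- The weight `‖ξ‖ + ‖ξ‖⁻¹` is large on the shells left out of a partial sum, and the power `‖ξ‖ ^
i` pays for `i` derivatives of `φ_k`. Flatness gives the bound near the origin, Schwartz decay at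
infinity. -/
theorem exists_weight_iteratedFDeriv_le_of_flat (ψ : 𝓢(Rn n, ℂ)) (N : ℕ)
    (h0 : ∀ j ≤ N, iteratedFDeriv ℝ j ψ 0 = 0) (a i j : ℕ) (hij : i + j ≤ N) :
    ∃ C : ℝ, 0 ≤ C ∧ ∀ ξ : Rn n, ξ ≠ 0 →
      (‖ξ‖ + ‖ξ‖⁻¹) * (‖ξ‖ ^ a * ‖iteratedFDeriv ℝ j ψ ξ‖) ≤ C * ‖ξ‖ ^ i := by
  obtain ⟨C, hC, h⟩ := exists_iteratedFDeriv_le_of_flat ψ N h0 j (by omega)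
  refine ⟨2 * C + 2 * SchwartzMap.seminorm ℝ (a + 1) j ψ, by positivity, fun ξ hξ => ?_⟩
  have hpos : 0 < ‖ξ‖ := norm_pos_iff.2 hξ
  have hS : 0 ≤ SchwartzMap.seminorm ℝ (a + 1) j ψ := by positivity
  rcases le_total ‖ξ‖ 1 with h1 | h1
  · have e1 : ‖ξ‖ + ‖ξ‖⁻¹ ≤ 2 * ‖ξ‖⁻¹ := by
      have : (1 : ℝ) ≤ ‖ξ‖⁻¹ := (one_le_inv₀ hpos).2 h1
      linarith
    have e2 : ‖ξ‖ ^ a ≤ 1 := pow_le_one₀ hpos.le h1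
    calc _ ≤ 2 * ‖ξ‖⁻¹ * (1 * (C * ‖ξ‖ ^ (N + 1 - j))) := by
          gcongr; exact h ξ
      _ = 2 * C * ‖ξ‖ ^ (N - j) := by
          rw [show N + 1 - j = N - j + 1 by omega, pow_succ]; field_simp
      _ ≤ 2 * C * ‖ξ‖ ^ i := by
          gcongr ?_ * ?_
          exact pow_le_pow_of_le_one hpos.le h1 (by omega)
      _ ≤ _ := by gcongr; linarith
  · have e1 : ‖ξ‖ + ‖ξ‖⁻¹ ≤ 2 * ‖ξ‖ := by
      have : ‖ξ‖⁻¹ ≤ 1 := inv_le_one_of_one_le₀ h1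
      linarith
    have e2 := SchwartzMap.le_seminorm ℝ (a + 1) j ψ ξ
    calc _ ≤ 2 * ‖ξ‖ * (‖ξ‖ ^ a * ‖iteratedFDeriv ℝ j ψ ξ‖) := by gcongr
      _ = 2 * (‖ξ‖ ^ (a + 1) * ‖iteratedFDeriv ℝ j ψ ξ‖) := by rw [pow_succ]; ring
      _ ≤ 2 * SchwartzMap.seminorm ℝ (a + 1) j ψ * 1 := by rw [mul_one]; gcongr
      _ ≤ _ := by
        gcongr
        · linarith
        · exact one_le_pow₀ h1

theorem IsLittlewoodPaley.exists_weight_dyadic_smul_le (hφ : IsLittlewoodPaley φ)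
    (ψ : 𝓢(Rn n, ℂ)) (N : ℕ) (h0 : ∀ j ≤ N, iteratedFDeriv ℝ j ψ 0 = 0) (a b : ℕ) (hb : b ≤ N) :
    ∃ C : ℝ, 0 ≤ C ∧ ∀ (k : ℤ) (ξ : Rn n), ξ ≠ 0 →
      (‖ξ‖ + ‖ξ‖⁻¹) * (‖ξ‖ ^ a * ‖iteratedFDeriv ℝ b (fun η => dyadic φ k η * ψ η) ξ‖) ≤ C := by
  choose D hD hDb using fun i => hφ.exists_iteratedFDeriv_dyadic_le i
  have : ∀ i : ℕ, ∃ C : ℝ, 0 ≤ C ∧ (i ∈ Finset.range (b + 1) → ∀ ξ : Rn n, ξ ≠ 0 →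
      (‖ξ‖ + ‖ξ‖⁻¹) * (‖ξ‖ ^ a * ‖iteratedFDeriv ℝ (b - i) ψ ξ‖) ≤ C * ‖ξ‖ ^ i) := by
    intro i
    by_cases hi : i ∈ Finset.range (b + 1)
    · obtain ⟨C, hC, h⟩ := exists_weight_iteratedFDeriv_le_of_flat ψ N h0 a i (b - i)
        (by rw [Finset.mem_range] at hi; omega)
      exact ⟨C, hC, fun _ => h⟩
    · exact ⟨0, le_rfl, fun h => absurd h hi⟩
  choose C hC hCb using this
  refine ⟨∑ i ∈ Finset.range (b + 1), (b.choose i : ℝ) * (D i * C i),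
    Finset.sum_nonneg fun i _ => mul_nonneg (by positivity) (mul_nonneg (hD i) (hC i)),
    fun k ξ hξ => ?_⟩
  have hpos : 0 < ‖ξ‖ := norm_pos_iff.2 hξ
  have hl := norm_iteratedFDeriv_mul_le (contDiff_dyadic φ k) (ψ.smooth ⊤) ξ (n := b)
    (mod_cast le_top)
  calc _ ≤ (‖ξ‖ + ‖ξ‖⁻¹) * (‖ξ‖ ^ a * ∑ i ∈ Finset.range (b + 1), (b.choose i : ℝ) *
        ‖iteratedFDeriv ℝ i (dyadic φ k) ξ‖ * ‖iteratedFDeriv ℝ (b - i) ψ ξ‖) := by gcongr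
    _ = ∑ i ∈ Finset.range (b + 1), (b.choose i : ℝ) * (‖iteratedFDeriv ℝ i (dyadic φ k) ξ‖ *
        ((‖ξ‖ + ‖ξ‖⁻¹) * (‖ξ‖ ^ a * ‖iteratedFDeriv ℝ (b - i) ψ ξ‖))) := by
      rw [Finset.mul_sum, Finset.mul_sum]
      refine Finset.sum_congr rfl fun i _ => by ring
    _ ≤ _ := by
      refine Finset.sum_le_sum fun i hi => mul_le_mul_of_nonneg_left ?_ (by positivity)
      calc _ ≤ ‖iteratedFDeriv ℝ i (dyadic φ k) ξ‖ * (C i * ‖ξ‖ ^ i) :=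
            mul_le_mul_of_nonneg_left (hCb i hi ξ hξ) (norm_nonneg _)
        _ = (‖ξ‖ ^ i * ‖iteratedFDeriv ℝ i (dyadic φ k) ξ‖) * C i := by ring
        _ ≤ _ := by
          have := hC i
          gcongr
          exact hDb i k ξ

theorem IsLittlewoodPaley.dyadic_zero (hφ : IsLittlewoodPaley φ) (k : ℤ) :
    (0 : Rn n) ∉ tsupport (dyadic φ k) := fun h => by
  have := (hφ.tsupport_dyadic k h).1
  have h2 : (0 : ℝ) < 2 ^ (k : ℝ) := by positivity
  rw [norm_zero] at this
  linarith

/-- The partial sums of the Littlewood–Paley decomposition of a Schwartz function that is flat at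
the origin converge in each seminorm of order at most `N`. -/
theorem IsLittlewoodPaley.exists_seminorm_sub_sum_le (hφ : IsLittlewoodPaley φ)
    (ψ : 𝓢(Rn n, ℂ)) (N : ℕ) (h0 : ∀ j ≤ N, iteratedFDeriv ℝ j ψ 0 = 0) (a b : ℕ) (hb : b ≤ N) :
    ∃ C : ℝ, 0 ≤ C ∧ ∀ m : ℕ, SchwartzMap.seminorm ℂ a b
      (ψ - ∑ k ∈ Finset.Icc (-(m : ℤ)) m, SchwartzMap.smulLeftCLM ℂ (dyadic φ k) ψ) ≤
        C * (2 ^ m : ℝ)⁻¹ := by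
  obtain ⟨C, hC, h⟩ := hφ.exists_weight_dyadic_smul_le ψ N h0 a b hb
  -- At most five pieces of the remainder are active near a point, and each is at most `8/3 · C ·
  -- 2^{-m}`.
  refine ⟨5 * (8 / 3 * C), by positivity, fun m => ?_⟩
  refine SchwartzMap.seminorm_le_bound ℂ _ _ _ (by positivity) fun ξ => ?_
  have hfun : ∀ S : Finset ℤ, ⇑(∑ k ∈ S, SchwartzMap.smulLeftCLM ℂ (dyadic φ k) ψ) =
      fun η => ∑ k ∈ S, dyadic φ k η * ψ η := by
    intro S
    ext η
    rw [sum_apply]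
    exact Finset.sum_congr rfl fun k _ => by
      rw [SchwartzMap.smulLeftCLM_apply_apply (hasTemperateGrowth_dyadic φ k), smul_eq_mul]
  set M := Finset.Icc (-(m : ℤ)) m with hM
  have hcd : ∀ k, ContDiff ℝ b fun η => dyadic φ k η * ψ η := fun k =>
    ((contDiff_dyadic φ k).mul (ψ.smooth ⊤)).of_le (mod_cast le_top)
  by_cases hξ : ξ = 0
  · subst hξ
    have : iteratedFDeriv ℝ b (⇑(ψ - ∑ k ∈ M, SchwartzMap.smulLeftCLM ℂ (dyadic φ k) ψ)) 0 = 0 := by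
      have e : (⇑(ψ - ∑ k ∈ M, SchwartzMap.smulLeftCLM ℂ (dyadic φ k) ψ)) =ᶠ[𝓝 0] ψ := by
        have : ∀ k ∈ M, ∀ᶠ η in 𝓝 (0 : Rn n), dyadic φ k η = 0 := fun k _ => by
          have := (hφ.dyadic_zero k)
          rw [notMem_tsupport_iff_eventuallyEq] at this
          exact this
        filter_upwards [(Finset.eventually_all M).2 this] with η hη
        rw [sub_apply, hfun]
        simp only
        rw [Finset.sum_eq_zero fun k hk => by rw [hη k hk, zero_mul], sub_zero]
      rw [(e.iteratedFDeriv ℝ b).eq_of_nhds, h0 b hb]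
    rw [this, norm_zero (E := ContinuousMultilinearMap ℝ (fun _ : Fin b => Rn n) ℂ), mul_zero]
    positivity
  obtain ⟨i, hi⟩ := exists_mem_annulus hξ
  have hpos : 0 < ‖ξ‖ := norm_pos_iff.2 hξ
  set W := Finset.Icc (i - 2) (i + 2) with hW
  -- Near `ξ` the pieces with index in `W ∪ M` add up to `ψ`, so only indices in `W` but outside `M`
  -- remain.
  have e : (⇑(ψ - ∑ k ∈ M, SchwartzMap.smulLeftCLM ℂ (dyadic φ k) ψ)) =ᶠ[𝓝 ξ]
      fun η => ∑ k ∈ W \ M, dyadic φ k η * ψ η := by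
    filter_upwards [hφ.eventually_sum_eq_one hi (S := W ∪ M) Finset.subset_union_left] with η hη
    rw [sub_apply, hfun]
    have : ψ η = ∑ k ∈ W ∪ M, dyadic φ k η * ψ η := by rw [← Finset.sum_mul, hη, one_mul]
    rw [← Finset.union_sdiff_right, sub_eq_iff_eq_add]
    conv_lhs => rw [this]
    rw [Finset.sum_sdiff Finset.subset_union_right]
  rw [(e.iteratedFDeriv ℝ b).eq_of_nhds, iteratedFDeriv_fun_sum_apply (fun k _ => (hcd k).contDiffAt)]
  have hterm : ∀ k ∈ W \ M, ‖ξ‖ ^ a * ‖iteratedFDeriv ℝ b (fun η => dyadic φ k η * ψ η) ξ‖ ≤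
      8 / 3 * C * (2 ^ m : ℝ)⁻¹ := by
    intro k hk
    by_cases hs : ξ ∈ tsupport (dyadic φ k)
    · have h1 := h k ξ hξ
      have h2 := hφ.tsupport_dyadic k hs
      -- An index outside `M` belongs to a shell of radius at least of order `2^m` or at most of
      -- order `2^{-m}`; in either case the weight is of order at least `2^m`.
      have h3 : (2 : ℝ) ^ m ≤ 8 / 3 * (‖ξ‖ + ‖ξ‖⁻¹) := by
        rw [Finset.mem_sdiff, hM] at hk
        have hinv : 0 < ‖ξ‖⁻¹ := by positivity
        rcases lt_or_ge (m : ℤ) k with hk1 | hk1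
        · have : (2 : ℝ) ^ m ≤ 2 ^ (k : ℝ) := by
            rw [← Real.rpow_natCast]
            apply Real.rpow_le_rpow_of_exponent_le one_le_two
            exact_mod_cast hk1.le
          linarith [h2.1]
        · have hk2 : k ≤ -(m : ℤ) := by
            by_contra hcon
            exact hk.2 (Finset.mem_Icc.2 ⟨by omega, hk1⟩)
          have : (2 : ℝ) ^ (k : ℝ) ≤ ((2 : ℝ) ^ m)⁻¹ := by
            rw [← Real.rpow_natCast, ← Real.rpow_neg two_pos.le]
            apply Real.rpow_le_rpow_of_exponent_le one_le_two
            exact_mod_cast hk2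
          have h4 : ‖ξ‖ ≤ 8 / 3 * ((2 : ℝ) ^ m)⁻¹ := h2.2.trans (by gcongr)
          have h5 : (2 : ℝ) ^ m ≤ 8 / 3 * ‖ξ‖⁻¹ := by
            rw [← div_eq_mul_inv, le_div_iff₀ hpos]
            calc (2 : ℝ) ^ m * ‖ξ‖ ≤ 2 ^ m * (8 / 3 * ((2 : ℝ) ^ m)⁻¹) := by gcongr
              _ = 8 / 3 := by field_simp
          linarith
      have h2m : (0 : ℝ) < 2 ^ m := by positivity
      rw [← div_eq_mul_inv, le_div_iff₀ h2m]
      set X := ‖ξ‖ ^ a * ‖iteratedFDeriv ℝ b (fun η => dyadic φ k η * ψ η) ξ‖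
      have hX : 0 ≤ X := by positivity
      calc X * 2 ^ m ≤ X * (8 / 3 * (‖ξ‖ + ‖ξ‖⁻¹)) := by gcongr
        _ = 8 / 3 * ((‖ξ‖ + ‖ξ‖⁻¹) * X) := by ring
        _ ≤ _ := by gcongr
    · have : ξ ∉ tsupport (fun η => dyadic φ k η * ψ η) :=
        fun hh => hs (tsupport_mul_subset_left hh)
      rw [image_eq_zero_of_notMem_tsupport (fun h => this (tsupport_iteratedFDeriv_subset b h)),
        norm_zero, mul_zero]
      positivity
  have hcard : ((W \ M).card : ℝ) ≤ 5 := by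
    have h1 := Finset.card_le_card (Finset.sdiff_subset (s := W) (t := M))
    have h2 : W.card = 5 := by rw [hW, Int.card_Icc]; omega
    exact_mod_cast h2 ▸ h1
  calc _ ≤ ‖ξ‖ ^ a * ∑ k ∈ W \ M, ‖iteratedFDeriv ℝ b (fun η => dyadic φ k η * ψ η) ξ‖ := by
        gcongr
        exact norm_sum_le _ _
    _ = ∑ k ∈ W \ M, ‖ξ‖ ^ a * ‖iteratedFDeriv ℝ b (fun η => dyadic φ k η * ψ η) ξ‖ :=
      Finset.mul_sum _ _ _
    _ ≤ ∑ k ∈ W \ M, 8 / 3 * C * (2 ^ m : ℝ)⁻¹ := Finset.sum_le_sum hterm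
    _ = (W \ M).card * (8 / 3 * C * (2 ^ m : ℝ)⁻¹) := by rw [Finset.sum_const, nsmul_eq_mul]
    _ ≤ 5 * (8 / 3 * C * (2 ^ m : ℝ)⁻¹) := by gcongr
    _ = _ := by ring

/-- A tempered distribution annihilated by every `φ_k` is of finite order at the origin. -/
theorem IsLittlewoodPaley.exists_order (hφ : IsLittlewoodPaley φ) (T : TDist n)
    (hT : ∀ k ψ, T (SchwartzMap.smulLeftCLM ℂ (dyadic φ k) ψ) = 0) :
    ∃ N : ℕ, ∀ ψ : 𝓢(Rn n, ℂ), (∀ j ≤ N, iteratedFDeriv ℝ j ψ 0 = 0) → T ψ = 0 := by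
  obtain ⟨s, C, -, hC⟩ := Seminorm.bound_of_continuous (schwartz_withSeminorms ℂ (Rn n) ℂ)
    ((normSeminorm ℂ ℂ).comp (T : 𝓢(Rn n, ℂ) →ₗ[ℂ] ℂ))
    (continuous_norm.comp (map_continuous T))
  -- The order is the highest number of derivatives in the finitely many seminorms that control `T`;
  -- up to this order the partial sums converge.
  refine ⟨s.sup Prod.snd, fun ψ h0 => ?_⟩
  have : ∀ q : ℕ × ℕ, ∃ D : ℝ, 0 ≤ D ∧ (q ∈ s → ∀ m : ℕ, schwartzSeminormFamily ℂ (Rn n) ℂ q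
      (ψ - ∑ k ∈ Finset.Icc (-(m : ℤ)) m, SchwartzMap.smulLeftCLM ℂ (dyadic φ k) ψ) ≤
        D * (2 ^ m : ℝ)⁻¹) := by
    intro q
    by_cases hq : q ∈ s
    · obtain ⟨D, hD, h⟩ := hφ.exists_seminorm_sub_sum_le ψ _ h0 q.1 q.2
        (Finset.le_sup (f := Prod.snd) hq)
      exact ⟨D, hD, fun _ => h⟩
    · exact ⟨0, le_rfl, fun h => absurd h hq⟩
  choose D hD hDb using this
  have hb : ∀ m : ℕ, ‖T ψ‖ ≤ C * ((∑ q ∈ s, D q) * (2 ^ m : ℝ)⁻¹) := by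
    intro m
    have e : T ψ = T (ψ - ∑ k ∈ Finset.Icc (-(m : ℤ)) m,
        SchwartzMap.smulLeftCLM ℂ (dyadic φ k) ψ) := by
      rw [map_sub, map_sum, Finset.sum_eq_zero fun k _ => hT k ψ, sub_zero]
    rw [e]
    refine (hC _).trans ?_
    rw [smul_apply, NNReal.smul_def, smul_eq_mul]
    gcongr
    have hs0 : 0 ≤ ∑ q ∈ s, D q := Finset.sum_nonneg fun q _ => hD q
    refine Seminorm.finset_sup_apply_le (by positivity) fun q hq => ?_
    refine (hDb q hq m).trans ?_
    gcongr
    exact Finset.single_le_sum (fun q _ => hD q) hq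
  have ht : Tendsto (fun m : ℕ => C * ((∑ q ∈ s, D q) * (2 ^ m : ℝ)⁻¹)) atTop (𝓝 0) := by
    have h1 : Tendsto (fun m : ℕ => (2 ^ m : ℝ)⁻¹) atTop (𝓝 0) :=
      tendsto_inv_atTop_zero.comp (tendsto_pow_atTop_atTop_of_one_lt one_lt_two)
    simpa using (h1.const_mul (∑ q ∈ s, D q)).const_mul (C : ℝ)
  have := ge_of_tendsto' ht hb
  exact norm_le_zero_iff.1 this

end

/-! ### Distributions with Fourier transform supported at the origin -/

section

variable {n : ℕ} {φ : 𝓢(Rn n, ℂ)} {s : ℝ} {p : ℝ≥0∞} {μ : ℝ}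

theorem lineDeriv_invTestFourier (m : Rn n) (ψ : 𝓢(Rn n, ℂ)) :
    ∂_{m} (invTestFourier ψ) = invTestFourier (SchwartzMap.smulLeftCLM ℂ (derivSymbol m) ψ) := by
  rw [invTestFourier, SchwartzMap.lineDerivOp_fourierInv_eq, invTestFourier]
  congr 1
  ext ξ
  have hm : (fun ξ : Rn n => inner ℝ ξ m).HasTemperateGrowth :=
    ((innerSL ℝ).flip m).hasTemperateGrowth
  simp only [smul_apply, SchwartzMap.smulLeftCLM_apply_apply hm, dilateTest_apply,
    SchwartzMap.smulLeftCLM_apply_apply (hasTemperateGrowth_derivSymbol m), derivSymbol,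
    smul_eq_mul, Complex.real_smul, inner_smul_left]
  have : (((invTwoPi : ℝˣ) : ℝ) : ℂ)⁻¹ = 2 * Real.pi := by simp [invTwoPi]
  simp only [conj_trivial]
  push_cast
  rw [this]
  ring

theorem invTestFourier_zero (ψ : 𝓢(Rn n, ℂ)) :
    invTestFourier ψ 0 = ((((2 * Real.pi) ^ n)⁻¹ : ℝ) : ℂ) * ∫ x, ψ x := by
  rw [invTestFourier, SchwartzMap.fourierInv_coe, Real.fourierInv_eq]
  have h := Measure.integral_comp_smul (volume : Measure (Rn n)) ψ ((invTwoPi⁻¹ : ℝˣ) : ℝ)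
  simp only [inner_zero_right, AddChar.map_zero_eq_one, one_smul, dilateTest_apply]
  rw [h, finrank_euclideanSpace_fin, Complex.real_smul]
  congr 3
  rw [abs_of_pos (by simp [invTwoPi]; positivity)]
  simp [invTwoPi]

theorem testFourier_lineDeriv (m : Rn n) (ψ : 𝓢(Rn n, ℂ)) :
    dilateTest invTwoPi (𝓕 (∂_{m} ψ)) =
      SchwartzMap.smulLeftCLM ℂ (derivSymbol m) (dilateTest invTwoPi (𝓕 ψ)) := by
  conv_lhs => rw [← invTestFourier_dilateTest_fourier ψ]
  rw [lineDeriv_invTestFourier, dilateTest_fourier_invTestFourier]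

/-- The value of a polynomial. -/
def evalPoly (q : MvPolynomial (Fin n) ℂ) (x : Rn n) : ℂ :=
  MvPolynomial.eval (fun i => (x i : ℂ)) q

theorem derivSymbol_single (i : Fin n) (x : Rn n) :
    derivSymbol (EuclideanSpace.single i 1) x = evalPoly (MvPolynomial.C Complex.I * MvPolynomial.X i) x := by
  simp [derivSymbol, evalPoly, EuclideanSpace.inner_single_right]

theorem evalPoly_mul (q r : MvPolynomial (Fin n) ℂ) (x : Rn n) :
    evalPoly (q * r) x = evalPoly q x * evalPoly r x := by simp [evalPoly]

theorem evalPoly_add (q r : MvPolynomial (Fin n) ℂ) (x : Rn n) :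
    evalPoly (q + r) x = evalPoly q x + evalPoly r x := by simp [evalPoly]

theorem evalPoly_C (c : ℂ) (x : Rn n) :
    evalPoly (MvPolynomial.C c : MvPolynomial (Fin n) ℂ) x = c := by simp [evalPoly]

theorem evalPoly_mul_X (q : MvPolynomial (Fin n) ℂ) (i : Fin n) (x : Rn n) (z : ℂ) :
    evalPoly (q * MvPolynomial.X i) x * z =
      -Complex.I * (evalPoly q x * (derivSymbol (EuclideanSpace.single i 1) x * z)) := by
  rw [derivSymbol_single, evalPoly_mul, evalPoly_mul, evalPoly_C]
  linear_combination (evalPoly q x * evalPoly (MvPolynomial.X i) x * z) * Complex.I_mul_I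

theorem integrable_evalPoly_mul (q : MvPolynomial (Fin n) ℂ) (ψ : 𝓢(Rn n, ℂ)) :
    Integrable fun x => evalPoly q x * ψ x := by
  induction q using MvPolynomial.induction_on generalizing ψ with
  | C a => simpa only [evalPoly_C] using ψ.integrable.const_mul a
  | add q r hq hr =>
    simp only [evalPoly_add, add_mul]
    exact (hq ψ).add (hr ψ)
  | mul_X q i hq =>
    have := (hq (SchwartzMap.smulLeftCLM ℂ (derivSymbol (EuclideanSpace.single i 1)) ψ)).const_mul
      (-Complex.I)
    simp only [evalPoly_mul_X]
    simpa only [SchwartzMap.smulLeftCLM_apply_apply (hasTemperateGrowth_derivSymbol _),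
      smul_eq_mul] using this

/-- Induction on the polynomial. The integral of the transform is a multiple of `ψ 0 = 0`, and a
factor `x_i` is a derivative of `ψ`, whose support still avoids the origin. -/
theorem integral_evalPoly_testFourier (q : MvPolynomial (Fin n) ℂ) (ψ : 𝓢(Rn n, ℂ))
    (h : (0 : Rn n) ∉ tsupport ψ) :
    ∫ x, evalPoly q x * dilateTest invTwoPi (𝓕 ψ) x = 0 := by
  induction q using MvPolynomial.induction_on generalizing ψ with
  | C a =>
    have h1 := invTestFourier_zero (dilateTest invTwoPi (𝓕 ψ))
    rw [invTestFourier_dilateTest_fourier, image_eq_zero_of_notMem_tsupport h] at h1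
    have h2 : ((((2 * Real.pi) ^ n)⁻¹ : ℝ) : ℂ) ≠ 0 := by
      have : (0 : ℝ) < ((2 * Real.pi) ^ n)⁻¹ := by positivity
      exact_mod_cast this.ne'
    have h3 := (mul_eq_zero.1 h1.symm).resolve_left h2
    simp only [evalPoly_C]
    rw [integral_const_mul, h3, mul_zero]
  | add q r hq hr =>
    simp only [evalPoly_add, add_mul]
    rw [integral_add (integrable_evalPoly_mul q _) (integrable_evalPoly_mul r _), hq ψ h, hr ψ h,
      add_zero]
  | mul_X q i hq =>
    have h1 := hq (∂_{(EuclideanSpace.single i 1 : Rn n)} ψ) fun hh =>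
      h (SchwartzMap.tsupport_lineDerivOp_subset _ _ hh)
    rw [testFourier_lineDeriv] at h1
    simp only [SchwartzMap.smulLeftCLM_apply_apply (hasTemperateGrowth_derivSymbol _),
      smul_eq_mul] at h1
    simp only [evalPoly_mul_X]
    rw [integral_const_mul, h1, mul_zero]

theorem fourierDist_eq_zero_of_mem_polynomials {f : TDist n} (hf : f ∈ polynomials n)
    (ψ : 𝓢(Rn n, ℂ)) (h : (0 : Rn n) ∉ tsupport ψ) : fourierDist f ψ = 0 := by
  induction hf using Submodule.span_induction with
  | mem f hf =>
    obtain ⟨q, hq⟩ := hf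
    rw [fourierDist_apply, hq]
    exact integral_evalPoly_testFourier q ψ h
  | zero => rw [fourierDist_zero]; rfl
  | add f g _ _ hf hg => rw [fourierDist_add, tdist_add_apply, hf, hg, add_zero]
  | smul c f _ hf => rw [fourierDist_smul, tdist_smul_apply, hf, mul_zero]

/-- The inverse transform of a derivative of the Dirac mass is a polynomial: each derivative brings
in a factor `i x_v` under the integral. -/
theorem exists_poly_iteratedLineDeriv (j : ℕ) (v : Fin j → Fin n) :
    ∃ q : MvPolynomial (Fin n) ℂ, ∀ ψ : 𝓢(Rn n, ℂ),
      (∂^{fun l => (EuclideanSpace.single (v l) 1 : Rn n)} (invTestFourier ψ)) 0 =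
        ∫ x, evalPoly q x * ψ x := by
  induction j with
  | zero =>
    refine ⟨MvPolynomial.C ((((2 * Real.pi) ^ n)⁻¹ : ℝ) : ℂ), fun ψ => ?_⟩
    rw [LineDeriv.iteratedLineDerivOp_fin_zero, invTestFourier_zero]
    simp only [evalPoly_C]
    rw [integral_const_mul]
  | succ j ih =>
    obtain ⟨q, hq⟩ := ih (Fin.init v)
    refine ⟨q * (MvPolynomial.C Complex.I * MvPolynomial.X (v (Fin.last j))), fun ψ => ?_⟩
    rw [LineDeriv.iteratedLineDerivOp_succ_right, lineDeriv_invTestFourier]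
    refine (hq _).trans (integral_congr_ae (.of_forall fun x => ?_))
    simp only [SchwartzMap.smulLeftCLM_apply_apply (hasTemperateGrowth_derivSymbol _), smul_eq_mul]
    rw [evalPoly_mul, derivSymbol_single, mul_assoc]

/-- The functional `ψ ↦ (∂_{v 0} ⋯ ∂_{v (j-1)} ψ)(0)`. -/
def derivAtZero {j : ℕ} (v : Fin j → Fin n) : 𝓢(Rn n, ℂ) →ₗ[ℂ] ℂ where
  toFun ψ := (∂^{fun l => (EuclideanSpace.single (v l) 1 : Rn n)} ψ) 0
  map_add' ψ χ := by rw [LineDeriv.iteratedLineDerivOp_add]; rfl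
  map_smul' c ψ := by rw [LineDeriv.iteratedLineDerivOp_smul]; rfl

theorem iteratedFDeriv_eq_zero_of_derivAtZero {j : ℕ} {ψ : 𝓢(Rn n, ℂ)}
    (h : ∀ v : Fin j → Fin n, derivAtZero v ψ = 0) : iteratedFDeriv ℝ j ψ 0 = 0 := by
  apply ContinuousMultilinearMap.toMultilinearMap_injective
  refine Module.Basis.ext_multilinear (fun _ => (EuclideanSpace.basisFun (Fin n) ℝ).toBasis)
    fun v => ?_
  have := h v
  rw [derivAtZero] at this
  simp only [LinearMap.coe_mk, AddHom.coe_mk] at this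
  rw [SchwartzMap.iteratedLineDerivOp_eq_iteratedFDeriv] at this
  simpa using this

/-- A tempered distribution whose Fourier transform is annihilated by every `φ_k` is a
polynomial. -/
theorem mem_polynomials_of_dyadic (hφ : IsLittlewoodPaley φ) {f : TDist n}
    (hf : ∀ k ψ, fourierDist f (SchwartzMap.smulLeftCLM ℂ (dyadic φ k) ψ) = 0) :
    f ∈ polynomials n := by
  obtain ⟨N, hN⟩ := hφ.exists_order (fourierDist f) hf
  set L : (Σ j : Fin (N + 1), Fin j → Fin n) → 𝓢(Rn n, ℂ) →ₗ[ℂ] ℂ := fun x => derivAtZero x.2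
    with hL
  have hker : ⨅ i, LinearMap.ker (L i) ≤
      LinearMap.ker (fourierDist f : 𝓢(Rn n, ℂ) →ₗ[ℂ] ℂ) := by
    intro ψ hψ
    rw [Submodule.mem_iInf] at hψ
    rw [LinearMap.mem_ker]
    refine hN ψ fun j hj => iteratedFDeriv_eq_zero_of_derivAtZero fun v => ?_
    exact LinearMap.mem_ker.1 (hψ ⟨⟨j, by omega⟩, v⟩)
  -- A functional that vanishes on the common kernel of finitely many functionals is a linear
  -- combination of them; here these are the derivatives at the origin up to order `N`.
  obtain ⟨c, hc⟩ := (Submodule.mem_span_range_iff_exists_fun ℂ).1 (mem_span_of_iInf_ker_le_ker hker)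
  choose q hq using fun x : (Σ j : Fin (N + 1), Fin j → Fin n) =>
    exists_poly_iteratedLineDeriv (x.1 : ℕ) x.2
  refine Submodule.subset_span ⟨∑ i, MvPolynomial.C (c i) * q i, fun ψ => ?_⟩
  have e1 : f ψ = ∑ i, c i * L i (invTestFourier ψ) := by
    rw [apply_eq_fourierDist]
    have := congrArg (fun F : 𝓢(Rn n, ℂ) →ₗ[ℂ] ℂ => F (invTestFourier ψ)) hc
    simpa using this.symm
  have e2 : ∀ x : Rn n, MvPolynomial.eval (fun i => (x i : ℂ))
      (∑ i, MvPolynomial.C (c i) * q i) * ψ x = ∑ i, c i * (evalPoly (q i) x * ψ x) := by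
    intro x
    rw [map_sum, Finset.sum_mul]
    refine Finset.sum_congr rfl fun i _ => ?_
    rw [map_mul, MvPolynomial.eval_C, mul_assoc]
    rfl
  simp only [e2]
  rw [e1, integral_finsetSum _ fun i _ => (integrable_evalPoly_mul (q i) ψ).const_mul (c i)]
  refine Finset.sum_congr rfl fun i _ => ?_
  rw [integral_const_mul, ← hq]
  rfl

end

/-! ### Canonical representatives -/

section

variable {n : ℕ} {φ : 𝓢(Rn n, ℂ)} {s : ℝ} {p : ℝ≥0∞} {μ : ℝ}

theorem smulLeftCLM_dyadic_fourierDist_eq_zero (hφ : IsLittlewoodPaley φ) {f : TDist n}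
    (hf : f ∈ polynomials n) (k : ℤ) :
    TemperedDistribution.smulLeftCLM ℂ (dyadic φ k) (fourierDist f) = 0 := by
  ext ψ
  rw [TemperedDistribution.smulLeftCLM_apply_apply,
    fourierDist_eq_zero_of_mem_polynomials hf _ fun h => hφ.dyadic_zero k ?_]
  · rfl
  · have : ⇑(SchwartzMap.smulLeftCLM ℂ (dyadic φ k) ψ) = fun ξ => dyadic φ k ξ * ψ ξ := by
      ext ξ
      rw [SchwartzMap.smulLeftCLM_apply_apply (hasTemperateGrowth_dyadic φ k), smul_eq_mul]
    rw [this] at h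
    exact tsupport_mul_subset_left h

theorem fnNormDist_congr (hφ : IsLittlewoodPaley φ) {f g : TDist n} (h : toMod f = toMod g) :
    fnNormDist φ s p μ f = fnNormDist φ s p μ g := by
  rw [fnNormDist, fnNormDist]
  congr 1
  ext k
  have h1 := smulLeftCLM_dyadic_fourierDist_eq_zero hφ ((Submodule.Quotient.eq _).1 h) k
  rw [fourierDist_sub, map_sub, sub_eq_zero] at h1
  rw [h1]

theorem fnNorm_toMod (hφ : IsLittlewoodPaley φ) (f : TDist n) :
    fnNorm φ s p μ (toMod f) = fnNormDist φ s p μ f :=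
  le_antisymm (iInf_le_of_le f (iInf_le_of_le rfl le_rfl)) (le_iInf₂ fun _ hg => (fnNormDist_congr hφ hg).ge)

theorem IsRealization.fnNorm_eq (hφ : IsLittlewoodPaley φ) (hp : 1 ≤ p) (hs : s < massExp n p μ)
    {F : DistMod n} {f : TDist n} (h : IsRealization F f) : fnNorm φ s p μ F = fnN φ s p μ f := by
  rw [← h.1, fnNorm_toMod hφ, fnNormDist_eq_fnN hφ hp hs h.2]

theorem isRealization_toMod {f : TDist n} (h : IsMeas f) : IsRealization (toMod f) f := ⟨rfl, h⟩

/-- A nonzero polynomial is not the realization of a class. -/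
theorem IsMeas.eq_zero_of_mem_polynomials (hφ : IsLittlewoodPaley φ) {f : TDist n} (hf : IsMeas f)
    (h : f ∈ polynomials n) : f = 0 := by
  -- The claim does not involve the parameters of a norm, so any norm with exponent below `massExp`
  -- serves; the choice is `p = 1`, `μ = 0`.
  have h1 : fnNormDist φ (massExp n 1 0 - 1) 1 0 f = fnNormDist φ (massExp n 1 0 - 1) 1 0 0 :=
    fnNormDist_congr hφ ((Submodule.Quotient.eq _).2 (by simpa using h))
  rw [fnNormDist_eq_fnN hφ le_rfl (by linarith) hf,
    fnNormDist_eq_fnN hφ le_rfl (by linarith) isMeas_zero, fnN_zero] at h1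
  exact eq_zero_of_fnN_eq_zero hφ le_rfl (by linarith) h1

theorem IsRealization.unique (hφ : IsLittlewoodPaley φ) {F : DistMod n} {f g : TDist n}
    (hf : IsRealization F f) (hg : IsRealization F g) : f = g := by
  have h := (Submodule.Quotient.eq (polynomials n)).1 (hf.1.trans hg.1.symm)
  exact sub_eq_zero.1 ((IsMeas.sub hf.2 hg.2).eq_zero_of_mem_polynomials hφ h)

theorem IsRealization.sub {F G : DistMod n} {f g : TDist n} (hf : IsRealization F f)
    (hg : IsRealization G g) : IsRealization (F - G) (f - g) :=
  ⟨by rw [← hf.1, ← hg.1]; rfl, IsMeas.sub hf.2 hg.2⟩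

/-- The sum of the dyadic pieces around the `k`-th one. -/
def fatDyadic (φ : 𝓢(Rn n, ℂ)) (k : ℤ) (ξ : Rn n) : ℂ :=
  ∑ j ∈ Finset.Icc (k - 2) (k + 2), dyadic φ j ξ

theorem hasTemperateGrowth_fatDyadic (φ : 𝓢(Rn n, ℂ)) (k : ℤ) :
    (fatDyadic φ k).HasTemperateGrowth :=
  Function.HasTemperateGrowth.sum fun _ _ => hasTemperateGrowth_dyadic φ _

theorem measurable_fatDyadic (φ : 𝓢(Rn n, ℂ)) (k : ℤ) : Measurable (fatDyadic φ k) :=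
  (continuous_finsetSum _ fun j _ => continuous_dyadic φ j).measurable

theorem IsLittlewoodPaley.fatDyadic_mul (hφ : IsLittlewoodPaley φ) (k : ℤ) (ξ : Rn n) :
    fatDyadic φ k ξ * dyadic φ k ξ = dyadic φ k ξ := by
  by_cases h : dyadic φ k ξ = 0
  · rw [h, mul_zero]
  · have h0 : ξ ≠ 0 := by
      rintro rfl
      exact hφ.dyadic_zero k (subset_tsupport _ h)
    obtain ⟨i, hi⟩ := exists_mem_annulus h0
    have := hφ.near_of_mem_annulus hi h
    rw [fatDyadic, hφ.sum_eq_one_of_subset hi, one_mul]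
    intro l hl
    rw [Finset.mem_Icc] at hl ⊢
    omega

theorem IsLittlewoodPaley.dyadic_mul_eq_zero (hφ : IsLittlewoodPaley φ) {j k : ℤ}
    (h : ¬ (k - 2 ≤ j ∧ j ≤ k + 2)) (ξ : Rn n) : dyadic φ j ξ * dyadic φ k ξ = 0 := by
  by_contra hne
  rw [mul_eq_zero, not_or] at hne
  have h0 : ξ ≠ 0 := by
    rintro rfl
    exact hφ.dyadic_zero k (subset_tsupport _ hne.2)
  obtain ⟨i, hi⟩ := exists_mem_annulus h0
  have h1 := hφ.near_of_mem_annulus hi hne.1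
  have h2 := hφ.near_of_mem_annulus hi hne.2
  omega

theorem IsLittlewoodPaley.fatDyadic_mul_eq_zero (hφ : IsLittlewoodPaley φ) {j k : ℤ}
    (h : ¬ (k - 4 ≤ j ∧ j ≤ k + 4)) (ξ : Rn n) : fatDyadic φ j ξ * dyadic φ k ξ = 0 := by
  rw [fatDyadic, Finset.sum_mul]
  refine Finset.sum_eq_zero fun l hl => hφ.dyadic_mul_eq_zero (fun hh => h ?_) ξ
  rw [Finset.mem_Icc] at hl
  omega

theorem exists_enorm_fatDyadic_le (φ : 𝓢(Rn n, ℂ)) :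
    ∃ C : ℝ≥0∞, C ≠ ∞ ∧ ∀ k ξ, ‖fatDyadic φ k ξ‖ₑ ≤ C := by
  obtain ⟨C, hC, h⟩ := exists_enorm_dyadic_le φ
  refine ⟨5 * C, ENNReal.mul_ne_top (by norm_num) hC, fun k ξ => ?_⟩
  refine (enorm_sum_le _ _).trans ((Finset.sum_le_sum fun j _ => h j ξ).trans ?_)
  rw [Finset.sum_const, nsmul_eq_mul, Int.card_Icc, show k + 2 + 1 - (k - 2) = 5 by ring]
  exact le_rfl

/-- `φ_j` meets the enlarged piece of index `k` only if `|j - k| ≤ 4`. This leaves nine terms, whose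
weights differ from `2^{-js}` by at most the factor `2^{|4s|}`. -/
theorem IsLittlewoodPaley.exists_fnMeas_sum_fatDyadic_lt_top (hφ : IsLittlewoodPaley φ)
    (ν : ℤ → Measure (Rn n)) {A : ℝ≥0∞} (hA : A ≠ ∞)
    (hν : ∀ k : ℤ, morrey p μ (ν k) ≤ pw (-(k * s)) * A) :
    fnMeas φ s p μ (Measure.sum fun k => (ν k).withDensity fun ξ => ‖fatDyadic φ k ξ‖ₑ) < ∞ := by
  obtain ⟨C, hC, hb⟩ := exists_enorm_dyadic_le φ
  obtain ⟨D, hD, hd⟩ := exists_enorm_fatDyadic_le φ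
  refine lt_of_le_of_lt (fnMeas_le (A := 9 * (D * C * pw |4 * s| * A)) fun j g hg => ?_) ?_
  · rw [lintegral_sum_measure]
    have e : ∀ k : ℤ, ∫⁻ ξ, ‖dyadic φ j ξ‖ₑ * g ξ
        ∂((ν k).withDensity fun ξ => ‖fatDyadic φ k ξ‖ₑ) =
        ∫⁻ ξ, ‖fatDyadic φ k ξ * dyadic φ j ξ‖ₑ * g ξ ∂(ν k) := by
      intro k
      rw [lintegral_withDensity_eq_lintegral_mul (g := fun ξ => ‖dyadic φ j ξ‖ₑ * g ξ) _
        (measurable_fatDyadic φ k).enorm ((measurable_enorm_dyadic φ j).mul hg.measurable)]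
      refine lintegral_congr fun ξ => ?_
      rw [Pi.mul_apply, enorm_mul, mul_assoc]
    rw [tsum_eq_sum (s := Finset.Icc (j - 4) (j + 4)) fun k hk => ?_]
    · have hterm : ∀ k ∈ Finset.Icc (j - 4) (j + 4), ∫⁻ ξ, ‖dyadic φ j ξ‖ₑ * g ξ
          ∂((ν k).withDensity fun ξ => ‖fatDyadic φ k ξ‖ₑ) ≤
          pw (-(j * s)) * (D * C * pw |4 * s| * A) := by
        intro k hk
        rw [Finset.mem_Icc] at hk
        rw [e k]
        calc _ ≤ ∫⁻ ξ, (D * C) * g ξ ∂(ν k) := by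
              refine lintegral_mono fun ξ => ?_
              rw [enorm_mul]
              gcongr
              · exact hd k ξ
              · exact hb j ξ
          _ = (D * C) * ∫⁻ ξ, g ξ ∂(ν k) := lintegral_const_mul _ hg.measurable
          _ ≤ (D * C) * (pw (-(j * s) + |4 * s|) * A) := by
            refine mul_le_mul' le_rfl (((hg.lintegral_le (ν k)).trans (hν k)).trans ?_)
            gcongr
            apply pw_mono
            have h1 : ((j : ℝ) - k) * s ≤ |4 * s| := by
              refine (le_abs_self _).trans ?_
              rw [abs_mul, abs_mul]
              refine mul_le_mul_of_nonneg_right ?_ (abs_nonneg _)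
              have h3 : (k : ℝ) - 4 ≤ j ∧ (j : ℝ) ≤ k + 4 := by
                constructor <;> [have := hk.2; have := hk.1] <;>
                  · have h4 : (k : ℤ) - 4 ≤ j ∧ j ≤ k + 4 := by omega
                    first | exact_mod_cast h4.1 | exact_mod_cast h4.2
              rw [show |(4 : ℝ)| = 4 by norm_num, abs_le]
              constructor <;> linarith [h3.1, h3.2]
            linarith
          _ = _ := by rw [pw_add]; ring
      refine (Finset.sum_le_sum hterm).trans (le_of_eq ?_)
      rw [Finset.sum_const, nsmul_eq_mul, Int.card_Icc, show j + 4 + 1 - (j - 4) = 9 by ring]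
      rw [show ((Int.toNat 9 : ℕ) : ℝ≥0∞) = 9 from rfl]
      ring
    · rw [e k]
      simp only [hφ.fatDyadic_mul_eq_zero fun hh => hk (Finset.mem_Icc.2 hh), enorm_zero, zero_mul,
        lintegral_zero]
  · exact ENNReal.mul_lt_top (by norm_num) (ENNReal.mul_lt_top (ENNReal.mul_lt_top
      (ENNReal.mul_lt_top hD.lt_top hC.lt_top) (pw_ne_top _).lt_top) hA.lt_top)

/-- Every class in the Fourier–Besov–Morrey space has a canonical representative. -/
theorem exists_isRealization (hφ : IsLittlewoodPaley φ) (hp : 1 ≤ p) (hs : s < massExp n p μ)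
    {F : DistMod n} (hF : fnNorm φ s p μ F < ∞) : ∃ f, IsRealization F f := by
  obtain ⟨f₁, rfl⟩ := Submodule.Quotient.mk_surjective _ F
  rw [fnNorm_toMod hφ] at hF
  set A := fnNormDist φ s p μ f₁ with hA
  set T := fourierDist f₁ with hT
  -- Adding `1` makes the inequality strict even for `A = 0`, so that for each `k` some density in
  -- the infimum satisfies the bound.
  have hlt : ∀ k : ℤ, morreyNorm p μ (TemperedDistribution.smulLeftCLM ℂ (dyadic φ k) T) <
      pw (-(k * s)) * (A + 1) := by
    intro k
    have h1 : pw (k * s) * morreyNorm p μ (TemperedDistribution.smulLeftCLM ℂ (dyadic φ k) T) ≤ A :=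
      le_iSup (fun k : ℤ => ENNReal.ofReal ((2 : ℝ) ^ ((k : ℝ) * s)) *
        morreyNorm p μ (TemperedDistribution.smulLeftCLM ℂ (dyadic φ k) (fourierDist f₁))) k
    refine (le_pw_neg_mul h1).trans_lt ?_
    exact (ENNReal.mul_lt_mul_iff_right (pw_ne_zero _) (pw_ne_top _)).2
      (ENNReal.lt_add_right hF.ne one_ne_zero)
  have hex : ∀ k : ℤ, ∃ (ν : Measure (Rn n)) (h : Rn n → ℂ),
      IsMorreyDensity p (TemperedDistribution.smulLeftCLM ℂ (dyadic φ k) T) ν h ∧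
      morreySup p μ ν h < pw (-(k * s)) * (A + 1) := by
    intro k
    have := hlt k
    rw [morreyNorm] at this
    simp only [iInf_lt_iff] at this
    obtain ⟨ν, h, H, h2⟩ := this
    exact ⟨ν, h, H, h2⟩
  choose ν h H hM using hex
  set lam : ℤ → Measure (Rn n) := fun k => (ν k).withDensity fun ξ => ‖h k ξ‖ₑ with hlam
  have hmor : ∀ k : ℤ, morrey p μ (lam k) ≤ pw (-(k * s)) * (A + 1) := fun k => by
    rw [hlam, morrey_withDensity hp (H k).volume_of_ne_one
      (H k).locallyIntegrable.aestronglyMeasurable]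
    exact (hM k).le
  set κ : Measure (Rn n) := Measure.sum fun k =>
    (lam k).withDensity fun ξ => ‖fatDyadic φ k ξ‖ₑ with hκ
  have hκfin : fnMeas φ s p μ κ < ∞ := hφ.exists_fnMeas_sum_fatDyadic_lt_top lam
    (ENNReal.add_ne_top.2 ⟨hF.ne, ENNReal.one_ne_top⟩) hmor
  have hκ0 : κ {0} = 0 := by
    rw [hκ, Measure.sum_apply _ (measurableSet_singleton 0), ENNReal.tsum_eq_zero]
    intro k
    rw [withDensity_apply _ (measurableSet_singleton 0), ← lintegral_indicator
      (measurableSet_singleton 0)]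
    rw [lintegral_eq_zero_iff ((measurable_fatDyadic φ k).enorm.indicator
      (measurableSet_singleton 0))]
    refine .of_forall fun ξ => ?_
    rw [Pi.zero_apply, Set.indicator_apply_eq_zero]
    rintro rfl
    rw [fatDyadic, Finset.sum_eq_zero, enorm_zero]
    exact fun j _ => image_eq_zero_of_notMem_tsupport (hφ.dyadic_zero j)
  have hκt : κ.HasTemperateGrowth := hasTemperateGrowth_of_fnMeas hφ hp hs hκ0 hκfin
  have hpiece : ∀ k ψ, ‖T (SchwartzMap.smulLeftCLM ℂ (dyadic φ k) ψ)‖ₑ ≤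
      ∫⁻ ξ, ‖ψ ξ‖ₑ ∂((lam k).withDensity fun ξ => ‖fatDyadic φ k ξ‖ₑ) := by
    intro k ψ
    -- The enlarged cut-off is `1` where `φ_k ≠ 0`. Inserting it makes the test function compactly
    -- supported, as the density identity requires, and confines the dominating measure to shells
    -- near `2^k`.
    have e1 : SchwartzMap.smulLeftCLM ℂ (dyadic φ k) ψ = SchwartzMap.smulLeftCLM ℂ (dyadic φ k)
        (SchwartzMap.smulLeftCLM ℂ (fatDyadic φ k) ψ) := by
      ext ξ
      simp only [SchwartzMap.smulLeftCLM_apply_apply (hasTemperateGrowth_dyadic φ k),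
        SchwartzMap.smulLeftCLM_apply_apply (hasTemperateGrowth_fatDyadic φ k), smul_eq_mul]
      rw [← mul_assoc, mul_comm (dyadic φ k ξ) (fatDyadic φ k ξ), hφ.fatDyadic_mul]
    have hcs : HasCompactSupport (SchwartzMap.smulLeftCLM ℂ (fatDyadic φ k) ψ) := by
      have : ⇑(SchwartzMap.smulLeftCLM ℂ (fatDyadic φ k) ψ) =
          fun ξ => ∑ j ∈ Finset.Icc (k - 2) (k + 2), dyadic φ j ξ * ψ ξ := by
        ext ξ
        rw [SchwartzMap.smulLeftCLM_apply_apply (hasTemperateGrowth_fatDyadic φ k), smul_eq_mul,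
          fatDyadic, Finset.sum_mul]
      rw [this]
      refine HasCompactSupport.of_support_subset_isCompact
        (isCompact_closedBall (0 : Rn n) (8 / 3 * (2 : ℝ) ^ ((k : ℝ) + 2))) fun ξ hξ => ?_
      obtain ⟨j, hj, hne⟩ := Finset.exists_ne_zero_of_sum_ne_zero hξ
      have h1 := (hφ.dyadic_support (left_ne_zero_of_mul hne)).2
      rw [mem_closedBall_zero_iff]
      refine h1.trans ?_
      gcongr
      · norm_num
      · have := (Finset.mem_Icc.1 hj).2
        exact_mod_cast this
    rw [e1, ← TemperedDistribution.smulLeftCLM_apply_apply, (H k).eq_integral _ hcs,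
      lintegral_withDensity_eq_lintegral_mul _ (measurable_fatDyadic φ k).enorm
        ψ.continuous.measurable.enorm, hlam,
      lintegral_withDensity_eq_lintegral_mul₀
        (H k).locallyIntegrable.aestronglyMeasurable.enorm
        ((measurable_fatDyadic φ k).enorm.mul ψ.continuous.measurable.enorm).aemeasurable]
    refine (enorm_integral_le_lintegral_enorm _).trans (lintegral_mono fun ξ => ?_)
    simp only [SchwartzMap.smulLeftCLM_apply_apply (hasTemperateGrowth_fatDyadic φ k), smul_eq_mul,
      enorm_mul, Pi.mul_apply]
    rw [mul_comm]
  have htot : ∀ ψ : 𝓢(Rn n, ℂ), ∑' k, ‖T (SchwartzMap.smulLeftCLM ℂ (dyadic φ k) ψ)‖ₑ ≤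
      ∫⁻ ξ, ‖ψ ξ‖ₑ ∂κ := by
    intro ψ
    rw [hκ, lintegral_sum_measure]
    exact ENNReal.tsum_le_tsum fun k => hpiece k ψ
  have hsum : ∀ ψ : 𝓢(Rn n, ℂ), Summable fun k => T (SchwartzMap.smulLeftCLM ℂ (dyadic φ k) ψ) := by
    intro ψ
    apply Summable.of_enorm
    refine ((htot ψ).trans_lt ?_).ne
    exact (ψ.integrable (μ := κ)).hasFiniteIntegral
  -- `T₀` is the sum of the pieces `φ_k T`, absolutely convergent under the domination by `κ`.
  obtain ⟨T₀, hT₀⟩ := exists_tdist_of_dominated κ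
    { toFun := fun ψ => ∑' k, T (SchwartzMap.smulLeftCLM ℂ (dyadic φ k) ψ)
      map_add' := fun ψ χ => by
        rw [← (hsum ψ).tsum_add (hsum χ)]
        simp only [map_add]
      map_smul' := fun c ψ => by
        rw [RingHom.id_apply, smul_eq_mul, ← tsum_mul_left]
        simp only [map_smul, smul_eq_mul] }
    (fun ψ => (enorm_tsum_le_tsum_enorm).trans (htot ψ))
  simp only [LinearMap.coe_mk, AddHom.coe_mk] at hT₀
  have hdom : Dominated (fourierDist (invFourierDist T₀)) κ := by
    intro ψ
    rw [fourierDist_invFourierDist, hT₀]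
    exact (enorm_tsum_le_tsum_enorm).trans (htot ψ)
  refine ⟨invFourierDist T₀, ?_, hdom.isMeas hκt hκ0⟩
  -- On the support of `φ_j` finitely many `φ_k` add up to one. Hence `φ_j T = φ_j T₀` for all `j`,
  -- and the difference is the transform of a polynomial.
  refine (Submodule.Quotient.eq _).2 (mem_polynomials_of_dyadic hφ fun j ψ => ?_)
  rw [fourierDist_sub, fourierDist_invFourierDist, tdist_sub_apply, hT₀, sub_eq_zero]
  rw [tsum_eq_sum (s := Finset.Icc (j - 2) (j + 2)) fun k hk => ?_]
  · rw [← map_sum]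
    congr 1
    ext ξ
    simp only [sum_apply, SchwartzMap.smulLeftCLM_apply_apply (hasTemperateGrowth_dyadic φ _),
      smul_eq_mul]
    rw [← Finset.sum_mul]
    have := hφ.fatDyadic_mul j ξ
    rw [fatDyadic] at this
    rw [← mul_assoc, this]
  · rw [← map_zero T]
    congr 1
    ext ξ
    simp only [SchwartzMap.smulLeftCLM_apply_apply (hasTemperateGrowth_dyadic φ _), smul_eq_mul]
    rw [← mul_assoc, hφ.dyadic_mul_eq_zero (fun hh => hk (Finset.mem_Icc.2 hh)), zero_mul]
    rfl

end

/-! ### Multipliers and products -/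

section

variable {n : ℕ} {f f' g g' u u' w w' : TDist n} {ν ν' : Measure (Rn n)} {h h' m : Rn n → ℂ}

theorem IsMeas.exists_density_of_tv_le (hf : IsMeas f) (hν : ν.HasTemperateGrowth)
    (h0 : ν {0} = 0) (hle : tv f ≤ ν) :
    ∃ h, Measurable h ∧ (∀ ξ, ‖h ξ‖ ≤ 1) ∧ IsFourierDensity f ν h :=
  (hf.dominated_tv.mono hle).exists_isFourierDensity hν h0

theorem IsFourierDensity.tempered_mono (H : IsFourierDensity f ν h) {N : ℕ}
    (hN : Integrable (fun ξ => ((1 + ‖ξ‖) ^ N)⁻¹ • h ξ) ν) {M : ℕ} (hNM : N ≤ M) :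
    Integrable (fun ξ => ((1 + ‖ξ‖) ^ M)⁻¹ • h ξ) ν := by
  refine hN.mono ?_ (.of_forall fun ξ => ?_)
  · refine AEStronglyMeasurable.fun_smul ?_ H.locallyIntegrable.aestronglyMeasurable
    apply Continuous.aestronglyMeasurable
    apply Continuous.inv₀ (by fun_prop)
    intro x; positivity
  · rw [norm_smul, norm_smul, Real.norm_of_nonneg (by positivity),
      Real.norm_of_nonneg (by positivity)]
    gcongr
    linarith [norm_nonneg ξ]

theorem IsFourierDensity.integrable (H : IsFourierDensity f ν h) (ψ : 𝓢(Rn n, ℂ)) :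
    Integrable (fun ξ => ψ ξ * h ξ) ν := by
  obtain ⟨N, hN⟩ := H.tempered
  obtain ⟨C, hC, hb⟩ := exists_schwartz_le ψ N
  refine (hN.norm.const_mul C.toReal).mono' ?_ (.of_forall fun ξ => ?_)
  · exact ψ.continuous.aestronglyMeasurable.mul H.locallyIntegrable.aestronglyMeasurable
  · have h1 := ENNReal.toReal_mono (ENNReal.mul_ne_top hC ENNReal.ofReal_ne_top) (hb ξ)
    rw [toReal_enorm, ENNReal.toReal_mul, ENNReal.toReal_ofReal (by positivity),
      Real.rpow_neg (by positivity), Real.rpow_natCast] at h1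
    rw [norm_mul, norm_smul, Real.norm_of_nonneg (by positivity), ← mul_assoc]
    gcongr

theorem IsFourierDensity.sub (H : IsFourierDensity f ν h) (H' : IsFourierDensity f' ν h') :
    IsFourierDensity (f - f') ν (fun ξ => h ξ - h' ξ) where
  locallyFinite := H.locallyFinite
  zero := H.zero
  tempered := by
    obtain ⟨N, hN⟩ := H.tempered
    obtain ⟨N', hN'⟩ := H'.tempered
    refine ⟨max N N', ?_⟩
    simp only [smul_sub]
    exact (H.tempered_mono hN (le_max_left _ _)).sub (H'.tempered_mono hN' (le_max_right _ _))
  eq_integral ψ := by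
    simp only [mul_sub]
    rw [integral_sub (H.integrable ψ) (H'.integrable ψ), fourierDist_sub, tdist_sub_apply,
      H.eq_integral, H'.eq_integral]

theorem exists_isFourierDensity_of_lintegral [IsLocallyFiniteMeasure ν] (h0 : ν {0} = 0)
    (hm : AEStronglyMeasurable h ν) {N : ℕ}
    (hN : ∫⁻ ξ, ‖h ξ‖ₑ * ENNReal.ofReal ((1 + ‖ξ‖) ^ (-(N : ℝ))) ∂ν < ∞) :
    ∃ f, IsFourierDensity f ν h := by
  have hwm : Measurable fun x : Rn n => ENNReal.ofReal ((1 + ‖x‖) ^ (-(N : ℝ))) := by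
    apply Measurable.ennreal_ofReal
    apply Continuous.measurable
    apply Continuous.rpow_const (by fun_prop)
    intro x; left; positivity
  set ν' := ν.withDensity fun ξ => ‖h ξ‖ₑ with hν'
  have ht : ν'.HasTemperateGrowth := by
    apply hasTemperateGrowth_of_lintegral (N := N)
    rw [hν', lintegral_withDensity_eq_lintegral_mul₀ hm.enorm hwm.aemeasurable]
    exact hN
  have hl : ∀ ψ : 𝓢(Rn n, ℂ), ∫⁻ ξ, ‖ψ ξ‖ₑ ∂ν' = ∫⁻ ξ, ‖ψ ξ * h ξ‖ₑ ∂ν := by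
    intro ψ
    rw [hν', lintegral_withDensity_eq_lintegral_mul₀ hm.enorm
      ψ.continuous.measurable.enorm.aemeasurable]
    refine lintegral_congr fun ξ => ?_
    rw [Pi.mul_apply, enorm_mul, mul_comm]
  have hi : ∀ ψ : 𝓢(Rn n, ℂ), Integrable (fun ξ => ψ ξ * h ξ) ν := by
    intro ψ
    refine ⟨ψ.continuous.aestronglyMeasurable.mul hm, ?_⟩
    rw [HasFiniteIntegral, ← hl]
    exact (ψ.integrable (μ := ν')).hasFiniteIntegral
  obtain ⟨T, hT⟩ := exists_tdist_of_dominated ν'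
    { toFun := fun ψ => ∫ ξ, ψ ξ * h ξ ∂ν
      map_add' := fun ψ χ => by
        rw [← integral_add (hi ψ) (hi χ)]
        simp only [add_apply, add_mul]
      map_smul' := fun c ψ => by
        rw [RingHom.id_apply, smul_eq_mul, ← integral_const_mul]
        simp only [smul_apply, smul_eq_mul, mul_assoc] } fun ψ => by
      rw [hl]
      exact enorm_integral_le_lintegral_enorm _
  refine ⟨invFourierDist T, inferInstance, h0, ⟨N, ?_, ?_⟩, fun ψ => ?_⟩
  · refine AEStronglyMeasurable.fun_smul ?_ hm
    apply Continuous.aestronglyMeasurable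
    apply Continuous.inv₀ (by fun_prop)
    intro x; positivity
  · refine lt_of_eq_of_lt (lintegral_congr fun x => ?_) hN
    rw [enorm_smul, Real.rpow_neg (by positivity), Real.rpow_natCast,
      Real.enorm_eq_ofReal (by positivity), mul_comm]
  · rw [fourierDist_invFourierDist, hT]
    rfl

/-! ### Multipliers -/

theorem IsMultiplier.isMeas_left (hg : IsMultiplier m f g) : IsMeas f :=
  let ⟨ν, h, H, _⟩ := hg; ⟨ν, h, H⟩

theorem IsMultiplier.isMeas_right (hg : IsMultiplier m f g) : IsMeas g :=
  let ⟨ν, _, _, H⟩ := hg; ⟨ν, _, H⟩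

/-- `IsMultiplier` speaks of one density, but the relation then holds for each, since any two define
the same complex measure. Uniqueness and linearity of multipliers rest on this. -/
theorem IsMultiplier.density (hg : IsMultiplier m f g) (H : IsFourierDensity f ν h) :
    IsFourierDensity g ν fun ξ => m ξ * h ξ := by
  obtain ⟨ν', h', H', G⟩ := hg
  have hS := H'.sameDensity H
  refine ⟨H.locallyFinite, H.zero, ?_, fun ψ => ?_⟩
  · obtain ⟨N, hN⟩ := G.tempered
    refine ⟨N, ?_⟩
    have := (hS.integrable_iff fun ξ => ((((1 + ‖ξ‖) ^ N)⁻¹ : ℝ) : ℂ) * m ξ).1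
      (hN.congr (.of_forall fun ξ => by simp only [Complex.real_smul, mul_assoc]))
    exact this.congr (.of_forall fun ξ => by simp only [Complex.real_smul, mul_assoc])
  · rw [G.eq_integral]
    have := hS.integral_eq fun ξ => ψ ξ * m ξ
    simpa only [mul_assoc] using this

theorem fourierDist_ext_density (H : IsFourierDensity g ν h) (H' : IsFourierDensity g' ν h) :
    g = g' := by
  apply fourierDist_injective
  ext ψ
  rw [H.eq_integral, H'.eq_integral]

theorem IsMultiplier.unique (hg : IsMultiplier m f g) (hg' : IsMultiplier m f g') : g = g' := by
  obtain ⟨ν, h, H, G⟩ := hg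
  exact fourierDist_ext_density G (hg'.density H)

theorem hasTemperateGrowth_tv_add (hf : IsMeas f) (hf' : IsMeas f') :
    (tv f + tv f').HasTemperateGrowth :=
  hasTemperateGrowth_add hf.hasTemperateGrowth_tv hf'.hasTemperateGrowth_tv

theorem tv_add_zero_singleton (f f' : TDist n) : (tv f + tv f') {0} = 0 := by
  rw [Measure.add_apply, tv_zero_singleton, tv_zero_singleton, add_zero]

/-- Two distributions whose Fourier transforms are measures have densities with respect to a common
measure. -/
theorem exists_common_density (hf : IsMeas f) (hf' : IsMeas f') :
    ∃ h h', IsFourierDensity f (tv f + tv f') h ∧ IsFourierDensity f' (tv f + tv f') h' := by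
  obtain ⟨h, -, -, H⟩ := hf.exists_density_of_tv_le (hasTemperateGrowth_tv_add hf hf')
    (tv_add_zero_singleton f f') (Measure.le_add_right le_rfl)
  obtain ⟨h', -, -, H'⟩ := hf'.exists_density_of_tv_le (hasTemperateGrowth_tv_add hf hf')
    (tv_add_zero_singleton f f') (Measure.le_add_left le_rfl)
  exact ⟨h, h', H, H'⟩

theorem IsMultiplier.sub (hg : IsMultiplier m f g) (hg' : IsMultiplier m f' g') :
    IsMultiplier m (f - f') (g - g') := by
  obtain ⟨h, h', H, H'⟩ := exists_common_density hg.isMeas_left hg'.isMeas_left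
  refine ⟨_, _, H.sub H', ?_⟩
  simp only [mul_sub]
  exact (hg.density H).sub (hg'.density H')

theorem IsMultiplier.tv_le (hg : IsMultiplier m f g) {M : Rn n → ℝ≥0∞}
    (hM : ∀ᵐ ξ ∂(tv f), ‖m ξ‖ₑ ≤ M ξ) : tv g ≤ (tv f).withDensity M := by
  obtain ⟨h, -, hb, H⟩ := hg.isMeas_left.exists_density
  rw [(hg.density H).tv_eq]
  apply withDensity_mono
  filter_upwards [hM] with ξ hξ
  rw [enorm_mul]
  refine (mul_le_of_le_one_right' ?_).trans hξ
  rw [← ofReal_norm]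
  exact ENNReal.ofReal_le_one.2 (hb ξ)

theorem exists_isMultiplier (hf : IsMeas f) (hm : AEStronglyMeasurable m (tv f)) {N : ℕ}
    (hN : ∫⁻ ξ, ‖m ξ‖ₑ * ENNReal.ofReal ((1 + ‖ξ‖) ^ (-(N : ℝ))) ∂(tv f) < ∞) :
    ∃ g, IsMultiplier m f g := by
  obtain ⟨h, hhm, hb, H⟩ := hf.exists_density
  have := H.locallyFinite
  obtain ⟨g, hg⟩ := exists_isFourierDensity_of_lintegral (h := fun ξ => m ξ * h ξ) (N := N)
    (tv_zero_singleton f) (hm.mul hhm.aestronglyMeasurable) (by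
      refine lt_of_le_of_lt (lintegral_mono fun ξ => ?_) hN
      rw [enorm_mul]
      gcongr
      refine mul_le_of_le_one_right' ?_
      rw [← ofReal_norm]
      exact ENNReal.ofReal_le_one.2 (hb ξ))
  exact ⟨g, _, _, H, hg⟩

/-- A bounded measurable multiplier. -/
theorem exists_isMultiplier_of_bounded (hf : IsMeas f) (hm : AEStronglyMeasurable m (tv f))
    (hb : ∀ ξ, ‖m ξ‖ₑ ≤ 1) : ∃ g, IsMultiplier m f g := by
  obtain ⟨N, hN⟩ := hf.hasTemperateGrowth_tv
  refine exists_isMultiplier hf hm (N := N) (lt_of_le_of_lt (lintegral_mono fun ξ => ?_) hN.2)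
  rw [Real.enorm_eq_ofReal (by positivity)]
  exact mul_le_of_le_one_left' (hb ξ)

/-! ### Products -/

/-- The convolution of the total variations of `f̂` and `ĝ`. -/
def convMeas (f g : TDist n) : Measure (Rn n) :=
  ((tv f).prod (tv g)).map fun z => z.1 + z.2

theorem IsFourierDensity.sigmaFinite (H : IsFourierDensity f ν h) : SigmaFinite ν :=
  have := H.locallyFinite
  inferInstance

theorem aestronglyMeasurable_prod_density (H : IsFourierDensity f ν h) (G : IsFourierDensity g ν' h')
    (ψ : 𝓢(Rn n, ℂ)) :
    AEStronglyMeasurable (fun z : Rn n × Rn n => ψ (z.1 + z.2) * (h z.1 * h' z.2)) (ν.prod ν') := by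
  have := H.sigmaFinite
  have := G.sigmaFinite
  refine AEStronglyMeasurable.mul ?_ (AEStronglyMeasurable.mul
    H.locallyIntegrable.aestronglyMeasurable.comp_fst
    G.locallyIntegrable.aestronglyMeasurable.comp_snd)
  exact (ψ.continuous.comp (continuous_fst.add continuous_snd)).aestronglyMeasurable

/-- The analogue for products. The change of density is made in one variable at a time, after
Tonelli's theorem for the absolute convergence and Fubini's for the value. -/
theorem IsProduct.density (hw : IsProduct f g w) (H : IsFourierDensity f ν h)
    (G : IsFourierDensity g ν' h') (ψ : 𝓢(Rn n, ℂ)) :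
    Integrable (fun z : Rn n × Rn n => ψ (z.1 + z.2) * (h z.1 * h' z.2)) (ν.prod ν') ∧
      fourierDist w ψ = (((2 * Real.pi) ^ n)⁻¹ : ℝ) *
        ∫ z : Rn n × Rn n, ψ (z.1 + z.2) * (h z.1 * h' z.2) ∂(ν.prod ν') := by
  obtain ⟨ν₁, h₁, ν₂, h₂, H₁, G₂, hψ⟩ := hw
  obtain ⟨hi, he⟩ := hψ ψ
  have := H.sigmaFinite
  have := G.sigmaFinite
  have := H₁.sigmaFinite
  have := G₂.sigmaFinite
  have hm := aestronglyMeasurable_prod_density H G ψ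
  have hS := H₁.sameDensity H
  have hS' := G₂.sameDensity G
  have hint : Integrable (fun z : Rn n × Rn n => ψ (z.1 + z.2) * (h z.1 * h' z.2))
      (ν.prod ν') := by
    refine ⟨hm, ?_⟩
    have hfin := hi.hasFiniteIntegral
    rw [HasFiniteIntegral, lintegral_prod _ hi.aestronglyMeasurable.enorm] at hfin
    rw [HasFiniteIntegral, lintegral_prod _ hm.enorm]
    refine lt_of_eq_of_lt ?_ hfin
    have e : ∀ (k k' : Rn n → ℂ) (σ : Measure (Rn n)) (x : Rn n),
        (∀ y, ‖k' y‖ₑ ≠ ∞) →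
        ∫⁻ y, ‖ψ (x + y) * (k x * k' y)‖ₑ ∂σ = (∫⁻ y, ‖ψ (x + y)‖ₑ * ‖k' y‖ₑ ∂σ) * ‖k x‖ₑ := by
      intro k k' σ x _
      rw [← lintegral_mul_const' _ _ enorm_ne_top]
      refine lintegral_congr fun y => ?_
      rw [enorm_mul, enorm_mul]
      ring
    simp only [e h h' ν' _ fun _ => enorm_ne_top, e h₁ h₂ ν₂ _ fun _ => enorm_ne_top]
    rw [hS.lintegral_eq fun x => ∫⁻ y, ‖ψ (x + y)‖ₑ * ‖h₂ y‖ₑ ∂ν₂]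
    refine lintegral_congr fun x => ?_
    rw [hS'.lintegral_eq fun y => ‖ψ (x + y)‖ₑ]
  refine ⟨hint, ?_⟩
  rw [he, integral_prod _ hi, integral_prod _ hint]
  congr 1
  have e : ∀ (k k' : Rn n → ℂ) (σ : Measure (Rn n)) (x : Rn n),
      ∫ y, ψ (x + y) * (k x * k' y) ∂σ = (∫ y, ψ (x + y) * k' y ∂σ) * k x := by
    intro k k' σ x
    rw [← integral_mul_const]
    refine integral_congr_ae (.of_forall fun y => ?_)
    simp only
    ring
  simp only [e]
  rw [hS.integral_eq fun x => ∫ y, ψ (x + y) * h₂ y ∂ν₂]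
  refine integral_congr_ae (.of_forall fun x => ?_)
  simp only
  rw [hS'.integral_eq fun y => ψ (x + y)]

theorem IsProduct.isMeas_left (hw : IsProduct f g w) : IsMeas f :=
  let ⟨ν, h, _, _, H, _⟩ := hw; ⟨ν, h, H⟩

theorem IsProduct.isMeas_right (hw : IsProduct f g w) : IsMeas g :=
  let ⟨_, _, ν, h, _, H, _⟩ := hw; ⟨ν, h, H⟩

theorem IsProduct.unique (hw : IsProduct f g w) (hw' : IsProduct f g w') : w = w' := by
  obtain ⟨ν, h, ν', h', H, G, hψ⟩ := hw
  apply fourierDist_injective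
  ext ψ
  rw [(hψ ψ).2, (hw'.density H G ψ).2]

theorem IsProduct.sub_left (hw : IsProduct f g w) (hw' : IsProduct f' g w') :
    IsProduct (f - f') g (w - w') := by
  obtain ⟨h, h', H, H'⟩ := exists_common_density hw.isMeas_left hw'.isMeas_left
  obtain ⟨ν, k, G⟩ := hw.isMeas_right
  refine ⟨_, _, _, _, H.sub H', G, fun ψ => ?_⟩
  obtain ⟨i1, e1⟩ := hw.density H G ψ
  obtain ⟨i2, e2⟩ := hw'.density H' G ψ
  simp only [sub_mul, mul_sub]
  refine ⟨i1.sub i2, ?_⟩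
  rw [integral_sub i1 i2, mul_sub, fourierDist_sub, tdist_sub_apply, e1, e2]

theorem IsProduct.sub_right (hw : IsProduct g f w) (hw' : IsProduct g f' w') :
    IsProduct g (f - f') (w - w') := by
  obtain ⟨h, h', H, H'⟩ := exists_common_density hw.isMeas_right hw'.isMeas_right
  obtain ⟨ν, k, G⟩ := hw.isMeas_left
  refine ⟨_, _, _, _, G, H.sub H', fun ψ => ?_⟩
  obtain ⟨i1, e1⟩ := hw.density G H ψ
  obtain ⟨i2, e2⟩ := hw'.density G H' ψ
  simp only [mul_sub]
  refine ⟨i1.sub i2, ?_⟩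
  rw [integral_sub i1 i2, mul_sub, fourierDist_sub, tdist_sub_apply, e1, e2]

theorem IsMeas.sFinite_tv (hf : IsMeas f) : SFinite (tv f) := by
  obtain ⟨h, -, -, H⟩ := hf.exists_density
  have := H.sigmaFinite
  infer_instance

theorem lintegral_convMeas (f : TDist n) (hg : IsMeas g) {G : Rn n → ℝ≥0∞} (hG : Measurable G) :
    ∫⁻ ξ, G ξ ∂(convMeas f g) = ∫⁻ x, ∫⁻ y, G (x + y) ∂(tv g) ∂(tv f) := by
  have := hg.sFinite_tv
  have hm : Measurable fun z : Rn n × Rn n => z.1 + z.2 := measurable_fst.add measurable_snd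
  rw [convMeas, lintegral_map hG hm,
    lintegral_prod (fun z : Rn n × Rn n => G (z.1 + z.2)) (hG.comp hm).aemeasurable]

theorem two_pi_pow_inv_le_one (n : ℕ) : ((2 * Real.pi) ^ n)⁻¹ ≤ 1 := by
  apply inv_le_one_of_one_le₀
  apply one_le_pow₀
  linarith [Real.pi_gt_three]

theorem enorm_two_pi_mul_integral_le (f g : TDist n)
    (hb : ∀ ξ, ‖h ξ‖ ≤ 1) (hb' : ∀ ξ, ‖h' ξ‖ ≤ 1) (ψ : 𝓢(Rn n, ℂ)) :
    ‖((((2 * Real.pi) ^ n)⁻¹ : ℝ) : ℂ) *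
      ∫ z : Rn n × Rn n, ψ (z.1 + z.2) * (h z.1 * h' z.2) ∂((tv f).prod (tv g))‖ₑ ≤
        ∫⁻ ξ, ‖ψ ξ‖ₑ ∂(convMeas f g) := by
  have hm : Measurable fun z : Rn n × Rn n => z.1 + z.2 := measurable_fst.add measurable_snd
  have e1 : ∀ (k : Rn n → ℂ), (∀ ξ, ‖k ξ‖ ≤ 1) → ∀ ξ, ‖k ξ‖ₑ ≤ 1 := fun k hk ξ => by
    rw [← ofReal_norm]
    exact ENNReal.ofReal_le_one.2 (hk ξ)
  rw [enorm_mul, convMeas, lintegral_map ψ.continuous.measurable.enorm hm]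
  refine (mul_le_of_le_one_left' ?_).trans ((enorm_integral_le_lintegral_enorm _).trans
    (lintegral_mono fun z => ?_))
  · rw [← ofReal_norm, Complex.norm_real, Real.norm_of_nonneg (by positivity)]
    exact ENNReal.ofReal_le_one.2 (two_pi_pow_inv_le_one n)
  · rw [enorm_mul, enorm_mul]
    exact mul_le_of_le_one_right' (mul_le_one' (e1 h hb _) (e1 h' hb' _))

theorem IsProduct.dominated (hw : IsProduct f g w) : Dominated (fourierDist w) (convMeas f g) := by
  obtain ⟨h, -, hb, H⟩ := hw.isMeas_left.exists_density
  obtain ⟨h', -, hb', G⟩ := hw.isMeas_right.exists_density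
  intro ψ
  rw [(hw.density H G ψ).2]
  exact enorm_two_pi_mul_integral_le f g hb hb' ψ

theorem exists_isProduct (hf : IsMeas f) (hg : IsMeas g)
    (hκ : (convMeas f g).HasTemperateGrowth) : ∃ w, IsProduct f g w := by
  obtain ⟨h, -, hb, H⟩ := hf.exists_density
  obtain ⟨h', -, hb', G⟩ := hg.exists_density
  have e1 : ∀ (k : Rn n → ℂ), (∀ ξ, ‖k ξ‖ ≤ 1) → ∀ ξ, ‖k ξ‖ₑ ≤ 1 := fun k hk ξ => by
    rw [← ofReal_norm]
    exact ENNReal.ofReal_le_one.2 (hk ξ)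
  have hm : Measurable fun z : Rn n × Rn n => z.1 + z.2 := measurable_fst.add measurable_snd
  have hi : ∀ ψ : 𝓢(Rn n, ℂ), Integrable
      (fun z : Rn n × Rn n => ψ (z.1 + z.2) * (h z.1 * h' z.2)) ((tv f).prod (tv g)) := by
    intro ψ
    refine ⟨aestronglyMeasurable_prod_density H G ψ, ?_⟩
    have h1 : ∫⁻ ξ, ‖ψ ξ‖ₑ ∂(convMeas f g) < ∞ :=
      (ψ.integrable (μ := convMeas f g)).hasFiniteIntegral
    rw [convMeas, lintegral_map ψ.continuous.measurable.enorm hm] at h1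
    refine lt_of_le_of_lt (lintegral_mono fun z => ?_) h1
    rw [enorm_mul, enorm_mul]
    exact mul_le_of_le_one_right' (mul_le_one' (e1 h hb _) (e1 h' hb' _))
  obtain ⟨T, hT⟩ := exists_tdist_of_dominated (convMeas f g)
    { toFun := fun ψ => ((((2 * Real.pi) ^ n)⁻¹ : ℝ) : ℂ) *
        ∫ z : Rn n × Rn n, ψ (z.1 + z.2) * (h z.1 * h' z.2) ∂((tv f).prod (tv g))
      map_add' := fun ψ χ => by
        rw [← mul_add, ← integral_add (hi ψ) (hi χ)]
        simp only [add_apply, add_mul]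
      map_smul' := fun c ψ => by
        have e : ∫ z : Rn n × Rn n, (c • ψ) (z.1 + z.2) * (h z.1 * h' z.2) ∂((tv f).prod (tv g)) =
            c * ∫ z : Rn n × Rn n, ψ (z.1 + z.2) * (h z.1 * h' z.2) ∂((tv f).prod (tv g)) := by
          rw [← integral_const_mul]
          simp only [smul_apply, smul_eq_mul, mul_assoc]
        rw [e, RingHom.id_apply, smul_eq_mul, mul_left_comm] }
    (enorm_two_pi_mul_integral_le f g hb hb')
  refine ⟨invFourierDist T, _, _, _, _, H, G, fun ψ => ⟨hi ψ, ?_⟩⟩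
  rw [fourierDist_invFourierDist, hT]
  rfl

end

/-! ### Dyadic bounds for weighted convolutions -/

section

variable {n : ℕ} {φ : 𝓢(Rn n, ℂ)} {s : ℝ} {p : ℝ≥0∞} {μ : ℝ}

theorem measurable_ofReal_norm_rpow (r : ℝ) : Measurable fun x : Rn n => ENNReal.ofReal (‖x‖ ^ r) :=
  (measurable_norm.pow_const r).ennreal_ofReal

/-- A dyadic bound for a weighted convolution, which splits the domain according to which of the two
variables is larger. -/
theorem exists_lintegral_conv_le (hφ : IsLittlewoodPaley φ) (hp : 1 ≤ p) {r : ℝ}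
    (hs : s < massExp n p μ) (hr : 0 < massExp n p μ - s + r) :
    ∃ C : ℝ≥0∞, C ≠ ∞ ∧ ∀ (ν₁ ν₂ : Measure (Rn n)) [SFinite ν₁] [SFinite ν₂], ν₁ {0} = 0 →
      ν₂ {0} = 0 → ∀ (G : Rn n → ℝ≥0∞), Measurable G → ∀ S : ℤ → ℝ≥0∞,
      (∀ (j : ℤ) (x : Rn n), ‖x‖ ≤ (2 : ℝ) ^ ((j : ℝ) + 1) →
        ∫⁻ y in annulus n j, G (x + y) ∂ν₁ ≤ S j * fnMeas φ s p μ ν₁) →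
      (∀ (j : ℤ) (x : Rn n), ‖x‖ ≤ (2 : ℝ) ^ ((j : ℝ) + 1) →
        ∫⁻ y in annulus n j, G (x + y) ∂ν₂ ≤ S j * fnMeas φ s p μ ν₂) →
      ∫⁻ x, ENNReal.ofReal (‖x‖ ^ r) * ∫⁻ y, G (x + y) ∂ν₂ ∂ν₁ ≤
        C * (∑' j : ℤ, pw (j * (massExp n p μ - s + r)) * S j) *
          (fnMeas φ s p μ ν₁ * fnMeas φ s p μ ν₂) := by
  obtain ⟨C₁, hC₁, h₁⟩ := exists_lintegral_rpow_ball_le (μ := μ) hφ hp hr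
  obtain ⟨C₂, hC₂, h₂⟩ := exists_lintegral_rpow_ball_le (μ := μ) (r := 0) hφ hp (s := s)
    (by linarith)
  set d := massExp n p μ - s with hd
  refine ⟨C₁ * pw (d + r) + pw |r| * C₂ * pw d, ENNReal.add_ne_top.2
    ⟨ENNReal.mul_ne_top hC₁ (pw_ne_top _), ENNReal.mul_ne_top (ENNReal.mul_ne_top (pw_ne_top _) hC₂)
      (pw_ne_top _)⟩, fun ν₁ ν₂ _ _ h01 h02 G hG S hS₁ hS₂ => ?_⟩
  set N₁ := fnMeas φ s p μ ν₁
  set N₂ := fnMeas φ s p μ ν₂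
  have hGm : Measurable fun z : Rn n × Rn n => G (z.1 + z.2) :=
    hG.comp (measurable_fst.add measurable_snd)
  have hB : ∀ i : ℤ, MeasurableSet {ξ : Rn n | ‖ξ‖ < (2 : ℝ) ^ (i : ℝ)} := fun i =>
    measurableSet_lt measurable_norm measurable_const
  have hlow : MeasurableSet {z : Rn n × Rn n | ‖z.1‖ ≤ ‖z.2‖} :=
    measurableSet_le measurable_fst.norm measurable_snd.norm
  -- `T₁` collects the region `‖x‖ ≤ ‖y‖`, `T₂` its complement.
  set T₁ : Rn n → ℝ≥0∞ := fun x =>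
    ∫⁻ y, {z : Rn n × Rn n | ‖z.1‖ ≤ ‖z.2‖}.indicator (fun z => G (z.1 + z.2)) (x, y) ∂ν₂
  set T₂ : Rn n → ℝ≥0∞ := fun x =>
    ∫⁻ y, {z : Rn n × Rn n | ‖z.1‖ ≤ ‖z.2‖}ᶜ.indicator (fun z => G (z.1 + z.2)) (x, y) ∂ν₂
  have hT₁ : Measurable T₁ := (hGm.indicator hlow).lintegral_prod_right'
  have hsplit : ∀ x, ∫⁻ y, G (x + y) ∂ν₂ = T₁ x + T₂ x := by
    intro x
    have hx : Measurable fun y : Rn n => (x, y) := measurable_prodMk_left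
    refine Eq.trans ?_ (lintegral_add_left ((hGm.indicator hlow).comp hx) _)
    refine lintegral_congr fun y => ?_
    have := congrFun (Set.indicator_self_add_compl {z : Rn n × Rn n | ‖z.1‖ ≤ ‖z.2‖}
      (fun z => G (z.1 + z.2))) (x, y)
    exact this.symm
  have hwm := measurable_ofReal_norm_rpow (n := n) r
  -- If `y` is the larger variable and lies in the annulus `j`, then `‖x‖ < 2^{j+1}`. The hypothesis
  -- bounds the integral in `y`, and the weighted mass of a ball bounds the one in `x`.
  have hpart₁ : ∫⁻ x, ENNReal.ofReal (‖x‖ ^ r) * T₁ x ∂ν₁ ≤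
      C₁ * pw (d + r) * (∑' j : ℤ, pw (j * (d + r)) * S j) * (N₁ * N₂) := by
    have hb : ∀ x, ENNReal.ofReal (‖x‖ ^ r) * T₁ x ≤ ∑' j : ℤ, (S j * N₂) *
        {ξ : Rn n | ‖ξ‖ < (2 : ℝ) ^ ((j + 1 : ℤ) : ℝ)}.indicator
          (fun ξ => ENNReal.ofReal (‖ξ‖ ^ r)) x := by
      intro x
      have h1 : T₁ x ≤ ∑' j : ℤ, (S j * N₂) *
          {ξ : Rn n | ‖ξ‖ < (2 : ℝ) ^ ((j + 1 : ℤ) : ℝ)}.indicator 1 x := by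
        change ∫⁻ y, _ ∂ν₂ ≤ _
        rw [lintegral_eq_tsum_annulus h02]
        refine ENNReal.tsum_le_tsum fun j => ?_
        by_cases hx : ‖x‖ < (2 : ℝ) ^ ((j + 1 : ℤ) : ℝ)
        · have hx' : x ∈ {ξ : Rn n | ‖ξ‖ < (2 : ℝ) ^ ((j + 1 : ℤ) : ℝ)} := hx
          rw [Set.indicator_of_mem hx', Pi.one_apply, mul_one]
          refine (lintegral_mono fun y => Set.indicator_le_self' (fun _ _ => zero_le) _).trans ?_
          refine hS₂ j x ?_
          push_cast at hx
          exact hx.le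
        · refine le_trans (le_of_eq ?_) zero_le
          rw [setLIntegral_congr_fun (g := fun _ => 0) (measurableSet_annulus j), lintegral_zero]
          intro y hy
          have hxy : (x, y) ∉ {z : Rn n × Rn n | ‖z.1‖ ≤ ‖z.2‖} := fun hxy => by
            have h1 : ‖x‖ ≤ ‖y‖ := hxy
            refine hx (h1.trans_lt ?_)
            push_cast
            exact hy.2
          exact Set.indicator_of_notMem hxy _
      refine (mul_le_mul_right h1 _).trans (le_of_eq ?_)
      rw [← ENNReal.tsum_mul_left]
      refine tsum_congr fun j => ?_
      by_cases hx : x ∈ {ξ : Rn n | ‖ξ‖ < (2 : ℝ) ^ ((j + 1 : ℤ) : ℝ)}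
      · rw [Set.indicator_of_mem hx, Set.indicator_of_mem hx, Pi.one_apply]
        ring
      · rw [Set.indicator_of_notMem hx, Set.indicator_of_notMem hx]
        ring
    calc _ ≤ ∑' j : ℤ, (S j * N₂) * ∫⁻ ξ in {ξ : Rn n | ‖ξ‖ < (2 : ℝ) ^ ((j + 1 : ℤ) : ℝ)},
          ENNReal.ofReal (‖ξ‖ ^ r) ∂ν₁ := by
          refine (lintegral_mono hb).trans (le_of_eq ?_)
          rw [lintegral_tsum fun j => ((hwm.indicator (hB _)).const_mul _).aemeasurable]
          refine tsum_congr fun j => ?_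
          rw [lintegral_const_mul _ (hwm.indicator (hB _)), lintegral_indicator (hB _)]
      _ ≤ ∑' j : ℤ, (S j * N₂) * (C₁ * pw ((j + 1 : ℤ) * (d + r)) * N₁) := by
          refine ENNReal.tsum_le_tsum fun j => ?_
          gcongr
          exact h₁ ν₁ h01 (j + 1)
      _ = ∑' j : ℤ, C₁ * pw (d + r) * (N₁ * N₂) * (pw (j * (d + r)) * S j) := by
          refine tsum_congr fun j => ?_
          rw [show (((j + 1 : ℤ) : ℝ)) * (d + r) = (d + r) + j * (d + r) by push_cast; ring, pw_add]
          ring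
      _ = _ := by rw [ENNReal.tsum_mul_left]; ring
  -- If `x` is larger, the weight is `2^{ir}` up to a constant on the annulus `i`. After exchanging
  -- the integrals only the unweighted mass of a ball in `y` is needed.
  have hpart₂ : ∫⁻ x, ENNReal.ofReal (‖x‖ ^ r) * T₂ x ∂ν₁ ≤
      pw |r| * C₂ * pw d * (∑' j : ℤ, pw (j * (d + r)) * S j) * (N₁ * N₂) := by
    rw [lintegral_eq_tsum_annulus h01]
    calc _ ≤ ∑' i : ℤ, pw |r| * pw (i * r) * ∫⁻ x in annulus n i,
          ∫⁻ y in {ξ : Rn n | ‖ξ‖ < (2 : ℝ) ^ ((i + 1 : ℤ) : ℝ)}, G (x + y) ∂ν₂ ∂ν₁ := by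
          refine ENNReal.tsum_le_tsum fun i => ?_
          have hm : Measurable fun x : Rn n =>
              ∫⁻ y in {ξ : Rn n | ‖ξ‖ < (2 : ℝ) ^ ((i + 1 : ℤ) : ℝ)}, G (x + y) ∂ν₂ :=
            hGm.lintegral_prod_right'
          rw [← lintegral_const_mul _ hm]
          refine setLIntegral_mono' (measurableSet_annulus i) fun x hx => ?_
          refine mul_le_mul' (rpow_norm_le_of_mem_annulus hx r) ?_
          rw [← lintegral_indicator (hB _)]
          refine lintegral_mono fun y => ?_
          by_cases hxy : ‖x‖ ≤ ‖y‖
          · rw [Set.indicator_of_notMem (by simpa using hxy)]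
            exact zero_le
          · rw [Set.indicator_of_mem (by simpa using hxy), Set.indicator_of_mem]
            have := hx.2
            simp only [Set.mem_ofPred_eq]
            push_cast
            linarith
      _ ≤ ∑' i : ℤ, pw |r| * pw (i * r) * (S i * N₁ * (C₂ * pw ((i + 1 : ℤ) * d) * N₂)) := by
          refine ENNReal.tsum_le_tsum fun i => ?_
          refine mul_le_mul' le_rfl ?_
          rw [lintegral_lintegral_swap (f := fun x y => G (x + y)) hGm.aemeasurable]
          calc _ ≤ ∫⁻ y in {ξ : Rn n | ‖ξ‖ < (2 : ℝ) ^ ((i + 1 : ℤ) : ℝ)}, S i * N₁ ∂ν₂ := by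
                refine setLIntegral_mono' (hB _) fun y hy => ?_
                have h3 := hS₁ i y (by
                  have : ‖y‖ < (2 : ℝ) ^ ((i + 1 : ℤ) : ℝ) := hy
                  push_cast at this
                  exact this.le)
                simpa only [add_comm y] using h3
            _ ≤ _ := by
                rw [setLIntegral_const]
                gcongr
                have h4 := h₂ ν₂ h02 (i + 1)
                simpa only [Real.rpow_zero, ENNReal.ofReal_one, setLIntegral_const, one_mul,
                  add_zero] using h4
      _ = ∑' i : ℤ, pw |r| * C₂ * pw d * (N₁ * N₂) * (pw (i * (d + r)) * S i) := by
          refine tsum_congr fun i => ?_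
          rw [show (((i + 1 : ℤ) : ℝ)) * d = d + i * d by push_cast; ring, pw_add, mul_add, pw_add]
          ring
      _ = _ := by rw [ENNReal.tsum_mul_left]; ring
  have hsum : ∫⁻ x, ENNReal.ofReal (‖x‖ ^ r) * ∫⁻ y, G (x + y) ∂ν₂ ∂ν₁ =
      ∫⁻ x, ENNReal.ofReal (‖x‖ ^ r) * T₁ x ∂ν₁ + ∫⁻ x, ENNReal.ofReal (‖x‖ ^ r) * T₂ x ∂ν₁ := by
    refine Eq.trans ?_ (lintegral_add_left (hwm.mul hT₁) _)
    refine lintegral_congr fun x => ?_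
    rw [hsplit, mul_add]
    rfl
  rw [hsum]
  refine (add_le_add hpart₁ hpart₂).trans (le_of_eq ?_)
  ring

/-- If `φ_k (x + y) ≠ 0` and both variables are at most `2^{j+1}`, then `j ≥ k - 2`. The translated
test function costs `2^{-js}` on the annulus `j`, and by `hsr` the geometric series over `j ≥ k - 2`
is governed by its first term. -/
theorem exists_lintegral_conv_dyadic_le (hφ : IsLittlewoodPaley φ) (hp : 1 ≤ p) {r : ℝ}
    (hs : s < massExp n p μ) (hr : 0 < massExp n p μ - s + r)
    (hsr : 0 < s - (massExp n p μ - s + r)) :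
    ∃ C : ℝ≥0∞, C ≠ ∞ ∧ ∀ (ν₁ ν₂ : Measure (Rn n)) [SFinite ν₁] [SFinite ν₂], ν₁ {0} = 0 →
      ν₂ {0} = 0 → ∀ (k : ℤ) (g : Rn n → ℝ≥0∞), IsMorreyTest p μ g →
      ∫⁻ x, ENNReal.ofReal (‖x‖ ^ r) * ∫⁻ y, ‖dyadic φ k (x + y)‖ₑ * g (x + y) ∂ν₂ ∂ν₁ ≤
        C * pw (-(k * (s - (massExp n p μ - s + r)))) *
          (fnMeas φ s p μ ν₁ * fnMeas φ s p μ ν₂) := by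
  obtain ⟨C, hC, h⟩ := exists_lintegral_conv_le (μ := μ) hφ hp hs hr
  obtain ⟨D, hD, hd⟩ := exists_setLIntegral_annulus_le (p := p) (μ := μ) hφ s
  obtain ⟨E, hE, he⟩ := exists_enorm_dyadic_le φ
  obtain ⟨F, hF, hf⟩ := exists_tsum_pw_le_of_le hsr
  set e := massExp n p μ - s + r with he'
  refine ⟨C * (E * D * (F * pw (2 * (s - e)))), by
    exact ENNReal.mul_ne_top hC (ENNReal.mul_ne_top (ENNReal.mul_ne_top hE hD)
      (ENNReal.mul_ne_top hF (pw_ne_top _))), fun ν₁ ν₂ _ _ h01 h02 k g hg => ?_⟩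
  have key : ∀ (ν : Measure (Rn n)) (j : ℤ) (x : Rn n), ‖x‖ ≤ (2 : ℝ) ^ ((j : ℝ) + 1) →
      ∫⁻ y in annulus n j, ‖dyadic φ k (x + y)‖ₑ * g (x + y) ∂ν ≤
        (if k - 2 ≤ j then E * D * pw (-(j * s)) else 0) * fnMeas φ s p μ ν := by
    intro ν j x hx
    split_ifs with hj
    · have hg' : IsMorreyTest p μ fun y => g (x + y) := by
        simpa only [add_comm x] using hg.comp_add x
      calc _ ≤ ∫⁻ y in annulus n j, E * g (x + y) ∂ν := by
            refine lintegral_mono fun y => ?_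
            gcongr
            exact he k _
        _ ≤ E * (D * pw (-(j * s)) * fnMeas φ s p μ ν) := by
            rw [lintegral_const_mul _ hg'.measurable]
            gcongr
            exact hd ν j _ hg'
        _ = _ := by ring
    · rw [zero_mul, setLIntegral_congr_fun (g := fun _ => 0) (measurableSet_annulus j),
        lintegral_zero]
      intro y hy
      have : dyadic φ k (x + y) = 0 := by
        by_contra hne
        have h1 := (hφ.dyadic_support hne).1
        have h2 : ‖x + y‖ < (2 : ℝ) ^ ((j : ℝ) + 1) + (2 : ℝ) ^ ((j : ℝ) + 1) :=
          (norm_add_le x y).trans_lt (add_lt_add_of_le_of_lt hx hy.2)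
        have h3 : (2 : ℝ) ^ (k : ℝ) < (2 : ℝ) ^ ((j : ℝ) + 3) := by
          rw [Real.rpow_add two_pos] at h2 ⊢
          have h4 : (0 : ℝ) < 2 ^ (j : ℝ) := by positivity
          rw [Real.rpow_one] at h2
          rw [show (2 : ℝ) ^ (3 : ℝ) = 8 by norm_num]
          linarith
        have h5 := rpow_two_lt_iff.1 h3
        have h6 : k < j + 3 := by exact_mod_cast h5
        omega
      simp only [this, enorm_zero, zero_mul]
  have hGm : Measurable fun ξ => ‖dyadic φ k ξ‖ₑ * g ξ :=
    (measurable_enorm_dyadic φ k).mul hg.measurable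
  refine (h ν₁ ν₂ h01 h02 _ hGm _ (key ν₁) (key ν₂)).trans ?_
  refine mul_le_mul' ?_ le_rfl
  rw [mul_assoc]
  refine mul_le_mul' le_rfl ?_
  calc _ = ∑' j : ℤ, E * D * (if k - 2 ≤ j then pw (-(j * (s - e))) else 0) := by
        refine tsum_congr fun j => ?_
        split_ifs
        · rw [show -((j : ℝ) * (s - e)) = j * e + -(j * s) by ring, pw_add]
          ring
        · simp
    _ ≤ E * D * (F * pw (-((k - 2 : ℤ) * (s - e)))) := by
        rw [ENNReal.tsum_mul_left]
        gcongr
        exact hf (k - 2)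
    _ = _ := by
        rw [show -(((k - 2 : ℤ) : ℝ) * (s - e)) = 2 * (s - e) + -(k * (s - e)) by push_cast; ring,
          pw_add]
        ring

/-- The dyadic norm does not see the atom that a convolution may have at the origin, so its size is
bounded separately. For `j ≥ 0` the point `-x` is enclosed in a unit ball, of mass at most of order
`2^{-js}` in the annulus; for `j ≤ 0` the mass of the whole annulus is small enough. -/
theorem exists_lintegral_conv_origin_le (hφ : IsLittlewoodPaley φ) (hp : 1 ≤ p) {r : ℝ}
    (hs : s < massExp n p μ) (hr : 0 < massExp n p μ - s + r)
    (hsr : 0 < s - (massExp n p μ - s + r)) :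
    ∃ C : ℝ≥0∞, C ≠ ∞ ∧ ∀ (ν₁ ν₂ : Measure (Rn n)) [SFinite ν₁] [SFinite ν₂], ν₁ {0} = 0 →
      ν₂ {0} = 0 →
      ∫⁻ x, ENNReal.ofReal (‖x‖ ^ r) * ∫⁻ y, ({0} : Set (Rn n)).indicator 1 (x + y) ∂ν₂ ∂ν₁ ≤
        C * (fnMeas φ s p μ ν₁ * fnMeas φ s p μ ν₂) := by
  obtain ⟨C, hC, h⟩ := exists_lintegral_conv_le (μ := μ) hφ hp hs hr
  obtain ⟨D, hD, hd⟩ := exists_setLIntegral_annulus_le (p := p) (μ := μ) hφ s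
  obtain ⟨A, hA, ha⟩ := exists_measure_annulus_le hφ hp s μ
  obtain ⟨B, hB, hb⟩ := exists_measure_ball_le_morrey n hp μ
  obtain ⟨F, hF, hf⟩ := exists_tsum_pw_le_of_le hsr
  set d := massExp n p μ - s with hd'
  set e := d + r with he'
  have hde : 0 < e + d := by linarith
  obtain ⟨F', hF', hf'⟩ := exists_tsum_pw_le_of_ge hde
  refine ⟨C * (ENNReal.ofReal B * D * (F * 1) + A * (F' * 1)), ENNReal.mul_ne_top hC
    (ENNReal.add_ne_top.2 ⟨ENNReal.mul_ne_top (ENNReal.mul_ne_top ENNReal.ofReal_ne_top hD)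
      (ENNReal.mul_ne_top hF ENNReal.one_ne_top), ENNReal.mul_ne_top hA
      (ENNReal.mul_ne_top hF' ENNReal.one_ne_top)⟩), fun ν₁ ν₂ _ _ h01 h02 => ?_⟩
  have key : ∀ (ν : Measure (Rn n)) (j : ℤ) (x : Rn n), ‖x‖ ≤ (2 : ℝ) ^ ((j : ℝ) + 1) →
      ∫⁻ y in annulus n j, ({0} : Set (Rn n)).indicator 1 (x + y) ∂ν ≤
        ((if 0 ≤ j then ENNReal.ofReal B * D * pw (-(j * s)) else 0) +
          (if j ≤ 0 then A * pw (j * d) else 0)) * fnMeas φ s p μ ν := by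
    intro ν j x _
    rw [add_mul]
    rcases le_total 0 j with hj | hj
    · refine le_add_right ?_
      rw [if_pos hj]
      calc _ ≤ ∫⁻ y in annulus n j, (Metric.ball (-x) 1).indicator 1 y ∂ν := by
            refine lintegral_mono fun y => ?_
            by_cases hy : x + y = 0
            · have : y ∈ Metric.ball (-x) 1 := by
                rw [show y = -x by rw [← add_eq_zero_iff_eq_neg, add_comm, hy]]
                exact Metric.mem_ball_self one_pos
              rw [Set.indicator_of_mem this]
              exact Set.indicator_apply_le' (fun _ => le_rfl) (fun _ => zero_le)
            · rw [Set.indicator_of_notMem (by simpa using hy)]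
              exact zero_le
        _ = (ν.restrict (annulus n j)) (Metric.ball (-x) 1) := lintegral_indicator_one measurableSet_ball
        _ ≤ ENNReal.ofReal B * (D * pw (-(j * s)) * fnMeas φ s p μ ν) := by
            refine (hb _ (-x) 1 one_pos).trans ?_
            rw [Real.one_rpow, mul_one]
            gcongr
            exact morrey_restrict_le (hd ν j)
        _ = _ := by ring
    · refine le_add_left ?_
      rw [if_pos hj]
      refine le_trans ?_ (ha ν j)
      rw [← setLIntegral_one]
      exact lintegral_mono fun y => Set.indicator_le_self' (fun _ _ => zero_le) _
  refine (h ν₁ ν₂ h01 h02 _ (measurable_one.indicator (measurableSet_singleton 0)) _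
    (key ν₁) (key ν₂)).trans ?_
  gcongr
  calc _ = ∑' j : ℤ, (ENNReal.ofReal B * D * (if 0 ≤ j then pw (-(j * (s - e))) else 0) +
        A * (if j ≤ 0 then pw (j * (e + d)) else 0)) := by
        refine tsum_congr fun j => ?_
        have e1 : pw (-((j : ℝ) * (s - e))) = pw (j * e) * pw (-(j * s)) := by
          rw [← pw_add]
          congr 1
          ring
        have e2 : pw ((j : ℝ) * (e + d)) = pw (j * e) * pw (j * d) := by rw [mul_add, pw_add]
        rw [e1, e2]
        split_ifs <;> ring
    _ ≤ ENNReal.ofReal B * D * (F * 1) + A * (F' * 1) := by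
        rw [ENNReal.tsum_add, ENNReal.tsum_mul_left, ENNReal.tsum_mul_left]
        gcongr
        · simpa [pw_zero] using hf 0
        · simpa [pw_zero] using hf' 0

end

/-! ### The flux -/

section

/-- The relations between the parameters of the equation and of the function space. -/
structure IsAdmissibleParam (n : ℕ) (p : ℝ≥0∞) (μ γ β s : ℝ) : Prop where
  one_le : 1 ≤ p
  massExp_sub : massExp n p μ - s = 2 * γ - β
  lt_two_mul : β < 2 * γ
  one_lt_two_mul : 1 < 2 * γ
  two_mul_lt : 2 * γ - 1 < s

variable {n : ℕ} {φ : 𝓢(Rn n, ℂ)} {s : ℝ} {p : ℝ≥0∞} {μ γ β : ℝ}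
  {a : Fin n → Fin n → ℂ} {P : Fin n → Rn n → ℂ} {f f' g g' q q' : TDist n}

theorem IsAdmissibleParam.lt_massExp (h : IsAdmissibleParam n p μ γ β s) : s < massExp n p μ := by
  linarith [h.massExp_sub, h.lt_two_mul]

theorem IsAdmissibleParam.sub_lt_massExp (h : IsAdmissibleParam n p μ γ β s) :
    s - 2 * γ < massExp n p μ := by
  linarith [h.lt_massExp, h.one_lt_two_mul]

theorem ae_ne_zero_tv (f : TDist n) : ∀ᵐ ξ ∂(tv f), ξ ≠ 0 := by
  rw [ae_iff]
  simpa using tv_zero_singleton f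

theorem absolutelyContinuous_of_fnMeas_lt_top (hφ : IsLittlewoodPaley φ) (hp : 1 ≤ p) (h1 : p ≠ 1)
    {ν : Measure (Rn n)} (h0 : ν {0} = 0) (h : fnMeas φ s p μ ν < ∞) : ν ≪ volume := by
  obtain ⟨C, hC, hb⟩ := exists_setLIntegral_annulus_le (p := p) (μ := μ) hφ s
  rw [← sum_restrict_annulus h0]
  refine Measure.absolutelyContinuous_sum_left fun i => ?_
  refine absolutelyContinuous_of_morrey_lt_top (p := p) (μ := μ) hp h1 ?_
  refine (morrey_restrict_le fun g hg => hb ν i g hg).trans_lt ?_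
  exact ENNReal.mul_lt_top (ENNReal.mul_lt_top hC.lt_top (pw_ne_top _).lt_top) h

/-- For `p ≠ 1` a finite norm makes `tv f` absolutely continuous, so a symbol known almost
everywhere suffices. For `p = 1` the pointwise bound away from the origin is used, the origin being
a null set of `tv f`. -/
theorem IsAdmissibleSymbol.ae_tv (hφ : IsLittlewoodPaley φ) {P : Rn n → ℂ}
    (hP : IsAdmissibleSymbol p β P) (hp : 1 ≤ p) (hs : s < massExp n p μ) :
    ∃ C : ℝ, 0 ≤ C ∧ ∀ f, fnN φ s p μ f < ∞ → AEMeasurable P (tv f) ∧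
      ∀ᵐ ξ ∂(tv f), ‖P ξ‖ ≤ C * ‖ξ‖ ^ β := by
  by_cases h1 : p = 1
  · obtain ⟨C, hC⟩ := hP.bound_of_eq_one h1
    refine ⟨max C 0, le_max_right _ _, fun f _ =>
      ⟨(hP.borel_of_eq_one h1).aemeasurable, ?_⟩⟩
    filter_upwards [ae_ne_zero_tv f] with ξ hξ
    exact (hC ξ hξ).trans (by gcongr; exact le_max_left _ _)
  · obtain ⟨C, hC⟩ := hP.bound
    refine ⟨max C 0, le_max_right _ _, fun f hf => ?_⟩
    have hac : tv f ≪ volume := by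
      refine absolutelyContinuous_of_fnMeas_lt_top (s := s) (μ := μ) hφ hp h1 (tv_zero_singleton f) ?_
      rwa [← fnN_eq_fnMeas_tv hφ hp hs (isMeas_of_fnN_lt_top hφ hp hs hf)]
    refine ⟨hP.measurable.mono_ac hac, ?_⟩
    filter_upwards [hac.ae_le hC] with ξ hξ
    exact hξ.trans (by gcongr; exact le_max_left _ _)

theorem measurable_rieszSymbol (j : Fin n) : Measurable (rieszSymbol j) := by
  unfold rieszSymbol
  have h1 : Measurable fun ξ : Rn n => ξ j :=
    (EuclideanSpace.proj (𝕜 := ℝ) j).continuous.measurable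
  exact (((Complex.measurable_ofReal.comp h1).const_mul _).neg).div
    (Complex.measurable_ofReal.comp measurable_norm)

theorem norm_rieszSymbol_le (j : Fin n) (ξ : Rn n) : ‖rieszSymbol j ξ‖ ≤ 1 := by
  rw [rieszSymbol, norm_div, norm_neg, norm_mul, Complex.norm_I, one_mul, Complex.norm_real,
    Complex.norm_real, norm_norm]
  exact div_le_one_of_le₀ (PiLp.norm_apply_le ξ j) (norm_nonneg _)

theorem exists_velocitySymbol_le (hφ : IsLittlewoodPaley φ)
    (hP : ∀ j, IsAdmissibleSymbol p β (P j)) (a : Fin n → Fin n → ℂ) (hp : 1 ≤ p)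
    (hs : s < massExp n p μ) :
    ∃ C : ℝ≥0∞, C ≠ ∞ ∧ ∀ f, fnN φ s p μ f < ∞ → ∀ k,
      AEStronglyMeasurable (velocitySymbol a P k) (tv f) ∧
      ∀ᵐ ξ ∂(tv f), ‖velocitySymbol a P k ξ‖ₑ ≤ C * ENNReal.ofReal (‖ξ‖ ^ (β - 1)) := by
  choose C hC hCb using fun j => (hP j).ae_tv (s := s) (μ := μ) hφ hp hs
  refine ⟨ENNReal.ofReal (∑ k, ∑ j, ‖a j k‖ * C j), ENNReal.ofReal_ne_top, fun f hf k => ⟨?_, ?_⟩⟩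
  · refine AEMeasurable.aestronglyMeasurable ?_
    unfold velocitySymbol
    refine Finset.aemeasurable_fun_sum _ fun j _ => ?_
    refine AEMeasurable.mul (AEMeasurable.mul ?_ ?_) (hCb j f hf).1
    · exact ((measurable_rieszSymbol j).const_mul _).aemeasurable
    · exact (Complex.measurable_ofReal.comp measurable_norm).inv.aemeasurable
  · have hall := ae_all_iff.2 fun j => (hCb j f hf).2
    filter_upwards [hall, ae_ne_zero_tv f] with ξ hξ h0
    have hpos : 0 < ‖ξ‖ := norm_pos_iff.2 h0
    rw [← ofReal_norm, ← ENNReal.ofReal_mul (Finset.sum_nonneg fun k _ =>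
      Finset.sum_nonneg fun j _ => mul_nonneg (norm_nonneg _) (hC j))]
    apply ENNReal.ofReal_le_ofReal
    calc _ ≤ ∑ j, ‖a j k * rieszSymbol j ξ * (‖ξ‖ : ℂ)⁻¹ * P j ξ‖ := norm_sum_le _ _
      _ ≤ ∑ j, ‖a j k‖ * C j * ‖ξ‖ ^ (β - 1) := by
        refine Finset.sum_le_sum fun j _ => ?_
        rw [norm_mul, norm_mul, norm_mul, norm_inv, Complex.norm_real, norm_norm]
        calc _ ≤ ‖a j k‖ * 1 * ‖ξ‖⁻¹ * (C j * ‖ξ‖ ^ β) := by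
              gcongr
              · exact norm_rieszSymbol_le j ξ
              · exact hξ j
          _ = _ := by
              rw [Real.rpow_sub hpos, Real.rpow_one]
              field_simp
      _ ≤ _ := by
        rw [← Finset.sum_mul]
        refine mul_le_mul_of_nonneg_right ?_ (by positivity)
        exact Finset.single_le_sum (f := fun k => ∑ j, ‖a j k‖ * C j)
          (fun k _ => Finset.sum_nonneg fun j _ => mul_nonneg (norm_nonneg _) (hC j))
          (Finset.mem_univ k)

theorem exists_isMultiplier_velocitySymbol (hφ : IsLittlewoodPaley φ)
    (hA : IsAdmissibleParam n p μ γ β s) (hP : ∀ j, IsAdmissibleSymbol p β (P j))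
    (hf : fnN φ s p μ f < ∞) (k : Fin n) : ∃ u, IsMultiplier (velocitySymbol a P k) f u := by
  obtain ⟨C, hC, h⟩ := exists_velocitySymbol_le hφ hP a hA.one_le hA.lt_massExp
  obtain ⟨hm, hb⟩ := h f hf k
  obtain ⟨N, D, hD, hN⟩ := exists_lintegral_rpow_weight_le (μ := μ) (s := s) (r := β - 1) hφ
    hA.one_le (by linarith [hA.massExp_sub, hA.one_lt_two_mul])
  have hmeas := isMeas_of_fnN_lt_top hφ hA.one_le hA.lt_massExp hf
  have hwm : Measurable fun x : Rn n => ENNReal.ofReal ((1 + ‖x‖) ^ (-(N : ℝ))) := by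
    apply Measurable.ennreal_ofReal
    apply Continuous.measurable
    apply Continuous.rpow_const (by fun_prop)
    intro x; left; positivity
  refine exists_isMultiplier hmeas hm (N := N) ?_
  calc _ ≤ ∫⁻ ξ, C * (ENNReal.ofReal (‖ξ‖ ^ (β - 1)) *
        ENNReal.ofReal ((1 + ‖ξ‖) ^ (-(N : ℝ)))) ∂(tv f) := by
        refine lintegral_mono_ae ?_
        filter_upwards [hb] with ξ hξ
        rw [← mul_assoc]
        gcongr
    _ ≤ C * (D * fnMeas φ s p μ (tv f)) := by
        rw [lintegral_const_mul' _ _ hC]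
        gcongr
        exact hN _ (tv_zero_singleton f)
    _ < ∞ := by
        rw [← fnN_eq_fnMeas_tv hφ hA.one_le hA.lt_massExp hmeas]
        exact ENNReal.mul_lt_top hC.lt_top (ENNReal.mul_lt_top hD.lt_top hf)

theorem lineDeriv_sub (m : Rn n) (f g : TDist n) : ∂_{m} (f - g) = ∂_{m} f - ∂_{m} g := by
  rw [sub_eq_add_neg, LineDeriv.lineDerivOp_add, LineDeriv.lineDerivOp_neg, ← sub_eq_add_neg]

/-- `q = ∇ · (P[f] g)`. -/
def IsFlux (a : Fin n → Fin n → ℂ) (P : Fin n → Rn n → ℂ) (f g q : TDist n) : Prop :=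
  ∃ u w : Fin n → TDist n,
    (∀ k, IsMultiplier (velocitySymbol a P k) f (u k) ∧ IsProduct (u k) g (w k)) ∧
      q = ∑ k, ∂_{(EuclideanSpace.single k 1 : Rn n)} (w k)

theorem IsFlux.unique (h : IsFlux a P f g q) (h' : IsFlux a P f g q') : q = q' := by
  obtain ⟨u, w, hw, rfl⟩ := h
  obtain ⟨u', w', hw', rfl⟩ := h'
  refine Finset.sum_congr rfl fun k _ => ?_
  have h1 := (hw k).1.unique (hw' k).1
  have h2 := (hw' k).2
  rw [← h1] at h2
  rw [(hw k).2.unique h2]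

theorem IsFlux.sub_left (h : IsFlux a P f g q) (h' : IsFlux a P f' g q') :
    IsFlux a P (f - f') g (q - q') := by
  obtain ⟨u, w, hw, rfl⟩ := h
  obtain ⟨u', w', hw', rfl⟩ := h'
  refine ⟨fun k => u k - u' k, fun k => w k - w' k, fun k =>
    ⟨(hw k).1.sub (hw' k).1, (hw k).2.sub_left (hw' k).2⟩, ?_⟩
  rw [← Finset.sum_sub_distrib]
  exact Finset.sum_congr rfl fun k _ => (lineDeriv_sub _ _ _).symm

theorem IsFlux.sub_right (h : IsFlux a P g f q) (h' : IsFlux a P g f' q') :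
    IsFlux a P g (f - f') (q - q') := by
  obtain ⟨u, w, hw, rfl⟩ := h
  obtain ⟨u', w', hw', rfl⟩ := h'
  have hu : ∀ k, u' k = u k := fun k => (hw' k).1.unique (hw k).1
  refine ⟨u, fun k => w k - w' k, fun k => ⟨(hw k).1, (hw k).2.sub_right ?_⟩, ?_⟩
  · have := (hw' k).2
    rwa [hu k] at this
  · rw [← Finset.sum_sub_distrib]
    exact Finset.sum_congr rfl fun k _ => (lineDeriv_sub _ _ _).symm

/-- Meant for convolutions, which may charge the origin: the atom is finite, and the dyadic norm
controls the rest. -/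
theorem hasTemperateGrowth_of_punctured (hφ : IsLittlewoodPaley φ) (hp : 1 ≤ p)
    (hs : s < massExp n p μ) {ν : Measure (Rn n)} (h0 : ν {0} < ∞) (h : fnMeas φ s p μ ν < ∞) :
    ν.HasTemperateGrowth := by
  rw [← Measure.restrict_add_restrict_compl (μ := ν) (measurableSet_singleton 0)]
  refine hasTemperateGrowth_add ?_ ?_
  · have : IsFiniteMeasure (ν.restrict {0}) := ⟨by simpa using h0⟩
    infer_instance
  · refine hasTemperateGrowth_of_fnMeas hφ hp hs ?_
      ((fnMeas_mono Measure.restrict_le_self).trans_lt h)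
    rw [Measure.restrict_apply (measurableSet_singleton 0)]
    simp

/-- The estimate of the convolution of `m f̂` and `ĝ`, where `|m| ≤ C |ξ|^{β-1}`. -/
theorem exists_fnMeas_convMeas_le (hφ : IsLittlewoodPaley φ) (hA : IsAdmissibleParam n p μ γ β s)
    (hP : ∀ j, IsAdmissibleSymbol p β (P j)) (a : Fin n → Fin n → ℂ) :
    ∃ C : ℝ≥0∞, C ≠ ∞ ∧ ∀ f g u k, fnN φ s p μ f < ∞ → fnN φ s p μ g < ∞ →
      IsMultiplier (velocitySymbol a P k) f u →
      fnMeas φ (s - (2 * γ - 1)) p μ (convMeas u g) ≤ C * (fnN φ s p μ f * fnN φ s p μ g) ∧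
        convMeas u g {0} ≤ C * (fnN φ s p μ f * fnN φ s p μ g) := by
  have hs := hA.lt_massExp
  -- The critical identity `d + (β - 1) = 2γ - 1`: the two convergence conditions of the convolution
  -- estimate become `1 < 2γ` and `2γ - 1 < s`.
  have he : massExp n p μ - s + (β - 1) = 2 * γ - 1 := by linarith [hA.massExp_sub]
  have h1 : 0 < massExp n p μ - s + (β - 1) := by linarith [hA.one_lt_two_mul]
  have h2 : 0 < s - (massExp n p μ - s + (β - 1)) := by linarith [hA.two_mul_lt]
  obtain ⟨C, hC, h⟩ := exists_velocitySymbol_le hφ hP a hA.one_le hs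
  obtain ⟨D, hD, hd⟩ := exists_lintegral_conv_dyadic_le (μ := μ) hφ hA.one_le hs h1 h2
  obtain ⟨E, hE, he'⟩ := exists_lintegral_conv_origin_le (μ := μ) hφ hA.one_le hs h1 h2
  refine ⟨C * (D + E), ENNReal.mul_ne_top hC (ENNReal.add_ne_top.2 ⟨hD, hE⟩),
    fun f g u k hf hg hu => ?_⟩
  have hfm := isMeas_of_fnN_lt_top hφ hA.one_le hs hf
  have hgm := isMeas_of_fnN_lt_top hφ hA.one_le hs hg
  have := hfm.sFinite_tv
  have := hgm.sFinite_tv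
  have htv := hu.tv_le (h f hf k).2
  have hwm := measurable_ofReal_norm_rpow (n := n) (β - 1)
  have key : ∀ G : Rn n → ℝ≥0∞, Measurable G → ∫⁻ ξ, G ξ ∂(convMeas u g) ≤
      C * ∫⁻ x, ENNReal.ofReal (‖x‖ ^ (β - 1)) * ∫⁻ y, G (x + y) ∂(tv g) ∂(tv f) := by
    intro G hG
    have hGm : Measurable fun z : Rn n × Rn n => G (z.1 + z.2) :=
      hG.comp (measurable_fst.add measurable_snd)
    have hI : Measurable fun x => ∫⁻ y, G (x + y) ∂(tv g) := hGm.lintegral_prod_right'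
    rw [lintegral_convMeas u hgm hG]
    refine (lintegral_mono' htv le_rfl).trans (le_of_eq ?_)
    rw [lintegral_withDensity_eq_lintegral_mul _ (hwm.const_mul C) hI,
      ← lintegral_const_mul' _ _ hC]
    refine lintegral_congr fun x => ?_
    rw [Pi.mul_apply, mul_assoc]
  rw [fnN_eq_fnMeas_tv hφ hA.one_le hs hfm, fnN_eq_fnMeas_tv hφ hA.one_le hs hgm]
  constructor
  · refine fnMeas_le fun k G hG => ?_
    refine (key _ ((measurable_enorm_dyadic φ k).mul hG.measurable)).trans ?_
    have h3 := hd (tv f) (tv g) (tv_zero_singleton f) (tv_zero_singleton g) k G hG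
    rw [he] at h3
    calc _ ≤ C * _ := mul_le_mul' le_rfl h3
      _ ≤ C * ((D + E) * pw (-(k * (s - (2 * γ - 1)))) *
          (fnMeas φ s p μ (tv f) * fnMeas φ s p μ (tv g))) := by
        gcongr
        exact le_self_add
      _ = _ := by ring
  · rw [← lintegral_indicator_one (measurableSet_singleton 0)]
    refine (key _ (measurable_one.indicator (measurableSet_singleton 0))).trans ?_
    have h3 := he' (tv f) (tv g) (tv_zero_singleton f) (tv_zero_singleton g)
    calc _ ≤ C * _ := mul_le_mul' le_rfl h3
      _ ≤ C * ((D + E) * (fnMeas φ s p μ (tv f) * fnMeas φ s p μ (tv g))) := by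
        gcongr
        exact le_add_self
      _ = _ := by ring

theorem exists_isFlux (hφ : IsLittlewoodPaley φ) (hA : IsAdmissibleParam n p μ γ β s)
    (hP : ∀ j, IsAdmissibleSymbol p β (P j)) (hf : fnN φ s p μ f < ∞) (hg : fnN φ s p μ g < ∞) :
    ∃ q, IsFlux a P f g q := by
  obtain ⟨C, hC, h⟩ := exists_fnMeas_convMeas_le hφ hA hP a
  choose u hu using exists_isMultiplier_velocitySymbol (a := a) hφ hA hP hf
  have hw : ∀ k, ∃ w, IsProduct (u k) g w := by
    intro k
    obtain ⟨h1, h2⟩ := h f g (u k) k hf hg (hu k)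
    have hfin : C * (fnN φ s p μ f * fnN φ s p μ g) < ∞ :=
      ENNReal.mul_lt_top hC.lt_top (ENNReal.mul_lt_top hf hg)
    exact exists_isProduct (hu k).isMeas_right
      (isMeas_of_fnN_lt_top hφ hA.one_le hA.lt_massExp hg)
      (hasTemperateGrowth_of_punctured (s := s - (2 * γ - 1)) (μ := μ) hφ hA.one_le
        (by linarith [hA.lt_massExp, hA.one_lt_two_mul]) (h2.trans_lt hfin) (h1.trans_lt hfin))
  choose w hw using hw
  exact ⟨_, u, w, fun k => ⟨hu k, hw k⟩, rfl⟩

theorem enorm_derivSymbol_single_le (k : Fin n) (ξ : Rn n) :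
    ‖derivSymbol (EuclideanSpace.single k 1) ξ‖ₑ ≤ ENNReal.ofReal ‖ξ‖ := by
  rw [← ofReal_norm]
  apply ENNReal.ofReal_le_ofReal
  rw [derivSymbol, norm_mul, Complex.norm_I, one_mul, Complex.norm_real]
  refine (norm_inner_le_norm _ _).trans ?_
  simp

/-- The divergence multiplies by a symbol of size at most `‖ξ‖`. This costs a factor `8/3 · 2^k` on
the support of `φ_k` and removes the possible atom of the products at the origin. -/
theorem exists_fnN_flux_le (hφ : IsLittlewoodPaley φ) (hA : IsAdmissibleParam n p μ γ β s)
    (hP : ∀ j, IsAdmissibleSymbol p β (P j)) (a : Fin n → Fin n → ℂ) :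
    ∃ C : ℝ≥0∞, C ≠ ∞ ∧ ∀ f g q, fnN φ s p μ f < ∞ → fnN φ s p μ g < ∞ → IsFlux a P f g q →
      fnN φ (s - 2 * γ) p μ q ≤ C * (fnN φ s p μ f * fnN φ s p μ g) := by
  obtain ⟨C, hC, h⟩ := exists_fnMeas_convMeas_le hφ hA hP a
  refine ⟨ENNReal.ofReal (8 / 3) * (n * C), ENNReal.mul_ne_top ENNReal.ofReal_ne_top
    (ENNReal.mul_ne_top (ENNReal.natCast_ne_top n) hC), ?_⟩
  rintro f g q hf hg ⟨u, w, hw, rfl⟩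
  have hnm : Measurable fun ξ : Rn n => ENNReal.ofReal ‖ξ‖ := measurable_norm.ennreal_ofReal
  set κ : Measure (Rn n) := Measure.sum fun k => convMeas (u k) g with hκ
  have hdom : Dominated (fourierDist (∑ k, ∂_{(EuclideanSpace.single k 1 : Rn n)} (w k)))
      (κ.withDensity fun ξ => ENNReal.ofReal ‖ξ‖) := by
    intro ψ
    rw [lintegral_withDensity_eq_lintegral_mul _ hnm ψ.continuous.measurable.enorm, hκ,
      lintegral_sum_measure, tsum_fintype, fourierDist_sum, tdist_sum_apply]
    refine (enorm_sum_le _ _).trans (Finset.sum_le_sum fun k _ => ?_)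
    rw [fourierDist_lineDeriv]
    refine ((hw k).2.dominated _).trans (lintegral_mono fun ξ => ?_)
    rw [SchwartzMap.smulLeftCLM_apply_apply (hasTemperateGrowth_derivSymbol _), smul_eq_mul,
      enorm_mul, Pi.mul_apply]
    gcongr
    exact enorm_derivSymbol_single_le k ξ
  have h0 : (κ.withDensity fun ξ => ENNReal.ofReal ‖ξ‖) {0} = 0 := by
    rw [withDensity_apply _ (measurableSet_singleton 0), setLIntegral_eq_zero_iff
      (measurableSet_singleton 0) hnm]
    refine .of_forall fun ξ hξ => ?_
    rw [Set.mem_singleton_iff] at hξ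
    simp [hξ]
  refine (fnN_le h0 hdom).trans (fnMeas_le fun k G hG => ?_)
  have hGm : Measurable fun ξ => ‖dyadic φ k ξ‖ₑ * G ξ :=
    (measurable_enorm_dyadic φ k).mul hG.measurable
  rw [lintegral_withDensity_eq_lintegral_mul _ hnm hGm]
  calc _ ≤ ∫⁻ ξ, ENNReal.ofReal (8 / 3) * pw k * (‖dyadic φ k ξ‖ₑ * G ξ) ∂κ := by
        refine lintegral_mono fun ξ => ?_
        rw [Pi.mul_apply]
        by_cases hξ : dyadic φ k ξ = 0
        · simp [hξ]
        · gcongr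
          rw [pw, ← ENNReal.ofReal_mul (by norm_num)]
          exact ENNReal.ofReal_le_ofReal (hφ.dyadic_support hξ).2
    _ = ENNReal.ofReal (8 / 3) * pw k *
          ∑ l, ∫⁻ ξ, ‖dyadic φ k ξ‖ₑ * G ξ ∂(convMeas (u l) g) := by
        rw [lintegral_const_mul _ hGm, hκ, lintegral_sum_measure, tsum_fintype]
    _ ≤ ENNReal.ofReal (8 / 3) * pw k * ∑ _l : Fin n, pw (-(k * (s - (2 * γ - 1)))) *
          (C * (fnN φ s p μ f * fnN φ s p μ g)) := by
        gcongr with l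
        refine (hG.lintegral_dyadic_le (s := s - (2 * γ - 1)) _ k).trans ?_
        gcongr
        exact (h f g (u l) l hf hg (hw l).1).1
    _ = _ := by
        rw [Finset.sum_const, Finset.card_univ, Fintype.card_fin, nsmul_eq_mul,
          show -((k : ℝ) * (s - 2 * γ)) = k + -(k * (s - (2 * γ - 1))) by ring, pw_add]
        ring

end

/-! ### Continuous curves and their integrals -/

section

variable {n : ℕ} {φ : 𝓢(Rn n, ℂ)} {s σ : ℝ} {p : ℝ≥0∞} {μ : ℝ}
  {I J : Set ℝ} {v v' : ℝ → TDist n} {f g : TDist n} {m : Rn n → ℂ}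

/-- `v` is a continuous curve in `FN^s_{p,μ,∞}` on the set `I` of times. -/
structure IsCurve (φ : 𝓢(Rn n, ℂ)) (s : ℝ) (p : ℝ≥0∞) (μ : ℝ) (I : Set ℝ) (v : ℝ → TDist n) :
    Prop where
  finite : ∀ t ∈ I, fnN φ s p μ (v t) < ∞
  continuous : ∀ t ∈ I, Tendsto (fun τ => fnN φ s p μ (v τ - v t)) (𝓝[I] t) (𝓝 0)

theorem tendsto_zero_of_le_add {ι : Type*} {l : Filter ι} {F G H : ι → ℝ≥0∞}
    (h : ∀ i, F i ≤ G i + H i) (hG : Tendsto G l (𝓝 0)) (hH : Tendsto H l (𝓝 0)) :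
    Tendsto F l (𝓝 0) := by
  have := hG.add hH
  rw [add_zero] at this
  exact tendsto_of_tendsto_of_tendsto_of_le_of_le tendsto_const_nhds this (fun _ => zero_le) h

theorem IsCurve.sub (hv : IsCurve φ s p μ I v) (hv' : IsCurve φ s p μ I v') :
    IsCurve φ s p μ I fun t => v t - v' t := by
  refine ⟨fun t ht => (fnN_sub_le _ _).trans_lt
    (ENNReal.add_lt_top.2 ⟨hv.finite t ht, hv'.finite t ht⟩), fun t ht => ?_⟩
  refine tendsto_zero_of_le_add (fun τ => ?_) (hv.continuous t ht) (hv'.continuous t ht)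
  rw [sub_sub_sub_comm]
  exact fnN_sub_le _ _

theorem IsCurve.comp (hv : IsCurve φ s p μ I v) {e : ℝ → ℝ} (he : Continuous e)
    (hJ : Set.MapsTo e J I) : IsCurve φ s p μ J fun t => v (e t) := by
  refine ⟨fun t ht => hv.finite _ (hJ ht), fun t ht => ?_⟩
  exact (hv.continuous _ (hJ ht)).comp
    (tendsto_nhdsWithin_iff.2 ⟨(he.tendsto t).mono_left nhdsWithin_le_nhds,
      eventually_nhdsWithin_of_forall fun τ hτ => hJ hτ⟩)

/-- A Lebesgue number of a cover by balls of small oscillation. Only one of the two times has to lie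
in `K`, which is needed when the end point of the time integral moves. -/
theorem IsCurve.exists_pos_le {K : Set ℝ} (hv : IsCurve φ s p μ I v) (hI : IsOpen I)
    (hK : IsCompact K) (hKI : K ⊆ I) {ε : ℝ≥0∞} (hε : ε ≠ 0) :
    ∃ δ > 0, ∀ x ∈ K, ∀ y, |y - x| < δ → fnN φ s p μ (v y - v x) ≤ ε := by
  have hε2 : 0 < ε / 2 := ENNReal.half_pos hε
  have h1 : ∀ x : K, ∃ r : ℝ, 0 < r ∧ ∀ y : ℝ, |y - x| < r → fnN φ s p μ (v y - v x) ≤ ε / 2 := by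
    intro x
    have h := hv.continuous x (hKI x.2)
    rw [hI.nhdsWithin_eq (hKI x.2)] at h
    have h2 := (h.eventually (gt_mem_nhds hε2))
    obtain ⟨r, hr, h3⟩ := Metric.eventually_nhds_iff.1 h2
    exact ⟨r, hr, fun y hy => (h3 (by rwa [Real.dist_eq])).le⟩
  choose r hr h using h1
  obtain ⟨δ, hδ, hL⟩ := lebesgue_number_lemma_of_metric hK
    (c := fun x : K => Metric.ball (x : ℝ) (r x)) (fun _ => Metric.isOpen_ball)
    (fun x hx => Set.mem_iUnion.2 ⟨⟨x, hx⟩, Metric.mem_ball_self (hr _)⟩)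
  refine ⟨δ, hδ, fun x hx y hy => ?_⟩
  obtain ⟨z, hz⟩ := hL x hx
  have hxz := hz (Metric.mem_ball_self hδ)
  have hyz := hz (show y ∈ Metric.ball x δ by rwa [Metric.mem_ball, Real.dist_eq])
  rw [Metric.mem_ball, Real.dist_eq] at hxz hyz
  have he : v y - v x = (v y - v z) - (v x - v z) := by abel
  rw [he]
  refine (fnN_sub_le _ _).trans ((add_le_add (h z y hyz) (h z x hxz)).trans ?_)
  rw [ENNReal.add_halves]

/-- The total variations of a curve, as a map into measures vanishing off `I`. -/
def tvCurve (I : Set ℝ) (v : ℝ → TDist n) (τ : ℝ) : Measure (Rn n) :=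
  open Classical in if τ ∈ I then tv (v τ) else 0

theorem tv_apply_le_add {E : Set (Rn n)} (hf : IsMeas f) (hg : IsMeas g) :
    tv f E ≤ tv g E + tv (f - g) E := by
  have := tv_add_le hg (hf.sub hg) E
  rwa [add_sub_cancel] at this

theorem tv_sub_comm (hf : IsMeas f) (hg : IsMeas g) : tv (f - g) = tv (g - f) := by
  have key : ∀ {f g : TDist n}, IsMeas f → IsMeas g → tv (f - g) ≤ tv (g - f) := by
    intro f g hf hg
    have h := (hg.sub hf)
    refine Dominated.tv_le ?_ h.hasTemperateGrowth_tv (tv_zero_singleton _)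
    rw [← neg_sub g f, fourierDist_neg]
    exact h.dominated_tv.neg
  exact le_antisymm (key hf hg) (key hg hf)

/-- Needed to integrate the total variations over time. The variation of a difference controls the
difference of the variations, so on a fixed annulus the mass depends continuously on `τ ∈ I`; the
annuli are then summed. -/
theorem IsCurve.measurable_tvCurve (hφ : IsLittlewoodPaley φ) (hp : 1 ≤ p)
    (hs : s < massExp n p μ) (hv : IsCurve φ s p μ I v) (hI : MeasurableSet I) :
    Measurable (tvCurve I v) := by
  classical
  obtain ⟨C, hC, hb⟩ := exists_measure_annulus_le (n := n) hφ hp s μ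
  have hm : ∀ τ ∈ I, IsMeas (v τ) := fun τ hτ => isMeas_of_fnN_lt_top hφ hp hs (hv.finite τ hτ)
  refine Measure.measurable_of_measurable_coe _ fun E hE => ?_
  have h0 : ∀ τ, tvCurve I v τ {0} = 0 := by
    intro τ
    rw [tvCurve]
    split_ifs
    · exact tv_zero_singleton _
    · simp
  have hsum : ∀ τ, tvCurve I v τ E = ∑' i : ℤ, tvCurve I v τ (E ∩ annulus n i) := by
    intro τ
    conv_lhs => rw [← sum_restrict_annulus (h0 τ)]
    rw [Measure.sum_apply _ hE]
    exact tsum_congr fun i => Measure.restrict_apply hE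
  simp_rw [hsum]
  refine Measurable.tsum fun i => ?_
  have hpw : (fun τ => tvCurve I v τ (E ∩ annulus n i)) =
      I.piecewise (fun τ => tv (v τ) (E ∩ annulus n i)) fun _ => 0 := by
    ext τ
    rw [tvCurve, Set.piecewise]
    split_ifs <;> simp
  rw [hpw]
  refine ContinuousOn.measurable_piecewise (fun t ht => ?_) continuousOn_const hI
  have hann : ∀ {f : TDist n}, IsMeas f → tv f (E ∩ annulus n i) ≤
      C * pw (i * (massExp n p μ - s)) * fnN φ s p μ f := by
    intro f hf
    rw [fnN_eq_fnMeas_tv hφ hp hs hf]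
    exact (measure_mono Set.inter_subset_right).trans (hb _ _)
  have hK : C * pw (i * (massExp n p μ - s)) ≠ ∞ := ENNReal.mul_ne_top hC (pw_ne_top _)
  have hfin : tv (v t) (E ∩ annulus n i) ≠ ∞ :=
    ((hann (hm t ht)).trans_lt (ENNReal.mul_lt_top hK.lt_top (hv.finite t ht))).ne
  have hlim : Tendsto (fun τ => C * pw (i * (massExp n p μ - s)) * fnN φ s p μ (v τ - v t))
      (𝓝[I] t) (𝓝 0) := by
    have := ENNReal.Tendsto.const_mul (hv.continuous t ht) (Or.inr hK)
    rwa [mul_zero] at this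
  refine (ENNReal.tendsto_nhds hfin).2 fun ε hε => ?_
  filter_upwards [hlim.eventually (gt_mem_nhds hε), self_mem_nhdsWithin] with τ hτ hτI
  have hd := (hann ((hm τ hτI).sub (hm t ht))).trans hτ.le
  refine ⟨tsub_le_iff_right.2 ((tv_apply_le_add (hm t ht) (hm τ hτI)).trans ?_),
    (tv_apply_le_add (hm τ hτI) (hm t ht)).trans (by gcongr)⟩
  rw [tv_sub_comm (hm t ht) (hm τ hτI)]
  gcongr

theorem IsCurve.continuousOn_apply (hφ : IsLittlewoodPaley φ) (hp : 1 ≤ p)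
    (hs : s < massExp n p μ) (hv : IsCurve φ s p μ I v) (ψ : 𝓢(Rn n, ℂ)) :
    ContinuousOn (fun τ => v τ ψ) I := by
  obtain ⟨C, hC, h⟩ := exists_enorm_apply_le (μ := μ) hφ hp hs ψ
  intro t ht
  rw [ContinuousWithinAt, tendsto_iff_edist_tendsto_0]
  have hlim := ENNReal.Tendsto.const_mul (a := C) (hv.continuous t ht) (Or.inr hC)
  rw [mul_zero] at hlim
  refine tendsto_of_tendsto_of_tendsto_of_le_of_le tendsto_const_nhds hlim (fun _ => zero_le)
    fun τ => ?_
  simp only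
  rw [edist_eq_enorm_sub, ← tdist_sub_apply]
  exact h _

/-- A curve in `FN^σ` is integrated to an element of `FN^s`. -/
theorem IsCurve.exists_integral (hφ : IsLittlewoodPaley φ) (hp : 1 ≤ p)
    (hσ : σ < massExp n p μ) (hs : s < massExp n p μ) (hv : IsCurve φ σ p μ I v)
    (hI : MeasurableSet I) {A : ℝ≥0∞} (hA : A ≠ ∞)
    (h : ∀ k : ℤ, ∀ G, IsMorreyTest p μ G →
      ∫⁻ τ in I, ∫⁻ ξ, ‖dyadic φ k ξ‖ₑ * G ξ ∂(tv (v τ)) ≤ pw (-(k * s)) * A) :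
    (∀ ψ : 𝓢(Rn n, ℂ), IntegrableOn (fun τ => v τ ψ) I) ∧
      ∃ b : TDist n, (∀ ψ : 𝓢(Rn n, ℂ), b ψ = ∫ τ in I, v τ ψ) ∧ fnN φ s p μ b ≤ A := by
  have hmeas := hv.measurable_tvCurve hφ hp hσ hI
  have hm : ∀ τ ∈ I, IsMeas (v τ) := fun τ hτ => isMeas_of_fnN_lt_top hφ hp hσ (hv.finite τ hτ)
  -- The time integral of the total variations dominates the transform of the integrated curve, so
  -- only `Λ` has to be estimated.
  set Λ : Measure (Rn n) := Measure.bind (volume.restrict I) (tvCurve I v) with hΛ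
  have hlint : ∀ F : Rn n → ℝ≥0∞, Measurable F →
      ∫⁻ ξ, F ξ ∂Λ = ∫⁻ τ in I, ∫⁻ ξ, F ξ ∂(tv (v τ)) := by
    intro F hF
    rw [hΛ, Measure.lintegral_bind hmeas.aemeasurable hF.aemeasurable]
    refine setLIntegral_congr_fun hI fun τ hτ => ?_
    simp only [tvCurve, if_pos hτ]
  have h0 : Λ {0} = 0 := by
    rw [← lintegral_indicator_one (measurableSet_singleton 0), hlint _
      (measurable_one.indicator (measurableSet_singleton 0))]
    simp only [lintegral_indicator_one (measurableSet_singleton (0 : Rn n)), tv_zero_singleton,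
      lintegral_zero]
  have hfn : fnMeas φ s p μ Λ ≤ A := by
    refine fnMeas_le fun k G hG => ?_
    exact (hlint _ ((measurable_enorm_dyadic φ k).mul hG.measurable)).trans_le (h k G hG)
  have hgr : Λ.HasTemperateGrowth :=
    hasTemperateGrowth_of_fnMeas hφ hp hs h0 (hfn.trans_lt hA.lt_top)
  have hdom : ∀ ψ : 𝓢(Rn n, ℂ), ∫⁻ τ in I, ‖fourierDist (v τ) ψ‖ₑ ≤ ∫⁻ ξ, ‖ψ ξ‖ₑ ∂Λ := by
    intro ψ
    rw [hlint _ ψ.continuous.measurable.enorm]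
    exact setLIntegral_mono' hI fun τ hτ => (hm τ hτ).dominated_tv ψ
  have hint' : ∀ ψ : 𝓢(Rn n, ℂ), IntegrableOn (fun τ => fourierDist (v τ) ψ) I := by
    intro ψ
    refine ⟨?_, ?_⟩
    · simp_rw [fourierDist_apply]
      exact (hv.continuousOn_apply hφ hp hσ _).aestronglyMeasurable hI
    · obtain ⟨C, hC, hC'⟩ := exists_lintegral_schwartz_le (μ := μ) hφ hp hs ψ
      exact ((hdom ψ).trans (hC' Λ h0)).trans_lt
        (ENNReal.mul_lt_top hC.lt_top (hfn.trans_lt hA.lt_top))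
  let S : 𝓢(Rn n, ℂ) →ₗ[ℂ] ℂ :=
    { toFun := fun ψ => ∫ τ in I, fourierDist (v τ) ψ
      map_add' := fun ψ ψ' => by
        simp only [map_add]
        exact integral_add (hint' ψ) (hint' ψ')
      map_smul' := fun c ψ => by
        simp only [map_smul, RingHom.id_apply]
        exact integral_smul c _ }
  obtain ⟨T, hT⟩ := exists_tdist_of_dominated Λ S
    (fun ψ => (enorm_integral_le_lintegral_enorm _).trans (hdom ψ))
  refine ⟨fun ψ => ?_, invFourierDist T, fun ψ => ?_, ?_⟩
  · have := hint' (invTestFourier ψ)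
    simpa only [← apply_eq_fourierDist] using this
  · rw [invFourierDist_apply, hT]
    simp only [S, LinearMap.coe_mk, AddHom.coe_mk, ← apply_eq_fourierDist]
  · refine (fnN_le h0 ?_).trans hfn
    rw [fourierDist_invFourierDist]
    intro ψ
    rw [hT]
    exact (enorm_integral_le_lintegral_enorm _).trans (hdom ψ)

theorem IsMultiplier.lintegral_dyadic_le (hφ : IsLittlewoodPaley φ) (hp : 1 ≤ p)
    (hs : s < massExp n p μ) (hg : IsMultiplier m f g) {k : ℤ} {ρ : ℝ≥0∞}
    (hρ : ∀ ξ, dyadic φ k ξ ≠ 0 → ‖m ξ‖ₑ ≤ ρ) {G : Rn n → ℝ≥0∞} (hG : IsMorreyTest p μ G) :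
    ∫⁻ ξ, ‖dyadic φ k ξ‖ₑ * G ξ ∂(tv g) ≤ ρ * (pw (-(k * s)) * fnN φ s p μ f) := by
  classical
  have hset : MeasurableSet {ξ | dyadic φ k ξ = 0} :=
    (isClosed_eq (continuous_dyadic φ k) continuous_const).measurableSet
  -- Nothing is known of `m` where `φ_k` vanishes; the value `∞` is harmless there, because it is
  -- multiplied by zero.
  set M : Rn n → ℝ≥0∞ := fun ξ => if dyadic φ k ξ = 0 then ∞ else ρ with hM
  have hMm : Measurable M := Measurable.ite hset measurable_const measurable_const
  have hle := hg.tv_le (M := M) (Eventually.of_forall fun ξ => by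
    simp only [hM]
    split_ifs with h
    · exact le_top
    · exact hρ ξ h)
  have hGm := (measurable_enorm_dyadic φ k).mul hG.measurable
  calc ∫⁻ ξ, ‖dyadic φ k ξ‖ₑ * G ξ ∂(tv g)
      ≤ ∫⁻ ξ, ‖dyadic φ k ξ‖ₑ * G ξ ∂((tv f).withDensity M) := lintegral_mono' hle le_rfl
    _ = ∫⁻ ξ, M ξ * (‖dyadic φ k ξ‖ₑ * G ξ) ∂(tv f) :=
        lintegral_withDensity_eq_lintegral_mul _ hMm hGm
    _ ≤ ∫⁻ ξ, ρ * (‖dyadic φ k ξ‖ₑ * G ξ) ∂(tv f) := by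
        refine lintegral_mono fun ξ => ?_
        simp only [hM]
        split_ifs with h
        · simp [h]
        · exact le_rfl
    _ = ρ * ∫⁻ ξ, ‖dyadic φ k ξ‖ₑ * G ξ ∂(tv f) := lintegral_const_mul _ hGm
    _ ≤ _ := by
        rw [fnN_eq_fnMeas_tv hφ hp hs hg.isMeas_left]
        exact mul_le_mul_right (hG.lintegral_dyadic_le _ k) _

theorem IsMultiplier.fnN_le (hφ : IsLittlewoodPaley φ) (hp : 1 ≤ p)
    (hσ : σ < massExp n p μ) (hs : s < massExp n p μ) (hg : IsMultiplier m f g) {D : ℝ≥0∞}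
    (hD : ∀ (k : ℤ) ξ, dyadic φ k ξ ≠ 0 → ‖m ξ‖ₑ ≤ D * pw (-(k * (s - σ)))) :
    fnN φ s p μ g ≤ D * fnN φ σ p μ f := by
  rw [fnN_eq_fnMeas_tv hφ hp hs hg.isMeas_right]
  refine fnMeas_le fun k G hG => (hg.lintegral_dyadic_le hφ hp hσ (hD k) hG).trans_eq ?_
  rw [show -((k : ℝ) * s) = -(k * (s - σ)) + -(k * σ) by ring, pw_add]
  ring

theorem IsMultiplier.fnN_le_of_norm_le (hφ : IsLittlewoodPaley φ) (hp : 1 ≤ p)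
    (hs : s < massExp n p μ) (hg : IsMultiplier m f g) {D : ℝ≥0∞}
    (hD : ∀ ξ, ξ ≠ 0 → ‖m ξ‖ₑ ≤ D) : fnN φ s p μ g ≤ D * fnN φ s p μ f := by
  refine hg.fnN_le hφ hp hs hs fun k ξ hk => ?_
  rw [sub_self, mul_zero, neg_zero, pw_zero, mul_one]
  refine hD ξ fun h => ?_
  subst h
  have := (hφ.dyadic_support hk).1
  rw [norm_zero] at this
  have h2 : (0 : ℝ) < 3 / 4 * 2 ^ (k : ℝ) := by positivity
  linarith

theorem IsMultiplier.sub_symbol {m' : Rn n → ℂ} {g' : TDist n} (hg : IsMultiplier m f g)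
    (hg' : IsMultiplier m' f g') : IsMultiplier (fun ξ => m ξ - m' ξ) f (g - g') := by
  obtain ⟨ν, h, H, H'⟩ := hg
  refine ⟨ν, h, H, ?_⟩
  have := H'.sub (hg'.density H)
  simpa only [sub_mul] using this

end

/-! ### Heat integrals -/

section

variable {n : ℕ} {φ : 𝓢(Rn n, ℂ)} {s : ℝ} {p : ℝ≥0∞} {μ γ : ℝ}
  {I : Set ℝ} {Q Q' v w : ℝ → TDist n} {f g b b' : TDist n} {t : ℝ}

theorem measurable_heatSymbol (γ t : ℝ) : Measurable (heatSymbol (n := n) γ t) := by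
  unfold heatSymbol
  exact Complex.measurable_ofReal.comp
    (((measurable_norm.pow_const (2 * γ)).const_mul (-t)).exp)

theorem enorm_heatSymbol (γ t : ℝ) (ξ : Rn n) :
    ‖heatSymbol γ t ξ‖ₑ = ENNReal.ofReal (Real.exp (-t * ‖ξ‖ ^ (2 * γ))) := by
  rw [heatSymbol, ← ofReal_norm, Complex.norm_real, Real.norm_of_nonneg (Real.exp_pos _).le]

theorem enorm_heatSymbol_le_one (ht : 0 ≤ t) (ξ : Rn n) : ‖heatSymbol γ t ξ‖ₑ ≤ 1 := by
  rw [enorm_heatSymbol, ← ENNReal.ofReal_one]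
  apply ENNReal.ofReal_le_ofReal
  rw [Real.exp_le_one_iff, neg_mul, Left.neg_nonpos_iff]
  positivity

/-- The time derivative of `e^{-tx}` has modulus `x e^{-tx} ≤ 1/t`, uniformly in `x`. Away from `t =
0` the heat flow is thus norm continuous even on rough data. -/
theorem abs_exp_sub_exp_le {c t t' x : ℝ} (hc : 0 < c) (ht : c ≤ t) (ht' : c ≤ t') (hx : 0 ≤ x) :
    |Real.exp (-t * x) - Real.exp (-t' * x)| ≤ |t - t'| / c := by
  wlog h : t ≤ t' generalizing t t'
  · rw [abs_sub_comm, abs_sub_comm t]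
    exact this ht' ht (le_of_not_ge h)
  have hle : Real.exp (-t' * x) ≤ Real.exp (-t * x) := by
    apply Real.exp_le_exp.2
    nlinarith
  rw [abs_of_nonneg (sub_nonneg.2 hle), abs_sub_comm, abs_of_nonneg (sub_nonneg.2 h),
    le_div_iff₀ hc]
  have h1 : Real.exp (-t' * x) = Real.exp (-t * x) * Real.exp (-((t' - t) * x)) := by
    rw [← Real.exp_add]; congr 1; ring
  have h2 : 1 - (t' - t) * x ≤ Real.exp (-((t' - t) * x)) := by
    have := Real.add_one_le_exp (-((t' - t) * x)); linarith
  have h3 : t * x * Real.exp (-t * x) ≤ 1 := by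
    have h4 : t * x ≤ Real.exp (t * x) := by linarith [Real.add_one_le_exp (t * x)]
    rw [neg_mul, Real.exp_neg]
    exact mul_inv_le_one_of_le₀ h4 (Real.exp_pos _).le
  have hE := Real.exp_pos (-t * x)
  have hd : 0 ≤ t' - t := sub_nonneg.2 h
  calc (Real.exp (-t * x) - Real.exp (-t' * x)) * c
      ≤ (Real.exp (-t * x) * ((t' - t) * x)) * t := by
        apply mul_le_mul _ ht hc.le (by positivity)
        rw [h1]
        nlinarith
    _ = (t' - t) * (t * x * Real.exp (-t * x)) := by ring
    _ ≤ (t' - t) * 1 := by gcongr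
    _ = t' - t := mul_one _

theorem enorm_heatSymbol_sub_le {c t t' : ℝ} (hc : 0 < c) (ht : c ≤ t) (ht' : c ≤ t') (ξ : Rn n) :
    ‖heatSymbol γ t ξ - heatSymbol γ t' ξ‖ₑ ≤ ENNReal.ofReal (|t - t'| / c) := by
  rw [heatSymbol, heatSymbol, ← Complex.ofReal_sub, ← ofReal_norm, Complex.norm_real,
    Real.norm_eq_abs]
  exact ENNReal.ofReal_le_ofReal (abs_exp_sub_exp_le hc ht ht' (by positivity))

theorem IsMeas.exists_heat (hf : IsMeas f) (ht : 0 ≤ t) :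
    ∃ g, IsMultiplier (heatSymbol γ t) f g :=
  exists_isMultiplier_of_bounded hf (measurable_heatSymbol γ t).aestronglyMeasurable
    (enorm_heatSymbol_le_one ht)

theorem IsCurve.heat (hφ : IsLittlewoodPaley φ) (hp : 1 ≤ p) (hs : s < massExp n p μ)
    (hQ : IsCurve φ s p μ I Q) (hI : I ⊆ Set.Ioi 0)
    (hv : ∀ τ ∈ I, IsMultiplier (heatSymbol γ τ) (Q τ) (v τ)) : IsCurve φ s p μ I v := by
  have hm : ∀ τ ∈ I, IsMeas (Q τ) := fun τ hτ => isMeas_of_fnN_lt_top hφ hp hs (hQ.finite τ hτ)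
  have hone : ∀ {t f g}, 0 ≤ t → IsMultiplier (heatSymbol γ t) f g →
      fnN φ s p μ g ≤ fnN φ s p μ f := by
    intro t f g ht h
    have := h.fnN_le_of_norm_le hφ hp hs (D := 1) fun ξ _ => enorm_heatSymbol_le_one ht ξ
    rwa [one_mul] at this
  refine ⟨fun t ht => (hone (hI ht).le (hv t ht)).trans_lt (hQ.finite t ht), fun t ht => ?_⟩
  have ht0 : 0 < t := hI ht
  have hlim : Tendsto (fun τ => ENNReal.ofReal (|τ - t| / (t / 2)) * fnN φ s p μ (Q t))
      (𝓝[I] t) (𝓝 0) := by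
    have h1 : Tendsto (fun τ : ℝ => ENNReal.ofReal (|τ - t| / (t / 2))) (𝓝[I] t) (𝓝 0) := by
      have h2 : Continuous fun τ : ℝ => ENNReal.ofReal (|τ - t| / (t / 2)) :=
        ENNReal.continuous_ofReal.comp (by fun_prop)
      have := (h2.tendsto t).mono_left (nhdsWithin_le_nhds (s := I))
      simpa using this
    have := ENNReal.Tendsto.mul_const h1 (Or.inr (hQ.finite t ht).ne)
    rwa [zero_mul] at this
  have hadd := (hQ.continuous t ht).add hlim
  rw [add_zero] at hadd
  refine tendsto_of_tendsto_of_tendsto_of_le_of_le' tendsto_const_nhds hadd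
    (Eventually.of_forall fun _ => zero_le) ?_
  have hnear : ∀ᶠ τ in 𝓝[I] t, t / 2 < τ := nhdsWithin_le_nhds (lt_mem_nhds (by linarith))
  filter_upwards [hnear, self_mem_nhdsWithin] with τ hτ hτI
  -- The intermediate term `G_γ(τ) Q(t)` separates the variation of `Q`, handled by contractivity,
  -- from that of the semigroup.
  obtain ⟨w, hw⟩ := (hm t ht).exists_heat (γ := γ) (t := τ) (by linarith)
  have he : v τ - v t = (v τ - w) + (w - v t) := by abel
  rw [he]
  refine (fnN_add_le _ _).trans (add_le_add ?_ ?_)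
  · exact hone (by linarith) ((hv τ hτI).sub hw)
  · exact (hw.sub_symbol (hv t ht)).fnN_le_of_norm_le hφ hp hs fun ξ _ =>
      enorm_heatSymbol_sub_le (by linarith) hτ.le (by linarith) ξ

theorem IsLittlewoodPaley.enorm_heatSymbol_le (hφ : IsLittlewoodPaley φ) (hγ : 0 ≤ γ) {k : ℤ}
    {ξ : Rn n} (h : dyadic φ k ξ ≠ 0) (ht : 0 ≤ t) :
    ‖heatSymbol γ t ξ‖ₑ ≤ ENNReal.ofReal (Real.exp (-(t * 2 ^ ((k - 1) * (2 * γ))))) := by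
  rw [enorm_heatSymbol, neg_mul]
  refine ENNReal.ofReal_le_ofReal (Real.exp_le_exp.2 (neg_le_neg ?_))
  gcongr
  rw [Real.rpow_mul (by norm_num)]
  refine Real.rpow_le_rpow (by positivity) ?_ (by linarith)
  refine le_trans ?_ (hφ.dyadic_support h).1
  rw [Real.rpow_sub (by norm_num), Real.rpow_one]
  have : (0 : ℝ) < 2 ^ (k : ℝ) := by positivity
  linarith

theorem lintegral_exp_neg_mul_le {y : ℝ} (hy : 0 < y) {a b : ℝ} (ha : 0 ≤ a) :
    ∫⁻ τ in Set.Ioo a b, ENNReal.ofReal (Real.exp (-(τ * y))) ≤ ENNReal.ofReal (1 / y) := by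
  have hint := integrableOn_exp_mul_Ioi (neg_lt_zero.2 hy) 0
  calc ∫⁻ τ in Set.Ioo a b, ENNReal.ofReal (Real.exp (-(τ * y)))
      ≤ ∫⁻ τ in Set.Ioi 0, ENNReal.ofReal (Real.exp (-y * τ)) := by
        refine (lintegral_mono_set (t := Set.Ioi 0)
          (fun τ hτ => lt_of_le_of_lt ha hτ.1)).trans_eq ?_
        simp only [neg_mul, mul_comm y]
    _ = ENNReal.ofReal (1 / y) := by
        rw [← ofReal_integral_eq_lintegral_ofReal hint
          (Eventually.of_forall fun τ => (Real.exp_pos _).le), integral_exp_mul_Ioi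
          (neg_lt_zero.2 hy)]
        simp

/-- Away from time zero `e^{-τy} ≤ 1/(ay)`. The gain `1/y` is the same as for the full integral, but
the prefactor tends to zero with the length of the interval. -/
theorem lintegral_exp_neg_mul_le' {y : ℝ} (hy : 0 < y) {a b : ℝ} (ha : 0 < a) :
    ∫⁻ τ in Set.Ioo a b, ENNReal.ofReal (Real.exp (-(τ * y))) ≤
      ENNReal.ofReal ((b - a) / a / y) := by
  have h1 : ∀ τ ∈ Set.Ioo a b, ENNReal.ofReal (Real.exp (-(τ * y))) ≤
      ENNReal.ofReal (1 / (a * y)) := by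
    intro τ hτ
    apply ENNReal.ofReal_le_ofReal
    rw [Real.exp_neg, ← one_div]
    apply one_div_le_one_div_of_le (by positivity)
    calc a * y ≤ τ * y := by have := hτ.1.le; gcongr
      _ ≤ _ := by linarith [Real.add_one_le_exp (τ * y)]
  calc ∫⁻ τ in Set.Ioo a b, ENNReal.ofReal (Real.exp (-(τ * y)))
      ≤ ∫⁻ _ in Set.Ioo a b, ENNReal.ofReal (1 / (a * y)) := setLIntegral_mono' measurableSet_Ioo h1
    _ = ENNReal.ofReal (1 / (a * y)) * ENNReal.ofReal (b - a) := by
        rw [setLIntegral_const, Real.volume_Ioo]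
    _ = _ := by
        rw [← ENNReal.ofReal_mul (by positivity)]
        congr 1
        field_simp

/-- The smoothing estimate for heat integrals. -/
theorem IsCurve.exists_heat_integral (hφ : IsLittlewoodPaley φ) (hp : 1 ≤ p)
    (hs : s < massExp n p μ) (hγ : 0 ≤ γ) {c d : ℝ} (hc : 0 ≤ c) (hcd : c ≤ d)
    (hQ : IsCurve φ (s - 2 * γ) p μ (Set.Ioo c d) Q)
    (hw : ∀ τ ∈ Set.Ioo c d, IsMultiplier (heatSymbol γ τ) (Q τ) (w τ)) {M : ℝ≥0∞} (hM : M ≠ ∞)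
    (hQM : ∀ τ ∈ Set.Ioo c d, fnN φ (s - 2 * γ) p μ (Q τ) ≤ M) {r : ℝ} (hr0 : 0 ≤ r)
    (hr : ∀ y, 0 < y → ∫⁻ τ in Set.Ioo c d, ENNReal.ofReal (Real.exp (-(τ * y))) ≤
      ENNReal.ofReal (r / y)) :
    (∀ ψ : 𝓢(Rn n, ℂ), IntervalIntegrable (fun τ => w τ ψ) volume c d) ∧
      ∃ B : TDist n, (∀ ψ : 𝓢(Rn n, ℂ), B ψ = ∫ τ in c..d, w τ ψ) ∧
        fnN φ s p μ B ≤ ENNReal.ofReal r * (pw (2 * γ) * M) := by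
  have hσ : s - 2 * γ < massExp n p μ := by linarith
  have hcurve := hQ.heat hφ hp hσ (fun τ hτ => lt_of_le_of_lt hc hτ.1) hw
  have key : ∀ k : ℤ, ∀ G, IsMorreyTest p μ G →
      ∫⁻ τ in Set.Ioo c d, ∫⁻ ξ, ‖dyadic φ k ξ‖ₑ * G ξ ∂(tv (w τ)) ≤
        pw (-(k * s)) * (ENNReal.ofReal r * (pw (2 * γ) * M)) := by
    intro k G hG
    -- `y` is a lower bound for `‖ξ‖^{2γ}` on the support of `φ_k`. The factor `1/y` gained by
    -- integrating in time raises the order by `2γ`.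
    set y : ℝ := 2 ^ ((k - 1) * (2 * γ)) with hy
    have hy0 : 0 < y := by positivity
    have hK : pw (-(k * (s - 2 * γ))) * M ≠ ∞ := ENNReal.mul_ne_top (pw_ne_top _) hM
    calc ∫⁻ τ in Set.Ioo c d, ∫⁻ ξ, ‖dyadic φ k ξ‖ₑ * G ξ ∂(tv (w τ))
        ≤ ∫⁻ τ in Set.Ioo c d, ENNReal.ofReal (Real.exp (-(τ * y))) *
            (pw (-(k * (s - 2 * γ))) * M) := by
          refine setLIntegral_mono' measurableSet_Ioo fun τ hτ => ?_
          refine ((hw τ hτ).lintegral_dyadic_le hφ hp hσ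
            (fun ξ hξ => hφ.enorm_heatSymbol_le hγ hξ (hc.trans hτ.1.le)) hG).trans ?_
          have := hQM τ hτ
          gcongr
      _ = (∫⁻ τ in Set.Ioo c d, ENNReal.ofReal (Real.exp (-(τ * y)))) *
            (pw (-(k * (s - 2 * γ))) * M) := lintegral_mul_const' _ _ hK
      _ ≤ ENNReal.ofReal (r / y) * (pw (-(k * (s - 2 * γ))) * M) := by
          gcongr
          exact hr y hy0
      _ = _ := by
          rw [div_eq_mul_inv, ENNReal.ofReal_mul hr0]
          have h2 : ENNReal.ofReal y⁻¹ = pw (-(k * (2 * γ))) * pw (2 * γ) := by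
            rw [hy, ← Real.rpow_neg (by norm_num), ← pw_add, pw]
            congr 2
            ring
          rw [h2, show -((k : ℝ) * s) = -(k * (2 * γ)) + -(k * (s - 2 * γ)) by ring, pw_add]
          ring
  obtain ⟨h1, B, hB, hBn⟩ := hcurve.exists_integral hφ hp hσ hs measurableSet_Ioo
    (ENNReal.mul_ne_top ENNReal.ofReal_ne_top (ENNReal.mul_ne_top (pw_ne_top _) hM)) key
  refine ⟨fun ψ => ?_, B, fun ψ => ?_, hBn⟩
  · rw [intervalIntegrable_iff_integrableOn_Ioo_of_le hcd]
    exact h1 ψ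
  · rw [hB, intervalIntegral.integral_of_le hcd, integral_Ioc_eq_integral_Ioo]

/-- `b = -∫₀ᵗ G_γ(t - τ) Q(τ) dτ`, written with `σ = t - τ` as the variable of integration. -/
def IsHeatIntegral (γ : ℝ) (Q : ℝ → TDist n) (t : ℝ) (b : TDist n) : Prop :=
  ∃ w : ℝ → TDist n, (∀ σ ∈ Set.Ioo 0 t, IsMultiplier (heatSymbol γ σ) (Q (t - σ)) (w σ)) ∧
    ∀ ψ : 𝓢(Rn n, ℂ), IntervalIntegrable (fun σ => w σ ψ) volume 0 t ∧
      b ψ = -∫ σ in (0 : ℝ)..t, w σ ψ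

theorem tdist_ext (h : ∀ ψ : 𝓢(Rn n, ℂ), f ψ = g ψ) : f = g := by
  ext ψ
  exact h ψ

theorem intervalIntegral_congr_Ioo {c d : ℝ} (hcd : c ≤ d) {F G : ℝ → ℂ}
    (h : ∀ τ ∈ Set.Ioo c d, F τ = G τ) : ∫ τ in c..d, F τ = ∫ τ in c..d, G τ := by
  rw [intervalIntegral.integral_of_le hcd, intervalIntegral.integral_of_le hcd,
    integral_Ioc_eq_integral_Ioo, integral_Ioc_eq_integral_Ioo]
  exact setIntegral_congr_fun measurableSet_Ioo h

theorem IsHeatIntegral.unique (ht : 0 ≤ t) (h : IsHeatIntegral γ Q t b)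
    (h' : IsHeatIntegral γ Q t b') : b = b' := by
  obtain ⟨w, hw, hb⟩ := h
  obtain ⟨w', hw', hb'⟩ := h'
  refine tdist_ext fun ψ => ?_
  rw [(hb ψ).2, (hb' ψ).2, intervalIntegral_congr_Ioo ht fun τ hτ => ?_]
  rw [(hw τ hτ).unique (hw' τ hτ)]

theorem IsHeatIntegral.congr (h : IsHeatIntegral γ Q t b)
    (hQ : ∀ τ ∈ Set.Ioo 0 t, Q τ = Q' τ) : IsHeatIntegral γ Q' t b := by
  obtain ⟨w, hw, hb⟩ := h
  refine ⟨w, fun σ hσ => ?_, hb⟩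
  rw [← hQ (t - σ) ⟨by linarith [hσ.2], by linarith [hσ.1]⟩]
  exact hw σ hσ

theorem IsHeatIntegral.sub (h : IsHeatIntegral γ Q t b) (h' : IsHeatIntegral γ Q' t b') :
    IsHeatIntegral γ (fun τ => Q τ - Q' τ) t (b - b') := by
  obtain ⟨w, hw, hb⟩ := h
  obtain ⟨w', hw', hb'⟩ := h'
  refine ⟨fun τ => w τ - w' τ, fun τ hτ => (hw τ hτ).sub (hw' τ hτ), fun ψ => ⟨?_, ?_⟩⟩
  · simpa only [tdist_sub_apply] using (hb ψ).1.sub (hb' ψ).1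
  · simp only [tdist_sub_apply]
    rw [intervalIntegral.integral_sub (hb ψ).1 (hb' ψ).1, (hb ψ).2, (hb' ψ).2]
    ring

theorem IsCurve.reflect (hQ : IsCurve φ s p μ (Set.Ioi 0) Q) {c : ℝ} {d : ℝ}
    (hd : d ≤ t) : IsCurve φ s p μ (Set.Ioo c d) fun σ => Q (t - σ) :=
  hQ.comp (by fun_prop) fun σ hσ => by
    have := hσ.2
    simp only [Set.mem_Ioi]
    linarith

theorem exists_isHeatIntegral (hφ : IsLittlewoodPaley φ) (hp : 1 ≤ p)
    (hs : s < massExp n p μ) (hγ : 0 ≤ γ) (hQ : IsCurve φ (s - 2 * γ) p μ (Set.Ioi 0) Q)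
    {M : ℝ≥0∞} (hM : M ≠ ∞) (hQM : ∀ τ, 0 < τ → fnN φ (s - 2 * γ) p μ (Q τ) ≤ M) (ht : 0 < t) :
    ∃ b, IsHeatIntegral γ Q t b ∧ fnN φ s p μ b ≤ pw (2 * γ) * M := by
  have hσ : s - 2 * γ < massExp n p μ := by linarith
  have hm : ∀ σ, ∃ w, σ ∈ Set.Ioo 0 t → IsMultiplier (heatSymbol γ σ) (Q (t - σ)) w := by
    intro σ
    by_cases h : σ ∈ Set.Ioo 0 t
    · obtain ⟨w, hw⟩ := (isMeas_of_fnN_lt_top hφ hp hσ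
        (hQ.finite (t - σ) (sub_pos.2 h.2))).exists_heat (γ := γ) h.1.le
      exact ⟨w, fun _ => hw⟩
    · exact ⟨0, fun h' => absurd h' h⟩
  choose w hw using hm
  obtain ⟨h1, B, hB, hn⟩ := (hQ.reflect le_rfl).exists_heat_integral hφ hp hs hγ le_rfl ht.le
    hw hM (fun τ hτ => hQM _ (sub_pos.2 hτ.2)) zero_le_one
    fun y hy => lintegral_exp_neg_mul_le hy le_rfl
  refine ⟨-B, ⟨w, hw, fun ψ => ⟨h1 ψ, ?_⟩⟩, ?_⟩
  · rw [tdist_neg_apply, hB]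
  · rwa [fnN_neg, ← one_mul (pw _ * M), ← ENNReal.ofReal_one]

/-- In the variable `σ` the time `t` enters through `Q (t - σ)`. On `(0, c)` with `c < t` the curve
`Q` is uniformly continuous and the full smoothing estimate applies. Near `σ = t`, where `Q` is only
bounded, the heat kernel is away from its singular time and the contribution is of size `(t - c)/c`.
-/
theorem IsHeatIntegral.tendsto (hφ : IsLittlewoodPaley φ) (hp : 1 ≤ p)
    (hs : s < massExp n p μ) (hγ : 0 ≤ γ) (hQ : IsCurve φ (s - 2 * γ) p μ (Set.Ioi 0) Q)
    {M : ℝ≥0∞} (hM : M ≠ ∞) (hQM : ∀ τ, 0 < τ → fnN φ (s - 2 * γ) p μ (Q τ) ≤ M)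
    {b : ℝ → TDist n} (hb : ∀ t, 0 < t → IsHeatIntegral γ Q t (b t)) (ht : 0 < t) :
    Tendsto (fun τ => fnN φ s p μ (b τ - b t)) (𝓝 t) (𝓝 0) := by
  have hσ : s - 2 * γ < massExp n p μ := by linarith
  refine ENNReal.tendsto_nhds_zero.2 fun ε hε => ?_
  have hε3 : ε / 3 ≠ 0 := (ENNReal.div_pos hε.ne' (by simp)).ne'
  have hKM : pw (2 * γ) * M ≠ ∞ := ENNReal.mul_ne_top (pw_ne_top _) hM
  -- the cut-off time
  obtain ⟨c, hc, hct, hcε⟩ : ∃ c, 0 < c ∧ c < t ∧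
      ENNReal.ofReal (2 * (t - c) / c) * (pw (2 * γ) * M) ≤ ε / 3 := by
    have h1 : Tendsto (fun c : ℝ => ENNReal.ofReal (2 * (t - c) / c) * (pw (2 * γ) * M))
        (𝓝[<] t) (𝓝 0) := by
      have h2 : ContinuousAt (fun c : ℝ => 2 * (t - c) / c) t := by
        have := ht.ne'
        fun_prop (disch := assumption)
      have h3 := (ENNReal.continuous_ofReal.tendsto _).comp
        (h2.tendsto.mono_left (nhdsWithin_le_nhds (s := Set.Iio t)))
      have := ENNReal.Tendsto.mul_const h3 (Or.inr hKM)
      simpa using this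
    have h4 := h1.eventually (ge_mem_nhds (pos_iff_ne_zero.2 hε3))
    have h5 : ∀ᶠ c in 𝓝[<] t, 0 < c := nhdsWithin_le_nhds (lt_mem_nhds ht)
    obtain ⟨c, ⟨hc1, hc2⟩, hc3⟩ := ((h4.and h5).and self_mem_nhdsWithin).exists
    exact ⟨c, hc2, hc3, hc1⟩
  have hK : pw (2 * γ) ≠ 0 := pw_ne_zero _
  -- The minimum with `1` keeps the bound finite, as the smoothing estimate requires.
  set ε' : ℝ≥0∞ := min (ε / 3 / pw (2 * γ)) 1 with hε'
  have hε'0 : ε' ≠ 0 := by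
    rw [hε', ← pos_iff_ne_zero, lt_min_iff]
    exact ⟨ENNReal.div_pos hε3 (pw_ne_top _), one_pos⟩
  have hε't : ε' ≠ ∞ := ((min_le_right _ _).trans_lt ENNReal.one_lt_top).ne
  obtain ⟨δ, hδ, hun⟩ := hQ.exists_pos_le isOpen_Ioi (isCompact_Icc (a := t - c) (b := t))
    (fun x hx => lt_of_lt_of_le (sub_pos.2 hct) hx.1) hε'0
  have hnear : ∀ᶠ τ in 𝓝 t, |τ - t| < min δ (t - c) :=
    (Metric.eventually_nhds_iff.2 ⟨min δ (t - c), lt_min hδ (sub_pos.2 hct),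
      fun τ hτ => by rwa [Real.dist_eq] at hτ⟩)
  filter_upwards [hnear] with τ hτ
  have hτδ := hτ.trans_le (min_le_left _ _)
  have hτc := abs_lt.1 (hτ.trans_le (min_le_right _ _))
  have hcτ : c < τ := by linarith [hτc.1]
  have hτ0 : 0 < τ := hc.trans hcτ
  obtain ⟨w, hw, hbw⟩ := hb t ht
  obtain ⟨w', hw', hbw'⟩ := hb τ hτ0
  obtain ⟨-, B₁, hB₁, hn₁⟩ := ((hQ.reflect (t := τ) hcτ.le).sub
    (hQ.reflect (t := t) hct.le)).exists_heat_integral (w := fun σ => w' σ - w σ)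
    (M := ε') (r := 1) hφ hp hs hγ le_rfl hc.le
    (fun σ hσ => (hw' σ ⟨hσ.1, hσ.2.trans hcτ⟩).sub (hw σ ⟨hσ.1, hσ.2.trans hct⟩)) hε't
    (fun σ hσ => hun _ ⟨by linarith [hσ.2], by linarith [hσ.1]⟩ _ (by
      rwa [sub_sub_sub_cancel_right])) zero_le_one
    fun y hy => lintegral_exp_neg_mul_le hy le_rfl
  have tail : ∀ {T : ℝ} {w : ℝ → TDist n}, c < T →
      (∀ σ ∈ Set.Ioo 0 T, IsMultiplier (heatSymbol γ σ) (Q (T - σ)) (w σ)) →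
      ∃ B : TDist n, (∀ ψ : 𝓢(Rn n, ℂ), B ψ = ∫ τ in c..T, w τ ψ) ∧
        fnN φ s p μ B ≤ ENNReal.ofReal ((T - c) / c) * (pw (2 * γ) * M) := by
    intro T w hT hw
    exact ((hQ.reflect le_rfl).exists_heat_integral hφ hp hs hγ hc.le hT.le
      (fun σ hσ => hw σ ⟨hc.trans hσ.1, hσ.2⟩) hM (fun σ hσ => hQM _ (sub_pos.2 hσ.2))
      (div_nonneg (sub_nonneg.2 hT.le) hc.le) fun y hy => lintegral_exp_neg_mul_le' hy hc).2
  obtain ⟨B₂, hB₂, hn₂⟩ := tail hcτ hw'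
  obtain ⟨B₃, hB₃, hn₃⟩ := tail hct hw
  have hsub : ∀ {T : ℝ} {w : ℝ → TDist n} {ψ : 𝓢(Rn n, ℂ)}, c < T →
      IntervalIntegrable (fun σ => w σ ψ) volume 0 T →
      IntervalIntegrable (fun σ => w σ ψ) volume 0 c ∧
        IntervalIntegrable (fun σ => w σ ψ) volume c T := by
    intro T w ψ hT h
    refine ⟨h.mono_set ?_, h.mono_set ?_⟩
    · rw [Set.uIcc_of_le hc.le, Set.uIcc_of_le (hc.trans hT).le]
      exact Set.Icc_subset_Icc_right hT.le
    · rw [Set.uIcc_of_le hT.le, Set.uIcc_of_le (hc.trans hT).le]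
      exact Set.Icc_subset_Icc_left hc.le
  have hdec : b τ - b t = -(B₁ + (B₂ - B₃)) := by
    refine tdist_ext fun ψ => ?_
    obtain ⟨h1, h2⟩ := hsub hct (hbw ψ).1
    obtain ⟨h3, h4⟩ := hsub hcτ (hbw' ψ).1
    rw [tdist_neg_apply, tdist_add_apply, tdist_sub_apply, tdist_sub_apply, (hbw ψ).2, (hbw' ψ).2,
      hB₁, hB₂, hB₃, ← intervalIntegral.integral_add_adjacent_intervals h1 h2,
      ← intervalIntegral.integral_add_adjacent_intervals h3 h4]
    simp only [tdist_sub_apply]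
    rw [intervalIntegral.integral_sub h3 h1]
    ring
  rw [hdec, fnN_neg]
  have e1 : fnN φ s p μ B₁ ≤ ε / 3 := by
    refine hn₁.trans ?_
    rw [ENNReal.ofReal_one, one_mul]
    calc pw (2 * γ) * ε' ≤ pw (2 * γ) * (ε / 3 / pw (2 * γ)) := by
          gcongr
          exact min_le_left _ _
      _ = ε / 3 := ENNReal.mul_div_cancel hK (pw_ne_top _)
  -- Nearby end points satisfy `T - c ≤ 2 (t - c)`; this explains the factor `2` in the choice of
  -- `c`.
  have e2 : ∀ {T : ℝ} {B : TDist n}, T ≤ 2 * t - c →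
      fnN φ s p μ B ≤ ENNReal.ofReal ((T - c) / c) * (pw (2 * γ) * M) →
      fnN φ s p μ B ≤ ε / 3 := by
    intro T B hT h
    refine h.trans (le_trans ?_ hcε)
    gcongr
    linarith
  calc fnN φ s p μ (B₁ + (B₂ - B₃)) ≤ fnN φ s p μ B₁ + (fnN φ s p μ B₂ + fnN φ s p μ B₃) :=
        (fnN_add_le _ _).trans (add_le_add_right (fnN_sub_le _ _) _)
    _ ≤ ε / 3 + (ε / 3 + ε / 3) :=
        add_le_add e1 (add_le_add (e2 (by linarith [hτc.2]) hn₂) (e2 (by linarith) hn₃))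
    _ = ε := by rw [← add_assoc, ENNReal.add_thirds]

/-- No smoothing is used: the heat flow contracts the weaker space that contains `Q`, so the tested
integrand is bounded and the integral is `O(t)`. This gives the weak convergence to the data. -/
theorem exists_enorm_heatIntegral_apply_le (hφ : IsLittlewoodPaley φ) (hp : 1 ≤ p)
    (hσ : s < massExp n p μ) (ψ : 𝓢(Rn n, ℂ)) : ∃ C : ℝ≥0∞, C ≠ ∞ ∧
      ∀ (γ : ℝ) (Q : ℝ → TDist n) (M : ℝ≥0∞) (t : ℝ) (b : TDist n), 0 < t →
        (∀ τ, 0 < τ → fnN φ s p μ (Q τ) ≤ M) → IsHeatIntegral γ Q t b →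
        ‖b ψ‖ₑ ≤ ENNReal.ofReal t * (C * M) := by
  obtain ⟨C, hC, h⟩ := exists_enorm_apply_le (μ := μ) hφ hp hσ ψ
  refine ⟨C, hC, fun γ Q M t b ht hQ ⟨w, hw, hb⟩ => ?_⟩
  rw [(hb ψ).2, enorm_neg, intervalIntegral.integral_of_le ht.le, integral_Ioc_eq_integral_Ioo]
  refine (enorm_integral_le_lintegral_enorm _).trans ?_
  calc ∫⁻ σ in Set.Ioo 0 t, ‖w σ ψ‖ₑ ≤ ∫⁻ _ in Set.Ioo 0 t, C * M := by
        refine setLIntegral_mono' measurableSet_Ioo fun σ hσt => (h _).trans ?_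
        gcongr
        have h1 := (hw σ hσt).fnN_le_of_norm_le (μ := μ) hφ hp hσ (D := 1) fun ξ _ =>
          enorm_heatSymbol_le_one hσt.1.le ξ
        rw [one_mul] at h1
        exact h1.trans (hQ _ (sub_pos.2 hσt.2))
    _ = ENNReal.ofReal t * (C * M) := by
        rw [setLIntegral_const, Real.volume_Ioo, sub_zero, mul_comm]

end

/-! ### The Duhamel term of bounded continuous curves -/

section

variable {n : ℕ} {φ : 𝓢(Rn n, ℂ)} {s : ℝ} {p : ℝ≥0∞} {μ γ β : ℝ}
  {a : Fin n → Fin n → ℂ} {P : Fin n → Rn n → ℂ}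
  {f f' g g' b b' Q e x y : ℝ → TDist n} {f₀ g₀ c c' : TDist n} {t : ℝ}

/-- The nonlinearity acts at each time separately, and time enters otherwise only through a linear
heat integral. The reflection `τ = t - σ` makes the symbol independent of `t`. -/
theorem isDuhamel_iff : IsDuhamel γ a P f g t c ↔
    ∃ Q : ℝ → TDist n, (∀ τ ∈ Set.Ioo 0 t, IsFlux a P (f τ) (g τ) (Q τ)) ∧
      IsHeatIntegral γ Q t c := by
  have hrefl : ∀ F : ℝ → ℂ, IntervalIntegrable F volume 0 t →
      IntervalIntegrable (fun σ => F (t - σ)) volume 0 t := by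
    intro F hF
    have := (hF.comp_sub_left t).symm
    simpa using this
  constructor
  · rintro ⟨u, w, v, hv, hb⟩
    refine ⟨fun τ => ∑ k, ∂_{(EuclideanSpace.single k 1 : Rn n)} (w k τ), fun τ hτ =>
      ⟨fun k => u k τ, fun k => w k τ, (hv τ hτ.1 hτ.2).1, rfl⟩, fun σ => v (t - σ),
      fun σ hσ => ?_, fun ψ => ⟨hrefl _ (hb ψ).1, ?_⟩⟩
    · have := (hv (t - σ) (sub_pos.2 hσ.2) (by linarith [hσ.1])).2
      rwa [sub_sub_cancel] at this
    · rw [(hb ψ).2, intervalIntegral.integral_comp_sub_left (fun τ => v τ ψ) t, sub_self, sub_zero]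
  · rintro ⟨Q, hQ, w, hw, hb⟩
    have hQ' : ∀ τ, ∃ uw : (Fin n → TDist n) × (Fin n → TDist n), τ ∈ Set.Ioo 0 t →
        (∀ k, IsMultiplier (velocitySymbol a P k) (f τ) (uw.1 k) ∧
          IsProduct (uw.1 k) (g τ) (uw.2 k)) ∧
        Q τ = ∑ k, ∂_{(EuclideanSpace.single k 1 : Rn n)} (uw.2 k) := by
      intro τ
      by_cases h : τ ∈ Set.Ioo 0 t
      · obtain ⟨u, w, h1, h2⟩ := hQ τ h
        exact ⟨(u, w), fun _ => ⟨h1, h2⟩⟩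
      · exact ⟨0, fun h' => absurd h' h⟩
    choose uw huw using hQ'
    refine ⟨fun k τ => (uw τ).1 k, fun k τ => (uw τ).2 k, fun τ => w (t - τ), fun τ h0 ht' =>
      ⟨(huw τ ⟨h0, ht'⟩).1, ?_⟩, fun ψ => ⟨hrefl _ (hb ψ).1, ?_⟩⟩
    · rw [← (huw τ ⟨h0, ht'⟩).2]
      have := hw (t - τ) ⟨sub_pos.2 ht', by linarith⟩
      rwa [sub_sub_cancel] at this
    · rw [(hb ψ).2, intervalIntegral.integral_comp_sub_left (fun σ => w σ ψ) t, sub_self, sub_zero]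

theorem IsDuhamel.unique (ht : 0 < t) (h : IsDuhamel γ a P f g t c)
    (h' : IsDuhamel γ a P f g t c') : c = c' := by
  obtain ⟨Q, hQ, hc⟩ := isDuhamel_iff.1 h
  obtain ⟨Q', hQ', hc'⟩ := isDuhamel_iff.1 h'
  exact hc.unique ht.le (hc'.congr fun τ hτ => (hQ' τ hτ).unique (hQ τ hτ))

theorem IsDuhamel.sub_left (h : IsDuhamel γ a P f g t c)
    (h' : IsDuhamel γ a P f' g t c') : IsDuhamel γ a P (fun τ => f τ - f' τ) g t (c - c') := by
  obtain ⟨Q, hQ, hc⟩ := isDuhamel_iff.1 h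
  obtain ⟨Q', hQ', hc'⟩ := isDuhamel_iff.1 h'
  exact isDuhamel_iff.2 ⟨_, fun τ hτ => (hQ τ hτ).sub_left (hQ' τ hτ), hc.sub hc'⟩

theorem IsDuhamel.sub_right (h : IsDuhamel γ a P f g t c)
    (h' : IsDuhamel γ a P f g' t c') : IsDuhamel γ a P f (fun τ => g τ - g' τ) t (c - c') := by
  obtain ⟨Q, hQ, hc⟩ := isDuhamel_iff.1 h
  obtain ⟨Q', hQ', hc'⟩ := isDuhamel_iff.1 h'
  exact isDuhamel_iff.2 ⟨_, fun τ hτ => (hQ τ hτ).sub_right (hQ' τ hτ), hc.sub hc'⟩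

theorem IsDuhamel.congr (h : IsDuhamel γ a P f g t c)
    (hf : ∀ τ, 0 < τ → f τ = f' τ) (hg : ∀ τ, 0 < τ → g τ = g' τ) :
    IsDuhamel γ a P f' g' t c := by
  obtain ⟨Q, hQ, hc⟩ := isDuhamel_iff.1 h
  refine isDuhamel_iff.2 ⟨Q, fun τ hτ => ?_, hc⟩
  rw [← hf τ hτ.1, ← hg τ hτ.1]
  exact hQ τ hτ

/-- `sup_{t > 0} ‖f(t)‖` for a curve of canonical representatives. -/
def pathN (φ : 𝓢(Rn n, ℂ)) (s : ℝ) (p : ℝ≥0∞) (μ : ℝ) (f : ℝ → TDist n) : ℝ≥0∞ :=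
  ⨆ (t : ℝ) (_ : 0 < t), fnN φ s p μ (f t)

theorem le_pathN (f : ℝ → TDist n) (ht : 0 < t) : fnN φ s p μ (f t) ≤ pathN φ s p μ f :=
  le_iSup₂ (f := fun (t : ℝ) (_ : 0 < t) => fnN φ s p μ (f t)) t ht

theorem pathN_le {A : ℝ≥0∞} (h : ∀ t, 0 < t → fnN φ s p μ (f t) ≤ A) : pathN φ s p μ f ≤ A :=
  iSup₂_le h

theorem pathN_add_le (f g : ℝ → TDist n) :
    pathN φ s p μ (fun t => f t + g t) ≤ pathN φ s p μ f + pathN φ s p μ g :=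
  pathN_le fun _ ht => (fnN_add_le _ _).trans (add_le_add (le_pathN f ht) (le_pathN g ht))

theorem pathN_sub_comm (f g : ℝ → TDist n) :
    pathN φ s p μ (fun t => f t - g t) = pathN φ s p μ fun t => g t - f t :=
  iSup_congr fun t => iSup_congr fun _ => by rw [← fnN_neg, neg_sub]

/-- Bounded continuous curves of canonical representatives. -/
structure IsBddCurve (φ : 𝓢(Rn n, ℂ)) (s : ℝ) (p : ℝ≥0∞) (μ : ℝ) (f : ℝ → TDist n) : Prop where
  bounded : pathN φ s p μ f < ∞
  continuous : ∀ t, 0 < t → Tendsto (fun τ => fnN φ s p μ (f τ - f t)) (𝓝 t) (𝓝 0)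

theorem IsBddCurve.lt_top (hf : IsBddCurve φ s p μ f) (ht : 0 < t) : fnN φ s p μ (f t) < ∞ :=
  (le_pathN f ht).trans_lt hf.bounded

theorem IsBddCurve.isCurve (hf : IsBddCurve φ s p μ f) : IsCurve φ s p μ (Set.Ioi 0) f :=
  ⟨fun _ ht => hf.lt_top ht, fun t ht => (hf.continuous t ht).mono_left nhdsWithin_le_nhds⟩

theorem IsCurve.isBddCurve (hf : IsCurve φ s p μ (Set.Ioi 0) f) (h : pathN φ s p μ f < ∞) :
    IsBddCurve φ s p μ f :=
  ⟨h, fun t ht => by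
    have := hf.continuous t ht
    rwa [isOpen_Ioi.nhdsWithin_eq ht] at this⟩

theorem IsBddCurve.sub (hf : IsBddCurve φ s p μ f) (hg : IsBddCurve φ s p μ g) :
    IsBddCurve φ s p μ fun t => f t - g t := by
  refine (hf.isCurve.sub hg.isCurve).isBddCurve ?_
  refine lt_of_le_of_lt (pathN_le fun t ht => (fnN_sub_le _ _).trans
    (add_le_add (le_pathN f ht) (le_pathN g ht))) (ENNReal.add_lt_top.2 ⟨hf.bounded, hg.bounded⟩)

theorem IsBddCurve.add (hf : IsBddCurve φ s p μ f) (hg : IsBddCurve φ s p μ g) :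
    IsBddCurve φ s p μ fun t => f t + g t := by
  refine ⟨(pathN_add_le f g).trans_lt (ENNReal.add_lt_top.2 ⟨hf.bounded, hg.bounded⟩),
    fun t ht => tendsto_zero_of_le_add (fun τ => ?_) (hf.continuous t ht) (hg.continuous t ht)⟩
  rw [add_sub_add_comm]
  exact fnN_add_le _ _

theorem isBddCurve_zero : IsBddCurve φ s p μ fun _ => (0 : TDist n) := by
  refine ⟨lt_of_le_of_lt (pathN_le (A := 0) fun t _ => fnN_zero.le) (by simp), fun t _ => ?_⟩
  simp only [sub_self, fnN_zero]
  exact tendsto_const_nhds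

theorem exists_isBddCurve_flux (hφ : IsLittlewoodPaley φ) (hA : IsAdmissibleParam n p μ γ β s)
    (hP : ∀ j, IsAdmissibleSymbol p β (P j)) (a : Fin n → Fin n → ℂ) :
    ∃ C : ℝ≥0∞, C ≠ ∞ ∧ ∀ f g, IsBddCurve φ s p μ f → IsBddCurve φ s p μ g →
      ∃ Q : ℝ → TDist n, (∀ τ, 0 < τ → IsFlux a P (f τ) (g τ) (Q τ)) ∧
        IsCurve φ (s - 2 * γ) p μ (Set.Ioi 0) Q ∧
        ∀ τ, 0 < τ → fnN φ (s - 2 * γ) p μ (Q τ) ≤ C * (pathN φ s p μ f * pathN φ s p μ g) := by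
  obtain ⟨C, hC, h⟩ := exists_fnN_flux_le (μ := μ) hφ hA hP a
  refine ⟨C, hC, fun f g hf hg => ?_⟩
  have hQ : ∀ τ, ∃ q, 0 < τ → IsFlux a P (f τ) (g τ) q := by
    intro τ
    by_cases hτ : 0 < τ
    · obtain ⟨q, hq⟩ := exists_isFlux (a := a) hφ hA hP (hf.lt_top hτ) (hg.lt_top hτ)
      exact ⟨q, fun _ => hq⟩
    · exact ⟨0, fun h' => absurd h' hτ⟩
  choose Q hQ using hQ
  have hbd : ∀ τ, 0 < τ →
      fnN φ (s - 2 * γ) p μ (Q τ) ≤ C * (pathN φ s p μ f * pathN φ s p μ g) := fun τ hτ =>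
    (h _ _ _ (hf.lt_top hτ) (hg.lt_top hτ) (hQ τ hτ)).trans
      (mul_le_mul_right (mul_le_mul' (le_pathN f hτ) (le_pathN g hτ)) _)
  refine ⟨Q, hQ, ⟨fun τ hτ => (hbd τ hτ).trans_lt
    (ENNReal.mul_lt_top hC.lt_top (ENNReal.mul_lt_top hf.bounded hg.bounded)), fun t ht => ?_⟩, hbd⟩
  have ht0 : 0 < t := ht
  have hlim : Tendsto (fun τ => C * (fnN φ s p μ (f τ - f t) * pathN φ s p μ g) +
      C * (fnN φ s p μ (f t) * fnN φ s p μ (g τ - g t))) (𝓝[Set.Ioi 0] t) (𝓝 0) := by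
    have h1 := ENNReal.Tendsto.const_mul (a := C)
      (ENNReal.Tendsto.mul_const (b := pathN φ s p μ g) (hf.isCurve.continuous t ht)
        (Or.inr hg.bounded.ne)) (Or.inr hC)
    have h2 := ENNReal.Tendsto.const_mul (a := C)
      (ENNReal.Tendsto.const_mul (a := fnN φ s p μ (f t)) (hg.isCurve.continuous t ht)
        (Or.inr (hf.lt_top ht0).ne)) (Or.inr hC)
    have := h1.add h2
    simpa using this
  refine tendsto_of_tendsto_of_tendsto_of_le_of_le' tendsto_const_nhds hlim
    (Eventually.of_forall fun _ => zero_le) ?_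
  filter_upwards [self_mem_nhdsWithin] with τ hτ
  have hτ0 : 0 < τ := hτ
  -- The intermediate flux of `f t` and `g τ` lets one factor vary at a time.
  obtain ⟨q, hq⟩ := exists_isFlux (a := a) hφ hA hP (hf.lt_top ht0) (hg.lt_top hτ0)
  have he : Q τ - Q t = (Q τ - q) + (q - Q t) := by abel
  rw [he]
  refine (fnN_add_le _ _).trans (add_le_add ?_ ?_)
  · refine (h _ _ _ ((fnN_sub_le _ _).trans_lt
      (ENNReal.add_lt_top.2 ⟨hf.lt_top hτ0, hf.lt_top ht0⟩)) (hg.lt_top hτ0)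
      ((hQ τ hτ0).sub_left hq)).trans ?_
    gcongr
    exact le_pathN g hτ0
  · exact h _ _ _ (hf.lt_top ht0) ((fnN_sub_le _ _).trans_lt
      (ENNReal.add_lt_top.2 ⟨hg.lt_top hτ0, hg.lt_top ht0⟩)) (hq.sub_right (hQ t ht0))

theorem exists_duhamel (hφ : IsLittlewoodPaley φ) (hA : IsAdmissibleParam n p μ γ β s)
    (hP : ∀ j, IsAdmissibleSymbol p β (P j)) (a : Fin n → Fin n → ℂ) :
    ∃ C : ℝ≥0∞, C ≠ ∞ ∧ ∀ f g, IsBddCurve φ s p μ f → IsBddCurve φ s p μ g →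
      ∃ b : ℝ → TDist n, (∀ t, 0 < t → IsDuhamel γ a P f g t (b t)) ∧ IsBddCurve φ s p μ b ∧
        pathN φ s p μ b ≤ C * (pathN φ s p μ f * pathN φ s p μ g) := by
  obtain ⟨C, hC, h⟩ := exists_isBddCurve_flux (μ := μ) hφ hA hP a
  have hγ : 0 ≤ γ := by linarith [hA.one_lt_two_mul]
  refine ⟨pw (2 * γ) * C, ENNReal.mul_ne_top (pw_ne_top _) hC, fun f g hf hg => ?_⟩
  obtain ⟨Q, hQ, hQc, hQM⟩ := h f g hf hg
  have hM : C * (pathN φ s p μ f * pathN φ s p μ g) ≠ ∞ :=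
    ENNReal.mul_ne_top hC (ENNReal.mul_ne_top hf.bounded.ne hg.bounded.ne)
  have hb : ∀ t, ∃ b, 0 < t → IsHeatIntegral γ Q t b ∧
      fnN φ s p μ b ≤ pw (2 * γ) * (C * (pathN φ s p μ f * pathN φ s p μ g)) := by
    intro t
    by_cases ht : 0 < t
    · obtain ⟨b, hb⟩ := exists_isHeatIntegral hφ hA.one_le hA.lt_massExp hγ hQc hM hQM ht
      exact ⟨b, fun _ => hb⟩
    · exact ⟨0, fun h' => absurd h' ht⟩
  choose b hb using hb
  have hle : pathN φ s p μ b ≤ pw (2 * γ) * C * (pathN φ s p μ f * pathN φ s p μ g) := by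
    rw [mul_assoc]
    exact pathN_le fun t ht => (hb t ht).2
  refine ⟨b, fun t ht => isDuhamel_iff.2 ⟨Q, fun τ hτ => hQ τ hτ.1, (hb t ht).1⟩,
    ⟨hle.trans_lt ?_, fun t ht => ?_⟩, hle⟩
  · rw [mul_assoc]
    exact ENNReal.mul_lt_top (pw_ne_top _).lt_top hM.lt_top
  · exact IsHeatIntegral.tendsto hφ hA.one_le hA.lt_massExp hγ hQc hM hQM
      (fun t ht => (hb t ht).1) ht

theorem exists_enorm_duhamel_apply_le (hφ : IsLittlewoodPaley φ)
    (hA : IsAdmissibleParam n p μ γ β s) (hP : ∀ j, IsAdmissibleSymbol p β (P j))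
    (a : Fin n → Fin n → ℂ) (ψ : 𝓢(Rn n, ℂ)) :
    ∃ C : ℝ≥0∞, C ≠ ∞ ∧ ∀ f g t c, IsBddCurve φ s p μ f → IsBddCurve φ s p μ g → 0 < t →
      IsDuhamel γ a P f g t c →
        ‖c ψ‖ₑ ≤ ENNReal.ofReal t * (C * (pathN φ s p μ f * pathN φ s p μ g)) := by
  obtain ⟨C, hC, h⟩ := exists_isBddCurve_flux (μ := μ) hφ hA hP a
  obtain ⟨D, hD, hd⟩ := exists_enorm_heatIntegral_apply_le (μ := μ) hφ hA.one_le
    hA.sub_lt_massExp ψ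
  refine ⟨D * C, ENNReal.mul_ne_top hD hC, fun f g t c hf hg ht hc => ?_⟩
  obtain ⟨Q, hQ, -, hQM⟩ := h f g hf hg
  obtain ⟨Q', hQ', hc'⟩ := isDuhamel_iff.1 hc
  rw [mul_assoc D]
  exact hd γ Q _ t c ht hQM (hc'.congr fun τ hτ => (hQ' τ hτ).unique (hQ τ hτ.1))

theorem exists_heat (hφ : IsLittlewoodPaley φ) (hp : 1 ≤ p) (hs : s < massExp n p μ)
    (hf : fnN φ s p μ f₀ < ∞) (γ : ℝ) : ∃ e : ℝ → TDist n,
      (∀ t, 0 < t → IsMultiplier (heatSymbol γ t) f₀ (e t)) ∧ IsBddCurve φ s p μ e := by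
  have he : ∀ t, ∃ e, 0 < t → IsMultiplier (heatSymbol γ t) f₀ e := by
    intro t
    by_cases ht : 0 < t
    · obtain ⟨e, he⟩ := (isMeas_of_fnN_lt_top hφ hp hs hf).exists_heat (γ := γ) ht.le
      exact ⟨e, fun _ => he⟩
    · exact ⟨0, fun h' => absurd h' ht⟩
  choose e he using he
  have hconst : IsCurve φ s p μ (Set.Ioi 0) fun _ => f₀ := by
    refine ⟨fun _ _ => hf, fun t _ => ?_⟩
    simp only [sub_self, fnN_zero]
    exact tendsto_const_nhds
  refine ⟨e, he, (hconst.heat hφ hp hs subset_rfl he).isBddCurve ?_⟩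
  refine lt_of_le_of_lt (pathN_le fun t ht => ?_) hf
  have := (he t ht).fnN_le_of_norm_le (μ := μ) hφ hp hs (D := 1) fun ξ _ =>
    enorm_heatSymbol_le_one ht.le ξ
  rwa [one_mul] at this

theorem fnN_heat_le (hφ : IsLittlewoodPaley φ) (hp : 1 ≤ p) (hs : s < massExp n p μ)
    (ht : 0 ≤ t) (h : IsMultiplier (heatSymbol γ t) f₀ c) : fnN φ s p μ c ≤ fnN φ s p μ f₀ := by
  have := h.fnN_le_of_norm_le (μ := μ) hφ hp hs (D := 1) fun ξ _ => enorm_heatSymbol_le_one ht ξ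
  rwa [one_mul] at this

/-- The heat semigroup is weakly continuous at `t = 0`. -/
theorem tendsto_heat_apply (he : ∀ t, 0 < t → IsMultiplier (heatSymbol γ t) f₀ (e t))
    (ψ : 𝓢(Rn n, ℂ)) : Tendsto (fun t => e t ψ) (𝓝[>] 0) (𝓝 (f₀ ψ)) := by
  obtain ⟨ν, h, H⟩ := (he 1 one_pos).isMeas_left
  set χ := invTestFourier ψ
  have hint := H.integrable χ
  rw [apply_eq_fourierDist f₀, H.eq_integral]
  have heq : ∀ᶠ t in 𝓝[>] (0 : ℝ), ∫ ξ, heatSymbol γ t ξ * (χ ξ * h ξ) ∂ν = e t ψ := by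
    filter_upwards [self_mem_nhdsWithin] with t ht
    rw [apply_eq_fourierDist (e t), ((he t ht).density H).eq_integral]
    exact integral_congr_ae (Eventually.of_forall fun ξ => by simp only [χ]; ring)
  refine Tendsto.congr' heq ?_
  refine tendsto_integral_filter_of_dominated_convergence (fun ξ => ‖χ ξ * h ξ‖)
    (Eventually.of_forall fun t =>
      (measurable_heatSymbol γ t).aestronglyMeasurable.mul hint.1) ?_ hint.norm
    (Eventually.of_forall fun ξ => ?_)
  · filter_upwards [self_mem_nhdsWithin] with t ht
    refine Eventually.of_forall fun ξ => ?_
    rw [norm_mul]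
    have h1 := enorm_heatSymbol_le_one (γ := γ) (le_of_lt ht) ξ
    have h2 : ‖heatSymbol γ t ξ‖ ≤ 1 := by
      rw [← ofReal_norm, ENNReal.ofReal_le_one] at h1
      exact h1
    exact mul_le_of_le_one_left (norm_nonneg _) h2
  · have hc : Continuous fun t : ℝ => heatSymbol γ t ξ * (χ ξ * h ξ) := by
      unfold heatSymbol
      fun_prop
    have := (hc.tendsto 0).mono_left (nhdsWithin_le_nhds (s := Set.Ioi 0))
    simpa [heatSymbol] using this

end

/-! ### Picard iteration -/

section

variable {n : ℕ} {φ : 𝓢(Rn n, ℂ)} {s : ℝ} {p : ℝ≥0∞} {μ γ β K ε : ℝ}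
  {a : Fin n → Fin n → ℂ} {P : Fin n → Rn n → ℂ}
  {f g x x' y y' : ℝ → TDist n} {f₀ g₀ : TDist n} {t : ℝ}

/-- The bilinear estimate with the constant `K`, for curves of canonical representatives. -/
def IsCurveConst (φ : 𝓢(Rn n, ℂ)) (s : ℝ) (p : ℝ≥0∞) (μ γ : ℝ) (a : Fin n → Fin n → ℂ)
    (P : Fin n → Rn n → ℂ) (K : ℝ) : Prop :=
  ∀ f g b : ℝ → TDist n, IsBddCurve φ s p μ f → IsBddCurve φ s p μ g →
    (∀ t, 0 < t → IsDuhamel γ a P f g t (b t)) →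
      pathN φ s p μ b ≤ ENNReal.ofReal K * pathN φ s p μ f * pathN φ s p μ g

/-- `x'(t) = G_γ(t) f₀ + 𝓑(x, x)(t)` for `t > 0`. -/
def IsStep (γ : ℝ) (a : Fin n → Fin n → ℂ) (P : Fin n → Rn n → ℂ) (f₀ : TDist n)
    (x x' : ℝ → TDist n) : Prop :=
  ∀ t, 0 < t → ∃ e b : TDist n,
    IsMultiplier (heatSymbol γ t) f₀ e ∧ IsDuhamel γ a P x x t b ∧ x' t = e + b

/-- Absorption of the last term into the left-hand side, which is legitimate because `X` is finite.
-/
theorem le_mul_of_le_add_mul {X D : ℝ≥0∞} {q : ℝ} (hq : 0 ≤ q) (hq1 : q < 1) (hX : X ≠ ∞)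
    (h : X ≤ D + ENNReal.ofReal q * X) : X ≤ ENNReal.ofReal (1 - q)⁻¹ * D := by
  have h1 : 0 < 1 - q := by linarith
  rcases eq_or_ne D ∞ with rfl | hD
  · rw [ENNReal.mul_top]
    · exact le_top
    · exact (ENNReal.ofReal_pos.2 (inv_pos.2 h1)).ne'
  · lift X to ℝ≥0 using hX
    lift D to ℝ≥0 using hD
    rw [← ENNReal.ofReal_coe_nnreal (p := X), ← ENNReal.ofReal_coe_nnreal (p := D)] at h ⊢
    rw [← ENNReal.ofReal_mul hq, ← ENNReal.ofReal_add D.coe_nonneg (mul_nonneg hq X.coe_nonneg),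
      ENNReal.ofReal_le_ofReal_iff (add_nonneg D.coe_nonneg (mul_nonneg hq X.coe_nonneg))] at h
    rw [← ENNReal.ofReal_mul (inv_nonneg.2 h1.le)]
    apply ENNReal.ofReal_le_ofReal
    rw [inv_mul_eq_div, le_div_iff₀ h1]
    linarith

theorem isBddCurve_of_isStep (hφ : IsLittlewoodPaley φ) (hA : IsAdmissibleParam n p μ γ β s)
    (hP : ∀ j, IsAdmissibleSymbol p β (P j)) (hf₀ : fnN φ s p μ f₀ < ∞)
    (hx : IsBddCurve φ s p μ x) :
    ∃ x', IsBddCurve φ s p μ x' ∧ IsStep γ a P f₀ x x' := by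
  obtain ⟨C, -, h⟩ := exists_duhamel (μ := μ) hφ hA hP a
  obtain ⟨b, hb, hbc, -⟩ := h x x hx hx
  obtain ⟨e, he, hec⟩ := exists_heat hφ hA.one_le hA.lt_massExp hf₀ γ
  exact ⟨_, hec.add hbc, fun t ht => ⟨e t, b t, he t ht, hb t ht, rfl⟩⟩

/-- The ball is preserved because `ε + K (2ε)² = ε + 4Kε · ε ≤ 2ε`. -/
theorem IsStep.pathN_le (hφ : IsLittlewoodPaley φ) (hA : IsAdmissibleParam n p μ γ β s)
    (hK : IsCurveConst φ s p μ γ a P K) (hK0 : 0 < K) (hε : 0 < ε) (hKε : 4 * K * ε < 1)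
    (hx : IsBddCurve φ s p μ x) (hxε : pathN φ s p μ x ≤ ENNReal.ofReal (2 * ε))
    (hf₀ : fnN φ s p μ f₀ ≤ ENNReal.ofReal ε) (h : IsStep γ a P f₀ x x') :
    pathN φ s p μ x' ≤ ENNReal.ofReal (2 * ε) := by
  have h' : ∀ t, ∃ b, 0 < t → ∃ e, IsMultiplier (heatSymbol γ t) f₀ e ∧
      IsDuhamel γ a P x x t b ∧ x' t = e + b := by
    intro t
    by_cases ht : 0 < t
    · obtain ⟨e, b, h1⟩ := h t ht
      exact ⟨b, fun _ => ⟨e, h1⟩⟩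
    · exact ⟨0, fun h' => absurd h' ht⟩
  choose b hb using h'
  have hbK := hK x x b hx hx fun t ht => (hb t ht).choose_spec.2.1
  refine ActiveScalar.pathN_le fun t ht => ?_
  obtain ⟨e, he, hbt, hxt⟩ := hb t ht
  rw [hxt]
  calc fnN φ s p μ (e + b t) ≤ fnN φ s p μ e + fnN φ s p μ (b t) := fnN_add_le _ _
    _ ≤ ENNReal.ofReal ε +
        ENNReal.ofReal K * ENNReal.ofReal (2 * ε) * ENNReal.ofReal (2 * ε) :=
        add_le_add ((fnN_heat_le hφ hA.one_le hA.lt_massExp ht.le he).trans hf₀)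
          ((le_pathN b ht).trans (hbK.trans (by gcongr)))
    _ ≤ ENNReal.ofReal (2 * ε) := by
        rw [← ENNReal.ofReal_mul hK0.le, ← ENNReal.ofReal_mul (by positivity),
          ← ENNReal.ofReal_add hε.le (by positivity)]
        apply ENNReal.ofReal_le_ofReal
        nlinarith

theorem IsStep.pathN_sub_le (hφ : IsLittlewoodPaley φ) (hA : IsAdmissibleParam n p μ γ β s)
    (hP : ∀ j, IsAdmissibleSymbol p β (P j))
    (hK : IsCurveConst φ s p μ γ a P K) (hK0 : 0 < K) (hε : 0 < ε)
    (hx : IsBddCurve φ s p μ x) (hxε : pathN φ s p μ x ≤ ENNReal.ofReal (2 * ε))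
    (hy : IsBddCurve φ s p μ y) (hyε : pathN φ s p μ y ≤ ENNReal.ofReal (2 * ε))
    (hxx : IsStep γ a P f₀ x x') (hyy : IsStep γ a P g₀ y y') :
    pathN φ s p μ (fun t => x' t - y' t) ≤ fnN φ s p μ (f₀ - g₀) +
      ENNReal.ofReal (4 * K * ε) * pathN φ s p μ (fun t => x t - y t) := by
  obtain ⟨C, -, h⟩ := exists_duhamel (μ := μ) hφ hA hP a
  obtain ⟨bx, hbx, -, -⟩ := h x x hx hx
  obtain ⟨by', hby, -, -⟩ := h y y hy hy
  -- The mixed term `𝓑(y, x)` gives `𝓑(x, x) - 𝓑(y, y) = 𝓑(x - y, x) + 𝓑(y, x - y)`. Each summand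
  -- costs `2Kε`, whence the ratio `4Kε`.
  obtain ⟨c, hc, -, -⟩ := h y x hy hx
  have h1 := hK (fun t => x t - y t) x (fun t => bx t - c t) (hx.sub hy) hx
    fun t ht => (hbx t ht).sub_left (hc t ht)
  have h2 := hK y (fun t => x t - y t) (fun t => c t - by' t) hy (hx.sub hy)
    fun t ht => (hc t ht).sub_right (hby t ht)
  refine ActiveScalar.pathN_le fun t ht => ?_
  obtain ⟨e, b, he, hb, hxt⟩ := hxx t ht
  obtain ⟨e', b', he', hb', hyt⟩ := hyy t ht
  rw [hxt, hyt, hb.unique ht (hbx t ht), hb'.unique ht (hby t ht)]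
  have hd : e + bx t - (e' + by' t) = (e - e') + ((bx t - c t) + (c t - by' t)) := by abel
  rw [hd]
  set X := pathN φ s p μ (fun t => x t - y t)
  calc fnN φ s p μ ((e - e') + ((bx t - c t) + (c t - by' t)))
      ≤ fnN φ s p μ (e - e') + (fnN φ s p μ (bx t - c t) + fnN φ s p μ (c t - by' t)) :=
        (fnN_add_le _ _).trans (add_le_add_right (fnN_add_le _ _) _)
    _ ≤ fnN φ s p μ (f₀ - g₀) + (ENNReal.ofReal K * X * ENNReal.ofReal (2 * ε) +
          ENNReal.ofReal K * ENNReal.ofReal (2 * ε) * X) := by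
        refine add_le_add (fnN_heat_le hφ hA.one_le hA.lt_massExp ht.le (he.sub he'))
          (add_le_add ?_ ?_)
        · exact (le_pathN (fun t => bx t - c t) ht).trans (h1.trans (by gcongr))
        · exact (le_pathN (fun t => c t - by' t) ht).trans (h2.trans (by gcongr))
    _ = _ := by
        rw [show 4 * K * ε = K * (2 * ε) + K * (2 * ε) by ring,
          ENNReal.ofReal_add (by positivity) (by positivity), ENNReal.ofReal_mul hK0.le]
        ring

/-- Uniform limits of bounded continuous curves. -/
theorem isBddCurve_of_tendsto {z : ℕ → ℝ → TDist n} (hz : ∀ m, IsBddCurve φ s p μ (z m))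
    (h : Tendsto (fun m => pathN φ s p μ fun t => f t - z m t) atTop (𝓝 0)) :
    IsBddCurve φ s p μ f := by
  constructor
  · obtain ⟨m, hm⟩ := (h.eventually (gt_mem_nhds (one_pos (α := ℝ≥0∞)))).exists
    refine lt_of_le_of_lt (b := pathN φ s p μ (fun t => f t - z m t) + pathN φ s p μ (z m)) ?_
      (ENNReal.add_lt_top.2 ⟨hm.trans ENNReal.one_lt_top, (hz m).bounded⟩)
    have := pathN_add_le (φ := φ) (s := s) (p := p) (μ := μ) (fun t => f t - z m t) (z m)
    simpa only [sub_add_cancel] using this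
  · intro t ht
    refine ENNReal.tendsto_nhds_zero.2 fun ε hε => ?_
    have hε3 : 0 < ε / 3 := ENNReal.div_pos hε.ne' (by simp)
    obtain ⟨m, hm⟩ := (h.eventually (gt_mem_nhds hε3)).exists
    filter_upwards [((hz m).continuous t ht).eventually (gt_mem_nhds hε3), lt_mem_nhds ht]
      with τ hτ hτ0
    have he : f τ - f t = (f τ - z m τ) + ((z m τ - z m t) - (f t - z m t)) := by abel
    rw [he]
    calc _ ≤ fnN φ s p μ (f τ - z m τ) +
          (fnN φ s p μ (z m τ - z m t) + fnN φ s p μ (f t - z m t)) :=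
          (fnN_add_le _ _).trans (add_le_add_right (fnN_sub_le _ _) _)
      _ ≤ ε / 3 + (ε / 3 + ε / 3) :=
          add_le_add ((le_pathN (fun t => f t - z m t) hτ0).trans hm.le)
            (add_le_add hτ.le ((le_pathN (fun t => f t - z m t) ht).trans hm.le))
      _ = ε := by rw [← add_assoc, ENNReal.add_thirds]

/-- The Picard iterates converge to a mild solution. -/
theorem exists_picard (hφ : IsLittlewoodPaley φ) (hA : IsAdmissibleParam n p μ γ β s)
    (hP : ∀ j, IsAdmissibleSymbol p β (P j))
    (hK : IsCurveConst φ s p μ γ a P K) (hK0 : 0 < K) (hε : 0 < ε) (hKε : 4 * K * ε < 1)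
    (hf₀ : fnN φ s p μ f₀ ≤ ENNReal.ofReal ε) :
    ∃ (z : ℕ → ℝ → TDist n) (f : ℝ → TDist n), (∀ t, z 0 t = 0) ∧
      (∀ m, IsStep γ a P f₀ (z m) (z (m + 1))) ∧
      (∀ t, 0 < t → ∀ ψ : 𝓢(Rn n, ℂ), Tendsto (fun m => z m t ψ) atTop (𝓝 (f t ψ))) ∧
      IsBddCurve φ s p μ f ∧ pathN φ s p μ f ≤ ENNReal.ofReal (2 * ε) ∧ IsStep γ a P f₀ f f := by
  have hstep : ∀ x, ∃ x', IsBddCurve φ s p μ x →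
      IsBddCurve φ s p μ x' ∧ IsStep γ a P f₀ x x' := by
    intro x
    by_cases hx : IsBddCurve φ s p μ x
    · obtain ⟨x', h⟩ := isBddCurve_of_isStep (γ := γ) (a := a) hφ hA hP
        (hf₀.trans_lt ENNReal.ofReal_lt_top) hx
      exact ⟨x', fun _ => h⟩
    · exact ⟨x, fun h => absurd h hx⟩
  choose Φ hΦ using hstep
  -- The iteration starts at zero, a curve that has every scaling symmetry; the proof of
  -- self-similarity relies on this.
  let z : ℕ → ℝ → TDist n := fun m => Nat.rec (fun _ => 0) (fun _ x => Φ x) m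
  have hz : ∀ m, IsBddCurve φ s p μ (z m) := by
    intro m
    induction m with
    | zero => exact isBddCurve_zero
    | succ m ih => exact (hΦ _ ih).1
  have hzs : ∀ m, IsStep γ a P f₀ (z m) (z (m + 1)) := fun m => (hΦ _ (hz m)).2
  have hzε : ∀ m, pathN φ s p μ (z m) ≤ ENNReal.ofReal (2 * ε) := by
    intro m
    induction m with
    | zero => exact ActiveScalar.pathN_le fun t _ => fnN_zero.trans_le zero_le
    | succ m ih => exact (hzs m).pathN_le hφ hA hK hK0 hε hKε (hz m) ih hf₀
  set q : ℝ≥0∞ := ENNReal.ofReal (4 * K * ε) with hq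
  have hq1 : q < 1 := by
    rw [hq, ← ENNReal.ofReal_one]
    exact (ENNReal.ofReal_lt_ofReal_iff one_pos).2 hKε
  set Δ : ℕ → ℝ≥0∞ := fun m => pathN φ s p μ fun t => z (m + 1) t - z m t with hΔ
  have hΔq : ∀ m, Δ m ≤ ENNReal.ofReal (2 * ε) * q ^ m := by
    intro m
    induction m with
    | zero =>
      have h0 : ∀ t, z 1 t - z 0 t = z 1 t := fun t => sub_zero _
      simp only [hΔ, zero_add, h0, pow_zero, mul_one]
      exact hzε 1
    | succ m ih =>
      have := (hzs (m + 1)).pathN_sub_le hφ hA hP hK hK0 hε (hz (m + 1)) (hzε (m + 1))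
        (hz m) (hzε m) (hzs m)
      rw [sub_self, fnN_zero, zero_add] at this
      refine this.trans ?_
      rw [pow_succ, ← mul_assoc, mul_comm]
      exact mul_le_mul_left ih _
  have hΔs : ∑' m, Δ m ≠ ∞ := by
    refine ne_top_of_le_ne_top ?_ (ENNReal.tsum_le_tsum hΔq)
    rw [ENNReal.tsum_mul_left, ENNReal.tsum_geometric]
    exact ENNReal.mul_ne_top ENNReal.ofReal_ne_top
      (ENNReal.inv_ne_top.2 (tsub_pos_of_lt hq1).ne')
  -- The tail `T m` bounds the distance of `z m` to the limit uniformly in time, so the limit curve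
  -- remains continuous.
  set T : ℕ → ℝ≥0∞ := fun m => ∑' i, Δ (i + m) with hT
  have hT0 : Tendsto T atTop (𝓝 0) := ENNReal.tendsto_sum_nat_add Δ hΔs
  have hlim : ∀ t, ∃ f, 0 < t → ∀ m, fnN φ s p μ (f - z m t) ≤ T m := by
    intro t
    by_cases ht : 0 < t
    · have hle : ∀ m, fnN φ s p μ (z (m + 1) t - z m t) ≤ Δ m := fun m =>
        le_pathN (fun t => z (m + 1) t - z m t) ht
      obtain ⟨f, hf⟩ := exists_fnN_sum_sub_le (μ := μ) hφ hA.one_le hA.lt_massExp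
        (fun m => z (m + 1) t - z m t) (ne_top_of_le_ne_top hΔs (ENNReal.tsum_le_tsum hle))
      refine ⟨f, fun _ m => ?_⟩
      have h1 := hf m
      rw [Finset.sum_range_sub (fun m => z m t)] at h1
      have h0 : z 0 t = 0 := rfl
      rw [h0, sub_zero] at h1
      exact h1.trans (ENNReal.tsum_le_tsum fun i => hle _)
    · exact ⟨0, fun h => absurd h ht⟩
  choose f hf using hlim
  have hfz : ∀ m, pathN φ s p μ (fun t => f t - z m t) ≤ T m := fun m =>
    ActiveScalar.pathN_le fun t ht => hf t ht m
  have hfz0 : Tendsto (fun m => pathN φ s p μ fun t => f t - z m t) atTop (𝓝 0) :=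
    tendsto_of_tendsto_of_tendsto_of_le_of_le tendsto_const_nhds hT0 (fun _ => zero_le) hfz
  have hfc := isBddCurve_of_tendsto hz hfz0
  have hfε : pathN φ s p μ f ≤ ENNReal.ofReal (2 * ε) := by
    have h1 : ∀ m, pathN φ s p μ f ≤ T m + ENNReal.ofReal (2 * ε) := by
      intro m
      have := pathN_add_le (φ := φ) (s := s) (p := p) (μ := μ) (fun t => f t - z m t) (z m)
      simp only [sub_add_cancel] at this
      exact this.trans (add_le_add (hfz m) (hzε m))
    have h2 := hT0.add_const (ENNReal.ofReal (2 * ε))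
    rw [zero_add] at h2
    exact ge_of_tendsto' h2 h1
  -- `y` is the next iterate of the limit `f`. Both are close to `z (m + 1)`, one by convergence and
  -- the other by contraction, and hence they coincide.
  obtain ⟨y, -, hy⟩ := isBddCurve_of_isStep (γ := γ) (a := a) hφ hA hP
    (hf₀.trans_lt ENNReal.ofReal_lt_top) hfc
  have hfy : ∀ t, 0 < t → f t = y t := by
    intro t ht
    refine sub_eq_zero.1 (eq_zero_of_fnN_eq_zero (μ := μ) hφ hA.one_le hA.lt_massExp ?_)
    have h1 : ∀ m, fnN φ s p μ (f t - y t) ≤ T (m + 1) + q * T m := by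
      intro m
      have h2 := (hzs m).pathN_sub_le hφ hA hP hK hK0 hε (hz m) (hzε m) hfc hfε hy
      rw [sub_self, fnN_zero, zero_add, pathN_sub_comm (z m) f] at h2
      have h3 : f t - y t = (f t - z (m + 1) t) + (z (m + 1) t - y t) := by abel
      rw [h3]
      refine (fnN_add_le _ _).trans (add_le_add (hf t ht (m + 1)) ?_)
      refine (le_pathN (fun t => z (m + 1) t - y t) ht).trans (h2.trans ?_)
      exact mul_le_mul_right (hfz m) _
    have h4 := (hT0.comp (tendsto_add_atTop_nat 1)).add
      (ENNReal.Tendsto.const_mul (a := q) hT0 (Or.inr (hq1.trans ENNReal.one_lt_top).ne))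
    rw [mul_zero, add_zero] at h4
    exact le_antisymm (ge_of_tendsto' h4 h1) zero_le
  refine ⟨z, f, fun _ => rfl, hzs, fun t ht ψ => ?_, hfc, hfε, fun t ht => ?_⟩
  · obtain ⟨C, hC, h⟩ := exists_enorm_apply_le (μ := μ) hφ hA.one_le hA.lt_massExp ψ
    rw [tendsto_iff_edist_tendsto_0]
    have h1 := ENNReal.Tendsto.const_mul (a := C) hT0 (Or.inr hC)
    rw [mul_zero] at h1
    refine tendsto_of_tendsto_of_tendsto_of_le_of_le tendsto_const_nhds h1 (fun _ => zero_le)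
      fun m => ?_
    simp only
    rw [edist_comm, edist_eq_enorm_sub, ← tdist_sub_apply]
    exact (h _).trans (mul_le_mul_right (hf t ht m) _)
  · obtain ⟨e, b, he, hb, hyt⟩ := hy t ht
    exact ⟨e, b, he, hb, (hfy t ht).trans hyt⟩

theorem IsStep.pathN_sub_le_mul (hφ : IsLittlewoodPaley φ) (hA : IsAdmissibleParam n p μ γ β s)
    (hP : ∀ j, IsAdmissibleSymbol p β (P j))
    (hK : IsCurveConst φ s p μ γ a P K) (hK0 : 0 < K) (hε : 0 < ε) (hKε : 4 * K * ε < 1)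
    (hx : IsBddCurve φ s p μ x) (hxε : pathN φ s p μ x ≤ ENNReal.ofReal (2 * ε))
    (hy : IsBddCurve φ s p μ y) (hyε : pathN φ s p μ y ≤ ENNReal.ofReal (2 * ε))
    (hxx : IsStep γ a P f₀ x x) (hyy : IsStep γ a P g₀ y y) :
    pathN φ s p μ (fun t => x t - y t) ≤
      ENNReal.ofReal (1 - 4 * K * ε)⁻¹ * fnN φ s p μ (f₀ - g₀) :=
  le_mul_of_le_add_mul (by positivity) hKε (hx.sub hy).bounded.ne
    (hxx.pathN_sub_le hφ hA hP hK hK0 hε hx hxε hy hyε hyy)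

/-- Mild solutions attain their data weakly. -/
theorem IsStep.tendsto_apply (hφ : IsLittlewoodPaley φ) (hA : IsAdmissibleParam n p μ γ β s)
    (hP : ∀ j, IsAdmissibleSymbol p β (P j)) (hx : IsBddCurve φ s p μ x)
    (h : IsStep γ a P f₀ x x) (ψ : 𝓢(Rn n, ℂ)) :
    Tendsto (fun t => x t ψ) (𝓝[>] 0) (𝓝 (f₀ ψ)) := by
  have h' : ∀ t, ∃ eb : TDist n × TDist n, 0 < t → IsMultiplier (heatSymbol γ t) f₀ eb.1 ∧
      IsDuhamel γ a P x x t eb.2 ∧ x t = eb.1 + eb.2 := by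
    intro t
    by_cases ht : 0 < t
    · obtain ⟨e, b, h1⟩ := h t ht
      exact ⟨(e, b), fun _ => h1⟩
    · exact ⟨0, fun h' => absurd h' ht⟩
  choose eb heb using h'
  obtain ⟨C, hC, hCb⟩ := exists_enorm_duhamel_apply_le (μ := μ) hφ hA hP a ψ
  have h1 := tendsto_heat_apply (fun t ht => (heb t ht).1) ψ
  have h2 : Tendsto (fun t => (eb t).2 ψ) (𝓝[>] 0) (𝓝 0) := by
    rw [tendsto_iff_edist_tendsto_0]
    have h3 : Tendsto (fun t : ℝ => ENNReal.ofReal t * (C * (pathN φ s p μ x * pathN φ s p μ x)))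
        (𝓝[>] 0) (𝓝 0) := by
      have h4 := (ENNReal.continuous_ofReal.tendsto 0).mono_left
        (nhdsWithin_le_nhds (s := Set.Ioi 0))
      have := ENNReal.Tendsto.mul_const h4 (b := C * (pathN φ s p μ x * pathN φ s p μ x))
        (Or.inr (ENNReal.mul_ne_top hC (ENNReal.mul_ne_top hx.bounded.ne hx.bounded.ne)))
      simpa using this
    refine tendsto_of_tendsto_of_tendsto_of_le_of_le' tendsto_const_nhds h3
      (Eventually.of_forall fun _ => zero_le) ?_
    filter_upwards [self_mem_nhdsWithin] with t ht
    rw [edist_zero_right]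
    exact hCb x x t _ hx hx ht (heb t ht).2.1
  have h5 := h1.add h2
  rw [add_zero] at h5
  refine h5.congr' ?_
  filter_upwards [self_mem_nhdsWithin] with t ht
  rw [(heb t ht).2.2, tdist_add_apply]

end

/-! ### Scaling -/

section

variable {n : ℕ} {φ : 𝓢(Rn n, ℂ)} {s : ℝ} {p : ℝ≥0∞} {μ γ β l t : ℝ}
  {a : Fin n → Fin n → ℂ} {P : Fin n → Rn n → ℂ} {f g w q : TDist n}
  {ν : Measure (Rn n)} {h h' m m' : Rn n → ℂ} {c d : ℂ}

theorem dilate_add (l : ℝˣ) (f g : TDist n) : dilate l (f + g) = dilate l f + dilate l g :=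
  tdist_ext fun ψ => by
    simp only [dilate_apply, tdist_add_apply]
    ring

theorem dilate_smul (l : ℝˣ) (c : ℂ) (f : TDist n) : dilate l (c • f) = c • dilate l f :=
  tdist_ext fun ψ => by
    simp only [dilate_apply, tdist_smul_apply]
    ring

theorem dilate_zero (l : ℝˣ) : dilate l (0 : TDist n) = 0 :=
  tdist_ext fun _ => mul_zero _

theorem dilate_sub (l : ℝˣ) (f g : TDist n) : dilate l (f - g) = dilate l f - dilate l g :=
  tdist_ext fun ψ => by
    simp only [dilate_apply, tdist_sub_apply]
    ring

theorem dilate_sum {ι : Type*} (l : ℝˣ) (S : Finset ι) (F : ι → TDist n) :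
    dilate l (∑ i ∈ S, F i) = ∑ i ∈ S, dilate l (F i) :=
  tdist_ext fun ψ => by
    simp only [dilate_apply, tdist_sum_apply, Finset.mul_sum]

theorem dilate_lineDeriv (l : ℝˣ) (f : TDist n) (v : Rn n) :
    ∂_{v} (dilate l f) = ((l : ℝ) : ℂ) • dilate l (∂_{v} f) := by
  refine tdist_ext fun ψ => ?_
  have hd : dilateTest l⁻¹ (∂_{v} ψ) = ((l : ℝ) : ℂ) • ∂_{v} (dilateTest l⁻¹ ψ) := by
    ext x
    have h1 : HasFDerivAt (fun x : Rn n => ψ (((l⁻¹ : ℝˣ) : ℝ) • x))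
        ((fderiv ℝ ψ (((l⁻¹ : ℝˣ) : ℝ) • x)).comp
          (((l⁻¹ : ℝˣ) : ℝ) • ContinuousLinearMap.id ℝ (Rn n))) x :=
      (ψ.differentiableAt.hasFDerivAt).comp x
        ((hasFDerivAt_id x).const_smul ((l⁻¹ : ℝˣ) : ℝ))
    have h2 : fderiv ℝ (dilateTest l⁻¹ ψ) x = _ := h1.fderiv
    rw [smul_apply, SchwartzMap.lineDerivOp_apply_eq_fderiv, h2, dilateTest_apply,
      SchwartzMap.lineDerivOp_apply_eq_fderiv]
    simp
  rw [tdist_smul_apply, dilate_apply, TemperedDistribution.lineDerivOp_apply_apply, dilate_apply,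
    TemperedDistribution.lineDerivOp_apply_apply, map_neg, map_neg, map_neg, hd, map_smul,
    smul_eq_mul]
  ring

theorem IsFourierDensity.smul (H : IsFourierDensity f ν h) (c : ℂ) :
    IsFourierDensity (c • f) ν fun ξ => c * h ξ where
  locallyFinite := H.locallyFinite
  zero := H.zero
  tempered := by
    obtain ⟨N, hN⟩ := H.tempered
    refine ⟨N, (hN.const_mul c).congr (Eventually.of_forall fun ξ => ?_)⟩
    simp only [Complex.real_smul]
    ring
  eq_integral ψ := by
    rw [fourierDist_smul, tdist_smul_apply, H.eq_integral, ← integral_const_mul]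
    exact integral_congr_ae (Eventually.of_forall fun ξ => by simp only; ring)

theorem IsFourierDensity.congr (H : IsFourierDensity f ν h) (hh : ∀ ξ, ξ ≠ 0 → h ξ = h' ξ) :
    IsFourierDensity f ν h' := by
  have hae : ∀ᵐ ξ ∂ν, h ξ = h' ξ := by
    have h0 : ∀ᵐ ξ ∂ν, ξ ≠ 0 := by
      rw [ae_iff]
      simpa using H.zero
    filter_upwards [h0] with ξ hξ using hh ξ hξ
  refine ⟨H.locallyFinite, H.zero, ?_, fun ψ => ?_⟩
  · obtain ⟨N, hN⟩ := H.tempered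
    exact ⟨N, hN.congr (hae.mono fun ξ hξ => by simp only [hξ])⟩
  · rw [H.eq_integral]
    exact integral_congr_ae (hae.mono fun ξ hξ => by simp only [hξ])

theorem IsFourierDensity.dilate (H : IsFourierDensity f ν h) (l : ℝˣ) :
    IsFourierDensity (dilate l f) (ν.map (MeasurableEquiv.smul₀ (l : ℝ) l.ne_zero))
      fun ξ => h ((l : ℝ)⁻¹ • ξ) := by
  set e : Rn n ≃ᵐ Rn n := MeasurableEquiv.smul₀ (l : ℝ) l.ne_zero with he
  have hl : (l : ℝ) ≠ 0 := l.ne_zero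
  have heq : ∀ ξ, e ξ = (l : ℝ) • ξ := fun ξ => rfl
  have hback : ∀ ξ, (l : ℝ)⁻¹ • e ξ = ξ := fun ξ => by rw [heq, inv_smul_smul₀ hl]
  have := H.locallyFinite
  refine ⟨?_, ?_, ?_, fun ψ => ?_⟩
  · have : IsFiniteMeasureOnCompacts (ν.map e) := by
      refine ⟨fun {K} hK => ?_⟩
      rw [e.map_apply]
      have : e ⁻¹' K = (fun ξ => (l : ℝ)⁻¹ • ξ) '' K := by
        ext ξ
        simp only [Set.mem_preimage, Set.mem_image]
        exact ⟨fun h => ⟨_, h, hback ξ⟩, by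
          rintro ⟨η, hη, rfl⟩
          rwa [heq, smul_inv_smul₀ hl]⟩
      rw [this]
      exact (hK.image (continuous_const_smul _)).measure_lt_top
    infer_instance
  · rw [e.map_apply]
    have : e ⁻¹' {0} = {0} := by
      ext ξ
      simp [heq, hl]
    rw [this, H.zero]
  · obtain ⟨N, hN⟩ := H.tempered
    refine ⟨N, ?_⟩
    rw [integrable_map_equiv]
    have hm : AEStronglyMeasurable h ν := H.locallyIntegrable.aestronglyMeasurable
    have hcont : Continuous fun ξ : Rn n => ((1 + ‖e ξ‖) ^ N)⁻¹ := by
      simp only [heq]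
      exact Continuous.inv₀ (by fun_prop) fun ξ => by positivity
    -- `R` is chosen so that `R ≥ 1` and `|l| R ≥ 1`, which gives `1 + ‖ξ‖ ≤ R (1 + ‖l ξ‖)`.
    set R : ℝ := max 1 |(l : ℝ)|⁻¹ with hR
    refine (hN.norm.const_mul (R ^ N)).mono' ?_ (Eventually.of_forall fun ξ => ?_)
    · simp only [Function.comp_def, hback]
      exact hcont.aestronglyMeasurable.smul hm
    · simp only [Function.comp_def, hback, norm_smul, norm_inv, norm_pow]
      rw [← mul_assoc]
      refine mul_le_mul_of_nonneg_right ?_ (norm_nonneg _)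
      rw [Real.norm_of_nonneg (by positivity), Real.norm_of_nonneg (by positivity),
        ← div_eq_mul_inv, le_div_iff₀ (by positivity), inv_mul_le_iff₀ (by positivity), ← mul_pow]
      refine pow_le_pow_left₀ (by positivity) ?_ _
      rw [heq, norm_smul, Real.norm_eq_abs]
      have h1 : 1 ≤ R := le_max_left _ _
      have h2 : 1 ≤ |(l : ℝ)| * R := by
        have : |(l : ℝ)| * |(l : ℝ)|⁻¹ = 1 := mul_inv_cancel₀ (abs_pos.2 hl).ne'
        calc (1 : ℝ) = |(l : ℝ)| * |(l : ℝ)|⁻¹ := this.symm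
          _ ≤ _ := by gcongr; exact le_max_right _ _
      nlinarith [norm_nonneg ξ]
  · rw [fourierDist_dilate, H.eq_integral, integral_map_equiv]
    exact integral_congr_ae (Eventually.of_forall fun ξ => by
      simp only [hback]
      rw [dilateTest_apply, heq])

theorem IsMultiplier.smul (hg : IsMultiplier m f g) (c : ℂ) :
    IsMultiplier m (c • f) (c • g) := by
  obtain ⟨ν, h, H, G⟩ := hg
  exact ⟨ν, _, H.smul c, (G.smul c).congr fun ξ _ => by ring⟩

theorem IsMultiplier.smul_symbol (hg : IsMultiplier m f g)
    (hm : ∀ ξ, ξ ≠ 0 → c * m ξ = m' ξ) : IsMultiplier m' f (c • g) := by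
  obtain ⟨ν, h, H, G⟩ := hg
  exact ⟨ν, h, H, (G.smul c).congr fun ξ hξ => by rw [← mul_assoc, hm ξ hξ]⟩

theorem IsMultiplier.dilate (hg : IsMultiplier m f g) (l : ℝˣ) :
    IsMultiplier (fun ξ => m ((l : ℝ)⁻¹ • ξ)) (dilate l f) (dilate l g) := by
  obtain ⟨ν, h, H, G⟩ := hg
  exact ⟨_, _, H.dilate l, G.dilate l⟩

theorem IsProduct.smul (hw : IsProduct f g w) (c d : ℂ) :
    IsProduct (c • f) (d • g) ((c * d) • w) := by
  obtain ⟨ν, h, ν', h', H, G, hw⟩ := hw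
  refine ⟨ν, _, ν', _, H.smul c, G.smul d, fun ψ => ?_⟩
  have he : (fun z : Rn n × Rn n => ψ (z.1 + z.2) * (c * h z.1 * (d * h' z.2))) =
      fun z => (c * d) * (ψ (z.1 + z.2) * (h z.1 * h' z.2)) := by
    ext z
    ring
  rw [he]
  refine ⟨(hw ψ).1.const_mul _, ?_⟩
  rw [fourierDist_smul, tdist_smul_apply, (hw ψ).2, integral_const_mul]
  ring

theorem IsProduct.dilate (hw : IsProduct f g w) (l : ℝˣ) :
    IsProduct (dilate l f) (dilate l g) (dilate l w) := by
  obtain ⟨ν, h, ν', h', H, G, hw⟩ := hw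
  have := H.sigmaFinite
  have := G.sigmaFinite
  set e : Rn n ≃ᵐ Rn n := MeasurableEquiv.smul₀ (l : ℝ) l.ne_zero with he
  have hback : ∀ ξ, (l : ℝ)⁻¹ • e ξ = ξ := fun ξ => inv_smul_smul₀ l.ne_zero ξ
  refine ⟨_, _, _, _, H.dilate l, G.dilate l, fun ψ => ?_⟩
  have hmap : (ν.map e).prod (ν'.map e) = (ν.prod ν').map (e.prodCongr e) :=
    Measure.map_prod_map ν ν' e.measurable e.measurable
  have hfun : ∀ z : Rn n × Rn n, dilateTest l ψ (z.1 + z.2) * (h z.1 * h' z.2) =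
      ψ ((e.prodCongr e z).1 + (e.prodCongr e z).2) *
        (h ((l : ℝ)⁻¹ • (e.prodCongr e z).1) * h' ((l : ℝ)⁻¹ • (e.prodCongr e z).2)) := by
    intro z
    have h1 : (e.prodCongr e z).1 = e z.1 := rfl
    have h2 : (e.prodCongr e z).2 = e z.2 := rfl
    rw [h1, h2, hback, hback, dilateTest_apply, smul_add]
    rfl
  rw [← he, hmap, integrable_map_equiv, integral_map_equiv, fourierDist_dilate]
  have := hw (dilateTest l ψ)
  simp only [hfun] at this
  exact this

theorem heatSymbol_smul (hl : 0 < l) (ξ : Rn n) :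
    heatSymbol γ (l ^ (2 * γ) * t) (l⁻¹ • ξ) = heatSymbol γ t ξ := by
  unfold heatSymbol
  congr 2
  rw [norm_smul, norm_inv, Real.norm_of_nonneg hl.le,
    Real.mul_rpow (inv_nonneg.2 hl.le) (norm_nonneg _), Real.inv_rpow hl.le]
  have : l ^ (2 * γ) ≠ 0 := (Real.rpow_pos_of_pos hl _).ne'
  field_simp

theorem velocitySymbol_smul (hP : ∀ j, IsHomogeneousSymbol β (P j)) (hl : 0 < l) (k : Fin n)
    {ξ : Rn n} (hξ : ξ ≠ 0) :
    ((l ^ (β - 1) : ℝ) : ℂ) * velocitySymbol a P k (l⁻¹ • ξ) = velocitySymbol a P k ξ := by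
  unfold velocitySymbol
  rw [Finset.mul_sum]
  refine Finset.sum_congr rfl fun j _ => ?_
  have hlc : (l : ℂ) ≠ 0 := Complex.ofReal_ne_zero.2 hl.ne'
  have hβ : ((l ^ β : ℝ) : ℂ) ≠ 0 := Complex.ofReal_ne_zero.2 (Real.rpow_pos_of_pos hl _).ne'
  have hnc : (‖ξ‖ : ℂ) ≠ 0 := Complex.ofReal_ne_zero.2 (norm_ne_zero_iff.2 hξ)
  rw [hP j l⁻¹ (inv_pos.2 hl) ξ hξ, rieszSymbol, rieszSymbol, norm_smul, norm_inv,
    Real.norm_of_nonneg hl.le, Real.rpow_sub hl, Real.rpow_one, Real.inv_rpow hl.le]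
  simp only [PiLp.smul_apply, smul_eq_mul]
  push_cast
  field_simp

/-- The product carries `c * c`, the homogeneous velocity symbol `l ^ (β - 1)` and the derivative
one more `l`; together the powers of `l` make `l ^ β`. -/
theorem IsFlux.dilate (hP : ∀ j, IsHomogeneousSymbol β (P j)) (hl : 0 < l) (c : ℂ)
    (hq : IsFlux a P f g q) :
    IsFlux a P (c • dilate (Units.mk0 l hl.ne') f) (c • dilate (Units.mk0 l hl.ne') g)
      ((c * c * ((l ^ β : ℝ) : ℂ)) • dilate (Units.mk0 l hl.ne') q) := by
  obtain ⟨u, w, hw, rfl⟩ := hq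
  set L := Units.mk0 l hl.ne' with hL
  set r : ℂ := ((l ^ (β - 1) : ℝ) : ℂ) with hr
  refine ⟨fun k => c • r • ActiveScalar.dilate L (u k),
    fun k => (c * c * r) • ActiveScalar.dilate L (w k), fun k => ⟨?_, ?_⟩, ?_⟩
  · refine IsMultiplier.smul (((hw k).1.dilate L).smul_symbol fun ξ hξ => ?_) c
    exact velocitySymbol_smul hP hl k hξ
  · have := ((hw k).2.dilate L).smul (c * r) c
    rw [mul_smul] at this
    rwa [show c * c * r = c * r * c by ring]
  · rw [dilate_sum, Finset.smul_sum]
    refine Finset.sum_congr rfl fun k _ => ?_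
    rw [LineDeriv.lineDerivOp_smul, dilate_lineDeriv, smul_smul]
    congr 1
    rw [hr, mul_assoc (c * c), ← Complex.ofReal_mul]
    congr 2
    simp only [hL, Units.val_mk0]
    rw [Real.rpow_sub hl, Real.rpow_one]
    field_simp

/-- The factor `l ^ (2 * γ)` in `hQ` is the Jacobian of the parabolic rescaling of time under which
the heat symbol is invariant. -/
theorem IsHeatIntegral.dilate (hl : 0 < l) (c : ℂ) {Q Q' : ℝ → TDist n}
    (hQ : ∀ τ ∈ Set.Ioo 0 t, Q' τ = (c * ((l ^ (2 * γ) : ℝ) : ℂ)) •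
      dilate (Units.mk0 l hl.ne') (Q (l ^ (2 * γ) * τ)))
    (h : IsHeatIntegral γ Q (l ^ (2 * γ) * t) f) :
    IsHeatIntegral γ Q' t (c • dilate (Units.mk0 l hl.ne') f) := by
  obtain ⟨w, hw, hf⟩ := h
  set L := Units.mk0 l hl.ne' with hL
  set r : ℝ := l ^ (2 * γ) with hr
  have hr0 : 0 < r := Real.rpow_pos_of_pos hl _
  refine ⟨fun σ => (c * (r : ℂ)) • ActiveScalar.dilate L (w (r * σ)), fun σ hσ => ?_,
    fun ψ => ?_⟩
  · rw [hQ (t - σ) ⟨sub_pos.2 hσ.2, by linarith [hσ.1]⟩]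
    refine IsMultiplier.smul ?_ _
    have h1 := (hw (r * σ) ⟨mul_pos hr0 hσ.1, mul_lt_mul_of_pos_left hσ.2 hr0⟩).dilate L
    rw [← mul_sub] at h1
    have h2 : (fun ξ : Rn n => heatSymbol γ (r * σ) ((L : ℝ)⁻¹ • ξ)) = heatSymbol γ σ := by
      ext ξ
      exact heatSymbol_smul hl ξ
    rwa [h2] at h1
  · obtain ⟨h1, h2⟩ := hf (dilateTest L⁻¹ ψ)
    have h3 := h1.comp_mul_left (c := r)
    rw [zero_div, mul_div_cancel_left₀ _ hr0.ne'] at h3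
    simp only [tdist_smul_apply, dilate_apply]
    refine ⟨(h3.const_mul _).const_mul _, ?_⟩
    rw [intervalIntegral.integral_const_mul, intervalIntegral.integral_const_mul,
      intervalIntegral.integral_comp_mul_left (fun σ => w σ (dilateTest L⁻¹ ψ)) hr0.ne', mul_zero,
      h2, Complex.real_smul]
    have : (r : ℂ) ≠ 0 := Complex.ofReal_ne_zero.2 hr0.ne'
    push_cast
    field_simp

/-- The identity `2 (2γ - β) + β = (2γ - β) + 2γ` singles out the exponent: for it the Duhamel term
of a self-similar curve scales like the curve itself. -/
theorem IsDuhamel.dilate (hP : ∀ j, IsHomogeneousSymbol β (P j)) (hl : 0 < l)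
    {x : ℝ → TDist n} (hx : ∀ τ, 0 < τ → x τ =
      ((l ^ (2 * γ - β) : ℝ) : ℂ) • dilate (Units.mk0 l hl.ne') (x (l ^ (2 * γ) * τ)))
    (h : IsDuhamel γ a P x x (l ^ (2 * γ) * t) f) :
    IsDuhamel γ a P x x t (((l ^ (2 * γ - β) : ℝ) : ℂ) • dilate (Units.mk0 l hl.ne') f) := by
  obtain ⟨Q, hQ, hf⟩ := isDuhamel_iff.1 h
  have hr0 : 0 < l ^ (2 * γ) := Real.rpow_pos_of_pos hl _
  refine isDuhamel_iff.2 ⟨fun τ => (((l ^ (2 * γ - β) : ℝ) : ℂ) * ((l ^ (2 * γ) : ℝ) : ℂ)) •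
    ActiveScalar.dilate (Units.mk0 l hl.ne') (Q (l ^ (2 * γ) * τ)), fun τ hτ => ?_,
    hf.dilate hl _ fun _ _ => rfl⟩
  have h1 := (hQ (l ^ (2 * γ) * τ) ⟨mul_pos hr0 hτ.1, mul_lt_mul_of_pos_left hτ.2 hr0⟩).dilate
    hP hl ((l ^ (2 * γ - β) : ℝ) : ℂ)
  rw [← hx τ hτ.1] at h1
  convert h1 using 2
  rw [mul_assoc, ← Complex.ofReal_mul (l ^ (2 * γ - β)) (l ^ β), ← Real.rpow_add hl]
  congr 3
  ring

theorem IsStep.dilate (hP : ∀ j, IsHomogeneousSymbol β (P j)) (hl : 0 < l)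
    {x x' : ℝ → TDist n} (hf : IsHomogeneousDist (-(2 * γ - β)) f) (hx : ∀ τ, 0 < τ → x τ =
      ((l ^ (2 * γ - β) : ℝ) : ℂ) • ActiveScalar.dilate (Units.mk0 l hl.ne') (x (l ^ (2 * γ) * τ)))
    (h : IsStep γ a P f x x') (ht : 0 < t) :
    x' t = ((l ^ (2 * γ - β) : ℝ) : ℂ) •
      ActiveScalar.dilate (Units.mk0 l hl.ne') (x' (l ^ (2 * γ) * t)) := by
  obtain ⟨e, b, he, hb, hxt⟩ := h t ht
  obtain ⟨e', b', he', hb', hxt'⟩ := h (l ^ (2 * γ) * t)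
    (mul_pos (Real.rpow_pos_of_pos hl _) ht)
  rw [hxt, hxt', dilate_add, smul_add, hb.unique ht (hb'.dilate hP hl hx)]
  congr 1
  have h1 := (he'.dilate (Units.mk0 l hl.ne')).smul ((l ^ (2 * γ - β) : ℝ) : ℂ)
  rw [hf l hl, smul_smul, ← Complex.ofReal_mul, ← Real.rpow_add hl, add_neg_cancel, Real.rpow_zero,
    Complex.ofReal_one, one_smul] at h1
  have h2 : (fun ξ : Rn n => heatSymbol γ (l ^ (2 * γ) * t)
      (((Units.mk0 l hl.ne' : ℝˣ) : ℝ)⁻¹ • ξ)) = heatSymbol γ t := by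
    ext ξ
    exact heatSymbol_smul hl ξ
  rw [h2] at h1
  exact he.unique h1

theorem dilate_mem_polynomials (l : ℝˣ) (hf : f ∈ polynomials n) :
    dilate l f ∈ polynomials n := by
  refine Submodule.span_induction ?_ ?_ ?_ ?_ hf
  · rintro f ⟨q, hq⟩
    refine Submodule.subset_span ⟨MvPolynomial.bind₁
      (fun i => MvPolynomial.C ((l : ℝ) : ℂ) * MvPolynomial.X i) q, fun ψ => ?_⟩
    have h1 := Measure.integral_comp_smul (volume : Measure (Rn n)) (fun x : Rn n =>
      MvPolynomial.eval (fun i => (x i : ℂ)) q * dilateTest l⁻¹ ψ x) (l : ℝ)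
    have hd : Module.finrank ℝ (Rn n) = n := by simp
    rw [hd] at h1
    rw [dilate_apply, hq, ← smul_eq_mul, Complex.coe_smul, ← abs_pow, ← abs_inv, ← h1]
    refine integral_congr_ae (Eventually.of_forall fun x => ?_)
    simp only
    congr 1
    · simp only [MvPolynomial.eval, MvPolynomial.eval₂Hom_bind₁]
      simp
    · rw [dilateTest_apply, smul_smul]
      simp
  · rw [dilate_zero]
    exact zero_mem _
  · intro x y _ _ hx hy
    rw [dilate_add]
    exact add_mem hx hy
  · intro c x _ hx
    rw [dilate_smul]
    exact Submodule.smul_mem _ _ hx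

theorem IsMeas.dilate (hf : IsMeas f) (l : ℝˣ) : IsMeas (dilate l f) := by
  obtain ⟨ν, h, H⟩ := hf
  exact ⟨_, _, H.dilate l⟩

theorem IsMeas.smul (hf : IsMeas f) (c : ℂ) : IsMeas (c • f) := by
  obtain ⟨ν, h, H⟩ := hf
  exact ⟨_, _, H.smul c⟩

/-- The canonical representative of a homogeneous distribution is homogeneous. -/
theorem IsHomogeneousDist.of_toMod_eq (hφ : IsLittlewoodPaley φ) {r : ℝ}
    (hg : IsHomogeneousDist r g) (hf : IsMeas f) (h : toMod g = toMod f) :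
    IsHomogeneousDist r f := by
  intro l hl
  have hmem : g - f ∈ polynomials n := (Submodule.Quotient.eq _).1 h
  -- Because `g` is homogeneous and `g - f` is a polynomial, the defect of homogeneity of `f` is a
  -- polynomial. Its transform is a measure without an atom at the origin, so it vanishes.
  refine sub_eq_zero.1 (IsMeas.eq_zero_of_mem_polynomials hφ ((hf.dilate _).sub (hf.smul _)) ?_)
  have h1 : dilate (Units.mk0 l hl.ne') f - ((l ^ r : ℝ) : ℂ) • f =
      ((l ^ r : ℝ) : ℂ) • (g - f) - dilate (Units.mk0 l hl.ne') (g - f) := by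
    rw [dilate_sub, hg l hl, smul_sub]
    abel
  rw [h1]
  exact sub_mem (Submodule.smul_mem _ _ hmem) (dilate_mem_polynomials _ hmem)

end

/-! ### Classes modulo polynomials -/

section

variable {n : ℕ} {φ : 𝓢(Rn n, ℂ)} {s : ℝ} {p : ℝ≥0∞} {μ γ β K ε r : ℝ}
  {a : Fin n → Fin n → ℂ} {P : Fin n → Rn n → ℂ}
  {θ : ℝ → DistMod n} {θ₀ : DistMod n} {f : ℝ → TDist n}

/-- The lower bound on `p` says `(n - μ)/p < n + β + 1 - 4γ`, which is `2γ - 1 < s`; the bound `hγn`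
makes the denominator positive. -/
theorem isAdmissibleParam_of_lt (hβγ : β < 2 * γ) (hγ : 1 / 2 < γ)
    (hγn : 2 * γ < (n + β + 1) / 2) (hp_one : 1 ≤ p)
    (hp : ENNReal.ofReal ((n - μ) / (n + β + 1 - 4 * γ)) < p)
    (hs : s = n - (n - μ) * p⁻¹.toReal - (2 * γ - β)) : IsAdmissibleParam n p μ γ β s where
  one_le := hp_one
  massExp_sub := by rw [massExp, hs]; ring
  lt_two_mul := hβγ
  one_lt_two_mul := by linarith
  two_mul_lt := by
    have hD : 0 < n + β + 1 - 4 * γ := by linarith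
    suffices h : (n - μ) * p⁻¹.toReal < n + β + 1 - 4 * γ by rw [hs]; linarith
    rcases eq_or_ne p ∞ with rfl | ht
    · simpa using hD
    · have hp0 : 0 < p.toReal := ENNReal.toReal_pos (one_pos.trans_le hp_one).ne' ht
      have h1 : (n - μ) / (n + β + 1 - 4 * γ) < p.toReal := by
        have := (ENNReal.toReal_lt_toReal ENNReal.ofReal_ne_top ht).2 hp
        rw [ENNReal.toReal_ofReal'] at this
        exact (le_max_left _ _).trans_lt this
      rw [ENNReal.toReal_inv, ← div_eq_mul_inv, div_lt_iff₀ hp0]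
      rw [div_lt_iff₀ hD] at h1
      linarith

theorem supNorm_eq_pathN (hφ : IsLittlewoodPaley φ) (hp : 1 ≤ p) (hs : s < massExp n p μ)
    (h : ∀ t, 0 < t → IsRealization (θ t) (f t)) : supNorm φ s p μ θ = pathN φ s p μ f :=
  iSup_congr fun t => iSup_congr fun ht => (h t ht).fnNorm_eq hφ hp hs

theorem isBC_iff_isBddCurve (hφ : IsLittlewoodPaley φ) (hp : 1 ≤ p) (hs : s < massExp n p μ)
    (h : ∀ t, 0 < t → IsRealization (θ t) (f t)) : IsBC φ s p μ θ ↔ IsBddCurve φ s p μ f := by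
  have hN := supNorm_eq_pathN (μ := μ) hφ hp hs h
  have hc : ∀ t, 0 < t → (fun τ => fnNorm φ s p μ (θ τ - θ t)) =ᶠ[𝓝 t]
      fun τ => fnN φ s p μ (f τ - f t) := by
    intro t ht
    filter_upwards [lt_mem_nhds ht] with τ hτ
    exact ((h τ hτ).sub (h t ht)).fnNorm_eq hφ hp hs
  exact ⟨fun H => ⟨hN ▸ H.bounded, fun t ht => (H.continuous t ht).congr' (hc t ht)⟩,
    fun H => ⟨hN.symm ▸ H.bounded, fun t ht => (H.continuous t ht).congr' (hc t ht).symm⟩⟩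

theorem IsBC.exists_realization (hφ : IsLittlewoodPaley φ) (hp : 1 ≤ p) (hs : s < massExp n p μ)
    (h : IsBC φ s p μ θ) :
    ∃ f : ℝ → TDist n, (∀ t, 0 < t → IsRealization (θ t) (f t)) ∧ IsBddCurve φ s p μ f := by
  have hf : ∀ t, ∃ f, 0 < t → IsRealization (θ t) f := by
    intro t
    by_cases ht : 0 < t
    · obtain ⟨f, hf⟩ := exists_isRealization (μ := μ) hφ hp hs (F := θ t) (lt_of_le_of_lt
        (le_iSup₂ (f := fun (t : ℝ) (_ : 0 < t) => fnNorm φ s p μ (θ t)) t ht) h.bounded)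
      exact ⟨f, fun _ => hf⟩
    · exact ⟨0, fun h' => absurd h' ht⟩
  choose f hf using hf
  exact ⟨f, hf, (isBC_iff_isBddCurve hφ hp hs hf).1 h⟩

theorem IsBddCurve.isRealization (hφ : IsLittlewoodPaley φ) (hp : 1 ≤ p)
    (hs : s < massExp n p μ) (h : IsBddCurve φ s p μ f) {t : ℝ} (ht : 0 < t) :
    IsRealization (toMod (f t)) (f t) :=
  isRealization_toMod (isMeas_of_fnN_lt_top hφ hp hs (h.lt_top ht))

theorem exists_isBilinearConst (hφ : IsLittlewoodPaley φ) (hA : IsAdmissibleParam n p μ γ β s)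
    (hP : ∀ j, IsAdmissibleSymbol p β (P j)) :
    ∃ K : ℝ, 0 < K ∧ IsBilinearConst φ s p μ γ a P K := by
  obtain ⟨C, hC, h⟩ := exists_duhamel (μ := μ) hφ hA hP a
  -- The added `1` ensures that the constant is positive.
  refine ⟨C.toReal + 1, by positivity, fun θ ϑ hθ hϑ => ?_⟩
  obtain ⟨f, hf, hfc⟩ := hθ.exists_realization hφ hA.one_le hA.lt_massExp
  obtain ⟨g, hg, hgc⟩ := hϑ.exists_realization hφ hA.one_le hA.lt_massExp
  obtain ⟨b, hb, hbc, hn⟩ := h f g hfc hgc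
  refine ⟨f, g, b, hf, hg, hb, ?_⟩
  rw [supNorm_eq_pathN hφ hA.one_le hA.lt_massExp
    (fun t ht => hbc.isRealization hφ hA.one_le hA.lt_massExp ht),
    supNorm_eq_pathN hφ hA.one_le hA.lt_massExp hf,
    supNorm_eq_pathN hφ hA.one_le hA.lt_massExp hg, mul_assoc]
  refine hn.trans (mul_le_mul_left ?_ _)
  rw [← ENNReal.ofReal_toReal hC]
  exact ENNReal.ofReal_le_ofReal (by simp)

/-- The estimate is given for some representatives and some Duhamel term; uniqueness of both
transfers it, with the same `K`, to all. -/
theorem IsBilinearConst.isCurveConst (hφ : IsLittlewoodPaley φ)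
    (hA : IsAdmissibleParam n p μ γ β s) (hP : ∀ j, IsAdmissibleSymbol p β (P j))
    (hK : IsBilinearConst φ s p μ γ a P K) : IsCurveConst φ s p μ γ a P K := by
  intro f g b hf hg hb
  have hs := hA.lt_massExp
  have hrf : ∀ t, 0 < t → IsRealization (toMod (f t)) (f t) := fun t ht =>
    hf.isRealization hφ hA.one_le hs ht
  have hrg : ∀ t, 0 < t → IsRealization (toMod (g t)) (g t) := fun t ht =>
    hg.isRealization hφ hA.one_le hs ht
  obtain ⟨C, -, h⟩ := exists_duhamel (μ := μ) hφ hA hP a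
  obtain ⟨c, hc, hcc, -⟩ := h f g hf hg
  obtain ⟨f', g', b', hf', hg', hb', hle⟩ := hK (fun t => toMod (f t)) (fun t => toMod (g t))
    ((isBC_iff_isBddCurve hφ hA.one_le hs hrf).2 hf)
    ((isBC_iff_isBddCurve hφ hA.one_le hs hrg).2 hg)
  have hbb : ∀ t, 0 < t → b' t = b t := fun t ht =>
    ((hb' t ht).congr (fun τ hτ => (hf' τ hτ).unique hφ (hrf τ hτ))
      fun τ hτ => (hg' τ hτ).unique hφ (hrg τ hτ)).unique ht (hb t ht)
  have hrb : ∀ t, 0 < t → IsRealization (toMod (b' t)) (b t) := by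
    intro t ht
    rw [hbb t ht, (hb t ht).unique ht (hc t ht)]
    exact hcc.isRealization hφ hA.one_le hs ht
  rwa [supNorm_eq_pathN hφ hA.one_le hs hrb, supNorm_eq_pathN hφ hA.one_le hs hrf,
    supNorm_eq_pathN hφ hA.one_le hs hrg] at hle

theorem IsSolutionInBall.exists_isStep (hφ : IsLittlewoodPaley φ)
    (hA : IsAdmissibleParam n p μ γ β s) (h : IsSolutionInBall φ s p μ γ a P r θ₀ θ) :
    ∃ (f₀ : TDist n) (f : ℝ → TDist n), IsRealization θ₀ f₀ ∧
      (∀ t, 0 < t → IsRealization (θ t) (f t)) ∧ IsBddCurve φ s p μ f ∧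
      pathN φ s p μ f ≤ ENNReal.ofReal r ∧ IsStep γ a P f₀ f f := by
  obtain ⟨f₀, f, h₀, hf, hm⟩ := h.mild
  refine ⟨f₀, f, h₀, hf, (isBC_iff_isBddCurve hφ hA.one_le hA.lt_massExp hf).1 h.bc, ?_, hm⟩
  rw [← supNorm_eq_pathN hφ hA.one_le hA.lt_massExp hf]
  exact h.norm_le

theorem exists_isSolutionInBall (hφ : IsLittlewoodPaley φ)
    (hA : IsAdmissibleParam n p μ γ β s) (hP : ∀ j, IsAdmissibleSymbol p β (P j))
    (hK : IsCurveConst φ s p μ γ a P K) (hK0 : 0 < K) (hε : 0 < ε) (hKε : 4 * K * ε < 1)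
    (hθ₀ : fnNorm φ s p μ θ₀ ≤ ENNReal.ofReal ε) :
    ∃ θ, IsSolutionInBall φ s p μ γ a P (2 * ε) θ₀ θ := by
  have hs := hA.lt_massExp
  obtain ⟨f₀, hf₀⟩ := exists_isRealization hφ hA.one_le hs (hθ₀.trans_lt ENNReal.ofReal_lt_top)
  rw [hf₀.fnNorm_eq hφ hA.one_le hs] at hθ₀
  obtain ⟨-, f, -, -, -, hfc, hfε, hm⟩ := exists_picard hφ hA hP hK hK0 hε hKε hθ₀
  have hr : ∀ t, 0 < t → IsRealization (toMod (f t)) (f t) := fun t ht =>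
    hfc.isRealization hφ hA.one_le hs ht
  refine ⟨fun t => toMod (f t), (isBC_iff_isBddCurve hφ hA.one_le hs hr).2 hfc, ?_,
    f₀, f, hf₀, hr, hm⟩
  rwa [supNorm_eq_pathN hφ hA.one_le hs hr]

theorem IsSolutionInBall.supNorm_sub_le (hφ : IsLittlewoodPaley φ)
    (hA : IsAdmissibleParam n p μ γ β s) (hP : ∀ j, IsAdmissibleSymbol p β (P j))
    (hK : IsCurveConst φ s p μ γ a P K) (hK0 : 0 < K) (hε : 0 < ε) (hKε : 4 * K * ε < 1)
    {ϑ₀ : DistMod n} {ϑ : ℝ → DistMod n} (hθ : IsSolutionInBall φ s p μ γ a P (2 * ε) θ₀ θ)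
    (hϑ : IsSolutionInBall φ s p μ γ a P (2 * ε) ϑ₀ ϑ) :
    supNorm φ s p μ (fun t => θ t - ϑ t) ≤
      ENNReal.ofReal (1 - 4 * K * ε)⁻¹ * fnNorm φ s p μ (θ₀ - ϑ₀) := by
  obtain ⟨f₀, f, hf₀, hf, hfc, hfε, hfm⟩ := hθ.exists_isStep hφ hA
  obtain ⟨g₀, g, hg₀, hg, hgc, hgε, hgm⟩ := hϑ.exists_isStep hφ hA
  rw [supNorm_eq_pathN hφ hA.one_le hA.lt_massExp fun t ht => (hf t ht).sub (hg t ht),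
    (hf₀.sub hg₀).fnNorm_eq hφ hA.one_le hA.lt_massExp]
  exact hfm.pathN_sub_le_mul hφ hA hP hK hK0 hε hKε hfc hfε hgc hgε hgm

theorem IsStep.unique (hφ : IsLittlewoodPaley φ)
    (hA : IsAdmissibleParam n p μ γ β s) (hP : ∀ j, IsAdmissibleSymbol p β (P j))
    (hK : IsCurveConst φ s p μ γ a P K) (hK0 : 0 < K) (hε : 0 < ε) (hKε : 4 * K * ε < 1)
    {f₀ : TDist n} {f g : ℝ → TDist n}
    (hf : IsBddCurve φ s p μ f) (hfε : pathN φ s p μ f ≤ ENNReal.ofReal (2 * ε))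
    (hg : IsBddCurve φ s p μ g) (hgε : pathN φ s p μ g ≤ ENNReal.ofReal (2 * ε))
    (hff : IsStep γ a P f₀ f f) (hgg : IsStep γ a P f₀ g g) {t : ℝ} (ht : 0 < t) :
    f t = g t := by
  have h := hff.pathN_sub_le_mul hφ hA hP hK hK0 hε hKε hf hfε hg hgε hgg
  rw [sub_self, fnN_zero, mul_zero] at h
  exact sub_eq_zero.1 (eq_zero_of_fnN_eq_zero (μ := μ) hφ hA.one_le hA.lt_massExp
    (le_antisymm ((le_pathN (fun t => f t - g t) ht).trans h) zero_le))

/-- Self-similarity of the solution with homogeneous data. -/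
theorem IsStep.self_similar (hφ : IsLittlewoodPaley φ)
    (hA : IsAdmissibleParam n p μ γ β s) (hP : ∀ j, IsAdmissibleSymbol p β (P j))
    (hK : IsCurveConst φ s p μ γ a P K) (hK0 : 0 < K) (hε : 0 < ε) (hKε : 4 * K * ε < 1)
    (hPh : ∀ j, IsHomogeneousSymbol β (P j)) {f₀ : TDist n}
    (hf₀ : fnN φ s p μ f₀ ≤ ENNReal.ofReal ε) (hh : IsHomogeneousDist (-(2 * γ - β)) f₀)
    (hf : IsBddCurve φ s p μ f) (hfε : pathN φ s p μ f ≤ ENNReal.ofReal (2 * ε))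
    (hff : IsStep γ a P f₀ f f) {l : ℝ} (hl : 0 < l) {t : ℝ} (ht : 0 < t) :
    f t = ((l ^ (2 * γ - β) : ℝ) : ℂ) •
      ActiveScalar.dilate (Units.mk0 l hl.ne') (f (l ^ (2 * γ) * t)) := by
  -- A general dilation need not preserve the dyadic norm, so the rescaled solution is not compared
  -- with the solution inside the ball. Instead each Picard iterate is self-similar, the property
  -- passes to the weak limit, and uniqueness identifies the limit with `f`.
  obtain ⟨z, g, hz0, hz, hlim, hg, hgε, hgg⟩ := exists_picard hφ hA hP hK hK0 hε hKε hf₀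
  have hzs : ∀ m t, 0 < t → z m t = ((l ^ (2 * γ - β) : ℝ) : ℂ) •
      ActiveScalar.dilate (Units.mk0 l hl.ne') (z m (l ^ (2 * γ) * t)) := by
    intro m
    induction m with
    | zero =>
      intro t _
      rw [hz0, hz0, dilate_zero]
      exact tdist_ext fun _ => (mul_zero _).symm
    | succ m ih => exact fun t ht => (hz m).dilate hPh hl hh ih ht
  have hlt : 0 < l ^ (2 * γ) * t := mul_pos (Real.rpow_pos_of_pos hl _) ht
  have huniq : ∀ {t}, 0 < t → f t = g t := fun ht =>
    IsStep.unique hφ hA hP hK hK0 hε hKε hf hfε hg hgε hff hgg ht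
  rw [huniq ht, huniq hlt]
  refine tdist_ext fun ψ => tendsto_nhds_unique (hlim t ht ψ) ?_
  have h1 := ((hlim _ hlt (dilateTest (Units.mk0 l hl.ne')⁻¹ ψ)).const_mul
    (((|((Units.mk0 l hl.ne' : ℝˣ) : ℝ)| ^ n)⁻¹ : ℝ) : ℂ)).const_mul ((l ^ (2 * γ - β) : ℝ) : ℂ)
  rw [tdist_smul_apply, dilate_apply]
  refine h1.congr fun m => ?_
  rw [hzs m t ht, tdist_smul_apply, dilate_apply]

end

end ActiveScalar

end

/-! ### The main theorem. -/

open ActiveScalar in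
theorem theorem3p1 (n : ℕ) (hn : 1 ≤ n) (γ β μ s : ℝ) (p : ℝ≥0∞)
    (hγ : 1 / 2 < γ) (hβ : 0 ≤ β) (hβγ : β < 2 * γ) (hγn : 2 * γ < (n + β + 1) / 2)
    (hμ : 0 ≤ μ) (hμn : μ < n) (hp_one : 1 ≤ p)
    (hp : ENNReal.ofReal ((n - μ) / (n + β + 1 - 4 * γ)) < p)
    (hs : s = n - (n - μ) * p⁻¹.toReal - (2 * γ - β))
    (φ : 𝓢(Rn n, ℂ)) (hφ : IsLittlewoodPaley φ)
    (a : Fin n → Fin n → ℂ) (P : Fin n → Rn n → ℂ) (hP : ∀ j, IsAdmissibleSymbol p β (P j)) :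
    (∃ K : ℝ, 0 < K ∧ IsBilinearConst φ s p μ γ a P K) ∧
    ∀ K : ℝ, 0 < K → IsBilinearConst φ s p μ γ a P K → ∀ ε : ℝ, 0 < ε → ε < 1 / (4 * K) →
      -- existence and uniqueness
      (∀ θ₀ : DistMod n, fnNorm φ s p μ θ₀ ≤ ENNReal.ofReal ε →
        ∃ θ : ℝ → DistMod n, IsSolutionInBall φ s p μ γ a P (2 * ε) θ₀ θ ∧
          ∀ θ' : ℝ → DistMod n, IsSolutionInBall φ s p μ γ a P (2 * ε) θ₀ θ' →
            ∀ t : ℝ, 0 < t → θ' t = θ t) ∧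
      -- Lipschitz continuity of the data-solution map
      (∃ L : ℝ≥0, ∀ (θ₀ ϑ₀ : DistMod n) (θ ϑ : ℝ → DistMod n),
        fnNorm φ s p μ θ₀ ≤ ENNReal.ofReal ε → fnNorm φ s p μ ϑ₀ ≤ ENNReal.ofReal ε →
        IsSolutionInBall φ s p μ γ a P (2 * ε) θ₀ θ →
        IsSolutionInBall φ s p μ γ a P (2 * ε) ϑ₀ ϑ →
          supNorm φ s p μ (fun t => θ t - ϑ t) ≤ L * fnNorm φ s p μ (θ₀ - ϑ₀)) ∧
      -- weak convergence to the data, for the canonical representatives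
      (∀ (θ₀ : DistMod n) (θ : ℝ → DistMod n), fnNorm φ s p μ θ₀ ≤ ENNReal.ofReal ε →
        IsSolutionInBall φ s p μ γ a P (2 * ε) θ₀ θ →
          ∃ (f₀ : TDist n) (f : ℝ → TDist n), IsRealization θ₀ f₀ ∧
            (∀ t : ℝ, 0 < t → IsRealization (θ t) (f t)) ∧
            ∀ ψ : 𝓢(Rn n, ℂ), Tendsto (fun t => f t ψ) (𝓝[>] 0) (𝓝 (f₀ ψ))) ∧
      -- self-similarity
      ((∀ j, IsHomogeneousSymbol β (P j)) →
        ∀ (θ₀ : DistMod n) (θ : ℝ → DistMod n), fnNorm φ s p μ θ₀ ≤ ENNReal.ofReal ε →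
        IsSolutionInBall φ s p μ γ a P (2 * ε) θ₀ θ →
        (∃ g : TDist n, toMod g = θ₀ ∧ IsHomogeneousDist (-(2 * γ - β)) g) →
          ∃ f : ℝ → TDist n, (∀ t : ℝ, 0 < t → IsRealization (θ t) (f t)) ∧
            ∀ (l : ℝ) (hl : 0 < l) (t : ℝ), 0 < t →
              f t = ((l ^ (2 * γ - β) : ℝ) : ℂ) •
                dilate (Units.mk0 l hl.ne') (f (l ^ (2 * γ) * t))) := by
  have hA : IsAdmissibleParam n p μ γ β s := isAdmissibleParam_of_lt hβγ hγ hγn hp_one hp hs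
  have hsm := hA.lt_massExp
  refine ⟨exists_isBilinearConst hφ hA hP, fun K hK0 hKb ε hε hεK => ?_⟩
  have hK := hKb.isCurveConst hφ hA hP
  have hKε : 4 * K * ε < 1 := by
    rw [lt_div_iff₀ (by positivity)] at hεK
    linarith
  refine ⟨fun θ₀ hθ₀ => ?_, ?_, fun θ₀ θ hθ₀ hθ => ?_, fun hPh θ₀ θ hθ₀ hθ ⟨g, hg, hgh⟩ => ?_⟩
  · obtain ⟨θ, hθ⟩ := exists_isSolutionInBall hφ hA hP hK hK0 hε hKε hθ₀
    refine ⟨θ, hθ, fun θ' hθ' t ht => ?_⟩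
    obtain ⟨f₀, f, hf₀, hf, hfc, hfε, hfm⟩ := hθ.exists_isStep hφ hA
    obtain ⟨g₀, g, hg₀, hg, hgc, hgε, hgm⟩ := hθ'.exists_isStep hφ hA
    rw [hg₀.unique hφ hf₀] at hgm
    rw [← (hf t ht).1, ← (hg t ht).1,
      hfm.unique hφ hA hP hK hK0 hε hKε hfc hfε hgc hgε hgm ht]
  · exact ⟨(1 - 4 * K * ε)⁻¹.toNNReal, fun θ₀ ϑ₀ θ ϑ _ _ hθ hϑ =>
      hθ.supNorm_sub_le hφ hA hP hK hK0 hε hKε hϑ⟩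
  · obtain ⟨f₀, f, hf₀, hf, hfc, -, hfm⟩ := hθ.exists_isStep hφ hA
    exact ⟨f₀, f, hf₀, hf, fun ψ => hfm.tendsto_apply hφ hA hP hfc ψ⟩
  · obtain ⟨f₀, f, hf₀, hf, hfc, hfε, hfm⟩ := hθ.exists_isStep hφ hA
    rw [hf₀.fnNorm_eq hφ hA.one_le hsm] at hθ₀
    refine ⟨f, hf, fun l hl t ht => ?_⟩
    exact hfm.self_similar hφ hA hP hK hK0 hε hKε hPh hθ₀
      (hgh.of_toMod_eq hφ hf₀.2 (hg.trans hf₀.1.symm)) hfc hfε hl ht
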